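/- Let $\Bbbk$ be an algebraically closed field of characteristic zero and let $\xi\in\Bbbk$ be a primitive fourth root of unity. Let $\mathcal K$ be the $8$-dimensional Hopf algebra generated by $a,b,c,d$ with relations $$ab=\xi ba,\quad ac=\xi ca,\quad cb=bc=0,\quad cd=\xi dc,\quad bd=\xi db,\quad ad=da=1,\quad b^2=c^2=0,\quad a^2c=b,\quad a^4=1,$$ and structure maps $$\Delta(a)=a\otimes a+b\otimes c,\quad \Delta(b)=a\otimes b+b\otimes d,\quad \Delta(c)=c\otimes a+d\otimes c,\quad \Delta(d)=c\otimes b+d\otimes d,$$ $$\varepsilon(a)=\varepsilon(d)=1,\quad \varepsilon(b)=\varepsilon(c)=0,\qquad S(a)=d,\quad S(b)=\xi b,\quad S(c)=-\xi c,\quad S(d)=a.$$ For $j\in\{1,3\}$ let $V_{3,j}$ be the left Yetter–Drinfeld module over $\mathcal K$ (compatibility $\delta(h\cdot v)=h_{(1)}v_{(-1)}S(h_{(3)})\otimes h_{(2)}\cdot v_{(0)}$) with basis $e_1,e_2$, action $$a\cdot e_1=-\xi e_1,\ \ b\cdot e_1=c\cdot e_1=0,\ \ d\cdot e_1=\xi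 e_1,\qquad a\cdot e_2=d\cdot e_2=-e_2,\ \ b\cdot e_2=-e_1,\ \ c\cdot e_2=e_1,$$ and coaction $$V_{3,1}:\ \ \delta(e_1)=d\otimes e_1+(\xi-1)\,c\otimes e_2,\quad \delta(e_2)=a\otimes e_2+\tfrac12(-\xi-1)\,b\otimes e_1;$$ $$V_{3,3}:\ \ \delta(e_1)=a\otimes e_1+(\xi+1)\,b\otimes e_2,\quad \delta(e_2)=d\otimes e_2+\tfrac12(1-\xi)\,c\otimes e_1.$$ Write $\mathfrak B(V)$ for the Nichols algebra of $V$ (the graded Hopf algebra $R=\bigoplus_{n\ge0}R(n)$ in the braided category of left Yetter–Drinfeld modules over $\mathcal K$ with $R(0)\simeq\Bbbk$, $R(1)\simeq V$, $R(1)$ the space of primitive elements of $R$, and $R$ generated by $R(1)$), and $\mathfrak B(V)\#\mathcal K$ for its bosonization, graded by $(\mathfrak B(V)\#\mathcal K)(n)=\mathfrak B(V)(n)\otimes\mathcal K$. For $\mu\in\Bbbk$ let $\mathfrak A_{3,1}(\mu)=\mathfrak A_{3,3}(\mu)$, as an algebra, be generated by $x,y,a,b,c,d$ with the relations of $\mathcal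 K$ for $a,b,c,d$ and $$ax=-\xi xa,\quad ay=-ya-xc,\quad bx=-\xi xb,\quad by=-yb-xd,$$ $$cx=\xi xc,\quad cy=-yc+xa,\quad dx=\xi xd,\quad dy=-yd+xb,$$ $$x^2-2y^2=\mu(1-a^2),\qquad xy+yx=\xi\mu\,ac,\qquad y^4=-\mu y^2(1-a^2)-\tfrac{\mu^2}{2}(1-a^2).$$ On $a,b,c,d$ the maps $\Delta,\varepsilon,S$ are to be those of $\mathcal K$; moreover $\varepsilon(x)=\varepsilon(y)=0$ and, for $\mathfrak A_{3,1}(\mu)$, $$\Delta(x)=x\otimes1+d\otimes x+(\xi-1)c\otimes y,\qquad \Delta(y)=y\otimes1+a\otimes y+\tfrac12(-\xi-1)b\otimes x,$$ $$S(x)=-ax-(1+\xi)cy,\qquad S(y)=-dy+\tfrac12(\xi-1)bx,$$ while for $\mathfrak A_{3,3}(\mu)$ $$\Delta(x)=x\otimes1+a\otimes x+(\xi+1)b\otimes y,\qquad \Delta(y)=y\otimes1+d\otimes y+\tfrac12(1-\xi)c\otimes x,$$ $$S(x)=-dx-(\xi-1)by,\qquad S(y)=-ay+\tfrac12(1+\xi)cx.$$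 For a Hopf algebra $H$ let $H_0$ be its coradical (the sum of its simple subcoalgebras), $H_{[0]}$ its Hopf coradical (the subalgebra generated by $H_0$) and $H_{[n+1]}=\{h:\Delta(h)\in H\otimes H_{[0]}+H_{[n]}\otimes H\}$ its standard filtration; $\operatorname{gr}H=\bigoplus_{n\ge0}H_{[n]}/H_{[n-1]}$ with $H_{[-1]}=0$. Then for every $\mu\in\Bbbk$ and $j\in\{1,3\}$: 1. The formulas above make $\mathfrak A_{3,j}(\mu)$ a Hopf algebra. The set $\{x^iy^ma^kb^l: 0\le i,l\le1,\ 0\le m,k\le3\}$ is a basis of it; in particular $\dim\mathfrak A_{3,j}(\mu)=64$. 2. The map $\mathcal K\to\mathfrak A_{3,j}(\mu)$ that sends $a,b,c,d$ to $a,b,c,d$ is an injective Hopf algebra map whose image is the Hopf coradical, so $\mathfrak A_{3,j}(\mu)_{[0]}\simeq\mathcal K$. 3. The standard filtration of $\mathfrak A_{3,j}(\mu)$ is an exhaustive Hopf algebra filtration, and $\operatorname{gr}\mathfrak A_{3,j}(\mu)\simeq\mathfrak B(V_{3,j})\#\mathcal K$ as graded Hopf algebras. -/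

import Mathlib

open scoped TensorProduct DirectSum
open Coalgebra HopfAlgebra

universe u

namespace HopfLift

/-! ## Coradical, Hopf coradical and standard filtration -/

section Filtration

variable (𝕜 : Type u) (H : Type u) [Field 𝕜] [Ring H] [HopfAlgebra 𝕜 H]

/-- `C` is a subcoalgebra: `Δ(C) ⊆ C ⊗ C`. -/
def IsSubcoalgebra (C : Submodule 𝕜 H) : Prop :=
  ∀ x ∈ C, comul (R := 𝕜) x ∈ LinearMap.range (TensorProduct.mapIncl C C)

/-- `C` is a simple subcoalgebra: nonzero, without proper nonzero subcoalgebras. -/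
def IsSimpleSubcoalgebra (C : Submodule 𝕜 H) : Prop :=
  IsSubcoalgebra 𝕜 H C ∧ C ≠ ⊥ ∧
    ∀ D : Submodule 𝕜 H, IsSubcoalgebra 𝕜 H D → D ≤ C → D = ⊥ ∨ D = C

/-- The coradical `H₀`, the sum of all simple subcoalgebras. -/
def coradical : Submodule 𝕜 H := sSup {C | IsSimpleSubcoalgebra 𝕜 H C}

/-- The Hopf coradical `H_[0]`, the subalgebra generated by the coradical. -/
def hopfCoradical : Subalgebra 𝕜 H := Algebra.adjoin 𝕜 (coradical 𝕜 H : Set H)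

/-- The standard filtration:
`H_[n+1] = {h | Δ(h) ∈ H ⊗ H_[0] + H_[n] ⊗ H}`. -/
def standardFiltration : ℕ → Submodule 𝕜 H
  | 0 => Subalgebra.toSubmodule (hopfCoradical 𝕜 H)
  | n + 1 =>
      (LinearMap.range ((Subalgebra.toSubmodule (hopfCoradical 𝕜 H)).subtype.lTensor H) ⊔
        LinearMap.range ((standardFiltration n).subtype.rTensor H)).comap
          (comul : H →ₗ[𝕜] H ⊗[𝕜] H)

variable {H}

/-- `F` is an exhaustive Hopf algebra filtration of `H`. -/
structure IsHopfFiltration (F : ℕ → Submodule 𝕜 H) : Prop where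
  mono : Monotone F
  iSup_eq_top : ⨆ n, F n = ⊤
  one_mem : (1 : H) ∈ F 0
  mul_mem : ∀ m n, ∀ x ∈ F m, ∀ y ∈ F n, x * y ∈ F (m + n)
  comul_mem : ∀ n, ∀ x ∈ F n, comul (R := 𝕜) x ∈
    ⨆ (i : ℕ) (j : ℕ) (_ : i + j = n), LinearMap.range (TensorProduct.mapIncl (F i) (F j))
  antipode_mem : ∀ n, ∀ x ∈ F n, antipode 𝕜 x ∈ F n

end Filtration

/-! ## The associated graded Hopf algebra -/

section Graded

variable {𝕜 : Type u} {H : Type u} [Field 𝕜] [Ring H] [HopfAlgebra 𝕜 H]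

/-- `F_{n-1}`, with `F_{-1} = 0`. -/
def prev (F : ℕ → Submodule 𝕜 H) : ℕ → Submodule 𝕜 H
  | 0 => ⊥
  | n + 1 => F n

/-- The homogeneous component `F_n / F_{n-1}`. -/
abbrev GrPiece (F : ℕ → Submodule 𝕜 H) (n : ℕ) : Type u :=
  F n ⧸ (prev F n).comap (F n).subtype

/-- The graded space `gr H = ⨁ F_n / F_{n-1}`. -/
abbrev Gr (F : ℕ → Submodule 𝕜 H) : Type u := ⨁ n, GrPiece F n

variable {F : ℕ → Submodule 𝕜 H}

theorem prev_le (hF : IsHopfFiltration 𝕜 F) (n : ℕ) : prev F n ≤ F n := by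
  cases n with
  | zero => exact bot_le
  | succ n => exact hF.mono (Nat.le_succ n)

theorem prev_mul_mem (hF : IsHopfFiltration 𝕜 F) (m n : ℕ) {x y : H} (hx : x ∈ prev F m)
    (hy : y ∈ F n) : x * y ∈ prev F (m + n) := by
  cases m with
  | zero =>
    have : x = 0 := by simpa [prev] using hx
    simp [this]
  | succ m =>
    rw [show m + 1 + n = (m + n) + 1 by omega]
    exact hF.mul_mem m n x hx y hy

theorem mul_prev_mem (hF : IsHopfFiltration 𝕜 F) (m n : ℕ) {x y : H} (hx : x ∈ F m)
    (hy : y ∈ prev F n) : x * y ∈ prev F (m + n) := by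
  cases n with
  | zero =>
    have : y = 0 := by simpa [prev] using hy
    simp [this]
  | succ n => exact hF.mul_mem m n x hx y hy

/-- Multiplication `F_m × F_n → F_{m+n} / F_{m+n-1}`. -/
def filMul (hF : IsHopfFiltration 𝕜 F) (m n : ℕ) : F m →ₗ[𝕜] F n →ₗ[𝕜] GrPiece F (m + n) :=
  LinearMap.mk₂ 𝕜
    (fun x y => Submodule.Quotient.mk ⟨(x : H) * y, hF.mul_mem m n x x.2 y y.2⟩)
    (fun x x' y => by rw [← Submodule.Quotient.mk_add]; congr 1; ext; simp [add_mul])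
    (fun c x y => by rw [← Submodule.Quotient.mk_smul]; congr 1; ext; simp)
    (fun x y y' => by rw [← Submodule.Quotient.mk_add]; congr 1; ext; simp [mul_add])
    (fun c x y => by rw [← Submodule.Quotient.mk_smul]; congr 1; ext; simp)

/-- The product `[x] [y] = [x y]` of homogeneous components. -/
def grPieceMul (hF : IsHopfFiltration 𝕜 F) (m n : ℕ) :
    GrPiece F m →ₗ[𝕜] GrPiece F n →ₗ[𝕜] GrPiece F (m + n) :=
  Submodule.liftQ _
    (LinearMap.flip (Submodule.liftQ _ (filMul hF m n).flip (by
      intro y hy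
      ext x
      exact (Submodule.Quotient.mk_eq_zero _).2 (mul_prev_mem hF m n x.2 hy))))
    (by
      intro x hx
      refine LinearMap.ext fun y => ?_
      induction y using Submodule.Quotient.induction_on with
      | H y => exact (Submodule.Quotient.mk_eq_zero _).2 (prev_mul_mem hF m n hx y.2))

/-- The product of `gr H`. -/
def grMul (hF : IsHopfFiltration 𝕜 F) : Gr F →ₗ[𝕜] Gr F →ₗ[𝕜] Gr F :=
  DirectSum.toModule 𝕜 ℕ _ fun m => LinearMap.flip (DirectSum.toModule 𝕜 ℕ _ fun n =>
    LinearMap.flip ((grPieceMul hF m n).compr₂ (DirectSum.lof 𝕜 ℕ (GrPiece F) (m + n))))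

/-- The unit of `gr H`. -/
def grOne (hF : IsHopfFiltration 𝕜 F) : Gr F :=
  DirectSum.lof 𝕜 ℕ (GrPiece F) 0 (Submodule.Quotient.mk ⟨1, hF.one_mem⟩)

/-- The inclusion `F_n / F_{n-1} → H / F_{n-1}`. -/
def grIncl (F : ℕ → Submodule 𝕜 H) (n : ℕ) : GrPiece F n →ₗ[𝕜] H ⧸ prev F n :=
  Submodule.mapQ _ _ (F n).subtype le_rfl

theorem grIncl_injective (F : ℕ → Submodule 𝕜 H) (n : ℕ) :
    Function.Injective (grIncl F n) := by
  rw [← LinearMap.ker_eq_bot, grIncl, Submodule.ker_mapQ, ← le_bot_iff, Submodule.map_le_iff_le_comap]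
  intro x hx
  exact (Submodule.Quotient.mk_eq_zero _).2 hx

/-- The map `F_n → H / F_{i-1} ⊗ H / F_{j-1}` induced by `Δ`. -/
def filComulAux (F : ℕ → Submodule 𝕜 H) (n i j : ℕ) :
    F n →ₗ[𝕜] (H ⧸ prev F i) ⊗[𝕜] (H ⧸ prev F j) :=
  TensorProduct.map (prev F i).mkQ (prev F j).mkQ ∘ₗ comul ∘ₗ (F n).subtype

/-- The inclusion `F_i / F_{i-1} ⊗ F_j / F_{j-1} → H / F_{i-1} ⊗ H / F_{j-1}`. -/
def grIncl₂ (F : ℕ → Submodule 𝕜 H) (i j : ℕ) :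
    GrPiece F i ⊗[𝕜] GrPiece F j →ₗ[𝕜] (H ⧸ prev F i) ⊗[𝕜] (H ⧸ prev F j) :=
  TensorProduct.map (grIncl F i) (grIncl F j)

theorem grIncl₂_injective (F : ℕ → Submodule 𝕜 H) (i j : ℕ) :
    Function.Injective (grIncl₂ F i j) :=
  TensorProduct.map_injective_of_flat_flat _ _ (grIncl_injective F i) (grIncl_injective F j)

theorem mapQ_mem_prev_of_lt (hF : IsHopfFiltration 𝕜 F) {k i : ℕ} (h : k < i) : F k ≤ prev F i := by
  cases i with
  | zero => omega
  | succ i => exact hF.mono (Nat.lt_succ_iff.1 h)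

theorem map_mapIncl_eq_zero (hF : IsHopfFiltration 𝕜 F) {k l i j : ℕ} (h : k < i ∨ l < j)
    (t : F k ⊗[𝕜] F l) :
    TensorProduct.map (prev F i).mkQ (prev F j).mkQ (TensorProduct.mapIncl (F k) (F l) t) = 0 := by
  induction t with
  | zero => simp
  | add s t hs ht => rw [map_add, map_add, hs, ht, add_zero]
  | tmul x y =>
    rcases h with h | h
    · have : (prev F i).mkQ (x : H) = 0 :=
        (Submodule.Quotient.mk_eq_zero _).2 (mapQ_mem_prev_of_lt hF h x.2)
      simp [TensorProduct.mapIncl, -Submodule.mkQ_apply, this]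
    · have : (prev F j).mkQ (y : H) = 0 :=
        (Submodule.Quotient.mk_eq_zero _).2 (mapQ_mem_prev_of_lt hF h y.2)
      simp [TensorProduct.mapIncl, -Submodule.mkQ_apply, this]

theorem filComulAux_mem (hF : IsHopfFiltration 𝕜 F) {n i j : ℕ} (hij : i + j = n) (x : F n) :
    filComulAux F n i j x ∈ LinearMap.range (grIncl₂ F i j) := by
  have key : (⨆ (k : ℕ) (l : ℕ) (_ : k + l = n),
      LinearMap.range (TensorProduct.mapIncl (F k) (F l))) ≤
      (LinearMap.range (grIncl₂ F i j)).comap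
        (TensorProduct.map (prev F i).mkQ (prev F j).mkQ) := by
    refine iSup_le fun k => iSup_le fun l => iSup_le fun hkl => ?_
    rintro _ ⟨t, rfl⟩
    rw [Submodule.mem_comap]
    by_cases h : k < i ∨ l < j
    · rw [map_mapIncl_eq_zero hF h]
      exact Submodule.zero_mem _
    · obtain ⟨rfl, rfl⟩ : k = i ∧ l = j := by omega
      refine ⟨TensorProduct.map (Submodule.mkQ _) (Submodule.mkQ _) t, ?_⟩
      rw [grIncl₂, TensorProduct.mapIncl, ← LinearMap.comp_apply, ← LinearMap.comp_apply,
        ← TensorProduct.map_comp, ← TensorProduct.map_comp]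
      rfl
  exact key (hF.comul_mem n x x.2)

theorem filComulAux_eq_zero (hF : IsHopfFiltration 𝕜 F) {n i j : ℕ} (hij : i + j = n) (x : F n)
    (hx : (x : H) ∈ prev F n) : filComulAux F n i j x = 0 := by
  cases n with
  | zero =>
    have : x = 0 := by
      ext
      simpa [prev] using hx
    rw [this, map_zero]
  | succ n =>
    have key : (⨆ (k : ℕ) (l : ℕ) (_ : k + l = n),
        LinearMap.range (TensorProduct.mapIncl (F k) (F l))) ≤
        LinearMap.ker (TensorProduct.map (prev F i).mkQ (prev F j).mkQ) := by
      refine iSup_le fun k => iSup_le fun l => iSup_le fun hkl => ?_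
      rintro _ ⟨t, rfl⟩
      exact map_mapIncl_eq_zero hF (by omega) t
    exact key (hF.comul_mem n x hx)

/-- The component `F_n / F_{n-1} → F_i / F_{i-1} ⊗ F_j / F_{j-1}`, `i + j = n`, of the
coproduct of `gr H`: the class of `h` goes to the class of the `F_i ⊗ F_j`-part of `Δ(h)`,
which is the element having the same image as `Δ(h)` in `H / F_{i-1} ⊗ H / F_{j-1}`. -/
noncomputable def grPieceComul (hF : IsHopfFiltration 𝕜 F) (n i j : ℕ) (hij : i + j = n) :
    GrPiece F n →ₗ[𝕜] GrPiece F i ⊗[𝕜] GrPiece F j :=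
  Submodule.liftQ _
    ((LinearEquiv.ofInjective (grIncl₂ F i j) (grIncl₂_injective F i j)).symm.toLinearMap ∘ₗ
      LinearMap.codRestrict _ (filComulAux F n i j) (filComulAux_mem hF hij))
    (by
      intro x hx
      have h0 : LinearMap.codRestrict _ (filComulAux F n i j) (filComulAux_mem hF hij) x = 0 :=
        Subtype.ext (filComulAux_eq_zero hF hij x hx)
      rw [LinearMap.mem_ker, LinearMap.comp_apply, h0, map_zero])

/-- The coproduct of `gr H`. -/
noncomputable def grComul (hF : IsHopfFiltration 𝕜 F) : Gr F →ₗ[𝕜] Gr F ⊗[𝕜] Gr F :=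
  DirectSum.toModule 𝕜 ℕ _ fun n => ∑ i : Fin (n + 1),
    TensorProduct.map (DirectSum.lof 𝕜 ℕ (GrPiece F) i)
      (DirectSum.lof 𝕜 ℕ (GrPiece F) (n - i)) ∘ₗ
        grPieceComul hF n i (n - i) (Nat.add_sub_of_le (Nat.lt_succ_iff.1 i.2))

/-- The counit of `gr H`: the counit of `H` on `F_0`, zero in positive degrees. -/
noncomputable def grCounit (F : ℕ → Submodule 𝕜 H) : Gr F →ₗ[𝕜] 𝕜 :=
  DirectSum.toModule 𝕜 ℕ _ fun n => match n with
    | 0 => Submodule.liftQ _ (counit ∘ₗ (F 0).subtype) (by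
        intro x hx
        have : x = 0 := by
          ext
          simpa [prev] using hx
        rw [this]
        exact Submodule.zero_mem _)
    | _ + 1 => 0

end Graded

/-! ## Yetter-Drinfeld modules, Nichols algebras and bosonization -/

section YetterDrinfeld

/-- A space `V` with an action of the algebra `H` and a linear map `V → H ⊗ V`. -/
structure ActCoact (𝕜 H V : Type u) [Field 𝕜] [Ring H] [HopfAlgebra 𝕜 H] [AddCommGroup V]
    [Module 𝕜 V] where
  /-- the left action of `H` on `V` -/
  act : H →ₐ[𝕜] Module.End 𝕜 V
  /-- the left coaction of `H` on `V` -/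
  coact : V →ₗ[𝕜] H ⊗[𝕜] V

variable {𝕜 H V W R B : Type u} [Field 𝕜] [Ring H] [HopfAlgebra 𝕜 H]
variable [AddCommGroup V] [Module 𝕜 V] [AddCommGroup W] [Module 𝕜 W]
variable [Ring R] [Algebra 𝕜 R] [Ring B] [Algebra 𝕜 B]

/-- `h₂ ⊗ h₃ ↦ (k ⊗ v ↦ k S(h₃) ⊗ h₂ · v)`. -/
noncomputable def ActCoact.adjAux (D : ActCoact 𝕜 H V) :
    H ⊗[𝕜] H →ₗ[𝕜] Module.End 𝕜 (H ⊗[𝕜] V) :=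
  TensorProduct.homTensorHomMap (RingHom.id 𝕜) H V H V ∘ₗ
    TensorProduct.map ((LinearMap.mul 𝕜 H).flip ∘ₗ antipode 𝕜) D.act.toLinearMap ∘ₗ
      (TensorProduct.comm 𝕜 H H).toLinearMap

/-- `h₁ ⊗ (h₂ ⊗ h₃) ↦ (k ⊗ v ↦ h₁ k S(h₃) ⊗ h₂ · v)`. -/
noncomputable def ActCoact.adj (D : ActCoact 𝕜 H V) :
    H ⊗[𝕜] (H ⊗[𝕜] H) →ₗ[𝕜] Module.End 𝕜 (H ⊗[𝕜] V) :=
  LinearMap.mul' 𝕜 (Module.End 𝕜 (H ⊗[𝕜] V)) ∘ₗ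
    TensorProduct.map (LinearMap.rTensorHom V ∘ₗ LinearMap.mul 𝕜 H) D.adjAux

/-- `V` is a left Yetter-Drinfeld module over `H`: a left `H`-module and left `H`-comodule with
`δ(h · v) = h₁ v₍₋₁₎ S(h₃) ⊗ h₂ · v₍₀₎`. -/
structure IsYetterDrinfeld (D : ActCoact 𝕜 H V) : Prop where
  coassoc : (TensorProduct.assoc 𝕜 H H V).toLinearMap ∘ₗ comul.rTensor V ∘ₗ D.coact =
    D.coact.lTensor H ∘ₗ D.coact
  counit_coact : (TensorProduct.lid 𝕜 V).toLinearMap ∘ₗ counit.rTensor V ∘ₗ D.coact =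
    LinearMap.id
  compat : ∀ (h : H) (v : V),
    D.coact (D.act h v) = D.adj (comul.lTensor H (comul h)) (D.coact v)

/-- A linear map compatible with actions and coactions. -/
structure IsYDHom (D : ActCoact 𝕜 H V) (E : ActCoact 𝕜 H W) (f : V →ₗ[𝕜] W) : Prop where
  map_act : ∀ (h : H) (v : V), f (D.act h v) = E.act h (f v)
  map_coact : ∀ v : V, E.coact (f v) = f.lTensor H (D.coact v)

/-- The diagonal action `h · (v ⊗ w) = h₁ · v ⊗ h₂ · w`. -/
noncomputable def diagAct (D : ActCoact 𝕜 H V) (E : ActCoact 𝕜 H W) :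
    H →ₗ[𝕜] Module.End 𝕜 (V ⊗[𝕜] W) :=
  TensorProduct.homTensorHomMap (RingHom.id 𝕜) V W V W ∘ₗ
    TensorProduct.map D.act.toLinearMap E.act.toLinearMap ∘ₗ comul

/-- The diagonal coaction `v ⊗ w ↦ v₍₋₁₎ w₍₋₁₎ ⊗ (v₍₀₎ ⊗ w₍₀₎)`. -/
noncomputable def diagCoact (D : ActCoact 𝕜 H V) (E : ActCoact 𝕜 H W) :
    V ⊗[𝕜] W →ₗ[𝕜] H ⊗[𝕜] (V ⊗[𝕜] W) :=
  (LinearMap.mul' 𝕜 H).rTensor (V ⊗[𝕜] W) ∘ₗ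
    (TensorProduct.tensorTensorTensorComm 𝕜 H V H W).toLinearMap ∘ₗ
      TensorProduct.map D.coact E.coact

/-- Given `f : B → H ⊗ B`, `b ↦ b₍₋₁₎ ⊗ b₍₀₎`, the product
`(r ⊗ b) (s ⊗ b') = r (b₍₋₁₎ · s) ⊗ b₍₀₎ b'` on `R ⊗ B`. For `B = R` and the coaction this is the
product of the braided tensor square of `R`; for `B = H` and `Δ` it is the smash product. -/
noncomputable def twistedMul (D : ActCoact 𝕜 H R) (f : B →ₗ[𝕜] H ⊗[𝕜] B) :
    R ⊗[𝕜] B →ₗ[𝕜] Module.End 𝕜 (R ⊗[𝕜] B) :=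
  LinearMap.mul' 𝕜 (Module.End 𝕜 (R ⊗[𝕜] B)) ∘ₗ
    TensorProduct.map (LinearMap.rTensorHom B ∘ₗ LinearMap.mul 𝕜 R)
      (TensorProduct.homTensorHomMap (RingHom.id 𝕜) R B R B ∘ₗ
        TensorProduct.map D.act.toLinearMap (LinearMap.mul 𝕜 B) ∘ₗ f)

/-- `R`, with the action and coaction `D`, is a Hopf algebra in the braided category of left
Yetter-Drinfeld modules over `H`. (A convolution inverse of the identity is automatically
a morphism of Yetter-Drinfeld modules.) -/
structure IsBraidedHopf [Coalgebra 𝕜 R] (D : ActCoact 𝕜 H R) : Prop where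
  yetterDrinfeld : IsYetterDrinfeld D
  act_one : ∀ h : H, D.act h 1 = counit (R := 𝕜) h • (1 : R)
  act_mul : ∀ (h : H) (z : R ⊗[𝕜] R),
    D.act h (LinearMap.mul' 𝕜 R z) = LinearMap.mul' 𝕜 R (diagAct D D h z)
  coact_one : D.coact 1 = 1 ⊗ₜ 1
  coact_mul : ∀ z : R ⊗[𝕜] R,
    D.coact (LinearMap.mul' 𝕜 R z) = (LinearMap.mul' 𝕜 R).lTensor H (diagCoact D D z)
  counit_act : ∀ (h : H) (r : R),
    counit (R := 𝕜) (D.act h r) = counit (R := 𝕜) h * counit (R := 𝕜) r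
  comul_act : ∀ (h : H) (r : R), comul (R := 𝕜) (D.act h r) = diagAct D D h (comul r)
  counit_coact : ∀ r : R,
    counit.lTensor H (D.coact r) = (1 : H) ⊗ₜ[𝕜] (counit (R := 𝕜) r)
  comul_coact : ∀ r : R, comul.lTensor H (D.coact r) = diagCoact D D (comul r)
  counit_one : counit (R := 𝕜) (1 : R) = 1
  counit_mul : ∀ r s : R, counit (R := 𝕜) (r * s) = counit (R := 𝕜) r * counit (R := 𝕜) s
  comul_one : comul (R := 𝕜) (1 : R) = 1 ⊗ₜ 1
  comul_mul : ∀ r s : R,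
    comul (R := 𝕜) (r * s) = twistedMul D D.coact (comul r) (comul s)
  exists_antipode : ∃ S : R →ₗ[𝕜] R,
    LinearMap.mul' 𝕜 R ∘ₗ S.rTensor R ∘ₗ comul = Algebra.linearMap 𝕜 R ∘ₗ counit ∧
    LinearMap.mul' 𝕜 R ∘ₗ S.lTensor R ∘ₗ comul = Algebra.linearMap 𝕜 R ∘ₗ counit

/-- `R = ⨁ 𝒢 n` is a grading of the braided Hopf algebra `R`. -/
structure IsBraidedGrading [Coalgebra 𝕜 R] (D : ActCoact 𝕜 H R) (𝒢 : ℕ → Submodule 𝕜 R) :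
    Prop where
  internal : DirectSum.IsInternal 𝒢
  act_mem : ∀ (n : ℕ) (h : H), ∀ r ∈ 𝒢 n, D.act h r ∈ 𝒢 n
  coact_mem : ∀ n, ∀ r ∈ 𝒢 n, D.coact r ∈ LinearMap.range ((𝒢 n).subtype.lTensor H)
  one_mem : (1 : R) ∈ 𝒢 0
  mul_mem : ∀ m n, ∀ r ∈ 𝒢 m, ∀ s ∈ 𝒢 n, r * s ∈ 𝒢 (m + n)
  counit_eq_zero : ∀ n, n ≠ 0 → ∀ r ∈ 𝒢 n, counit (R := 𝕜) r = 0
  comul_mem : ∀ n, ∀ r ∈ 𝒢 n, comul (R := 𝕜) r ∈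
    ⨆ (i : ℕ) (j : ℕ) (_ : i + j = n), LinearMap.range (TensorProduct.mapIncl (𝒢 i) (𝒢 j))

/-- The graded braided Hopf algebra `R = ⨁ 𝒢 n` is the Nichols algebra of `V`: `R(0) ≃ 𝕜`,
`R(1) ≃ V`, `R(1)` is the space of primitive elements, and `R(1)` generates `R`. -/
structure IsNicholsAlgebra [Coalgebra 𝕜 R] (E : ActCoact 𝕜 H V) (D : ActCoact 𝕜 H R)
    (𝒢 : ℕ → Submodule 𝕜 R) : Prop where
  yetterDrinfeld : IsYetterDrinfeld E
  braidedHopf : IsBraidedHopf D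
  grading : IsBraidedGrading D 𝒢
  degree_zero : Nonempty (𝒢 0 ≃ₗ[𝕜] 𝕜)
  degree_one : ∃ θ : V →ₗ[𝕜] R, IsYDHom E D θ ∧ Function.Injective θ ∧ LinearMap.range θ = 𝒢 1
  primitive : ∀ r : R, r ∈ 𝒢 1 ↔ comul (R := 𝕜) r = r ⊗ₜ 1 + 1 ⊗ₜ r
  generated : Algebra.adjoin 𝕜 (𝒢 1 : Set R) = ⊤

/-- The product of the bosonization `R # H`: `(b # g) (c # h) = b (g₁ · c) # g₂ h`. -/
noncomputable def bosonMul (D : ActCoact 𝕜 H R) :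
    R ⊗[𝕜] H →ₗ[𝕜] Module.End 𝕜 (R ⊗[𝕜] H) :=
  twistedMul D comul

/-- The coproduct of the bosonization `R # H`:
`Δ(b # g) = b¹ # (b²)₍₋₁₎ g₁ ⊗ (b²)₍₀₎ # g₂`. -/
noncomputable def bosonComul [Coalgebra 𝕜 R] (D : ActCoact 𝕜 H R) :
    R ⊗[𝕜] H →ₗ[𝕜] (R ⊗[𝕜] H) ⊗[𝕜] (R ⊗[𝕜] H) :=
  ((LinearMap.mul' 𝕜 H).lTensor R ∘ₗ (TensorProduct.assoc 𝕜 R H H).toLinearMap).rTensor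
      (R ⊗[𝕜] H) ∘ₗ
    (TensorProduct.tensorTensorTensorComm 𝕜 (R ⊗[𝕜] H) R H H).toLinearMap ∘ₗ
      TensorProduct.map
        ((TensorProduct.assoc 𝕜 R H R).symm.toLinearMap ∘ₗ D.coact.lTensor R ∘ₗ comul) comul

/-- The counit of the bosonization `R # H`. -/
noncomputable def bosonCounit [Coalgebra 𝕜 R] : R ⊗[𝕜] H →ₗ[𝕜] 𝕜 :=
  LinearMap.mul' 𝕜 𝕜 ∘ₗ TensorProduct.map counit counit

/-- `gr L ≃ R # H` as graded Hopf algebras, where `gr L` is taken with respect to the Hopf algebra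
filtration `F` and `R # H` is graded by `(R # H)(n) = R(n) ⊗ H`. -/
def GrIsoBosonization {L : Type u} [Ring L] [HopfAlgebra 𝕜 L] {F : ℕ → Submodule 𝕜 L}
    (hF : IsHopfFiltration 𝕜 F) [Coalgebra 𝕜 R] (D : ActCoact 𝕜 H R)
    (𝒢 : ℕ → Submodule 𝕜 R) : Prop :=
  ∃ φ : Gr F ≃ₗ[𝕜] R ⊗[𝕜] H,
    φ (grOne hF) = 1 ⊗ₜ 1 ∧
    (∀ u v, φ (grMul hF u v) = bosonMul D (φ u) (φ v)) ∧
    (∀ u, bosonCounit (φ u) = grCounit F u) ∧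
    (∀ u, bosonComul D (φ u) =
      TensorProduct.map φ.toLinearMap φ.toLinearMap (grComul hF u)) ∧
    ∀ n, (LinearMap.range (DirectSum.lof 𝕜 ℕ (GrPiece F) n)).map φ.toLinearMap =
      LinearMap.range ((𝒢 n).subtype.rTensor H)

end YetterDrinfeld

/-! ## The Hopf algebra `𝒦` -/

section AntipodeOfGenerators

variable {𝕜 A : Type u} [Field 𝕜] [Ring A] [Bialgebra 𝕜 A]

theorem antipode_left_mul (S : A →ₐ[𝕜] Aᵐᵒᵖ) (z w : A ⊗[𝕜] A) (e : 𝕜)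
    (hz : LinearMap.mul' 𝕜 A
      (((MulOpposite.opLinearEquiv 𝕜).symm.toLinearMap ∘ₗ S.toLinearMap).rTensor A z) =
        algebraMap 𝕜 A e) :
    LinearMap.mul' 𝕜 A
      (((MulOpposite.opLinearEquiv 𝕜).symm.toLinearMap ∘ₗ S.toLinearMap).rTensor A (z * w)) =
    e • LinearMap.mul' 𝕜 A
      (((MulOpposite.opLinearEquiv 𝕜).symm.toLinearMap ∘ₗ S.toLinearMap).rTensor A w) := by
  induction w with
  | zero => simp
  | add u v hu hv => rw [mul_add, map_add, map_add, hu, hv, map_add, map_add, smul_add]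
  | tmul p q =>
    have key : ∀ t : A ⊗[𝕜] A, LinearMap.mul' 𝕜 A
        (((MulOpposite.opLinearEquiv 𝕜).symm.toLinearMap ∘ₗ S.toLinearMap).rTensor A
          (t * p ⊗ₜ q)) = (S p).unop * LinearMap.mul' 𝕜 A
        (((MulOpposite.opLinearEquiv 𝕜).symm.toLinearMap ∘ₗ S.toLinearMap).rTensor A t) * q := by
      intro t
      induction t with
      | zero => simp
      | add u v hu hv => rw [add_mul, map_add, map_add, hu, hv, map_add, map_add, mul_add, add_mul]
      | tmul r s => simp [mul_assoc]
    rw [key, hz, ← Algebra.commutes, mul_assoc, ← Algebra.smul_def]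
    simp

theorem antipode_right_mul (S : A →ₐ[𝕜] Aᵐᵒᵖ) (z w : A ⊗[𝕜] A) (e : 𝕜)
    (hw : LinearMap.mul' 𝕜 A
      (((MulOpposite.opLinearEquiv 𝕜).symm.toLinearMap ∘ₗ S.toLinearMap).lTensor A w) =
        algebraMap 𝕜 A e) :
    LinearMap.mul' 𝕜 A
      (((MulOpposite.opLinearEquiv 𝕜).symm.toLinearMap ∘ₗ S.toLinearMap).lTensor A (z * w)) =
    e • LinearMap.mul' 𝕜 A
      (((MulOpposite.opLinearEquiv 𝕜).symm.toLinearMap ∘ₗ S.toLinearMap).lTensor A z) := by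
  induction z with
  | zero => simp
  | add u v hu hv => rw [add_mul, map_add, map_add, hu, hv, map_add, map_add, smul_add]
  | tmul p q =>
    have key : ∀ t : A ⊗[𝕜] A, LinearMap.mul' 𝕜 A
        (((MulOpposite.opLinearEquiv 𝕜).symm.toLinearMap ∘ₗ S.toLinearMap).lTensor A
          (p ⊗ₜ q * t)) = p * LinearMap.mul' 𝕜 A
        (((MulOpposite.opLinearEquiv 𝕜).symm.toLinearMap ∘ₗ S.toLinearMap).lTensor A t) *
          (S q).unop := by
      intro t
      induction t with
      | zero => simp
      | add u v hu hv => rw [mul_add, map_add, map_add, hu, hv, map_add, map_add, mul_add, add_mul]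
      | tmul r s => simp [mul_assoc]
    rw [key, hw, ← Algebra.commutes, mul_assoc, ← Algebra.smul_def]
    simp

/-- A bialgebra with an algebra map `S : A → Aᵒᵖ` satisfying the antipode axioms on a set of
algebra generators is a Hopf algebra with antipode `S`. -/
@[reducible]
noncomputable def hopfOfGenerators (S : A →ₐ[𝕜] Aᵐᵒᵖ) (s : Set A) (hs : Algebra.adjoin 𝕜 s = ⊤)
    (hl : ∀ g ∈ s, LinearMap.mul' 𝕜 A
      (((MulOpposite.opLinearEquiv 𝕜).symm.toLinearMap ∘ₗ S.toLinearMap).rTensor A (comul g)) =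
        algebraMap 𝕜 A (counit g))
    (hr : ∀ g ∈ s, LinearMap.mul' 𝕜 A
      (((MulOpposite.opLinearEquiv 𝕜).symm.toLinearMap ∘ₗ S.toLinearMap).lTensor A (comul g)) =
        algebraMap 𝕜 A (counit g)) :
    HopfAlgebra 𝕜 A where
  antipode := (MulOpposite.opLinearEquiv 𝕜).symm.toLinearMap ∘ₗ S.toLinearMap
  mul_antipode_rTensor_comul := by
    ext g
    have hg : g ∈ Algebra.adjoin 𝕜 s := hs ▸ Algebra.mem_top
    induction hg using Algebra.adjoin_induction with
    | mem g hg => exact hl g hg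
    | algebraMap r => simp [Algebra.TensorProduct.algebraMap_apply]
    | add u v _ _ hu hv => rw [map_add, hu, hv, map_add]
    | mul u v _ _ hu hv =>
      have hu' := antipode_left_mul S (comul u) (comul v) (counit u) hu
      simp only [LinearMap.comp_apply] at hu hv ⊢
      rw [Bialgebra.comul_mul, hu']
      erw [hv]
      simp [Algebra.smul_def]
  mul_antipode_lTensor_comul := by
    ext g
    have hg : g ∈ Algebra.adjoin 𝕜 s := hs ▸ Algebra.mem_top
    induction hg using Algebra.adjoin_induction with
    | mem g hg => exact hr g hg
    | algebraMap r => simp [Algebra.TensorProduct.algebraMap_apply]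
    | add u v _ _ hu hv => rw [map_add, hu, hv, map_add]
    | mul u v _ _ hu hv =>
      have hu' := antipode_right_mul S (comul u) (comul v) (counit v) hv
      simp only [LinearMap.comp_apply] at hu hv ⊢
      rw [Bialgebra.comul_mul, hu']
      erw [hu]
      simp only [map_mul, Bialgebra.counit_mul, Algebra.smul_def, Algebra.linearMap_apply]
      exact Algebra.commutes _ _

end AntipodeOfGenerators

/-- The generators of `𝒦`. -/
inductive KGen
  | a
  | b
  | c
  | d

section AlgebraK

variable {𝕜 : Type u} [Field 𝕜]

/-- The defining relations of the algebra `𝒦`. -/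
inductive KRel (ξ : 𝕜) : FreeAlgebra 𝕜 KGen → FreeAlgebra 𝕜 KGen → Prop
  | ab : KRel ξ (.ι 𝕜 .a * .ι 𝕜 .b) (ξ • (.ι 𝕜 .b * .ι 𝕜 .a))
  | ac : KRel ξ (.ι 𝕜 .a * .ι 𝕜 .c) (ξ • (.ι 𝕜 .c * .ι 𝕜 .a))
  | cb : KRel ξ (.ι 𝕜 .c * .ι 𝕜 .b) 0
  | bc : KRel ξ (.ι 𝕜 .b * .ι 𝕜 .c) 0
  | cd : KRel ξ (.ι 𝕜 .c * .ι 𝕜 .d) (ξ • (.ι 𝕜 .d * .ι 𝕜 .c))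
  | bd : KRel ξ (.ι 𝕜 .b * .ι 𝕜 .d) (ξ • (.ι 𝕜 .d * .ι 𝕜 .b))
  | ad_da : KRel ξ (.ι 𝕜 .a * .ι 𝕜 .d) (.ι 𝕜 .d * .ι 𝕜 .a)
  | ad : KRel ξ (.ι 𝕜 .a * .ι 𝕜 .d) 1
  | bb : KRel ξ (.ι 𝕜 .b ^ 2) 0
  | cc : KRel ξ (.ι 𝕜 .c ^ 2) 0
  | aac : KRel ξ (.ι 𝕜 .a ^ 2 * .ι 𝕜 .c) (.ι 𝕜 .b)
  | a_four : KRel ξ (.ι 𝕜 .a ^ 4) 1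

/-- The algebra `𝒦`. -/
def K (ξ : 𝕜) : Type u := RingQuot (KRel ξ)

noncomputable instance (ξ : 𝕜) : Ring (K ξ) := inferInstanceAs (Ring (RingQuot (KRel ξ)))

noncomputable instance (ξ : 𝕜) : Algebra 𝕜 (K ξ) :=
  inferInstanceAs (Algebra 𝕜 (RingQuot (KRel ξ)))

/-- The projection from the free algebra. -/
noncomputable def K.mk (ξ : 𝕜) : FreeAlgebra 𝕜 KGen →ₐ[𝕜] K ξ := RingQuot.mkAlgHom 𝕜 (KRel ξ)

theorem K.mk_rel {ξ : 𝕜} {u v : FreeAlgebra 𝕜 KGen} (h : KRel ξ u v) : K.mk ξ u = K.mk ξ v :=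
  RingQuot.mkAlgHom_rel 𝕜 h

theorem K.mk_surjective (ξ : 𝕜) : Function.Surjective (K.mk ξ) :=
  RingQuot.mkAlgHom_surjective 𝕜 (KRel ξ)

/-- A generator as an element of `𝒦`. -/
noncomputable def K.gen (ξ : 𝕜) (g : KGen) : K ξ := K.mk ξ (.ι 𝕜 g)

/-- The algebra map out of `𝒦` with prescribed values on the generators. -/
noncomputable def K.lift {ξ : 𝕜} {A : Type u} [Ring A] [Algebra 𝕜 A] (f : KGen → A)
    (hf : ∀ ⦃u v⦄, KRel ξ u v → FreeAlgebra.lift 𝕜 f u = FreeAlgebra.lift 𝕜 f v) :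
    K ξ →ₐ[𝕜] A :=
  RingQuot.liftAlgHom 𝕜 ⟨FreeAlgebra.lift 𝕜 f, hf⟩

@[simp]
theorem K.lift_gen {ξ : 𝕜} {A : Type u} [Ring A] [Algebra 𝕜 A] (f : KGen → A)
    (hf : ∀ ⦃u v⦄, KRel ξ u v → FreeAlgebra.lift 𝕜 f u = FreeAlgebra.lift 𝕜 f v) (g : KGen) :
    K.lift f hf (K.gen ξ g) = f g :=
  (RingQuot.liftAlgHom_mkAlgHom_apply 𝕜 (FreeAlgebra.lift 𝕜 f) hf _).trans
    (FreeAlgebra.lift_ι_apply f g)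

theorem K.adjoin_gen (ξ : 𝕜) : Algebra.adjoin 𝕜 (Set.range (K.gen ξ)) = ⊤ := by
  have h : Set.range (K.gen ξ) =
      K.mk ξ '' Set.range (FreeAlgebra.ι 𝕜) := by
    rw [← Set.range_comp]
    rfl
  rw [h, Algebra.adjoin_image, FreeAlgebra.adjoin_range_ι, Algebra.map_top,
    AlgHom.range_eq_top]
  exact K.mk_surjective ξ

theorem K.hom_ext {ξ : 𝕜} {A : Type u} [Ring A] [Algebra 𝕜 A] {f g : K ξ →ₐ[𝕜] A}
    (h : ∀ x, f (K.gen ξ x) = g (K.gen ξ x)) : f = g := by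
  refine AlgHom.ext_of_adjoin_eq_top (K.adjoin_gen ξ) ?_
  rintro _ ⟨x, rfl⟩
  exact h x

section Relations

variable (ξ : 𝕜)

local notation "a'" => K.gen ξ KGen.a
local notation "b'" => K.gen ξ KGen.b
local notation "c'" => K.gen ξ KGen.c
local notation "d'" => K.gen ξ KGen.d

theorem K.rel_ad : a' * d' = 1 := by
  simpa [K.gen] using K.mk_rel (KRel.ad (ξ := ξ))

theorem K.rel_da : d' * a' = 1 := by
  rw [← K.rel_ad]
  simpa [K.gen] using (K.mk_rel (KRel.ad_da (ξ := ξ))).symm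

theorem K.rel_a_four : a' * (a' * (a' * a')) = 1 := by
  simpa [K.gen, pow_succ, mul_assoc] using K.mk_rel (KRel.a_four (ξ := ξ))

theorem K.rel_aac : a' * (a' * c') = b' := by
  simpa [K.gen, pow_succ, mul_assoc] using K.mk_rel (KRel.aac (ξ := ξ))

theorem K.rel_bb : b' * b' = 0 := by
  simpa [K.gen, pow_succ, mul_assoc] using K.mk_rel (KRel.bb (ξ := ξ))

theorem K.rel_ab : a' * b' = ξ • (b' * a') := by
  simpa [K.gen, pow_succ, mul_assoc] using K.mk_rel (KRel.ab (ξ := ξ))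

theorem K.d_eq : d' = a' * (a' * a') := by
  have h := congrArg (fun z => d' * z) (K.rel_a_four ξ)
  simpa [← mul_assoc, K.rel_da] using h.symm

theorem K.c_eq : c' = a' * (a' * b') := by
  have h := congrArg (fun z => z * c') (K.rel_a_four ξ)
  simp only [mul_assoc, K.rel_aac, one_mul] at h
  exact h.symm

theorem sq_eq_neg_one (h : IsPrimitiveRoot ξ 4) : ξ * ξ = -1 := by
  have h4 : ξ ^ 4 = 1 := h.pow_eq_one
  have h2 : ξ ^ 2 ≠ 1 := h.pow_ne_one_of_pos_of_lt (by norm_num) (by norm_num)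
  have : (ξ ^ 2 - 1) * (ξ ^ 2 + 1) = 0 := by linear_combination h4
  rcases mul_eq_zero.1 this with h | h
  · exact absurd (sub_eq_zero.1 h) h2
  · linear_combination h

theorem K.rel_bb_assoc (w : K ξ) : b' * (b' * w) = 0 := by
  rw [← mul_assoc, K.rel_bb, zero_mul]

theorem K.rel_a_four_assoc (w : K ξ) : a' * (a' * (a' * (a' * w))) = w := by
  have h := congrArg (fun z => z * w) (K.rel_a_four ξ)
  simpa only [mul_assoc, one_mul] using h

variable [hξ : Fact (IsPrimitiveRoot ξ 4)]

theorem K.rel_ba : b' * a' = -ξ • (a' * b') := by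
  have h := sq_eq_neg_one ξ hξ.out
  rw [K.rel_ab, smul_smul, neg_mul, h, neg_neg, one_smul]

theorem K.rel_ba_assoc (w : K ξ) : b' * (a' * w) = -ξ • (a' * (b' * w)) := by
  rw [← mul_assoc, K.rel_ba, smul_mul_assoc, mul_assoc]

/-- The values of the coproduct of `𝒦` on the generators. -/
noncomputable def K.comulGen : KGen → K ξ ⊗[𝕜] K ξ
  | .a => a' ⊗ₜ a' + b' ⊗ₜ c'
  | .b => a' ⊗ₜ b' + b' ⊗ₜ d'
  | .c => c' ⊗ₜ a' + d' ⊗ₜ c'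
  | .d => c' ⊗ₜ b' + d' ⊗ₜ d'

/-- The values of the counit of `𝒦` on the generators. -/
def K.counitGen : KGen → 𝕜
  | .a => 1
  | .b => 0
  | .c => 0
  | .d => 1

/-- The values of the antipode of `𝒦` on the generators. -/
noncomputable def K.antipodeGen : KGen → (K ξ)ᵐᵒᵖ
  | .a => .op d'
  | .b => .op (ξ • b')
  | .c => .op (-ξ • c')
  | .d => .op a'

theorem K.comulGen_rel ⦃u v : FreeAlgebra 𝕜 KGen⦄ (h : KRel ξ u v) :
    FreeAlgebra.lift 𝕜 (K.comulGen ξ) u = FreeAlgebra.lift 𝕜 (K.comulGen ξ) v := by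
  have hs := sq_eq_neg_one ξ hξ.out
  cases h <;>
  simp only [map_mul, map_pow, map_smul, map_zero, map_one, FreeAlgebra.lift_ι_apply, K.comulGen,
    K.c_eq, K.d_eq, pow_succ, pow_zero, one_mul, add_mul, mul_add,
    Algebra.TensorProduct.tmul_mul_tmul, mul_assoc, K.rel_ba, K.rel_ba_assoc, K.rel_bb,
    K.rel_bb_assoc, K.rel_a_four, K.rel_a_four_assoc, smul_mul_assoc, mul_smul_comm, smul_smul,
    TensorProduct.tmul_smul, ← TensorProduct.smul_tmul', mul_zero, zero_mul, mul_one,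
    TensorProduct.tmul_zero, TensorProduct.zero_tmul, smul_zero, add_zero, zero_add,
    Algebra.TensorProduct.one_def, neg_mul, mul_neg, hs, neg_neg, one_smul, neg_smul,
    smul_neg, smul_add, TensorProduct.tmul_neg, TensorProduct.neg_tmul, neg_zero] <;>
  module

theorem K.counitGen_rel ⦃u v : FreeAlgebra 𝕜 KGen⦄ (h : KRel ξ u v) :
    FreeAlgebra.lift 𝕜 (K.counitGen (𝕜 := 𝕜)) u = FreeAlgebra.lift 𝕜 (K.counitGen (𝕜 := 𝕜)) v := by
  cases h <;> simp [K.counitGen]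

theorem K.antipodeGen_rel ⦃u v : FreeAlgebra 𝕜 KGen⦄ (h : KRel ξ u v) :
    FreeAlgebra.lift 𝕜 (K.antipodeGen ξ) u = FreeAlgebra.lift 𝕜 (K.antipodeGen ξ) v := by
  have hs := sq_eq_neg_one ξ hξ.out
  apply MulOpposite.unop_injective
  cases h <;>
  simp only [map_mul, map_pow, map_smul, map_zero, map_one, FreeAlgebra.lift_ι_apply,
    K.antipodeGen, MulOpposite.unop_mul, MulOpposite.unop_smul, MulOpposite.unop_op,
    MulOpposite.unop_pow, MulOpposite.unop_zero, MulOpposite.unop_one,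
    K.c_eq, K.d_eq, pow_succ, pow_zero, one_mul, mul_assoc, K.rel_ba, K.rel_ba_assoc, K.rel_bb,
    K.rel_bb_assoc, K.rel_a_four, K.rel_a_four_assoc, smul_mul_assoc, mul_smul_comm, smul_smul,
    mul_zero, zero_mul, mul_one, smul_zero, neg_mul, mul_neg, hs, neg_neg, one_smul, neg_smul,
    smul_neg, neg_zero]

/-- The coproduct of `𝒦`. -/
noncomputable def K.comulHom : K ξ →ₐ[𝕜] K ξ ⊗[𝕜] K ξ := K.lift (K.comulGen ξ) (K.comulGen_rel ξ)

/-- The counit of `𝒦`. -/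
noncomputable def K.counitHom : K ξ →ₐ[𝕜] 𝕜 := K.lift K.counitGen (K.counitGen_rel ξ)

/-- The antipode of `𝒦`, as an algebra map to the opposite algebra. -/
noncomputable def K.antipodeHom : K ξ →ₐ[𝕜] (K ξ)ᵐᵒᵖ :=
  K.lift (K.antipodeGen ξ) (K.antipodeGen_rel ξ)

noncomputable instance K.instBialgebra : Bialgebra 𝕜 (K ξ) :=
  Bialgebra.ofAlgHom (K.comulHom ξ) (K.counitHom ξ)
    (by
      refine K.hom_ext fun x => ?_
      cases x <;>
        simp [K.comulHom, K.comulGen, TensorProduct.add_tmul, TensorProduct.tmul_add] <;> abel)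
    (by
      refine K.hom_ext fun x => ?_
      cases x <;> simp [K.comulHom, K.counitHom, K.comulGen, K.counitGen])
    (by
      refine K.hom_ext fun x => ?_
      cases x <;> simp [K.comulHom, K.counitHom, K.comulGen, K.counitGen])

theorem K.comul_gen (x : KGen) : comul (R := 𝕜) (K.gen ξ x) = K.comulGen ξ x :=
  K.lift_gen _ (K.comulGen_rel ξ) x

theorem K.counit_gen (x : KGen) : counit (R := 𝕜) (K.gen ξ x) = K.counitGen x :=
  K.lift_gen _ (K.counitGen_rel ξ) x

/-- The Hopf algebra `𝒦`. -/
noncomputable instance K.instHopfAlgebra : HopfAlgebra 𝕜 (K ξ) :=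
  hopfOfGenerators (K.antipodeHom ξ) (Set.range (K.gen ξ)) (K.adjoin_gen ξ)
    (by
      have hs := sq_eq_neg_one ξ hξ.out
      rintro _ ⟨x, rfl⟩
      rw [K.comul_gen, K.counit_gen]
      cases x <;>
      simp [K.antipodeHom, K.comulGen, K.counitGen, K.antipodeGen, K.c_eq, K.d_eq, mul_assoc,
        K.rel_ba, K.rel_ba_assoc, K.rel_bb, K.rel_bb_assoc, K.rel_a_four, K.rel_a_four_assoc,
        smul_smul, hs])
    (by
      have hs := sq_eq_neg_one ξ hξ.out
      rintro _ ⟨x, rfl⟩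
      rw [K.comul_gen, K.counit_gen]
      cases x <;>
      simp [K.antipodeHom, K.comulGen, K.counitGen, K.antipodeGen, K.c_eq, K.d_eq, mul_assoc,
        K.rel_ba, K.rel_ba_assoc, K.rel_bb, K.rel_bb_assoc, K.rel_a_four, K.rel_a_four_assoc,
        smul_smul, hs])

end Relations

end AlgebraK

/-! ## The algebras `𝔄_{3,1}(μ)` and `𝔄_{3,3}(μ)` -/

/-- The index `j ∈ {1, 3}` of `V_{3,j}` and `𝔄_{3,j}(μ)`. -/
inductive Idx
  | one
  | three

/-- The generators `x, y` and `a, b, c, d` of `𝔄_{3,j}(μ)`. -/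
inductive AGen
  | x
  | y
  | k (g : KGen)

section AlgebraA

variable {𝕜 : Type u} [Field 𝕜]

local notation "fx" => FreeAlgebra.ι 𝕜 AGen.x
local notation "fy" => FreeAlgebra.ι 𝕜 AGen.y
local notation "fa" => FreeAlgebra.ι 𝕜 (AGen.k KGen.a)
local notation "fb" => FreeAlgebra.ι 𝕜 (AGen.k KGen.b)
local notation "fc" => FreeAlgebra.ι 𝕜 (AGen.k KGen.c)
local notation "fd" => FreeAlgebra.ι 𝕜 (AGen.k KGen.d)

/-- The defining relations of the algebra `𝔄_{3,1}(μ) = 𝔄_{3,3}(μ)`. -/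
inductive ARel (ξ μ : 𝕜) : FreeAlgebra 𝕜 AGen → FreeAlgebra 𝕜 AGen → Prop
  | k (u v : FreeAlgebra 𝕜 KGen) (h : KRel ξ u v) :
      ARel ξ μ (FreeAlgebra.lift 𝕜 (fun g => FreeAlgebra.ι 𝕜 (AGen.k g)) u)
        (FreeAlgebra.lift 𝕜 (fun g => FreeAlgebra.ι 𝕜 (AGen.k g)) v)
  | ax : ARel ξ μ (fa * fx) (-ξ • (fx * fa))
  | ay : ARel ξ μ (fa * fy) (-(fy * fa) - fx * fc)
  | bx : ARel ξ μ (fb * fx) (-ξ • (fx * fb))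
  | by_ : ARel ξ μ (fb * fy) (-(fy * fb) - fx * fd)
  | cx : ARel ξ μ (fc * fx) (ξ • (fx * fc))
  | cy : ARel ξ μ (fc * fy) (-(fy * fc) + fx * fa)
  | dx : ARel ξ μ (fd * fx) (ξ • (fx * fd))
  | dy : ARel ξ μ (fd * fy) (-(fy * fd) + fx * fb)
  | xx : ARel ξ μ (fx ^ 2 - 2 * fy ^ 2) (μ • (1 - fa ^ 2))
  | xy : ARel ξ μ (fx * fy + fy * fx) ((ξ * μ) • (fa * fc))
  | yyyy : ARel ξ μ (fy ^ 4) (-(μ • (fy ^ 2 * (1 - fa ^ 2))) - (μ ^ 2 / 2) • (1 - fa ^ 2))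

/-- The algebra `𝔄_{3,j}(μ)`. It does not depend on `j`, but its coalgebra structure does. -/
def A (_j : Idx) (ξ μ : 𝕜) : Type u := RingQuot (ARel ξ μ)

variable (j : Idx) (ξ μ : 𝕜)

noncomputable instance : Ring (A j ξ μ) := inferInstanceAs (Ring (RingQuot (ARel ξ μ)))

noncomputable instance : Algebra 𝕜 (A j ξ μ) :=
  inferInstanceAs (Algebra 𝕜 (RingQuot (ARel ξ μ)))

/-- The projection from the free algebra. -/
noncomputable def A.mk : FreeAlgebra 𝕜 AGen →ₐ[𝕜] A j ξ μ := RingQuot.mkAlgHom 𝕜 (ARel ξ μ)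

/-- A generator as an element of `𝔄_{3,j}(μ)`. -/
noncomputable def A.gen (g : AGen) : A j ξ μ := A.mk j ξ μ (.ι 𝕜 g)

variable {j ξ μ}

theorem A.mk_rel {u v : FreeAlgebra 𝕜 AGen} (h : ARel ξ μ u v) : A.mk j ξ μ u = A.mk j ξ μ v :=
  RingQuot.mkAlgHom_rel 𝕜 h

/-- The algebra map out of `𝔄_{3,j}(μ)` with prescribed values on the generators. -/
noncomputable def A.lift {B : Type u} [Ring B] [Algebra 𝕜 B] (f : AGen → B)
    (hf : ∀ ⦃u v⦄, ARel ξ μ u v → FreeAlgebra.lift 𝕜 f u = FreeAlgebra.lift 𝕜 f v) :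
    A j ξ μ →ₐ[𝕜] B :=
  RingQuot.liftAlgHom 𝕜 ⟨FreeAlgebra.lift 𝕜 f, hf⟩

@[simp]
theorem A.lift_gen {B : Type u} [Ring B] [Algebra 𝕜 B] (f : AGen → B)
    (hf : ∀ ⦃u v⦄, ARel ξ μ u v → FreeAlgebra.lift 𝕜 f u = FreeAlgebra.lift 𝕜 f v) (g : AGen) :
    A.lift f hf (A.gen j ξ μ g) = f g :=
  (RingQuot.liftAlgHom_mkAlgHom_apply 𝕜 (FreeAlgebra.lift 𝕜 f) hf _).trans
    (FreeAlgebra.lift_ι_apply f g)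

theorem A.adjoin_gen : Algebra.adjoin 𝕜 (Set.range (A.gen j ξ μ)) = ⊤ := by
  have h : Set.range (A.gen j ξ μ) = A.mk j ξ μ '' Set.range (FreeAlgebra.ι 𝕜) := by
    rw [← Set.range_comp]
    rfl
  rw [h, Algebra.adjoin_image, FreeAlgebra.adjoin_range_ι, Algebra.map_top,
    AlgHom.range_eq_top]
  exact RingQuot.mkAlgHom_surjective 𝕜 (ARel ξ μ)

theorem A.hom_ext {B : Type u} [Ring B] [Algebra 𝕜 B] {f g : A j ξ μ →ₐ[𝕜] B}
    (h : ∀ s, f (A.gen j ξ μ s) = g (A.gen j ξ μ s)) : f = g := by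
  refine AlgHom.ext_of_adjoin_eq_top A.adjoin_gen ?_
  rintro _ ⟨x, rfl⟩
  exact h x

variable (j ξ μ)

/-- The algebra map `𝒦 → 𝔄_{3,j}(μ)` fixing the generators `a, b, c, d`. -/
noncomputable def A.ofK : K ξ →ₐ[𝕜] A j ξ μ :=
  K.lift (fun g => A.gen j ξ μ (.k g)) (by
    intro u v h
    have e : FreeAlgebra.lift 𝕜 (fun g => A.gen j ξ μ (.k g)) =
        (A.mk j ξ μ).comp (FreeAlgebra.lift 𝕜 (fun g => FreeAlgebra.ι 𝕜 (AGen.k g))) := by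
      ext g
      simp [A.gen]
    rw [e]
    exact A.mk_rel (.k u v h))

@[simp]
theorem A.ofK_gen (g : KGen) : A.ofK j ξ μ (K.gen ξ g) = A.gen j ξ μ (.k g) := by
  simp [A.ofK]

section ARelations

local notation "ax" => A.gen j ξ μ AGen.x
local notation "ay" => A.gen j ξ μ AGen.y
local notation "aa" => A.gen j ξ μ (AGen.k KGen.a)
local notation "ab" => A.gen j ξ μ (AGen.k KGen.b)
local notation "ac" => A.gen j ξ μ (AGen.k KGen.c)
local notation "ad" => A.gen j ξ μ (AGen.k KGen.d)

theorem A.c_eq : ac = aa * (aa * ab) := by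
  simpa using congrArg (A.ofK j ξ μ) (K.c_eq ξ)

theorem A.d_eq : ad = aa * (aa * aa) := by
  simpa using congrArg (A.ofK j ξ μ) (K.d_eq ξ)

theorem A.rel_a_four : aa * (aa * (aa * aa)) = 1 := by
  simpa using congrArg (A.ofK j ξ μ) (K.rel_a_four ξ)

theorem A.rel_a_four_assoc (w : A j ξ μ) : aa * (aa * (aa * (aa * w))) = w := by
  simpa only [mul_assoc, one_mul] using congrArg (fun z => z * w) (A.rel_a_four j ξ μ)

theorem A.rel_bb : ab * ab = 0 := by
  simpa using congrArg (A.ofK j ξ μ) (K.rel_bb ξ)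

theorem A.rel_bb_assoc (w : A j ξ μ) : ab * (ab * w) = 0 := by
  rw [← mul_assoc, A.rel_bb, zero_mul]

theorem A.rel_ax : aa * ax = -(ξ • (ax * aa)) := by
  simpa [A.gen] using A.mk_rel (j := j) (ARel.ax (ξ := ξ) (μ := μ))

theorem A.rel_ax_assoc (w : A j ξ μ) : aa * (ax * w) = -(ξ • (ax * (aa * w))) := by
  rw [← mul_assoc, A.rel_ax, neg_mul, smul_mul_assoc, mul_assoc]

theorem A.rel_bx : ab * ax = -(ξ • (ax * ab)) := by
  simpa [A.gen] using A.mk_rel (j := j) (ARel.bx (ξ := ξ) (μ := μ))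

theorem A.rel_bx_assoc (w : A j ξ μ) : ab * (ax * w) = -(ξ • (ax * (ab * w))) := by
  rw [← mul_assoc, A.rel_bx, neg_mul, smul_mul_assoc, mul_assoc]

theorem A.rel_ay : aa * ay = -(ay * aa) - ax * (aa * (aa * ab)) := by
  rw [← A.c_eq]
  simpa [A.gen] using A.mk_rel (j := j) (ARel.ay (ξ := ξ) (μ := μ))

theorem A.rel_ay_assoc (w : A j ξ μ) :
    aa * (ay * w) = -(ay * (aa * w)) - ax * (aa * (aa * (ab * w))) := by
  rw [← mul_assoc, A.rel_ay]
  simp only [sub_mul, neg_mul, mul_assoc]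

theorem A.rel_by : ab * ay = -(ay * ab) - ax * (aa * (aa * aa)) := by
  rw [← A.d_eq]
  simpa [A.gen] using A.mk_rel (j := j) (ARel.by_ (ξ := ξ) (μ := μ))

theorem A.rel_by_assoc (w : A j ξ μ) :
    ab * (ay * w) = -(ay * (ab * w)) - ax * (aa * (aa * (aa * w))) := by
  rw [← mul_assoc, A.rel_by]
  simp only [sub_mul, neg_mul, mul_assoc]

theorem A.rel_xx : ax * ax = (2 : 𝕜) • (ay * ay) + μ • 1 - μ • (aa * aa) := by
  have h := A.mk_rel (j := j) (ARel.xx (ξ := ξ) (μ := μ))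
  simp only [map_sub, map_pow, map_mul, map_smul, map_one, map_ofNat] at h
  change ax ^ 2 - 2 * ay ^ 2 = μ • (1 - aa ^ 2) at h
  rw [sub_eq_iff_eq_add] at h
  rw [← sq, h, ofNat_smul_eq_nsmul]
  simp only [sq, smul_sub, nsmul_eq_mul, Nat.cast_ofNat]
  abel

theorem A.rel_xx_assoc (w : A j ξ μ) :
    ax * (ax * w) = (2 : 𝕜) • (ay * (ay * w)) + μ • w - μ • (aa * (aa * w)) := by
  rw [← mul_assoc, A.rel_xx]
  simp only [sub_mul, add_mul, smul_mul_assoc, mul_assoc, one_mul]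

theorem A.rel_yx : ay * ax = -(ax * ay) + (ξ * μ) • (aa * (aa * (aa * ab))) := by
  have h := A.mk_rel (j := j) (ARel.xy (ξ := ξ) (μ := μ))
  simp only [map_add, map_mul, map_smul] at h
  change ax * ay + ay * ax = (ξ * μ) • (aa * ac) at h
  rw [← A.c_eq, ← h]
  abel

theorem A.rel_yx_assoc (w : A j ξ μ) :
    ay * (ax * w) = -(ax * (ay * w)) + (ξ * μ) • (aa * (aa * (aa * (ab * w)))) := by
  rw [← mul_assoc, A.rel_yx]
  simp only [add_mul, neg_mul, smul_mul_assoc, mul_assoc]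

theorem A.rel_y_four : ay * (ay * (ay * ay)) =
    -(μ • (ay * ay)) + μ • (ay * (ay * (aa * aa))) - (μ ^ 2 / 2) • 1 +
      (μ ^ 2 / 2) • (aa * aa) := by
  have h := A.mk_rel (j := j) (ARel.yyyy (ξ := ξ) (μ := μ))
  simp only [map_sub, map_neg, map_pow, map_mul, map_smul, map_one] at h
  change ay ^ 4 = -(μ • (ay ^ 2 * (1 - aa ^ 2))) - (μ ^ 2 / 2) • (1 - aa ^ 2) at h
  have e : ay * (ay * (ay * ay)) = ay ^ 4 := by simp only [pow_succ, pow_zero, one_mul, mul_assoc]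
  rw [e, h]
  simp only [sq, smul_sub, mul_sub, mul_one, mul_assoc]
  abel

theorem A.rel_y_four_assoc (w : A j ξ μ) : ay * (ay * (ay * (ay * w))) =
    -(μ • (ay * (ay * w))) + μ • (ay * (ay * (aa * (aa * w)))) - (μ ^ 2 / 2) • w +
      (μ ^ 2 / 2) • (aa * (aa * w)) := by
  have h := congrArg (fun z => z * w) (A.rel_y_four j ξ μ)
  simpa only [mul_assoc, one_mul, add_mul, sub_mul, neg_mul, smul_mul_assoc] using h

variable [hξ : Fact (IsPrimitiveRoot ξ 4)]

theorem A.rel_ba : ab * aa = -(ξ • (aa * ab)) := by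
  simpa using congrArg (A.ofK j ξ μ) (K.rel_ba ξ)

theorem A.rel_ba_assoc (w : A j ξ μ) : ab * (aa * w) = -(ξ • (aa * (ab * w))) := by
  rw [← mul_assoc, A.rel_ba, neg_mul, smul_mul_assoc, mul_assoc]

end ARelations

end AlgebraA

/-! ## The coproduct of `𝔄_{3,j}(μ)` -/

set_option linter.unusedSimpArgs false

section AHopf

variable {𝕜 : Type u} [Field 𝕜] (j : Idx) (ξ μ : 𝕜)

/-- The values of the coproduct of `𝔄_{3,j}(μ)` on the generators. -/
noncomputable def A.comulGen : (j : Idx) → AGen → A j ξ μ ⊗[𝕜] A j ξ μ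
  | .one, .x =>
      A.gen .one ξ μ .x ⊗ₜ 1 +
      A.gen .one ξ μ (.k .d) ⊗ₜ A.gen .one ξ μ .x +
      (ξ - 1) • (A.gen .one ξ μ (.k .c) ⊗ₜ A.gen .one ξ μ .y)
  | .one, .y =>
      A.gen .one ξ μ .y ⊗ₜ 1 +
      A.gen .one ξ μ (.k .a) ⊗ₜ A.gen .one ξ μ .y +
      ((1 / 2) * (-ξ - 1)) • (A.gen .one ξ μ (.k .b) ⊗ₜ A.gen .one ξ μ .x)
  | .three, .x =>
      A.gen .three ξ μ .x ⊗ₜ 1 +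
      A.gen .three ξ μ (.k .a) ⊗ₜ A.gen .three ξ μ .x +
      (ξ + 1) • (A.gen .three ξ μ (.k .b) ⊗ₜ A.gen .three ξ μ .y)
  | .three, .y =>
      A.gen .three ξ μ .y ⊗ₜ 1 +
      A.gen .three ξ μ (.k .d) ⊗ₜ A.gen .three ξ μ .y +
      ((1 / 2) * (1 - ξ)) • (A.gen .three ξ μ (.k .c) ⊗ₜ A.gen .three ξ μ .x)
  | j, .k .a => A.gen j ξ μ (.k .a) ⊗ₜ A.gen j ξ μ (.k .a) + A.gen j ξ μ (.k .b) ⊗ₜ A.gen j ξ μ (.k .c)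
  | j, .k .b => A.gen j ξ μ (.k .a) ⊗ₜ A.gen j ξ μ (.k .b) + A.gen j ξ μ (.k .b) ⊗ₜ A.gen j ξ μ (.k .d)
  | j, .k .c => A.gen j ξ μ (.k .c) ⊗ₜ A.gen j ξ μ (.k .a) + A.gen j ξ μ (.k .d) ⊗ₜ A.gen j ξ μ (.k .c)
  | j, .k .d => A.gen j ξ μ (.k .c) ⊗ₜ A.gen j ξ μ (.k .b) + A.gen j ξ μ (.k .d) ⊗ₜ A.gen j ξ μ (.k .d)

section XFour

variable {B : Type u} [Ring B] [Algebra 𝕜 B] [CharZero 𝕜]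

theorem x_four_aux {μ : 𝕜} {X Y a : B} (hxx : X ^ 2 - 2 * Y ^ 2 = μ • (1 - a ^ 2))
    (hc : a ^ 2 * Y ^ 2 = Y ^ 2 * a ^ 2) (ha : a ^ 4 = 1) :
    X ^ 4 = (4 : 𝕜) • (Y ^ 4 + μ • (Y ^ 2 * (1 - a ^ 2)) + (μ ^ 2 / 2) • (1 - a ^ 2)) := by
  have h1 : X ^ 4 = X ^ 2 * X ^ 2 := by rw [← pow_add]
  have h2 : Y ^ 4 = Y ^ 2 * Y ^ 2 := by rw [← pow_add]
  have h3 : a ^ 2 * a ^ 2 = 1 := by rw [← pow_add, ha]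
  have h4 : X ^ 2 = (2 : 𝕜) • Y ^ 2 + μ • 1 - μ • a ^ 2 := by
    rw [sub_eq_iff_eq_add] at hxx
    rw [hxx, two_mul]
    module
  rw [h1, h2, h4]
  simp only [mul_add, add_mul, mul_sub, sub_mul, smul_mul_assoc, mul_smul_comm, mul_one, one_mul,
    hc, h3]
  module

end XFour

section ARelations2

local notation "ax" => A.gen j ξ μ AGen.x
local notation "ay" => A.gen j ξ μ AGen.y
local notation "aa" => A.gen j ξ μ (AGen.k KGen.a)
local notation "ab" => A.gen j ξ μ (AGen.k KGen.b)
local notation "ac" => A.gen j ξ μ (AGen.k KGen.c)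
local notation "ad" => A.gen j ξ μ (AGen.k KGen.d)

variable [hξ : Fact (IsPrimitiveRoot ξ 4)]

theorem A.rel_yy [CharZero 𝕜] :
    ay * ay = (1 / 2 : 𝕜) • (ax * ax) - (μ / 2) • 1 + (μ / 2) • (aa * aa) := by
  rw [A.rel_xx]
  module

theorem A.rel_yy_assoc [CharZero 𝕜] (w : A j ξ μ) :
    ay * (ay * w) = (1 / 2 : 𝕜) • (ax * (ax * w)) - (μ / 2) • w + (μ / 2) • (aa * (aa * w)) := by
  rw [← mul_assoc, A.rel_yy]
  simp only [sub_mul, add_mul, smul_mul_assoc, mul_assoc, one_mul]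

theorem A.rel_x_four [CharZero 𝕜] : ax * (ax * (ax * ax)) = 0 := by
  have hs := sq_eq_neg_one ξ hξ.out
  have e : ax * (ax * (ax * ax)) = ax ^ 4 := by simp only [pow_succ, pow_zero, one_mul, mul_assoc]
  have h4 : aa ^ 4 = 1 := by simp only [pow_succ, pow_zero, one_mul, mul_assoc, A.rel_a_four]
  have hxx : ax ^ 2 - 2 * ay ^ 2 = μ • (1 - aa ^ 2) := by
    rw [sq, A.rel_xx, two_mul, sq, sq]
    module
  have hc1 : aa * (aa * ay) = ay * (aa * aa) := by
    simp only [mul_assoc, A.rel_ay, A.rel_ax_assoc, A.rel_ba, mul_sub, mul_neg, mul_smul_comm,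
      sub_mul, neg_mul, ← mul_assoc aa ay, A.rel_ba_assoc]
    module
  have hc : aa ^ 2 * ay ^ 2 = ay ^ 2 * aa ^ 2 := by
    simp only [sq, mul_assoc]
    rw [← mul_assoc aa ay, ← mul_assoc aa, hc1, mul_assoc, mul_assoc, hc1]
  have h := A.rel_y_four j ξ μ
  have hz : ay ^ 4 + μ • (ay ^ 2 * (1 - aa ^ 2)) + (μ ^ 2 / 2) • (1 - aa ^ 2) = 0 := by
    simp only [pow_succ, pow_zero, one_mul, mul_assoc, mul_sub, mul_one]
    rw [h]
    module
  rw [e, x_four_aux hxx hc h4, hz, smul_zero]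

theorem A.rel_x_four_assoc [CharZero 𝕜] (w : A j ξ μ) : ax * (ax * (ax * (ax * w))) = 0 := by
  have h := congrArg (fun z => z * w) (A.rel_x_four j ξ μ)
  simpa only [mul_assoc, zero_mul] using h

end ARelations2

/-- The values of the counit of `𝔄_{3,j}(μ)` on the generators. -/
def A.counitGen : AGen → 𝕜
  | .x => 0
  | .y => 0
  | .k g => K.counitGen g

/-- The values of the antipode of `𝔄_{3,j}(μ)` on the generators. -/
noncomputable def A.antipodeGen : (j : Idx) → AGen → (A j ξ μ)ᵐᵒᵖ
  | .one, .x =>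
      .op (-(A.gen .one ξ μ (.k .a) * A.gen .one ξ μ .x) -
      (1 + ξ) • (A.gen .one ξ μ (.k .c) * A.gen .one ξ μ .y))
  | .one, .y =>
      .op (-(A.gen .one ξ μ (.k .d) * A.gen .one ξ μ .y) +
      ((1 / 2) * (ξ - 1)) • (A.gen .one ξ μ (.k .b) * A.gen .one ξ μ .x))
  | .three, .x =>
      .op (-(A.gen .three ξ μ (.k .d) * A.gen .three ξ μ .x) -
      (ξ - 1) • (A.gen .three ξ μ (.k .b) * A.gen .three ξ μ .y))
  | .three, .y =>
      .op (-(A.gen .three ξ μ (.k .a) * A.gen .three ξ μ .y) +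
      ((1 / 2) * (1 + ξ)) • (A.gen .three ξ μ (.k .c) * A.gen .three ξ μ .x))
  | j, .k .a => .op (A.gen j ξ μ (.k .d))
  | j, .k .b => .op (ξ • A.gen j ξ μ (.k .b))
  | j, .k .c => .op (-ξ • A.gen j ξ μ (.k .c))
  | j, .k .d => .op (A.gen j ξ μ (.k .a))

theorem A.counitGen_rel ⦃u v : FreeAlgebra 𝕜 AGen⦄ (h : ARel ξ μ u v) :
    FreeAlgebra.lift 𝕜 (A.counitGen (𝕜 := 𝕜)) u = FreeAlgebra.lift 𝕜 (A.counitGen (𝕜 := 𝕜)) v := by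
  cases h with
  | k u v h => cases h <;> simp [A.counitGen, K.counitGen]
  | _ => simp [A.counitGen, K.counitGen]

section HopfA

variable [hξ : Fact (IsPrimitiveRoot ξ 4)]

theorem A.antipodeGen_rel_k ⦃u v : FreeAlgebra 𝕜 KGen⦄ (h : KRel ξ u v) :
    FreeAlgebra.lift 𝕜 (fun g => A.antipodeGen ξ μ j (.k g)) u =
      FreeAlgebra.lift 𝕜 (fun g => A.antipodeGen ξ μ j (.k g)) v := by
  have e : FreeAlgebra.lift 𝕜 (fun g => A.antipodeGen ξ μ j (.k g)) =
      ((AlgHom.op (A.ofK j ξ μ)).comp (FreeAlgebra.lift 𝕜 (K.antipodeGen ξ))) := by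
    ext g
    cases g <;> cases j <;> simp [A.antipodeGen, K.antipodeGen]
  rw [e, AlgHom.comp_apply, AlgHom.comp_apply, K.antipodeGen_rel ξ h]

theorem A.comulGen_rel_k ⦃u v : FreeAlgebra 𝕜 KGen⦄ (h : KRel ξ u v) :
    FreeAlgebra.lift 𝕜 (fun g => A.comulGen ξ μ j (.k g)) u =
      FreeAlgebra.lift 𝕜 (fun g => A.comulGen ξ μ j (.k g)) v := by
  have e : FreeAlgebra.lift 𝕜 (fun g => A.comulGen ξ μ j (.k g)) =
      ((Algebra.TensorProduct.map (A.ofK j ξ μ) (A.ofK j ξ μ)).comp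
        (FreeAlgebra.lift 𝕜 (K.comulGen ξ))) := by
    ext g
    cases g <;> cases j <;> simp [A.comulGen, K.comulGen]
  rw [e, AlgHom.comp_apply, AlgHom.comp_apply, K.comulGen_rel ξ h]

variable [CharZero 𝕜]

/-- Elements of an algebra satisfying the defining relations of `𝔄_{3,j}(μ)`; the last relation
may be replaced by `x⁴ = 0`, and those which involve `c, x`, `c, y`, `d, x` or `d, y` are redundant. -/
theorem A.rel_of {B : Type u} [Ring B] [Algebra 𝕜 B] (f : AGen → B)
    (hk : ∀ ⦃u v⦄, KRel ξ u v →
      FreeAlgebra.lift 𝕜 (fun g => f (.k g)) u = FreeAlgebra.lift 𝕜 (fun g => f (.k g)) v)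
    (hax : f (.k .a) * f .x = -ξ • (f .x * f (.k .a)))
    (hay : f (.k .a) * f .y = -(f .y * f (.k .a)) - f .x * f (.k .c))
    (hbx : f (.k .b) * f .x = -ξ • (f .x * f (.k .b)))
    (hby : f (.k .b) * f .y = -(f .y * f (.k .b)) - f .x * f (.k .d))
    (hxx : f .x * f .x - (f .y * f .y + f .y * f .y) = μ • (1 - f (.k .a) * f (.k .a)))
    (hxy : f .x * f .y + f .y * f .x = (ξ * μ) • (f (.k .a) * f (.k .c)))
    (hx4 : (f .x * f .x) * (f .x * f .x) = 0)
    ⦃u v : FreeAlgebra 𝕜 AGen⦄ (h : ARel ξ μ u v) :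
    FreeAlgebra.lift 𝕜 f u = FreeAlgebra.lift 𝕜 f v := by
  have hs := sq_eq_neg_one ξ hξ.out
  have hb : ∀ g, K.lift (fun g => f (.k g)) hk (K.gen ξ g) = f (.k g) := fun g => K.lift_gen _ hk g
  have hd : f (.k .d) = f (.k .a) * (f (.k .a) * f (.k .a)) := by
    simpa only [map_mul, hb] using congrArg (K.lift _ hk) (K.d_eq ξ)
  have hc : f (.k .c) = f (.k .a) * (f (.k .a) * f (.k .b)) := by
    simpa only [map_mul, hb] using congrArg (K.lift _ hk) (K.c_eq ξ)
  have ha4 : f (.k .a) * (f (.k .a) * (f (.k .a) * f (.k .a))) = 1 := by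
    simpa only [map_mul, hb, map_one] using congrArg (K.lift _ hk) (K.rel_a_four ξ)
  have hba : f (.k .b) * f (.k .a) = -ξ • (f (.k .a) * f (.k .b)) := by
    simpa only [map_mul, hb, map_smul] using congrArg (K.lift _ hk) (K.rel_ba ξ)
  generalize hX : f .x = X at *
  generalize hY : f .y = Y at *
  generalize hA : f (.k .a) = a at *
  generalize hB : f (.k .b) = b at *
  have ha4' : ∀ w, a * (a * (a * (a * w))) = w := fun w => by
    simpa only [mul_assoc, one_mul] using congrArg (fun z => z * w) ha4
  have hba' : ∀ w, b * (a * w) = -ξ • (a * (b * w)) := fun w => by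
    rw [← mul_assoc, hba, smul_mul_assoc, mul_assoc]
  have hax' : ∀ w, a * (X * w) = -ξ • (X * (a * w)) := fun w => by
    rw [← mul_assoc, hax, smul_mul_assoc, mul_assoc]
  rw [hc] at hay
  rw [hd] at hby
  have hay' : ∀ w, a * (Y * w) = -(Y * (a * w)) - X * (a * (a * (b * w))) := fun w => by
    rw [← mul_assoc, hay]
    simp only [sub_mul, neg_mul, mul_assoc]
  have hxx2 : X ^ 2 - 2 * Y ^ 2 = μ • (1 - a ^ 2) := by simpa only [sq, two_mul] using hxx
  cases h with
  | k u v h =>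
    have e : (FreeAlgebra.lift 𝕜 f).comp
        (FreeAlgebra.lift 𝕜 (fun g => FreeAlgebra.ι 𝕜 (AGen.k g))) =
          FreeAlgebra.lift 𝕜 (fun g => f (.k g)) := by
      ext g
      simp
    rw [← AlgHom.comp_apply, ← AlgHom.comp_apply, e, hk h]
  | xx => simpa [hX, hY, hA, map_ofNat] using hxx2
  | yyyy =>
    have h4 : a ^ 4 = 1 := by simpa only [pow_succ, pow_zero, one_mul, mul_assoc] using ha4
    have hc1 : a * (a * Y) = Y * (a * a) := by
      simp only [mul_assoc, hay, hax', hba, mul_sub, mul_neg, mul_smul_comm, sub_mul, neg_mul,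
        ← mul_assoc a Y]
      module
    have hcc : a ^ 2 * Y ^ 2 = Y ^ 2 * a ^ 2 := by
      simp only [sq, mul_assoc]
      rw [← mul_assoc a Y, ← mul_assoc a, hc1, mul_assoc, mul_assoc, hc1]
    have key := x_four_aux hxx2 hcc h4
    have hx0 : X ^ 4 = 0 := by rw [← hx4, ← sq, ← sq, ← pow_mul]
    rw [hx0, eq_comm, smul_eq_zero_iff_right (by norm_num)] at key
    have goal : Y ^ 4 = -(μ • (Y ^ 2 * (1 - a ^ 2))) - (μ ^ 2 / 2) • (1 - a ^ 2) := by
      rw [← sub_eq_zero, ← key]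
      abel
    simpa [hX, hY, hA] using goal
  | _ =>
    simp only [map_mul, map_smul, map_add, map_sub, map_neg, FreeAlgebra.lift_ι_apply, hX, hY, hA,
      hB, hc, hd, mul_assoc, hay, hay', hax, hax', hba, hba', hbx, hby, hxy, ha4, ha4', mul_sub,
      mul_neg, mul_smul_comm, smul_neg, neg_neg, smul_sub, mul_one] <;>
    first
    | done
    | (match_scalars <;> grind)

theorem A.antipodeGen_x_sq_one :
    (A.antipodeGen ξ μ .one .x).unop * (A.antipodeGen ξ μ .one .x).unop =
      -ξ • ((A.gen .one ξ μ .x) * ((A.gen .one ξ μ .x) * ((A.gen .one ξ μ (.k .a)) * (A.gen .one ξ μ (.k .a))))) + (2 : 𝕜) • ((A.gen .one ξ μ .x) * ((A.gen .one ξ μ .y) * ((A.gen .one ξ μ (.k .a)) * ((A.gen .one ξ μ (.k .a)) * ((A.gen .one ξ μ (.k .a)) * (A.gen .one ξ μ (.k .b))))))) := by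
  have hs := sq_eq_neg_one ξ hξ.out
  simp only [A.antipodeGen, MulOpposite.unop_mul, MulOpposite.unop_smul, MulOpposite.unop_op, MulOpposite.unop_pow,
      MulOpposite.unop_zero, MulOpposite.unop_one, MulOpposite.unop_add, MulOpposite.unop_sub,
      MulOpposite.unop_neg, MulOpposite.unop_ofNat, A.c_eq, A.d_eq, pow_succ, pow_zero, one_mul, mul_assoc, mul_add, add_mul, mul_sub, sub_mul,
      two_mul, A.rel_ba, A.rel_ba_assoc, A.rel_bb, A.rel_bb_assoc, A.rel_a_four,
      A.rel_a_four_assoc, A.rel_ax, A.rel_ax_assoc, A.rel_ay, A.rel_ay_assoc, A.rel_bx,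
      A.rel_bx_assoc, A.rel_by, A.rel_by_assoc, A.rel_yy, A.rel_yy_assoc, A.rel_yx,
      A.rel_yx_assoc, A.rel_x_four, A.rel_x_four_assoc, smul_mul_assoc, mul_smul_comm,
      mul_zero, zero_mul, mul_one, smul_zero, neg_mul, mul_neg, neg_neg, smul_neg, neg_zero,
      add_zero, zero_add, sub_zero, zero_sub, smul_add, smul_sub]
  match_scalars <;> first | ring1 | grind

theorem A.antipodeGen_x_four_one :
    ((A.antipodeGen ξ μ .one .x).unop * (A.antipodeGen ξ μ .one .x).unop) * ((A.antipodeGen ξ μ .one .x).unop * (A.antipodeGen ξ μ .one .x).unop) = 0 := by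
  have hs := sq_eq_neg_one ξ hξ.out
  rw [A.antipodeGen_x_sq_one]
  simp only [neg_smul, A.c_eq, A.d_eq, pow_succ, pow_zero, one_mul, mul_assoc, mul_add, add_mul, mul_sub, sub_mul,
      two_mul, A.rel_ba, A.rel_ba_assoc, A.rel_bb, A.rel_bb_assoc, A.rel_a_four,
      A.rel_a_four_assoc, A.rel_ax, A.rel_ax_assoc, A.rel_ay, A.rel_ay_assoc, A.rel_bx,
      A.rel_bx_assoc, A.rel_by, A.rel_by_assoc, A.rel_yy, A.rel_yy_assoc, A.rel_yx,
      A.rel_yx_assoc, A.rel_x_four, A.rel_x_four_assoc, smul_mul_assoc, mul_smul_comm,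
      mul_zero, zero_mul, mul_one, smul_zero, neg_mul, mul_neg, neg_neg, smul_neg, neg_zero,
      add_zero, zero_add, sub_zero, zero_sub, smul_add, smul_sub]
  match_scalars <;> first | ring1 | grind

theorem A.antipodeGen_x_sq_three :
    (A.antipodeGen ξ μ .three .x).unop * (A.antipodeGen ξ μ .three .x).unop =
      ξ • ((A.gen .three ξ μ .x) * ((A.gen .three ξ μ .x) * ((A.gen .three ξ μ (.k .a)) * (A.gen .three ξ μ (.k .a))))) - (2 : 𝕜) • ((A.gen .three ξ μ .x) * ((A.gen .three ξ μ .y) * ((A.gen .three ξ μ (.k .a)) * ((A.gen .three ξ μ (.k .a)) * ((A.gen .three ξ μ (.k .a)) * (A.gen .three ξ μ (.k .b))))))) := by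
  have hs := sq_eq_neg_one ξ hξ.out
  simp only [A.antipodeGen, MulOpposite.unop_mul, MulOpposite.unop_smul, MulOpposite.unop_op, MulOpposite.unop_pow,
      MulOpposite.unop_zero, MulOpposite.unop_one, MulOpposite.unop_add, MulOpposite.unop_sub,
      MulOpposite.unop_neg, MulOpposite.unop_ofNat, A.c_eq, A.d_eq, pow_succ, pow_zero, one_mul, mul_assoc, mul_add, add_mul, mul_sub, sub_mul,
      two_mul, A.rel_ba, A.rel_ba_assoc, A.rel_bb, A.rel_bb_assoc, A.rel_a_four,
      A.rel_a_four_assoc, A.rel_ax, A.rel_ax_assoc, A.rel_ay, A.rel_ay_assoc, A.rel_bx,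
      A.rel_bx_assoc, A.rel_by, A.rel_by_assoc, A.rel_yy, A.rel_yy_assoc, A.rel_yx,
      A.rel_yx_assoc, A.rel_x_four, A.rel_x_four_assoc, smul_mul_assoc, mul_smul_comm,
      mul_zero, zero_mul, mul_one, smul_zero, neg_mul, mul_neg, neg_neg, smul_neg, neg_zero,
      add_zero, zero_add, sub_zero, zero_sub, smul_add, smul_sub]
  match_scalars <;> first | ring1 | grind

theorem A.antipodeGen_x_four_three :
    ((A.antipodeGen ξ μ .three .x).unop * (A.antipodeGen ξ μ .three .x).unop) * ((A.antipodeGen ξ μ .three .x).unop * (A.antipodeGen ξ μ .three .x).unop) = 0 := by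
  have hs := sq_eq_neg_one ξ hξ.out
  rw [A.antipodeGen_x_sq_three]
  simp only [neg_smul, A.c_eq, A.d_eq, pow_succ, pow_zero, one_mul, mul_assoc, mul_add, add_mul, mul_sub, sub_mul,
      two_mul, A.rel_ba, A.rel_ba_assoc, A.rel_bb, A.rel_bb_assoc, A.rel_a_four,
      A.rel_a_four_assoc, A.rel_ax, A.rel_ax_assoc, A.rel_ay, A.rel_ay_assoc, A.rel_bx,
      A.rel_bx_assoc, A.rel_by, A.rel_by_assoc, A.rel_yy, A.rel_yy_assoc, A.rel_yx,
      A.rel_yx_assoc, A.rel_x_four, A.rel_x_four_assoc, smul_mul_assoc, mul_smul_comm,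
      mul_zero, zero_mul, mul_one, smul_zero, neg_mul, mul_neg, neg_neg, smul_neg, neg_zero,
      add_zero, zero_add, sub_zero, zero_sub, smul_add, smul_sub]
  match_scalars <;> first | ring1 | grind

theorem A.antipodeGen_rel ⦃u v : FreeAlgebra 𝕜 AGen⦄ (h : ARel ξ μ u v) :
    FreeAlgebra.lift 𝕜 (A.antipodeGen ξ μ j) u = FreeAlgebra.lift 𝕜 (A.antipodeGen ξ μ j) v := by
  have hs := sq_eq_neg_one ξ hξ.out
  refine A.rel_of ξ μ (A.antipodeGen ξ μ j) (A.antipodeGen_rel_k j ξ μ) ?_ ?_ ?_ ?_ ?_ ?_ ?_ h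
  · apply MulOpposite.unop_injective
    cases j <;>
    simp only [A.antipodeGen, MulOpposite.unop_mul, MulOpposite.unop_smul, MulOpposite.unop_op, MulOpposite.unop_pow,
      MulOpposite.unop_zero, MulOpposite.unop_one, MulOpposite.unop_add, MulOpposite.unop_sub,
      MulOpposite.unop_neg, MulOpposite.unop_ofNat, A.c_eq, A.d_eq, pow_succ, pow_zero, one_mul, mul_assoc, mul_add, add_mul, mul_sub, sub_mul,
      two_mul, A.rel_ba, A.rel_ba_assoc, A.rel_bb, A.rel_bb_assoc, A.rel_a_four,
      A.rel_a_four_assoc, A.rel_ax, A.rel_ax_assoc, A.rel_ay, A.rel_ay_assoc, A.rel_bx,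
      A.rel_bx_assoc, A.rel_by, A.rel_by_assoc, A.rel_yy, A.rel_yy_assoc, A.rel_yx,
      A.rel_yx_assoc, A.rel_x_four, A.rel_x_four_assoc, smul_mul_assoc, mul_smul_comm,
      mul_zero, zero_mul, mul_one, smul_zero, neg_mul, mul_neg, neg_neg, smul_neg, neg_zero,
      add_zero, zero_add, sub_zero, zero_sub, smul_add, smul_sub] <;>
    match_scalars <;> first | ring1 | grind
  · apply MulOpposite.unop_injective
    cases j <;>
    simp only [A.antipodeGen, MulOpposite.unop_mul, MulOpposite.unop_smul, MulOpposite.unop_op, MulOpposite.unop_pow,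
      MulOpposite.unop_zero, MulOpposite.unop_one, MulOpposite.unop_add, MulOpposite.unop_sub,
      MulOpposite.unop_neg, MulOpposite.unop_ofNat, A.c_eq, A.d_eq, pow_succ, pow_zero, one_mul, mul_assoc, mul_add, add_mul, mul_sub, sub_mul,
      two_mul, A.rel_ba, A.rel_ba_assoc, A.rel_bb, A.rel_bb_assoc, A.rel_a_four,
      A.rel_a_four_assoc, A.rel_ax, A.rel_ax_assoc, A.rel_ay, A.rel_ay_assoc, A.rel_bx,
      A.rel_bx_assoc, A.rel_by, A.rel_by_assoc, A.rel_yy, A.rel_yy_assoc, A.rel_yx,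
      A.rel_yx_assoc, A.rel_x_four, A.rel_x_four_assoc, smul_mul_assoc, mul_smul_comm,
      mul_zero, zero_mul, mul_one, smul_zero, neg_mul, mul_neg, neg_neg, smul_neg, neg_zero,
      add_zero, zero_add, sub_zero, zero_sub, smul_add, smul_sub] <;>
    match_scalars <;> first | ring1 | grind
  · apply MulOpposite.unop_injective
    cases j <;>
    simp only [A.antipodeGen, MulOpposite.unop_mul, MulOpposite.unop_smul, MulOpposite.unop_op, MulOpposite.unop_pow,
      MulOpposite.unop_zero, MulOpposite.unop_one, MulOpposite.unop_add, MulOpposite.unop_sub,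
      MulOpposite.unop_neg, MulOpposite.unop_ofNat, A.c_eq, A.d_eq, pow_succ, pow_zero, one_mul, mul_assoc, mul_add, add_mul, mul_sub, sub_mul,
      two_mul, A.rel_ba, A.rel_ba_assoc, A.rel_bb, A.rel_bb_assoc, A.rel_a_four,
      A.rel_a_four_assoc, A.rel_ax, A.rel_ax_assoc, A.rel_ay, A.rel_ay_assoc, A.rel_bx,
      A.rel_bx_assoc, A.rel_by, A.rel_by_assoc, A.rel_yy, A.rel_yy_assoc, A.rel_yx,
      A.rel_yx_assoc, A.rel_x_four, A.rel_x_four_assoc, smul_mul_assoc, mul_smul_comm,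
      mul_zero, zero_mul, mul_one, smul_zero, neg_mul, mul_neg, neg_neg, smul_neg, neg_zero,
      add_zero, zero_add, sub_zero, zero_sub, smul_add, smul_sub] <;>
    match_scalars <;> first | ring1 | grind
  · apply MulOpposite.unop_injective
    cases j <;>
    simp only [A.antipodeGen, MulOpposite.unop_mul, MulOpposite.unop_smul, MulOpposite.unop_op, MulOpposite.unop_pow,
      MulOpposite.unop_zero, MulOpposite.unop_one, MulOpposite.unop_add, MulOpposite.unop_sub,
      MulOpposite.unop_neg, MulOpposite.unop_ofNat, A.c_eq, A.d_eq, pow_succ, pow_zero, one_mul, mul_assoc, mul_add, add_mul, mul_sub, sub_mul,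
      two_mul, A.rel_ba, A.rel_ba_assoc, A.rel_bb, A.rel_bb_assoc, A.rel_a_four,
      A.rel_a_four_assoc, A.rel_ax, A.rel_ax_assoc, A.rel_ay, A.rel_ay_assoc, A.rel_bx,
      A.rel_bx_assoc, A.rel_by, A.rel_by_assoc, A.rel_yy, A.rel_yy_assoc, A.rel_yx,
      A.rel_yx_assoc, A.rel_x_four, A.rel_x_four_assoc, smul_mul_assoc, mul_smul_comm,
      mul_zero, zero_mul, mul_one, smul_zero, neg_mul, mul_neg, neg_neg, smul_neg, neg_zero,
      add_zero, zero_add, sub_zero, zero_sub, smul_add, smul_sub] <;>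
    match_scalars <;> first | ring1 | grind
  · apply MulOpposite.unop_injective
    cases j
    · simp only [MulOpposite.unop_sub, MulOpposite.unop_mul, MulOpposite.unop_add, A.antipodeGen_x_sq_one]
      simp only [A.antipodeGen, MulOpposite.unop_mul, MulOpposite.unop_smul, MulOpposite.unop_op, MulOpposite.unop_pow,
      MulOpposite.unop_zero, MulOpposite.unop_one, MulOpposite.unop_add, MulOpposite.unop_sub,
      MulOpposite.unop_neg, MulOpposite.unop_ofNat, A.c_eq, A.d_eq, pow_succ, pow_zero, one_mul, mul_assoc, mul_add, add_mul, mul_sub, sub_mul,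
      two_mul, A.rel_ba, A.rel_ba_assoc, A.rel_bb, A.rel_bb_assoc, A.rel_a_four,
      A.rel_a_four_assoc, A.rel_ax, A.rel_ax_assoc, A.rel_ay, A.rel_ay_assoc, A.rel_bx,
      A.rel_bx_assoc, A.rel_by, A.rel_by_assoc, A.rel_yy, A.rel_yy_assoc, A.rel_yx,
      A.rel_yx_assoc, A.rel_x_four, A.rel_x_four_assoc, smul_mul_assoc, mul_smul_comm,
      mul_zero, zero_mul, mul_one, smul_zero, neg_mul, mul_neg, neg_neg, smul_neg, neg_zero,
      add_zero, zero_add, sub_zero, zero_sub, smul_add, smul_sub]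
      match_scalars <;> first | ring1 | grind
    · simp only [MulOpposite.unop_sub, MulOpposite.unop_mul, MulOpposite.unop_add, A.antipodeGen_x_sq_three]
      simp only [A.antipodeGen, MulOpposite.unop_mul, MulOpposite.unop_smul, MulOpposite.unop_op, MulOpposite.unop_pow,
      MulOpposite.unop_zero, MulOpposite.unop_one, MulOpposite.unop_add, MulOpposite.unop_sub,
      MulOpposite.unop_neg, MulOpposite.unop_ofNat, A.c_eq, A.d_eq, pow_succ, pow_zero, one_mul, mul_assoc, mul_add, add_mul, mul_sub, sub_mul,
      two_mul, A.rel_ba, A.rel_ba_assoc, A.rel_bb, A.rel_bb_assoc, A.rel_a_four,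
      A.rel_a_four_assoc, A.rel_ax, A.rel_ax_assoc, A.rel_ay, A.rel_ay_assoc, A.rel_bx,
      A.rel_bx_assoc, A.rel_by, A.rel_by_assoc, A.rel_yy, A.rel_yy_assoc, A.rel_yx,
      A.rel_yx_assoc, A.rel_x_four, A.rel_x_four_assoc, smul_mul_assoc, mul_smul_comm,
      mul_zero, zero_mul, mul_one, smul_zero, neg_mul, mul_neg, neg_neg, smul_neg, neg_zero,
      add_zero, zero_add, sub_zero, zero_sub, smul_add, smul_sub]
      match_scalars <;> first | ring1 | grind
  · apply MulOpposite.unop_injective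
    cases j <;>
    simp only [A.antipodeGen, MulOpposite.unop_mul, MulOpposite.unop_smul, MulOpposite.unop_op, MulOpposite.unop_pow,
      MulOpposite.unop_zero, MulOpposite.unop_one, MulOpposite.unop_add, MulOpposite.unop_sub,
      MulOpposite.unop_neg, MulOpposite.unop_ofNat, A.c_eq, A.d_eq, pow_succ, pow_zero, one_mul, mul_assoc, mul_add, add_mul, mul_sub, sub_mul,
      two_mul, A.rel_ba, A.rel_ba_assoc, A.rel_bb, A.rel_bb_assoc, A.rel_a_four,
      A.rel_a_four_assoc, A.rel_ax, A.rel_ax_assoc, A.rel_ay, A.rel_ay_assoc, A.rel_bx,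
      A.rel_bx_assoc, A.rel_by, A.rel_by_assoc, A.rel_yy, A.rel_yy_assoc, A.rel_yx,
      A.rel_yx_assoc, A.rel_x_four, A.rel_x_four_assoc, smul_mul_assoc, mul_smul_comm,
      mul_zero, zero_mul, mul_one, smul_zero, neg_mul, mul_neg, neg_neg, smul_neg, neg_zero,
      add_zero, zero_add, sub_zero, zero_sub, smul_add, smul_sub] <;>
    match_scalars <;> first | ring1 | grind
  · apply MulOpposite.unop_injective
    cases j
    · exact A.antipodeGen_x_four_one ξ μ
    · exact A.antipodeGen_x_four_three ξ μ

theorem A.comulGen_x_sq_one :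
    (A.comulGen ξ μ .one .x) * (A.comulGen ξ μ .one .x) =
      ((A.gen .one ξ μ .x) * (A.gen .one ξ μ .x)) ⊗ₜ 1 - (2 : 𝕜) • (((A.gen .one ξ μ .x) * ((A.gen .one ξ μ (.k .a)) * ((A.gen .one ξ μ (.k .a)) * (A.gen .one ξ μ (.k .b))))) ⊗ₜ (A.gen .one ξ μ .y)) +
        ((A.gen .one ξ μ (.k .a)) * (A.gen .one ξ μ (.k .a))) ⊗ₜ ((A.gen .one ξ μ .x) * (A.gen .one ξ μ .x)) + (2 * ξ) • (((A.gen .one ξ μ (.k .a)) * (A.gen .one ξ μ (.k .b))) ⊗ₜ ((A.gen .one ξ μ .x) * (A.gen .one ξ μ .y))) +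
        (μ * (1 - ξ)) • (((A.gen .one ξ μ (.k .a)) * (A.gen .one ξ μ (.k .b))) ⊗ₜ ((A.gen .one ξ μ (.k .a)) * ((A.gen .one ξ μ (.k .a)) * ((A.gen .one ξ μ (.k .a)) * (A.gen .one ξ μ (.k .b)))))) +
        (1 + ξ) • (((A.gen .one ξ μ .x) * ((A.gen .one ξ μ (.k .a)) * ((A.gen .one ξ μ (.k .a)) * (A.gen .one ξ μ (.k .a))))) ⊗ₜ (A.gen .one ξ μ .x)) := by
  have hs := sq_eq_neg_one ξ hξ.out
  simp only [A.comulGen, Algebra.TensorProduct.tmul_mul_tmul, Algebra.TensorProduct.one_def,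
      TensorProduct.tmul_smul, ← TensorProduct.smul_tmul', TensorProduct.tmul_zero,
      TensorProduct.zero_tmul, TensorProduct.tmul_neg, TensorProduct.neg_tmul,
      TensorProduct.tmul_add, TensorProduct.add_tmul, TensorProduct.tmul_sub,
      TensorProduct.sub_tmul, A.c_eq, A.d_eq, pow_succ, pow_zero, one_mul, mul_assoc, mul_add, add_mul, mul_sub, sub_mul,
      two_mul, A.rel_ba, A.rel_ba_assoc, A.rel_bb, A.rel_bb_assoc, A.rel_a_four,
      A.rel_a_four_assoc, A.rel_ax, A.rel_ax_assoc, A.rel_ay, A.rel_ay_assoc, A.rel_bx,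
      A.rel_bx_assoc, A.rel_by, A.rel_by_assoc, A.rel_yy, A.rel_yy_assoc, A.rel_yx,
      A.rel_yx_assoc, A.rel_x_four, A.rel_x_four_assoc, smul_mul_assoc, mul_smul_comm,
      mul_zero, zero_mul, mul_one, smul_zero, neg_mul, mul_neg, neg_neg, smul_neg, neg_zero,
      add_zero, zero_add, sub_zero, zero_sub, smul_add, smul_sub]
  match_scalars <;> first | ring1 | grind

theorem A.comulGen_x_four_one :
    ((A.comulGen ξ μ .one .x) * (A.comulGen ξ μ .one .x)) * ((A.comulGen ξ μ .one .x) * (A.comulGen ξ μ .one .x)) = 0 := by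
  have hs := sq_eq_neg_one ξ hξ.out
  rw [A.comulGen_x_sq_one]
  simp only [Algebra.TensorProduct.tmul_mul_tmul, Algebra.TensorProduct.one_def,
      TensorProduct.tmul_smul, ← TensorProduct.smul_tmul', TensorProduct.tmul_zero,
      TensorProduct.zero_tmul, TensorProduct.tmul_neg, TensorProduct.neg_tmul,
      TensorProduct.tmul_add, TensorProduct.add_tmul, TensorProduct.tmul_sub,
      TensorProduct.sub_tmul, A.c_eq, A.d_eq, pow_succ, pow_zero, one_mul, mul_assoc, mul_add, add_mul, mul_sub, sub_mul,
      two_mul, A.rel_ba, A.rel_ba_assoc, A.rel_bb, A.rel_bb_assoc, A.rel_a_four,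
      A.rel_a_four_assoc, A.rel_ax, A.rel_ax_assoc, A.rel_ay, A.rel_ay_assoc, A.rel_bx,
      A.rel_bx_assoc, A.rel_by, A.rel_by_assoc, A.rel_yy, A.rel_yy_assoc, A.rel_yx,
      A.rel_yx_assoc, A.rel_x_four, A.rel_x_four_assoc, smul_mul_assoc, mul_smul_comm,
      mul_zero, zero_mul, mul_one, smul_zero, neg_mul, mul_neg, neg_neg, smul_neg, neg_zero,
      add_zero, zero_add, sub_zero, zero_sub, smul_add, smul_sub]
  match_scalars <;> first | ring1 | grind

theorem A.comulGen_x_sq_three :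
    (A.comulGen ξ μ .three .x) * (A.comulGen ξ μ .three .x) =
      ((A.gen .three ξ μ .x) * (A.gen .three ξ μ .x)) ⊗ₜ 1 + (2 : 𝕜) • (((A.gen .three ξ μ .x) * (A.gen .three ξ μ (.k .b))) ⊗ₜ (A.gen .three ξ μ .y)) +
        ((A.gen .three ξ μ (.k .a)) * (A.gen .three ξ μ (.k .a))) ⊗ₜ ((A.gen .three ξ μ .x) * (A.gen .three ξ μ .x)) + (2 * ξ) • (((A.gen .three ξ μ (.k .a)) * (A.gen .three ξ μ (.k .b))) ⊗ₜ ((A.gen .three ξ μ .x) * (A.gen .three ξ μ .y))) +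
        (μ * (1 + ξ)) • (((A.gen .three ξ μ (.k .a)) * (A.gen .three ξ μ (.k .b))) ⊗ₜ ((A.gen .three ξ μ (.k .a)) * ((A.gen .three ξ μ (.k .a)) * ((A.gen .three ξ μ (.k .a)) * (A.gen .three ξ μ (.k .b)))))) +
        (1 - ξ) • (((A.gen .three ξ μ .x) * (A.gen .three ξ μ (.k .a))) ⊗ₜ (A.gen .three ξ μ .x)) := by
  have hs := sq_eq_neg_one ξ hξ.out
  simp only [A.comulGen, Algebra.TensorProduct.tmul_mul_tmul, Algebra.TensorProduct.one_def,
      TensorProduct.tmul_smul, ← TensorProduct.smul_tmul', TensorProduct.tmul_zero,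
      TensorProduct.zero_tmul, TensorProduct.tmul_neg, TensorProduct.neg_tmul,
      TensorProduct.tmul_add, TensorProduct.add_tmul, TensorProduct.tmul_sub,
      TensorProduct.sub_tmul, A.c_eq, A.d_eq, pow_succ, pow_zero, one_mul, mul_assoc, mul_add, add_mul, mul_sub, sub_mul,
      two_mul, A.rel_ba, A.rel_ba_assoc, A.rel_bb, A.rel_bb_assoc, A.rel_a_four,
      A.rel_a_four_assoc, A.rel_ax, A.rel_ax_assoc, A.rel_ay, A.rel_ay_assoc, A.rel_bx,
      A.rel_bx_assoc, A.rel_by, A.rel_by_assoc, A.rel_yy, A.rel_yy_assoc, A.rel_yx,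
      A.rel_yx_assoc, A.rel_x_four, A.rel_x_four_assoc, smul_mul_assoc, mul_smul_comm,
      mul_zero, zero_mul, mul_one, smul_zero, neg_mul, mul_neg, neg_neg, smul_neg, neg_zero,
      add_zero, zero_add, sub_zero, zero_sub, smul_add, smul_sub]
  match_scalars <;> first | ring1 | grind

theorem A.comulGen_x_four_three :
    ((A.comulGen ξ μ .three .x) * (A.comulGen ξ μ .three .x)) * ((A.comulGen ξ μ .three .x) * (A.comulGen ξ μ .three .x)) = 0 := by
  have hs := sq_eq_neg_one ξ hξ.out
  rw [A.comulGen_x_sq_three]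
  simp only [Algebra.TensorProduct.tmul_mul_tmul, Algebra.TensorProduct.one_def,
      TensorProduct.tmul_smul, ← TensorProduct.smul_tmul', TensorProduct.tmul_zero,
      TensorProduct.zero_tmul, TensorProduct.tmul_neg, TensorProduct.neg_tmul,
      TensorProduct.tmul_add, TensorProduct.add_tmul, TensorProduct.tmul_sub,
      TensorProduct.sub_tmul, A.c_eq, A.d_eq, pow_succ, pow_zero, one_mul, mul_assoc, mul_add, add_mul, mul_sub, sub_mul,
      two_mul, A.rel_ba, A.rel_ba_assoc, A.rel_bb, A.rel_bb_assoc, A.rel_a_four,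
      A.rel_a_four_assoc, A.rel_ax, A.rel_ax_assoc, A.rel_ay, A.rel_ay_assoc, A.rel_bx,
      A.rel_bx_assoc, A.rel_by, A.rel_by_assoc, A.rel_yy, A.rel_yy_assoc, A.rel_yx,
      A.rel_yx_assoc, A.rel_x_four, A.rel_x_four_assoc, smul_mul_assoc, mul_smul_comm,
      mul_zero, zero_mul, mul_one, smul_zero, neg_mul, mul_neg, neg_neg, smul_neg, neg_zero,
      add_zero, zero_add, sub_zero, zero_sub, smul_add, smul_sub]
  match_scalars <;> first | ring1 | grind

theorem A.comulGen_rel ⦃u v : FreeAlgebra 𝕜 AGen⦄ (h : ARel ξ μ u v) :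
    FreeAlgebra.lift 𝕜 (A.comulGen ξ μ j) u = FreeAlgebra.lift 𝕜 (A.comulGen ξ μ j) v := by
  have hs := sq_eq_neg_one ξ hξ.out
  refine A.rel_of ξ μ (A.comulGen ξ μ j) (A.comulGen_rel_k j ξ μ) ?_ ?_ ?_ ?_ ?_ ?_ ?_ h
  · cases j <;>
    simp only [A.comulGen, Algebra.TensorProduct.tmul_mul_tmul, Algebra.TensorProduct.one_def,
      TensorProduct.tmul_smul, ← TensorProduct.smul_tmul', TensorProduct.tmul_zero,
      TensorProduct.zero_tmul, TensorProduct.tmul_neg, TensorProduct.neg_tmul,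
      TensorProduct.tmul_add, TensorProduct.add_tmul, TensorProduct.tmul_sub,
      TensorProduct.sub_tmul, A.c_eq, A.d_eq, pow_succ, pow_zero, one_mul, mul_assoc, mul_add, add_mul, mul_sub, sub_mul,
      two_mul, A.rel_ba, A.rel_ba_assoc, A.rel_bb, A.rel_bb_assoc, A.rel_a_four,
      A.rel_a_four_assoc, A.rel_ax, A.rel_ax_assoc, A.rel_ay, A.rel_ay_assoc, A.rel_bx,
      A.rel_bx_assoc, A.rel_by, A.rel_by_assoc, A.rel_yy, A.rel_yy_assoc, A.rel_yx,
      A.rel_yx_assoc, A.rel_x_four, A.rel_x_four_assoc, smul_mul_assoc, mul_smul_comm,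
      mul_zero, zero_mul, mul_one, smul_zero, neg_mul, mul_neg, neg_neg, smul_neg, neg_zero,
      add_zero, zero_add, sub_zero, zero_sub, smul_add, smul_sub] <;>
    match_scalars <;> first | ring1 | grind
  · cases j <;>
    simp only [A.comulGen, Algebra.TensorProduct.tmul_mul_tmul, Algebra.TensorProduct.one_def,
      TensorProduct.tmul_smul, ← TensorProduct.smul_tmul', TensorProduct.tmul_zero,
      TensorProduct.zero_tmul, TensorProduct.tmul_neg, TensorProduct.neg_tmul,
      TensorProduct.tmul_add, TensorProduct.add_tmul, TensorProduct.tmul_sub,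
      TensorProduct.sub_tmul, A.c_eq, A.d_eq, pow_succ, pow_zero, one_mul, mul_assoc, mul_add, add_mul, mul_sub, sub_mul,
      two_mul, A.rel_ba, A.rel_ba_assoc, A.rel_bb, A.rel_bb_assoc, A.rel_a_four,
      A.rel_a_four_assoc, A.rel_ax, A.rel_ax_assoc, A.rel_ay, A.rel_ay_assoc, A.rel_bx,
      A.rel_bx_assoc, A.rel_by, A.rel_by_assoc, A.rel_yy, A.rel_yy_assoc, A.rel_yx,
      A.rel_yx_assoc, A.rel_x_four, A.rel_x_four_assoc, smul_mul_assoc, mul_smul_comm,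
      mul_zero, zero_mul, mul_one, smul_zero, neg_mul, mul_neg, neg_neg, smul_neg, neg_zero,
      add_zero, zero_add, sub_zero, zero_sub, smul_add, smul_sub] <;>
    match_scalars <;> first | ring1 | grind
  · cases j <;>
    simp only [A.comulGen, Algebra.TensorProduct.tmul_mul_tmul, Algebra.TensorProduct.one_def,
      TensorProduct.tmul_smul, ← TensorProduct.smul_tmul', TensorProduct.tmul_zero,
      TensorProduct.zero_tmul, TensorProduct.tmul_neg, TensorProduct.neg_tmul,
      TensorProduct.tmul_add, TensorProduct.add_tmul, TensorProduct.tmul_sub,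
      TensorProduct.sub_tmul, A.c_eq, A.d_eq, pow_succ, pow_zero, one_mul, mul_assoc, mul_add, add_mul, mul_sub, sub_mul,
      two_mul, A.rel_ba, A.rel_ba_assoc, A.rel_bb, A.rel_bb_assoc, A.rel_a_four,
      A.rel_a_four_assoc, A.rel_ax, A.rel_ax_assoc, A.rel_ay, A.rel_ay_assoc, A.rel_bx,
      A.rel_bx_assoc, A.rel_by, A.rel_by_assoc, A.rel_yy, A.rel_yy_assoc, A.rel_yx,
      A.rel_yx_assoc, A.rel_x_four, A.rel_x_four_assoc, smul_mul_assoc, mul_smul_comm,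
      mul_zero, zero_mul, mul_one, smul_zero, neg_mul, mul_neg, neg_neg, smul_neg, neg_zero,
      add_zero, zero_add, sub_zero, zero_sub, smul_add, smul_sub] <;>
    match_scalars <;> first | ring1 | grind
  · cases j <;>
    simp only [A.comulGen, Algebra.TensorProduct.tmul_mul_tmul, Algebra.TensorProduct.one_def,
      TensorProduct.tmul_smul, ← TensorProduct.smul_tmul', TensorProduct.tmul_zero,
      TensorProduct.zero_tmul, TensorProduct.tmul_neg, TensorProduct.neg_tmul,
      TensorProduct.tmul_add, TensorProduct.add_tmul, TensorProduct.tmul_sub,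
      TensorProduct.sub_tmul, A.c_eq, A.d_eq, pow_succ, pow_zero, one_mul, mul_assoc, mul_add, add_mul, mul_sub, sub_mul,
      two_mul, A.rel_ba, A.rel_ba_assoc, A.rel_bb, A.rel_bb_assoc, A.rel_a_four,
      A.rel_a_four_assoc, A.rel_ax, A.rel_ax_assoc, A.rel_ay, A.rel_ay_assoc, A.rel_bx,
      A.rel_bx_assoc, A.rel_by, A.rel_by_assoc, A.rel_yy, A.rel_yy_assoc, A.rel_yx,
      A.rel_yx_assoc, A.rel_x_four, A.rel_x_four_assoc, smul_mul_assoc, mul_smul_comm,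
      mul_zero, zero_mul, mul_one, smul_zero, neg_mul, mul_neg, neg_neg, smul_neg, neg_zero,
      add_zero, zero_add, sub_zero, zero_sub, smul_add, smul_sub] <;>
    match_scalars <;> first | ring1 | grind
  · cases j
    · simp only [A.comulGen_x_sq_one]
      simp only [A.comulGen, Algebra.TensorProduct.tmul_mul_tmul, Algebra.TensorProduct.one_def,
      TensorProduct.tmul_smul, ← TensorProduct.smul_tmul', TensorProduct.tmul_zero,
      TensorProduct.zero_tmul, TensorProduct.tmul_neg, TensorProduct.neg_tmul,
      TensorProduct.tmul_add, TensorProduct.add_tmul, TensorProduct.tmul_sub,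
      TensorProduct.sub_tmul, A.c_eq, A.d_eq, pow_succ, pow_zero, one_mul, mul_assoc, mul_add, add_mul, mul_sub, sub_mul,
      two_mul, A.rel_ba, A.rel_ba_assoc, A.rel_bb, A.rel_bb_assoc, A.rel_a_four,
      A.rel_a_four_assoc, A.rel_ax, A.rel_ax_assoc, A.rel_ay, A.rel_ay_assoc, A.rel_bx,
      A.rel_bx_assoc, A.rel_by, A.rel_by_assoc, A.rel_yy, A.rel_yy_assoc, A.rel_yx,
      A.rel_yx_assoc, A.rel_x_four, A.rel_x_four_assoc, smul_mul_assoc, mul_smul_comm,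
      mul_zero, zero_mul, mul_one, smul_zero, neg_mul, mul_neg, neg_neg, smul_neg, neg_zero,
      add_zero, zero_add, sub_zero, zero_sub, smul_add, smul_sub]
      match_scalars <;> first | ring1 | grind
    · simp only [A.comulGen_x_sq_three]
      simp only [A.comulGen, Algebra.TensorProduct.tmul_mul_tmul, Algebra.TensorProduct.one_def,
      TensorProduct.tmul_smul, ← TensorProduct.smul_tmul', TensorProduct.tmul_zero,
      TensorProduct.zero_tmul, TensorProduct.tmul_neg, TensorProduct.neg_tmul,
      TensorProduct.tmul_add, TensorProduct.add_tmul, TensorProduct.tmul_sub,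
      TensorProduct.sub_tmul, A.c_eq, A.d_eq, pow_succ, pow_zero, one_mul, mul_assoc, mul_add, add_mul, mul_sub, sub_mul,
      two_mul, A.rel_ba, A.rel_ba_assoc, A.rel_bb, A.rel_bb_assoc, A.rel_a_four,
      A.rel_a_four_assoc, A.rel_ax, A.rel_ax_assoc, A.rel_ay, A.rel_ay_assoc, A.rel_bx,
      A.rel_bx_assoc, A.rel_by, A.rel_by_assoc, A.rel_yy, A.rel_yy_assoc, A.rel_yx,
      A.rel_yx_assoc, A.rel_x_four, A.rel_x_four_assoc, smul_mul_assoc, mul_smul_comm,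
      mul_zero, zero_mul, mul_one, smul_zero, neg_mul, mul_neg, neg_neg, smul_neg, neg_zero,
      add_zero, zero_add, sub_zero, zero_sub, smul_add, smul_sub]
      match_scalars <;> first | ring1 | grind
  · cases j <;>
    simp only [A.comulGen, Algebra.TensorProduct.tmul_mul_tmul, Algebra.TensorProduct.one_def,
      TensorProduct.tmul_smul, ← TensorProduct.smul_tmul', TensorProduct.tmul_zero,
      TensorProduct.zero_tmul, TensorProduct.tmul_neg, TensorProduct.neg_tmul,
      TensorProduct.tmul_add, TensorProduct.add_tmul, TensorProduct.tmul_sub,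
      TensorProduct.sub_tmul, A.c_eq, A.d_eq, pow_succ, pow_zero, one_mul, mul_assoc, mul_add, add_mul, mul_sub, sub_mul,
      two_mul, A.rel_ba, A.rel_ba_assoc, A.rel_bb, A.rel_bb_assoc, A.rel_a_four,
      A.rel_a_four_assoc, A.rel_ax, A.rel_ax_assoc, A.rel_ay, A.rel_ay_assoc, A.rel_bx,
      A.rel_bx_assoc, A.rel_by, A.rel_by_assoc, A.rel_yy, A.rel_yy_assoc, A.rel_yx,
      A.rel_yx_assoc, A.rel_x_four, A.rel_x_four_assoc, smul_mul_assoc, mul_smul_comm,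
      mul_zero, zero_mul, mul_one, smul_zero, neg_mul, mul_neg, neg_neg, smul_neg, neg_zero,
      add_zero, zero_add, sub_zero, zero_sub, smul_add, smul_sub] <;>
    match_scalars <;> first | ring1 | grind
  · cases j
    · exact A.comulGen_x_four_one ξ μ
    · exact A.comulGen_x_four_three ξ μ

/-- The coproduct of `𝔄_{3,j}(μ)`. -/
noncomputable def A.comulHom : A j ξ μ →ₐ[𝕜] A j ξ μ ⊗[𝕜] A j ξ μ :=
  A.lift (A.comulGen ξ μ j) (A.comulGen_rel j ξ μ)

/-- The counit of `𝔄_{3,j}(μ)`. -/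
noncomputable def A.counitHom : A j ξ μ →ₐ[𝕜] 𝕜 := A.lift A.counitGen (A.counitGen_rel ξ μ)

/-- The antipode of `𝔄_{3,j}(μ)`, as an algebra map to the opposite algebra. -/
noncomputable def A.antipodeHom : A j ξ μ →ₐ[𝕜] (A j ξ μ)ᵐᵒᵖ :=
  A.lift (A.antipodeGen ξ μ j) (A.antipodeGen_rel j ξ μ)

noncomputable instance A.instBialgebra : Bialgebra 𝕜 (A j ξ μ) :=
  Bialgebra.ofAlgHom (A.comulHom j ξ μ) (A.counitHom j ξ μ)
    (by
      have hs := sq_eq_neg_one ξ hξ.out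
      refine A.hom_ext fun g => ?_
      rcases g with _ | _ | _ | _ | _ | _ <;> cases j <;>
        simp [A.comulHom, A.comulGen, TensorProduct.add_tmul, TensorProduct.tmul_add,
          ← TensorProduct.smul_tmul', Algebra.TensorProduct.one_def, -smul_add] <;>
        match_scalars <;> first | ring1 | grind)
    (by
      refine A.hom_ext fun g => ?_
      rcases g with _ | _ | _ | _ | _ | _ <;> cases j <;>
        simp [A.comulHom, A.counitHom, A.comulGen, A.counitGen, K.counitGen])
    (by
      refine A.hom_ext fun g => ?_
      rcases g with _ | _ | _ | _ | _ | _ <;> cases j <;>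
        simp [A.comulHom, A.counitHom, A.comulGen, A.counitGen, K.counitGen])

theorem A.comul_gen (g : AGen) : comul (R := 𝕜) (A.gen j ξ μ g) = A.comulGen ξ μ j g :=
  A.lift_gen _ (A.comulGen_rel j ξ μ) g

theorem A.counit_gen (g : AGen) : counit (R := 𝕜) (A.gen j ξ μ g) = A.counitGen g :=
  A.lift_gen _ (A.counitGen_rel ξ μ) g

/-- The Hopf algebra `𝔄_{3,j}(μ)`. -/
noncomputable instance A.instHopfAlgebra : HopfAlgebra 𝕜 (A j ξ μ) :=
  hopfOfGenerators (A.antipodeHom j ξ μ) (Set.range (A.gen j ξ μ)) A.adjoin_gen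
    (by
      have hs := sq_eq_neg_one ξ hξ.out
      rintro _ ⟨g, rfl⟩
      rw [A.comul_gen, A.counit_gen]
      rcases g with _ | _ | _ | _ | _ | _ <;> cases j <;>
      simp [A.antipodeHom, A.comulGen, A.antipodeGen, A.counitGen, K.counitGen, A.c_eq, A.d_eq, pow_succ, pow_zero, one_mul, mul_assoc, mul_add, add_mul, mul_sub, sub_mul,
      two_mul, A.rel_ba, A.rel_ba_assoc, A.rel_bb, A.rel_bb_assoc, A.rel_a_four,
      A.rel_a_four_assoc, A.rel_ax, A.rel_ax_assoc, A.rel_ay, A.rel_ay_assoc, A.rel_bx,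
      A.rel_bx_assoc, A.rel_by, A.rel_by_assoc, A.rel_yy, A.rel_yy_assoc, A.rel_yx,
      A.rel_yx_assoc, A.rel_x_four, A.rel_x_four_assoc, smul_mul_assoc, mul_smul_comm,
      mul_zero, zero_mul, mul_one, smul_zero, neg_mul, mul_neg, neg_neg, smul_neg, neg_zero,
      add_zero, zero_add, sub_zero, zero_sub, smul_add, smul_sub] <;>
      match_scalars <;> grind)
    (by
      have hs := sq_eq_neg_one ξ hξ.out
      rintro _ ⟨g, rfl⟩
      rw [A.comul_gen, A.counit_gen]
      rcases g with _ | _ | _ | _ | _ | _ <;> cases j <;>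
      simp [A.antipodeHom, A.comulGen, A.antipodeGen, A.counitGen, K.counitGen, A.c_eq, A.d_eq, pow_succ, pow_zero, one_mul, mul_assoc, mul_add, add_mul, mul_sub, sub_mul,
      two_mul, A.rel_ba, A.rel_ba_assoc, A.rel_bb, A.rel_bb_assoc, A.rel_a_four,
      A.rel_a_four_assoc, A.rel_ax, A.rel_ax_assoc, A.rel_ay, A.rel_ay_assoc, A.rel_bx,
      A.rel_bx_assoc, A.rel_by, A.rel_by_assoc, A.rel_yy, A.rel_yy_assoc, A.rel_yx,
      A.rel_yx_assoc, A.rel_x_four, A.rel_x_four_assoc, smul_mul_assoc, mul_smul_comm,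
      mul_zero, zero_mul, mul_one, smul_zero, neg_mul, mul_neg, neg_neg, smul_neg, neg_zero,
      add_zero, zero_add, sub_zero, zero_sub, smul_add, smul_sub] <;>
      match_scalars <;> grind)

theorem A.antipode_gen (g : AGen) :
    antipode 𝕜 (A.gen j ξ μ g) = (A.antipodeGen ξ μ j g).unop :=
  congrArg MulOpposite.unop (A.lift_gen (j := j) _ (A.antipodeGen_rel j ξ μ) g)

end HopfA

end AHopf

/-! ## The Yetter-Drinfeld modules `V_{3,1}` and `V_{3,3}` -/

section ModuleV

variable {𝕜 : Type u} [Field 𝕜] (j : Idx) (ξ : 𝕜)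

/-- The matrices by which `a, b, c, d` act on the basis `e₁, e₂` of `V_{3,j}`. -/
def V3.actMatrix : KGen → Matrix (Fin 2) (Fin 2) 𝕜
  | .a => !![-ξ, 0; 0, -1]
  | .b => !![0, -1; 0, 0]
  | .c => !![0, 1; 0, 0]
  | .d => !![ξ, 0; 0, -1]

variable [hξ : Fact (IsPrimitiveRoot ξ 4)]

/-- The action of `𝒦` on `V_{3,j}`. -/
noncomputable def V3.act : K ξ →ₐ[𝕜] Module.End 𝕜 (Fin 2 → 𝕜) :=
  (Matrix.toLinAlgEquiv' (R := 𝕜) (n := Fin 2)).toAlgHom.comp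
    (K.lift (V3.actMatrix ξ) (by
      have hs := sq_eq_neg_one ξ hξ.out
      intro u v h
      cases h <;> ext i k <;> fin_cases i <;> fin_cases k <;>
        simp [V3.actMatrix, Matrix.mul_apply, Fin.sum_univ_two, pow_succ, hs]))

/-- The values on the basis `e₁, e₂` of the coaction of `V_{3,j}`. -/
noncomputable def V3.coactBasis : Idx → Fin 2 → K ξ ⊗[𝕜] (Fin 2 → 𝕜)
  | .one, 0 => K.gen ξ .d ⊗ₜ ![1, 0] + (ξ - 1) • (K.gen ξ .c ⊗ₜ ![0, 1])
  | .one, 1 => K.gen ξ .a ⊗ₜ ![0, 1] + (1 / 2 * (-ξ - 1)) • (K.gen ξ .b ⊗ₜ ![1, 0])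
  | .three, 0 => K.gen ξ .a ⊗ₜ ![1, 0] + (ξ + 1) • (K.gen ξ .b ⊗ₜ ![0, 1])
  | .three, 1 => K.gen ξ .d ⊗ₜ ![0, 1] + (1 / 2 * (1 - ξ)) • (K.gen ξ .c ⊗ₜ ![1, 0])

/-- The Yetter-Drinfeld module `V_{3,j}`, with basis `e₁ = ![1, 0]`, `e₂ = ![0, 1]`. -/
noncomputable def V3 : ActCoact 𝕜 (K ξ) (Fin 2 → 𝕜) where
  act := V3.act ξ
  coact := (Pi.basisFun 𝕜 (Fin 2)).constr 𝕜 (V3.coactBasis ξ j)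

end ModuleV

end HopfLift

/-! Two facts carry the theorem: 𝔄_{3,j}(μ) has a normal form that is independent of μ, and
𝔄_{3,j}(0) is a bosonization.

Modulo the other relations, the quartic relation on y is equivalent to x⁴ = 0, and x² - 2y² = μ(1 -
a²) eliminates y². The convenient normal form is therefore ∑ xⁱyᵐk with i < 4, m < 2 and k ∈ 𝒦. The
free right 𝒦-module on these xⁱyᵐ carries operators that satisfy all relations (`NF.opGen_rel`), and
acting on 1 inverts the obvious map from this module to 𝔄_{3,j}(μ) (`A.nf`). This gives dimension
64; trading x² back for y² turns the monomials into the required basis.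

Filter 𝔄_{3,j}(μ) by the degree in x, y. In normal form μ occurs only in terms of lower degree, so
taking top components gives symbol maps `A.symb` to 𝔄_{3,j}(0), compatible with products and
coproducts (`A.symb_mul`, `A.comul_symb`). They identify the associated graded Hopf algebra with
𝔄_{3,j}(0). The part of degree zero is 𝒦. The coradical lies in degree zero of any Hopf algebra
filtration, and a, b, c, d span a simple matrix coalgebra, so the Hopf coradical is 𝒦
(`A.hopfCoradical_eq`).

The critical point is strictness: the degree filtration is the standard one
(`A.mem_fil_of_comul_mem`). It follows once no nonzero symbol of degree at least two is annihilated
by the skew derivation dual to x. On powers of x this derivation produces the quantum integers (i +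
1)_ζ with ζ = ±ξ, which are nonzero up to i + 1 = 3; a triangular argument deals with the terms
containing y (`A.eq_zero_of_skewX`). The same strictness, at μ = 0, confines the primitive elements
to degree one, which is the defining property of a Nichols algebra.

At μ = 0, setting x = y = 0 gives a Hopf projection onto 𝒦. The structure `Splitting` carries out
Radford's decomposition, with the algebra R of coinvariants realized both as a subalgebra of H and
as the quotient H / Hι(K)⁺. Here R is generated by x and y. It is the Nichols algebra of V_{3,j}
(`A.isNicholsAlgebra`), and `A.grIsoBosonization` combines R ⊗ 𝒦 ≃ 𝔄_{3,j}(0) with the symbol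
isomorphism. -/

namespace HopfLift

/-! ### The basis aᵏbˡ of 𝒦 -/

section KBasis

variable {𝕜 : Type u} [Field 𝕜] (ξ : 𝕜)

/-- The relations of `𝒦` hold for `a, b, a²b, a³` as soon as `a⁴ = 1`, `b² = 0` and
`ab = ξba`. -/
theorem K.rel_of {B : Type u} [Ring B] [Algebra 𝕜 B] (hs : ξ * ξ = -1) (f : KGen → B)
    (ha : f .a * (f .a * (f .a * f .a)) = 1) (hb : f .b * f .b = 0)
    (hba : f .b * f .a = -(ξ • (f .a * f .b)))
    (hc : f .c = f .a * (f .a * f .b)) (hd : f .d = f .a * (f .a * f .a))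
    ⦃u v : FreeAlgebra 𝕜 KGen⦄ (h : KRel ξ u v) :
    FreeAlgebra.lift 𝕜 f u = FreeAlgebra.lift 𝕜 f v := by
  have ha' : ∀ w, f .a * (f .a * (f .a * (f .a * w))) = w := fun w => by
    simpa only [mul_assoc, one_mul] using congrArg (fun z => z * w) ha
  have hb' : ∀ w, f .b * (f .b * w) = 0 := fun w => by rw [← mul_assoc, hb, zero_mul]
  have hba' : ∀ w, f .b * (f .a * w) = -(ξ • (f .a * (f .b * w))) := fun w => by
    rw [← mul_assoc, hba, neg_mul, smul_mul_assoc, mul_assoc]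
  cases h <;>
    simp only [map_mul, map_pow, map_smul, map_zero, map_one, FreeAlgebra.lift_ι_apply, hc, hd,
      pow_succ, pow_zero, one_mul, mul_assoc, hba, hba', hb, hb', ha, ha', smul_mul_assoc,
      mul_smul_comm, smul_smul, mul_zero, zero_mul, mul_one, smul_zero, neg_mul, mul_neg, hs,
      neg_neg, one_smul, neg_smul, smul_neg, neg_zero]

/-- Induction over the algebra generators `a, b` of `𝒦`. -/
theorem K.induction {P : K ξ → Prop} (ha : P (K.gen ξ .a)) (hb : P (K.gen ξ .b))
    (hr : ∀ r : 𝕜, P (algebraMap 𝕜 _ r)) (hadd : ∀ u v, P u → P v → P (u + v))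
    (hm : ∀ u v, P u → P v → P (u * v)) (u : K ξ) : P u := by
  have hu : u ∈ Algebra.adjoin 𝕜 (Set.range (K.gen ξ)) := K.adjoin_gen ξ ▸ Algebra.mem_top
  induction hu using Algebra.adjoin_induction with
  | mem g hg =>
    obtain ⟨g, rfl⟩ := hg
    cases g
    · exact ha
    · exact hb
    · exact K.c_eq ξ ▸ hm _ _ ha (hm _ _ ha hb)
    · exact K.d_eq ξ ▸ hm _ _ ha (hm _ _ ha ha)
  | algebraMap r => exact hr r
  | add u v _ _ hu hv => exact hadd u v hu hv
  | mul u v _ _ hu hv => exact hm u v hu hv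

/-- Left multiplication by `a` in the basis `aᵏbˡ`. -/
def K.opA : Module.End 𝕜 (Fin 4 × Fin 2 → 𝕜) where
  -- Subtraction in `Fin 4` wraps around; this encodes a⁴ = 1.
  toFun f p := f (p.1 - 1, p.2)
  map_add' _ _ := rfl
  map_smul' _ _ := rfl

/-- Left multiplication by `b` in the basis `aᵏbˡ`. -/
def K.opB : Module.End 𝕜 (Fin 4 × Fin 2 → 𝕜) where
  -- From baᵏ = (-ξ)ᵏaᵏb and b² = 0.
  toFun f p := if p.2 = 1 then (-ξ) ^ (p.1 : ℕ) * f (p.1, 0) else 0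
  map_add' f g := by ext p; by_cases h : p.2 = 1 <;> simp [h, mul_add]
  map_smul' c f := by ext p; by_cases h : p.2 = 1 <;> simp [h, mul_left_comm]

/-- The operators of the left regular representation of `𝒦`. -/
def K.opGen : KGen → Module.End 𝕜 (Fin 4 × Fin 2 → 𝕜)
  | .a => K.opA
  | .b => K.opB ξ
  | .c => K.opA * (K.opA * K.opB ξ)
  | .d => K.opA * (K.opA * K.opA)

variable [hξ : Fact (IsPrimitiveRoot ξ 4)]

/-- The left regular representation of `𝒦` in the basis `aᵏbˡ`. -/
noncomputable def K.rep : K ξ →ₐ[𝕜] Module.End 𝕜 (Fin 4 × Fin 2 → 𝕜) :=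
  K.lift (K.opGen ξ) (by
    have hs := sq_eq_neg_one ξ hξ.out
    refine K.rel_of ξ hs _ ?_ ?_ ?_ rfl rfl
    · refine LinearMap.ext fun f => funext fun ⟨k, l⟩ => ?_
      change f (k - 1 - 1 - 1 - 1, l) = f (k, l)
      congr 2
      fin_cases k <;> rfl
    · refine LinearMap.ext fun f => funext fun ⟨k, l⟩ => ?_
      simp [K.opGen, K.opB]
    · refine LinearMap.ext fun f => funext fun ⟨k, l⟩ => ?_
      fin_cases l
      · simp [K.opGen, K.opB, K.opA]
      · fin_cases k <;> simp [K.opGen, K.opB, K.opA, pow_succ, hs] <;> grind)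

/-- The monomials `aᵏbˡ` of `𝒦`. -/
noncomputable def K.mono (p : Fin 4 × Fin 2) : K ξ :=
  K.gen ξ .a ^ (p.1 : ℕ) * K.gen ξ .b ^ (p.2 : ℕ)

/-- Acting on the vector that stands for 1 turns the monomials into the standard basis; their linear
independence in `K.basis` comes from here. -/
theorem K.rep_mono (p : Fin 4 × Fin 2) :
    K.rep ξ (K.mono ξ p) (Pi.single (0, 0) 1) = Pi.single p 1 := by
  have ha : ∀ q : Fin 4 × Fin 2, (K.opA : Module.End 𝕜 _) (Pi.single q (1 : 𝕜)) =
      Pi.single (q.1 + 1, q.2) 1 := by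
    rintro ⟨k, l⟩
    ext ⟨k', l'⟩
    simp only [K.opA, LinearMap.coe_mk, AddHom.coe_mk, Pi.single_apply, Prod.mk.injEq,
      sub_eq_iff_eq_add]
  have hb : K.opB ξ (Pi.single (0, 0) 1) = Pi.single (0, 1) 1 := by
    ext ⟨k, l⟩
    fin_cases k <;> fin_cases l <;> simp [K.opB]
  obtain ⟨k, l⟩ := p
  fin_cases k <;> fin_cases l <;>
    simp [K.mono, K.rep, K.opGen, ha, hb, pow_succ]

/-- The span is stable under left multiplication by a and b, so it is a left ideal, and it contains
1. -/
theorem K.span_mono : Submodule.span 𝕜 (Set.range (K.mono ξ)) = ⊤ := by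
  have hs := sq_eq_neg_one ξ hξ.out
  set N := Submodule.span 𝕜 (Set.range (K.mono ξ)) with hN
  have hm : ∀ p, K.mono ξ p ∈ N := fun p => Submodule.subset_span ⟨p, rfl⟩
  have ha : ∀ w ∈ N, K.gen ξ .a * w ∈ N := by
    intro w hw
    induction hw using Submodule.span_induction with
    | zero => simp
    | add u v _ _ hu hv => rw [mul_add]; exact add_mem hu hv
    | smul c u _ hu => rw [mul_smul_comm]; exact N.smul_mem c hu
    | mem w hw =>
      obtain ⟨⟨k, l⟩, rfl⟩ := hw
      have : K.gen ξ .a * K.mono ξ (k, l) = K.mono ξ (k + 1, l) := by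
        fin_cases k <;>
          simp [K.mono, pow_succ, mul_assoc, K.rel_a_four_assoc]
      rw [this]
      exact hm _
  have hb : ∀ w ∈ N, K.gen ξ .b * w ∈ N := by
    intro w hw
    induction hw using Submodule.span_induction with
    | zero => simp
    | add u v _ _ hu hv => rw [mul_add]; exact add_mem hu hv
    | smul c u _ hu => rw [mul_smul_comm]; exact N.smul_mem c hu
    | mem w hw =>
      obtain ⟨⟨k, l⟩, rfl⟩ := hw
      have : K.gen ξ .b * K.mono ξ (k, l) =
          (if l = 0 then (-ξ) ^ (k : ℕ) else 0) • K.mono ξ (k, 1) := by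
        fin_cases k <;> fin_cases l <;>
          simp [K.mono, pow_succ, mul_assoc, K.rel_ba_assoc, K.rel_ba, K.rel_bb, smul_smul]
      rw [this]
      exact N.smul_mem _ (hm _)
  rw [eq_top_iff]
  intro u _
  suffices h : ∀ w ∈ N, u * w ∈ N by simpa [K.mono] using h _ (hm (0, 0))
  refine K.induction ξ (P := fun u => ∀ w ∈ N, u * w ∈ N) ha hb (fun r w hw => ?_) (fun u v hu hv w hw => ?_)
    (fun u v hu hv w hw => ?_) u
  · rw [← Algebra.smul_def]
    exact N.smul_mem r hw
  · rw [add_mul]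
    exact add_mem (hu w hw) (hv w hw)
  · rw [mul_assoc]
    exact hu _ (hv w hw)

/-- The basis `aᵏbˡ` of `𝒦`. -/
noncomputable def K.basis : Module.Basis (Fin 4 × Fin 2) 𝕜 (K ξ) :=
  Module.Basis.mk (v := K.mono ξ)
    (by
      have h : LinearIndependent 𝕜 (fun p : Fin 4 × Fin 2 => (Pi.single p 1 : Fin 4 × Fin 2 → 𝕜)) :=
        Pi.linearIndependent_single_one _ _
      refine LinearIndependent.of_comp
        ((LinearMap.applyₗ (R := 𝕜) (Pi.single (0, 0) 1 : Fin 4 × Fin 2 → 𝕜)) ∘ₗ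
          (K.rep ξ).toLinearMap) ?_
      convert h using 2 with p
      exact K.rep_mono ξ p)
    (K.span_mono ξ).ge

theorem K.basis_apply (p : Fin 4 × Fin 2) : K.basis ξ p = K.mono ξ p := by
  simp [K.basis]

end KBasis


/-! ### A representation on the free right 𝒦-module with basis xⁱyᵐ -/

section ABasis

variable {𝕜 : Type u} [Field 𝕜] (ξ μ : 𝕜)

/-- The free right `𝒦`-module with basis `xⁱyᵐ`, `i < 4`, `m < 2`, in which `𝔄_{3,j}(μ)` is
realized; `f` stands for `∑ xⁱyᵐ f (i, m)`. -/
abbrev NF (ξ : 𝕜) : Type u := Fin 4 × Fin 2 → K ξ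

variable {ξ} in
theorem NF.ext {f g : NF ξ} (h0 : f (0, 0) = g (0, 0)) (h1 : f (1, 0) = g (1, 0))
    (h2 : f (2, 0) = g (2, 0)) (h3 : f (3, 0) = g (3, 0)) (h4 : f (0, 1) = g (0, 1))
    (h5 : f (1, 1) = g (1, 1)) (h6 : f (2, 1) = g (2, 1)) (h7 : f (3, 1) = g (3, 1)) : f = g := by
  funext ⟨i, l⟩
  fin_cases i <;> fin_cases l <;> assumption

/-- The element of `NF ξ` with given coefficients. -/
def NF.mk {B : Type u} (k0 k1 k2 k3 l0 l1 l2 l3 : B) : Fin 4 × Fin 2 → B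
  | (0, 0) => k0
  | (1, 0) => k1
  | (2, 0) => k2
  | (3, 0) => k3
  | (0, 1) => l0
  | (1, 1) => l1
  | (2, 1) => l2
  | (3, 1) => l3

section mk
variable {B : Type u} (k0 k1 k2 k3 l0 l1 l2 l3 : B)
@[simp] theorem NF.mk_00 : NF.mk k0 k1 k2 k3 l0 l1 l2 l3 (0, 0) = k0 := rfl
@[simp] theorem NF.mk_10 : NF.mk k0 k1 k2 k3 l0 l1 l2 l3 (1, 0) = k1 := rfl
@[simp] theorem NF.mk_20 : NF.mk k0 k1 k2 k3 l0 l1 l2 l3 (2, 0) = k2 := rfl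
@[simp] theorem NF.mk_30 : NF.mk k0 k1 k2 k3 l0 l1 l2 l3 (3, 0) = k3 := rfl
@[simp] theorem NF.mk_01 : NF.mk k0 k1 k2 k3 l0 l1 l2 l3 (0, 1) = l0 := rfl
@[simp] theorem NF.mk_11 : NF.mk k0 k1 k2 k3 l0 l1 l2 l3 (1, 1) = l1 := rfl
@[simp] theorem NF.mk_21 : NF.mk k0 k1 k2 k3 l0 l1 l2 l3 (2, 1) = l2 := rfl
@[simp] theorem NF.mk_31 : NF.mk k0 k1 k2 k3 l0 l1 l2 l3 (3, 1) = l3 := rfl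
end mk

local notation "a'" => K.gen ξ KGen.a
local notation "b'" => K.gen ξ KGen.b

/-- Left multiplication by `x` on `NF ξ`. -/
noncomputable def NF.opX : Module.End 𝕜 (NF ξ) where
  toFun f := NF.mk 0 (f (0, 0)) (f (1, 0)) (f (2, 0)) 0 (f (0, 1)) (f (1, 1)) (f (2, 1))
  map_add' f g := by apply NF.ext <;> simp
  map_smul' c f := by apply NF.ext <;> simp

/-- Left multiplication by `y` on `NF ξ`. -/
noncomputable def NF.opY : Module.End 𝕜 (NF ξ) where
  -- The entries are the normal forms of yxⁱyᵐk, by yx = -xy + ξμa³b and y² = ½x² - (μ/2)(1 - a²).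
  -- Since a³b commutes with x, the corrections cancel in pairs and y commutes with x². Every
  -- summand with a factor μ sits two degrees below the leading ones.
  toFun f := NF.mk
    ((ξ * μ) • (a' * (a' * (a' * (b' * f (1, 0))))) - (μ / 2) • f (0, 1) +
      (μ / 2) • (a' * (a' * f (0, 1))))
    ((μ / 2) • f (1, 1) + (μ / 2) • (a' * (a' * f (1, 1))))
    ((1 / 2 : 𝕜) • f (0, 1) + (ξ * μ) • (a' * (a' * (a' * (b' * f (3, 0))))) -
      (μ / 2) • f (2, 1) + (μ / 2) • (a' * (a' * f (2, 1))))
    (-((1 / 2 : 𝕜) • f (1, 1)) + (μ / 2) • f (3, 1) + (μ / 2) • (a' * (a' * f (3, 1))))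
    (f (0, 0) + (ξ * μ) • (a' * (a' * (a' * (b' * f (1, 1))))))
    (-f (1, 0))
    (f (2, 0) + (ξ * μ) • (a' * (a' * (a' * (b' * f (3, 1))))))
    (-f (3, 0))
  map_add' f g := by apply NF.ext <;> simp [mul_add] <;> module
  map_smul' c f := by apply NF.ext <;> simp <;> module

/-- Left multiplication by `a` on `NF ξ`. -/
noncomputable def NF.opA : Module.End 𝕜 (NF ξ) where
  -- Passing a across y leaves the extra summand -xa²b, because ay = -ya - xc and c = a²b.
  toFun f := NF.mk
    (a' * f (0, 0))
    (-ξ • (a' * f (1, 0)) - a' * (a' * (b' * f (0, 1))))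
    ((-ξ) ^ 2 • (a' * f (2, 0)) + ξ • (a' * (a' * (b' * f (1, 1)))))
    ((-ξ) ^ 3 • (a' * f (3, 0)) - (-ξ) ^ 2 • (a' * (a' * (b' * f (2, 1)))))
    (-(a' * f (0, 1)))
    (ξ • (a' * f (1, 1)))
    (-((-ξ) ^ 2 • (a' * f (2, 1))))
    (-((-ξ) ^ 3 • (a' * f (3, 1))))
  map_add' f g := by apply NF.ext <;> simp [mul_add] <;> module
  map_smul' c f := by apply NF.ext <;> simp <;> module

/-- Left multiplication by `b` on `NF ξ`. -/
noncomputable def NF.opB : Module.End 𝕜 (NF ξ) where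
  toFun f := NF.mk
    (b' * f (0, 0))
    (-ξ • (b' * f (1, 0)) - a' * (a' * (a' * f (0, 1))))
    ((-ξ) ^ 2 • (b' * f (2, 0)) + ξ • (a' * (a' * (a' * f (1, 1)))))
    ((-ξ) ^ 3 • (b' * f (3, 0)) - (-ξ) ^ 2 • (a' * (a' * (a' * f (2, 1)))))
    (-(b' * f (0, 1)))
    (ξ • (b' * f (1, 1)))
    (-((-ξ) ^ 2 • (b' * f (2, 1))))
    (-((-ξ) ^ 3 • (b' * f (3, 1))))
  map_add' f g := by apply NF.ext <;> simp [mul_add] <;> module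
  map_smul' c f := by apply NF.ext <;> simp <;> module

section coeffs

theorem NF.opX_apply (f : NF ξ) : NF.opX ξ f =
    NF.mk 0 (f (0, 0)) (f (1, 0)) (f (2, 0)) 0 (f (0, 1)) (f (1, 1)) (f (2, 1)) := rfl

theorem NF.opY_apply (f : NF ξ) : NF.opY ξ μ f = NF.mk
    ((ξ * μ) • (a' * (a' * (a' * (b' * f (1, 0))))) - (μ / 2) • f (0, 1) +
      (μ / 2) • (a' * (a' * f (0, 1))))
    ((μ / 2) • f (1, 1) + (μ / 2) • (a' * (a' * f (1, 1))))
    ((1 / 2 : 𝕜) • f (0, 1) + (ξ * μ) • (a' * (a' * (a' * (b' * f (3, 0))))) -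
      (μ / 2) • f (2, 1) + (μ / 2) • (a' * (a' * f (2, 1))))
    (-((1 / 2 : 𝕜) • f (1, 1)) + (μ / 2) • f (3, 1) + (μ / 2) • (a' * (a' * f (3, 1))))
    (f (0, 0) + (ξ * μ) • (a' * (a' * (a' * (b' * f (1, 1))))))
    (-f (1, 0))
    (f (2, 0) + (ξ * μ) • (a' * (a' * (a' * (b' * f (3, 1))))))
    (-f (3, 0)) := rfl

theorem NF.opA_apply (f : NF ξ) : NF.opA ξ f = NF.mk
    (a' * f (0, 0))
    (-ξ • (a' * f (1, 0)) - a' * (a' * (b' * f (0, 1))))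
    ((-ξ) ^ 2 • (a' * f (2, 0)) + ξ • (a' * (a' * (b' * f (1, 1)))))
    ((-ξ) ^ 3 • (a' * f (3, 0)) - (-ξ) ^ 2 • (a' * (a' * (b' * f (2, 1)))))
    (-(a' * f (0, 1)))
    (ξ • (a' * f (1, 1)))
    (-((-ξ) ^ 2 • (a' * f (2, 1))))
    (-((-ξ) ^ 3 • (a' * f (3, 1)))) := rfl

theorem NF.opB_apply (f : NF ξ) : NF.opB ξ f = NF.mk
    (b' * f (0, 0))
    (-ξ • (b' * f (1, 0)) - a' * (a' * (a' * f (0, 1))))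
    ((-ξ) ^ 2 • (b' * f (2, 0)) + ξ • (a' * (a' * (a' * f (1, 1)))))
    ((-ξ) ^ 3 • (b' * f (3, 0)) - (-ξ) ^ 2 • (a' * (a' * (a' * f (2, 1)))))
    (-(b' * f (0, 1)))
    (ξ • (b' * f (1, 1)))
    (-((-ξ) ^ 2 • (b' * f (2, 1))))
    (-((-ξ) ^ 3 • (b' * f (3, 1)))) := rfl

end coeffs

/-- The operators of the generators of `𝔄_{3,j}(μ)` on `NF ξ`. -/
noncomputable def NF.opGen : AGen → Module.End 𝕜 (NF ξ)
  | .x => NF.opX ξ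
  | .y => NF.opY ξ μ
  | .k .a => NF.opA ξ
  | .k .b => NF.opB ξ
  | .k .c => NF.opA ξ * (NF.opA ξ * NF.opB ξ)
  | .k .d => NF.opA ξ * (NF.opA ξ * NF.opA ξ)

variable [hξ : Fact (IsPrimitiveRoot ξ 4)] [CharZero 𝕜]

-- By `A.rel_of` the quartic relation on y may be replaced by x⁴ = 0, which holds because `NF.opX`
-- shifts out of range after four steps; c and d are words in a and b. What remains is to compare
-- eight coefficients for each relation. This is the consistency check that prevents the algebra
-- from collapsing below dimension 64.
set_option maxHeartbeats 4000000 in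
theorem NF.opGen_rel ⦃u v : FreeAlgebra 𝕜 AGen⦄ (h : ARel ξ μ u v) :
    FreeAlgebra.lift 𝕜 (NF.opGen ξ μ) u = FreeAlgebra.lift 𝕜 (NF.opGen ξ μ) v := by
  have hs := sq_eq_neg_one ξ hξ.out
  refine A.rel_of ξ μ (NF.opGen ξ μ)
    (K.rel_of ξ hs (fun g => NF.opGen ξ μ (.k g)) ?_ ?_ ?_ rfl rfl) ?_ ?_ ?_ ?_ ?_ ?_ ?_ h
  all_goals
    refine LinearMap.ext fun f => ?_
    apply NF.ext
  all_goals
    simp only [NF.opGen, Module.End.mul_apply, Module.End.one_apply, LinearMap.neg_apply,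
      LinearMap.sub_apply, LinearMap.add_apply, LinearMap.smul_apply, LinearMap.zero_apply,
      Pi.neg_apply, Pi.sub_apply, Pi.add_apply, Pi.smul_apply, Pi.zero_apply,
      NF.opX_apply, NF.opY_apply, NF.opA_apply, NF.opB_apply,
      NF.mk_00, NF.mk_10, NF.mk_20, NF.mk_30, NF.mk_01, NF.mk_11, NF.mk_21, NF.mk_31,
      mul_add, mul_sub, mul_neg, mul_smul_comm, mul_zero, smul_zero, neg_zero, sub_zero, zero_sub,
      add_zero, zero_add, K.rel_ba_assoc, K.rel_bb_assoc, K.rel_a_four_assoc]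
    try (match_scalars <;> grind)

end ABasis


/-! ### The normal form isomorphism -/

section NormalForm

variable {𝕜 : Type u} [Field 𝕜] (j : Idx) (ξ μ : 𝕜)

/-- Induction over the algebra generators `x, y, a, b` of `𝔄_{3,j}(μ)`. -/
theorem A.induction {P : A j ξ μ → Prop} (hx : P (A.gen j ξ μ .x)) (hy : P (A.gen j ξ μ .y))
    (ha : P (A.gen j ξ μ (.k .a))) (hb : P (A.gen j ξ μ (.k .b)))
    (hr : ∀ r : 𝕜, P (algebraMap 𝕜 _ r)) (hadd : ∀ u v, P u → P v → P (u + v))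
    (hm : ∀ u v, P u → P v → P (u * v)) (u : A j ξ μ) : P u := by
  have hu : u ∈ Algebra.adjoin 𝕜 (Set.range (A.gen j ξ μ)) := by
    rw [A.adjoin_gen]
    exact Algebra.mem_top
  induction hu using Algebra.adjoin_induction with
  | mem g hg =>
    obtain ⟨g, rfl⟩ := hg
    rcases g with _ | _ | _ | _ | _ | _
    · exact hx
    · exact hy
    · exact ha
    · exact hb
    · exact A.c_eq j ξ μ ▸ hm _ _ ha (hm _ _ ha hb)
    · exact A.d_eq j ξ μ ▸ hm _ _ ha (hm _ _ ha ha)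
  | algebraMap r => exact hr r
  | add u v _ _ hu hv => exact hadd u v hu hv
  | mul u v _ _ hu hv => exact hm u v hu hv

/-- The monomials `xⁱyᵐ`. -/
noncomputable def A.mon (p : Fin 4 × Fin 2) : A j ξ μ :=
  A.gen j ξ μ .x ^ (p.1 : ℕ) * A.gen j ξ μ .y ^ (p.2 : ℕ)

/-- The element `∑ xⁱyᵐ f (i, m)`. -/
noncomputable def NF.toA : NF ξ →ₗ[𝕜] A j ξ μ :=
  ∑ p, LinearMap.mulLeft 𝕜 (A.mon j ξ μ p) ∘ₗ (A.ofK j ξ μ).toLinearMap ∘ₗ LinearMap.proj p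

theorem NF.toA_apply (f : NF ξ) :
    NF.toA j ξ μ f = ∑ p, A.mon j ξ μ p * A.ofK j ξ μ (f p) := by
  simp [NF.toA]

variable [hξ : Fact (IsPrimitiveRoot ξ 4)] [CharZero 𝕜]

/-- The action of `𝔄_{3,j}(μ)` on `NF ξ`. -/
noncomputable def NF.rep : A j ξ μ →ₐ[𝕜] Module.End 𝕜 (NF ξ) :=
  A.lift (NF.opGen ξ μ) (NF.opGen_rel ξ μ)

@[simp]
theorem NF.rep_gen (g : AGen) : NF.rep j ξ μ (A.gen j ξ μ g) = NF.opGen ξ μ g := A.lift_gen _ _ _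

/-- The shift drops the coefficients of x³ and x³y, which is legitimate because x⁴ = 0. -/
theorem NF.toA_opX (f : NF ξ) : NF.toA j ξ μ (NF.opX ξ f) = A.gen j ξ μ .x * NF.toA j ξ μ f := by
  simp only [NF.toA_apply, Fintype.sum_prod_type, Fin.sum_univ_four, Fin.sum_univ_two, A.mon,
    NF.opX_apply, NF.mk_00, NF.mk_10, NF.mk_20, NF.mk_30, NF.mk_01, NF.mk_11, NF.mk_21, NF.mk_31]
  simp [pow_succ, mul_add, mul_assoc, A.rel_x_four_assoc]
  try abel

theorem NF.toA_opY (f : NF ξ) : NF.toA j ξ μ (NF.opY ξ μ f) = A.gen j ξ μ .y * NF.toA j ξ μ f := by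
  have hs := sq_eq_neg_one ξ hξ.out
  simp only [NF.toA_apply, Fintype.sum_prod_type, Fin.sum_univ_four, Fin.sum_univ_two, A.mon,
    NF.opY_apply, NF.mk_00, NF.mk_10, NF.mk_20, NF.mk_30, NF.mk_01, NF.mk_11, NF.mk_21, NF.mk_31]
  simp [pow_succ, mul_add, mul_sub, mul_assoc, A.rel_x_four_assoc, A.rel_yx_assoc, A.rel_yy_assoc,
    A.rel_ax_assoc, A.rel_bx_assoc, A.rel_ay_assoc, A.rel_by_assoc, A.rel_ba_assoc,
    A.rel_bb_assoc, A.rel_a_four_assoc]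
  match_scalars <;> grind

theorem NF.toA_opA (f : NF ξ) :
    NF.toA j ξ μ (NF.opA ξ f) = A.gen j ξ μ (.k .a) * NF.toA j ξ μ f := by
  have hs := sq_eq_neg_one ξ hξ.out
  simp only [NF.toA_apply, Fintype.sum_prod_type, Fin.sum_univ_four, Fin.sum_univ_two, A.mon,
    NF.opA_apply, NF.mk_00, NF.mk_10, NF.mk_20, NF.mk_30, NF.mk_01, NF.mk_11, NF.mk_21, NF.mk_31]
  simp [pow_succ, mul_add, mul_sub, mul_assoc, A.rel_x_four_assoc, A.rel_yx_assoc, A.rel_yy_assoc,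
    A.rel_ax_assoc, A.rel_bx_assoc, A.rel_ay_assoc, A.rel_by_assoc, A.rel_ba_assoc,
    A.rel_bb_assoc, A.rel_a_four_assoc]
  match_scalars <;> grind

theorem NF.toA_opB (f : NF ξ) :
    NF.toA j ξ μ (NF.opB ξ f) = A.gen j ξ μ (.k .b) * NF.toA j ξ μ f := by
  have hs := sq_eq_neg_one ξ hξ.out
  simp only [NF.toA_apply, Fintype.sum_prod_type, Fin.sum_univ_four, Fin.sum_univ_two, A.mon,
    NF.opB_apply, NF.mk_00, NF.mk_10, NF.mk_20, NF.mk_30, NF.mk_01, NF.mk_11, NF.mk_21, NF.mk_31]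
  simp [pow_succ, mul_add, mul_sub, mul_assoc, A.rel_x_four_assoc, A.rel_yx_assoc, A.rel_yy_assoc,
    A.rel_ax_assoc, A.rel_bx_assoc, A.rel_ay_assoc, A.rel_by_assoc, A.rel_ba_assoc,
    A.rel_bb_assoc, A.rel_a_four_assoc]
  match_scalars <;> grind

/-- `NF.toA` intertwines the operators with left multiplication. Evaluated at 1, this says that
`NF.toA` undoes u ↦ u · 1: one half of the isomorphism `A.nf`. -/
theorem NF.toA_rep (u : A j ξ μ) (f : NF ξ) :
    NF.toA j ξ μ (NF.rep j ξ μ u f) = u * NF.toA j ξ μ f := by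
  revert f
  refine A.induction j ξ μ (P := fun u => ∀ f, NF.toA j ξ μ (NF.rep j ξ μ u f) = u * NF.toA j ξ μ f)
    ?_ ?_ ?_ ?_ (fun r f => ?_) (fun u v hu hv f => ?_) (fun u v hu hv f => ?_) u
  · simpa [NF.opGen] using NF.toA_opX j ξ μ
  · simpa [NF.opGen] using NF.toA_opY j ξ μ
  · simpa [NF.opGen] using NF.toA_opA j ξ μ
  · simpa [NF.opGen] using NF.toA_opB j ξ μ
  · rw [AlgHom.commutes, Module.algebraMap_end_apply, map_smul, Algebra.smul_def]
  · rw [map_add, LinearMap.add_apply, map_add, hu, hv, add_mul]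
  · rw [map_mul, Module.End.mul_apply, hu, hv, mul_assoc]

theorem NF.rep_ofK_single (k k' : K ξ) :
    NF.rep j ξ μ (A.ofK j ξ μ k) (Pi.single (0, 0) k') = Pi.single (0, 0) (k * k') := by
  revert k'
  refine K.induction ξ (P := fun k => ∀ k', NF.rep j ξ μ (A.ofK j ξ μ k) (Pi.single (0, 0) k') =
    Pi.single (0, 0) (k * k')) (fun k' => ?_) (fun k' => ?_) (fun r k' => ?_)
    (fun u v hu hv k' => ?_) (fun u v hu hv k' => ?_) k
  · apply NF.ext <;> simp [NF.opGen, NF.opA_apply, Pi.single_apply]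
  · apply NF.ext <;> simp [NF.opGen, NF.opB_apply, Pi.single_apply]
  · simp [Module.algebraMap_end_apply, ← Algebra.smul_def, ← Pi.single_smul]
  · rw [map_add, map_add, LinearMap.add_apply, hu, hv, add_mul, Pi.single_add]
  · rw [map_mul, map_mul, Module.End.mul_apply, hv, hu, mul_assoc]

/-- Building xⁱyᵐ up from the right never requires a reordering, so no correction terms appear. This
is the other half of `A.nf`. -/
theorem NF.rep_mon_ofK (p : Fin 4 × Fin 2) (k : K ξ) :
    NF.rep j ξ μ (A.mon j ξ μ p * A.ofK j ξ μ k) (Pi.single (0, 0) 1) = Pi.single p k := by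
  have h0 : NF.opY ξ μ (Pi.single (0, 0) k) = Pi.single (0, 1) k := by
    apply NF.ext <;> simp [NF.opY_apply, Pi.single_apply]
  have h1 : ∀ l, NF.opX ξ (Pi.single (0, l) k) = Pi.single (1, l) k := by
    intro l; fin_cases l <;> apply NF.ext <;> simp [NF.opX_apply, Pi.single_apply]
  have h2 : ∀ l, NF.opX ξ (Pi.single (1, l) k) = Pi.single (2, l) k := by
    intro l; fin_cases l <;> apply NF.ext <;> simp [NF.opX_apply, Pi.single_apply]
  have h3 : ∀ l, NF.opX ξ (Pi.single (2, l) k) = Pi.single (3, l) k := by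
    intro l; fin_cases l <;> apply NF.ext <;> simp [NF.opX_apply, Pi.single_apply]
  rw [map_mul, Module.End.mul_apply, NF.rep_ofK_single, mul_one]
  obtain ⟨i, l⟩ := p
  fin_cases i <;> fin_cases l <;>
    simp [A.mon, NF.opGen, pow_succ, h0, h1, h2, h3]

/-- The normal form isomorphism `𝔄_{3,j}(μ) ≃ NF ξ`. -/
noncomputable def A.nf : A j ξ μ ≃ₗ[𝕜] NF ξ :=
  LinearEquiv.ofLinear (LinearMap.applyₗ (R := 𝕜) (Pi.single (0, 0) 1 : NF ξ) ∘ₗ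
      (NF.rep j ξ μ).toLinearMap) (NF.toA j ξ μ)
    (by
      refine LinearMap.ext fun f => ?_
      simp only [LinearMap.comp_apply, LinearMap.id_apply, NF.toA_apply, map_sum]
      simp only [AlgHom.toLinearMap_apply, LinearMap.applyₗ_apply_apply, NF.rep_mon_ofK]
      exact Finset.univ_sum_single f)
    (by
      refine LinearMap.ext fun u => ?_
      simp only [LinearMap.comp_apply, LinearMap.id_apply, AlgHom.toLinearMap_apply,
        LinearMap.applyₗ_apply_apply, NF.toA_rep]
      simp [NF.toA_apply, Fintype.sum_prod_type, Fin.sum_univ_four, Fin.sum_univ_two, A.mon,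
        Pi.single_apply])

theorem A.nf_symm_apply (f : NF ξ) :
    (A.nf j ξ μ).symm f = ∑ p, A.mon j ξ μ p * A.ofK j ξ μ (f p) := NF.toA_apply j ξ μ f

theorem A.nf_mul (u v : A j ξ μ) : A.nf j ξ μ (u * v) = NF.rep j ξ μ u (A.nf j ξ μ v) := by
  simp [A.nf]

theorem A.nf_mon_ofK (p : Fin 4 × Fin 2) (k : K ξ) :
    A.nf j ξ μ (A.mon j ξ μ p * A.ofK j ξ μ k) = Pi.single p k := NF.rep_mon_ofK j ξ μ p k

/-- Normal forms carry 𝒦 on the right, so right multiplication by 𝒦 only touches the coefficients.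
-/
theorem A.nf_mul_ofK (u : A j ξ μ) (k : K ξ) (p : Fin 4 × Fin 2) :
    A.nf j ξ μ (u * A.ofK j ξ μ k) p = A.nf j ξ μ u p * k := by
  have h : u * A.ofK j ξ μ k = (A.nf j ξ μ).symm (fun p => A.nf j ξ μ u p * k) := by
    conv_lhs => rw [← (A.nf j ξ μ).symm_apply_apply u]
    simp only [A.nf_symm_apply, Finset.sum_mul, map_mul, mul_assoc]
  rw [h, LinearEquiv.apply_symm_apply]

theorem A.nf_ofK (k : K ξ) : A.nf j ξ μ (A.ofK j ξ μ k) = Pi.single (0, 0) k := by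
  simpa [A.mon] using A.nf_mon_ofK j ξ μ (0, 0) k

theorem A.ofK_injective : Function.Injective (A.ofK j ξ μ) := by
  intro k k' h
  have := congrArg (fun u => A.nf j ξ μ u (0, 0)) h
  simpa [A.nf_ofK] using this

theorem A.finrank_eq : Module.finrank 𝕜 (A j ξ μ) = 64 := by
  haveI : Module.Finite 𝕜 (K ξ) := Module.Finite.of_basis (K.basis ξ)
  rw [(A.nf j ξ μ).finrank_eq, Module.finrank_pi_fintype]
  simp [Module.finrank_eq_card_basis (K.basis ξ)]

end NormalForm

/-! ### The basis xⁱyᵐaᵏbˡ with i < 2 and m < 4 -/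

section Basis64

variable {𝕜 : Type u} [Field 𝕜] [CharZero 𝕜] (j : Idx) (ξ μ : 𝕜)
  [hξ : Fact (IsPrimitiveRoot ξ 4)]

local notation "ax" => A.gen j ξ μ AGen.x
local notation "ay" => A.gen j ξ μ AGen.y
local notation "aa" => A.gen j ξ μ (AGen.k KGen.a)
local notation "ab" => A.gen j ξ μ (AGen.k KGen.b)

/-- The elements `xⁱyᵐaᵏbˡ`, `i, l < 2`, `m, k < 4`. -/
noncomputable def A.pbw (q : Fin 2 × Fin 4 × Fin 4 × Fin 2) : A j ξ μ :=
  ax ^ (q.1 : ℕ) * ay ^ (q.2.1 : ℕ) * aa ^ (q.2.2.1 : ℕ) * ab ^ (q.2.2.2 : ℕ)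

theorem A.mul_ofK_mem_span_pbw (i : Fin 2) (m : Fin 4) (k : K ξ) :
    ax ^ (i : ℕ) * ay ^ (m : ℕ) * A.ofK j ξ μ k ∈
      Submodule.span 𝕜 (Set.range (A.pbw j ξ μ)) := by
  have hk : k ∈ Submodule.span 𝕜 (Set.range (K.mono ξ)) := K.span_mono ξ ▸ Submodule.mem_top
  induction hk using Submodule.span_induction with
  | zero => simp
  | add u v _ _ hu hv => rw [map_add, mul_add]; exact add_mem hu hv
  | smul c u _ hu => rw [map_smul, mul_smul_comm]; exact Submodule.smul_mem _ c hu
  | mem w hw =>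
    obtain ⟨⟨k, l⟩, rfl⟩ := hw
    refine Submodule.subset_span ⟨(i, m, k, l), ?_⟩
    simp [A.pbw, K.mono, mul_assoc]

theorem A.span_pbw : Submodule.span 𝕜 (Set.range (A.pbw j ξ μ)) = ⊤ := by
  have hs := sq_eq_neg_one ξ hξ.out
  set N := Submodule.span 𝕜 (Set.range (A.pbw j ξ μ))
  rw [eq_top_iff]
  intro u _
  rw [← (A.nf j ξ μ).symm_apply_apply u, A.nf_symm_apply]
  refine Submodule.sum_mem _ fun p _ => ?_
  generalize A.nf j ξ μ u p = k
  have hm := A.mul_ofK_mem_span_pbw j ξ μ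
  -- Eliminating x² in favour of y² exchanges the range i < 4, m < 2 for i < 2, m < 4. The a² that
  -- this creates commutes with y and is absorbed by the coefficient in 𝒦.
  have e2 : ∀ w, ax * (ax * w) = (2 : 𝕜) • (ay * (ay * w)) + μ • w - μ • (aa * (aa * w)) :=
    A.rel_xx_assoc j ξ μ
  have e3 : ∀ w, aa * (aa * (ay * w)) = ay * (aa * (aa * w)) := by
    intro w
    simp only [A.rel_ay_assoc, A.rel_ax_assoc, A.rel_ba_assoc, mul_sub, mul_neg, mul_smul_comm]
    match_scalars <;> grind
  obtain ⟨i, l⟩ := p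
  have h0 : ∀ m : Fin 4, ay ^ (m : ℕ) * A.ofK j ξ μ k ∈ N := fun m => by simpa using hm 0 m k
  have h1 : ∀ m : Fin 4, ax * (ay ^ (m : ℕ) * A.ofK j ξ μ k) ∈ N := fun m => by
    simpa [mul_assoc] using hm 1 m k
  have g0 : ∀ m : Fin 4, ay ^ (m : ℕ) * (aa * (aa * A.ofK j ξ μ k)) ∈ N := fun m => by
    simpa using hm 0 m (K.gen ξ .a * (K.gen ξ .a * k))
  have g1 : ∀ m : Fin 4, ax * (ay ^ (m : ℕ) * (aa * (aa * A.ofK j ξ μ k))) ∈ N := fun m => by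
    simpa [mul_assoc] using hm 1 m (K.gen ξ .a * (K.gen ξ .a * k))
  have h00 := h0 0
  have h01 := h0 1
  have h02 := h0 2
  have h03 := h0 3
  have h10 := h1 0
  have h11 := h1 1
  have h12 := h1 2
  have h13 := h1 3
  have g00 := g0 0
  have g01 := g0 1
  have g10 := g1 0
  have g11 := g1 1
  simp [pow_succ, mul_assoc] at h00 h01 h02 h03 h10 h11 h12 h13 g00 g01 g10 g11
  have hc : ∀ r : 𝕜, ∀ v ∈ N, r • v ∈ N := fun r v hv => N.smul_mem r hv
  fin_cases i <;> fin_cases l <;>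
    simp only [A.mon, Fin.zero_eta, Fin.mk_one, Fin.reduceFinMk, Fin.val_zero, Fin.val_one, Fin.val_two,
      pow_succ, pow_zero, one_mul, mul_one, mul_assoc, Fin.isValue, Fin.coe_ofNat_eq_mod,
      Nat.reduceMod] <;>
    try simp only [e2, e3, mul_add, mul_sub, mul_smul_comm]
  · exact h00
  · exact h01
  · exact h10
  · exact h11
  · exact sub_mem (add_mem (hc _ _ h02) (hc _ _ h00)) (hc _ _ g00)
  · exact sub_mem (add_mem (hc _ _ h03) (hc _ _ h01)) (hc _ _ g01)
  · exact sub_mem (add_mem (hc _ _ h12) (hc _ _ h10)) (hc _ _ g10)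
  · exact sub_mem (add_mem (hc _ _ h13) (hc _ _ h11)) (hc _ _ g11)

/-- The basis `xⁱyᵐaᵏbˡ` of `𝔄_{3,j}(μ)`. -/
theorem A.exists_basis :
    ∃ B : Module.Basis (Fin 2 × Fin 4 × Fin 4 × Fin 2) 𝕜 (A j ξ μ),
      ∀ (i : Fin 2) (m : Fin 4) (k : Fin 4) (l : Fin 2), B (i, m, k, l) =
        ax ^ (i : ℕ) * ay ^ (m : ℕ) * aa ^ (k : ℕ) * ab ^ (l : ℕ) := by
  refine ⟨basisOfTopLeSpanOfCardEqFinrank (A.pbw j ξ μ) (A.span_pbw j ξ μ).ge ?_, ?_⟩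
  · rw [A.finrank_eq]
    simp
  · intro i m k l
    simp [A.pbw]

end Basis64


/-! ### Degree and leading terms of normal forms -/

section Degree

variable {𝕜 : Type u} [Field 𝕜] (ξ μ : 𝕜)

/-- The degree of `xⁱyᵐ`. -/
def NF.deg (p : Fin 4 × Fin 2) : ℕ := (p.1 : ℕ) + (p.2 : ℕ)

@[simp] theorem NF.deg_00 : NF.deg (0, 0) = 0 := rfl
@[simp] theorem NF.deg_10 : NF.deg (1, 0) = 1 := rfl
@[simp] theorem NF.deg_20 : NF.deg (2, 0) = 2 := rfl
@[simp] theorem NF.deg_30 : NF.deg (3, 0) = 3 := rfl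
@[simp] theorem NF.deg_01 : NF.deg (0, 1) = 1 := rfl
@[simp] theorem NF.deg_11 : NF.deg (1, 1) = 2 := rfl
@[simp] theorem NF.deg_21 : NF.deg (2, 1) = 3 := rfl
@[simp] theorem NF.deg_31 : NF.deg (3, 1) = 4 := rfl

theorem NF.deg_le (p : Fin 4 × Fin 2) : NF.deg p ≤ 4 := by
  unfold NF.deg
  omega

/-- The component of degree `n`. -/
noncomputable def NF.top (n : ℕ) : NF ξ →ₗ[𝕜] NF ξ where
  toFun f p := if NF.deg p = n then f p else 0
  map_add' f g := by ext p; by_cases h : NF.deg p = n <;> simp [h]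
  map_smul' c f := by ext p; by_cases h : NF.deg p = n <;> simp [h]

theorem NF.top_apply (n : ℕ) (f : NF ξ) (p : Fin 4 × Fin 2) :
    NF.top ξ n f p = if NF.deg p = n then f p else 0 := rfl

/-- The elements of degree at most `n`. -/
def NF.le (n : ℕ) : Submodule 𝕜 (NF ξ) where
  carrier := {f | ∀ p, n < NF.deg p → f p = 0}
  add_mem' hf hg p hp := by simp [hf p hp, hg p hp]
  zero_mem' _ _ := rfl
  smul_mem' c f hf p hp := by simp [hf p hp]

theorem NF.mem_le_iff {n : ℕ} {f : NF ξ} : f ∈ NF.le ξ n ↔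
    (n < 1 → f (1, 0) = 0) ∧ (n < 2 → f (2, 0) = 0) ∧ (n < 3 → f (3, 0) = 0) ∧
    (n < 1 → f (0, 1) = 0) ∧ (n < 2 → f (1, 1) = 0) ∧ (n < 3 → f (2, 1) = 0) ∧
    (n < 4 → f (3, 1) = 0) := by
  constructor
  · intro h
    exact ⟨h (1, 0), h (2, 0), h (3, 0), h (0, 1), h (1, 1), h (2, 1), h (3, 1)⟩
  · rintro ⟨h1, h2, h3, h4, h5, h6, h7⟩ ⟨i, l⟩
    fin_cases i <;> fin_cases l <;> first | assumption | exact fun h => absurd h (by simp)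

theorem NF.le_mono {m n : ℕ} (h : m ≤ n) : NF.le ξ m ≤ NF.le ξ n :=
  fun _ hf p hp => hf p (h.trans_lt hp)

theorem NF.top_mem (n : ℕ) (f : NF ξ) : NF.top ξ n f ∈ NF.le ξ n := by
  intro p hp
  rw [NF.top_apply, if_neg hp.ne']

theorem NF.top_eq_zero {m n : ℕ} (h : m < n) {f : NF ξ} (hf : f ∈ NF.le ξ m) :
    NF.top ξ n f = 0 := by
  ext p
  rw [NF.top_apply]
  split_ifs with hp
  · exact hf p (hp ▸ h)
  · rfl

theorem NF.mem_le_of_top_eq_zero {n : ℕ} {f : NF ξ} (hf : f ∈ NF.le ξ (n + 1))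
    (h : NF.top ξ (n + 1) f = 0) : f ∈ NF.le ξ n := by
  intro p hp
  rcases eq_or_ne (NF.deg p) (n + 1) with hq | hq
  · have := congrFun h p
    rwa [NF.top_apply, if_pos hq] at this
  · exact hf p (by omega)

theorem NF.top_top (m n : ℕ) (f : NF ξ) :
    NF.top ξ m (NF.top ξ n f) = if m = n then NF.top ξ n f else 0 := by
  ext p
  rw [NF.top_apply, NF.top_apply]
  split_ifs <;> first | (exfalso; omega) | simp_all [NF.top_apply]

theorem NF.opX_mem {n : ℕ} {f : NF ξ} (hf : f ∈ NF.le ξ n) : NF.opX ξ f ∈ NF.le ξ (n + 1) := by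
  rw [NF.mem_le_iff] at *
  obtain ⟨h1, h2, h3, h4, h5, h6, h7⟩ := hf
  simp only [NF.opX_apply, NF.mk_00, NF.mk_10, NF.mk_20, NF.mk_30, NF.mk_01, NF.mk_11, NF.mk_21, NF.mk_31]
  exact ⟨fun h => by omega, fun h => h1 (by omega), fun h => h2 (by omega), fun _ => trivial,
    fun h => h4 (by omega), fun h => h5 (by omega), fun h => h6 (by omega)⟩

theorem NF.opY_mem {n : ℕ} {f : NF ξ} (hf : f ∈ NF.le ξ n) : NF.opY ξ μ f ∈ NF.le ξ (n + 1) := by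
  rw [NF.mem_le_iff] at *
  obtain ⟨h1, h2, h3, h4, h5, h6, h7⟩ := hf
  simp only [NF.opY_apply, NF.mk_00, NF.mk_10, NF.mk_20, NF.mk_30, NF.mk_01, NF.mk_11, NF.mk_21, NF.mk_31]
  refine ⟨fun h => ?_, fun h => ?_, fun h => ?_, fun h => ?_, fun h => ?_, fun h => ?_, fun h => ?_⟩
  · omega
  · simp [h4 (by omega), h6 (by omega), h3 (by omega)]
  · simp [h5 (by omega), h7 (by omega)]
  · omega
  · simp [h1 (by omega)]
  · simp [h2 (by omega), h7 (by omega)]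
  · simp [h3 (by omega)]

theorem NF.opA_mem {n : ℕ} {f : NF ξ} (hf : f ∈ NF.le ξ n) : NF.opA ξ f ∈ NF.le ξ n := by
  rw [NF.mem_le_iff] at *
  obtain ⟨h1, h2, h3, h4, h5, h6, h7⟩ := hf
  simp only [NF.opA_apply, NF.mk_00, NF.mk_10, NF.mk_20, NF.mk_30, NF.mk_01, NF.mk_11, NF.mk_21, NF.mk_31]
  refine ⟨fun h => ?_, fun h => ?_, fun h => ?_, fun h => ?_, fun h => ?_, fun h => ?_, fun h => ?_⟩
  · simp [h1 h, h4 h]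
  · simp [h2 h, h5 h]
  · simp [h3 h, h6 h]
  · simp [h4 h]
  · simp [h5 h]
  · simp [h6 h]
  · simp [h7 h]

theorem NF.opB_mem {n : ℕ} {f : NF ξ} (hf : f ∈ NF.le ξ n) : NF.opB ξ f ∈ NF.le ξ n := by
  rw [NF.mem_le_iff] at *
  obtain ⟨h1, h2, h3, h4, h5, h6, h7⟩ := hf
  simp only [NF.opB_apply, NF.mk_00, NF.mk_10, NF.mk_20, NF.mk_30, NF.mk_01, NF.mk_11, NF.mk_21, NF.mk_31]
  refine ⟨fun h => ?_, fun h => ?_, fun h => ?_, fun h => ?_, fun h => ?_, fun h => ?_, fun h => ?_⟩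
  · simp [h1 h, h4 h]
  · simp [h2 h, h5 h]
  · simp [h3 h, h6 h]
  · simp [h4 h]
  · simp [h5 h]
  · simp [h6 h]
  · simp [h7 h]

theorem NF.top_opX (n : ℕ) (f : NF ξ) :
    NF.top ξ (n + 1) (NF.opX ξ f) = NF.opX ξ (NF.top ξ n f) := by
  rcases n with _ | _ | _ | _ | _ | n <;> apply NF.ext <;> simp [NF.opX_apply, NF.top_apply]

theorem NF.top_opA (n : ℕ) (f : NF ξ) :
    NF.top ξ n (NF.opA ξ f) = NF.opA ξ (NF.top ξ n f) := by
  rcases n with _ | _ | _ | _ | _ | n <;> apply NF.ext <;> simp [NF.opA_apply, NF.top_apply]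

theorem NF.top_opB (n : ℕ) (f : NF ξ) :
    NF.top ξ n (NF.opB ξ f) = NF.opB ξ (NF.top ξ n f) := by
  rcases n with _ | _ | _ | _ | _ | n <;> apply NF.ext <;> simp [NF.opB_apply, NF.top_apply]

/-- The summands of `NF.opY` with a factor μ land two degrees below the leading ones. In degree n +
1 they could only come from components of f in degree n + 2, which vanish by `hf`. The operators of
x, a and b are homogeneous, so no such bound is needed for them. -/
theorem NF.top_opY {n : ℕ} {f : NF ξ} (hf : f ∈ NF.le ξ n) :
    NF.top ξ (n + 1) (NF.opY ξ μ f) = NF.opY ξ 0 (NF.top ξ n f) := by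
  obtain ⟨h1, h2, h3, h4, h5, h6, h7⟩ := (NF.mem_le_iff ξ).1 hf
  rcases n with _ | _ | _ | _ | _ | n <;> apply NF.ext <;>
    simp [NF.opY_apply, NF.top_apply, h1, h2, h3, h4, h5, h6, h7]

end Degree

/-! ### The degree filtration and the multiplicativity of symbols -/

section Symbol

variable {𝕜 : Type u} [Field 𝕜] [CharZero 𝕜] (j : Idx) (ξ μ : 𝕜)
  [hξ : Fact (IsPrimitiveRoot ξ 4)]

/-- The filtration of `𝔄_{3,j}(μ)` by the degree in `x, y`. -/
noncomputable def A.fil (n : ℕ) : Submodule 𝕜 (A j ξ μ) :=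
  (NF.le ξ n).comap (A.nf j ξ μ).toLinearMap

/-- The symbol of degree `n` of an element of `𝔄_{3,j}(μ)`, in `𝔄_{3,j}(0)`. -/
noncomputable def A.symb (n : ℕ) : A j ξ μ →ₗ[𝕜] A j ξ 0 :=
  (A.nf j ξ 0).symm.toLinearMap ∘ₗ NF.top ξ n ∘ₗ (A.nf j ξ μ).toLinearMap

theorem A.mem_fil {n : ℕ} {u : A j ξ μ} : u ∈ A.fil j ξ μ n ↔ A.nf j ξ μ u ∈ NF.le ξ n := Iff.rfl

theorem A.nf_symb (n : ℕ) (u : A j ξ μ) :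
    A.nf j ξ 0 (A.symb j ξ μ n u) = NF.top ξ n (A.nf j ξ μ u) := by
  simp [A.symb]

theorem A.fil_mono : Monotone (A.fil j ξ μ) := fun _ _ h _ hu => NF.le_mono ξ h hu

theorem A.fil_four : A.fil j ξ μ 4 = ⊤ := by
  rw [eq_top_iff]
  intro u _ p hp
  exact absurd (NF.deg_le p) (by omega)

theorem A.symb_eq_zero {m n : ℕ} (h : m < n) {u : A j ξ μ} (hu : u ∈ A.fil j ξ μ m) :
    A.symb j ξ μ n u = 0 := by
  apply (A.nf j ξ 0).injective
  rw [A.nf_symb, NF.top_eq_zero ξ h ((A.mem_fil j ξ μ).1 hu), map_zero]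

theorem A.symb_mul_ofK (n : ℕ) (u : A j ξ μ) (k : K ξ) :
    A.symb j ξ μ n (u * A.ofK j ξ μ k) = A.symb j ξ μ n u * A.ofK j ξ 0 k := by
  apply (A.nf j ξ 0).injective
  ext p
  rw [A.nf_mul_ofK, A.nf_symb, A.nf_symb, NF.top_apply, NF.top_apply, A.nf_mul_ofK]
  split_ifs <;> simp

theorem A.symb_mon (p : Fin 4 × Fin 2) :
    A.symb j ξ μ (NF.deg p) (A.mon j ξ μ p) = A.mon j ξ 0 p := by
  apply (A.nf j ξ 0).injective
  have h0 := A.nf_mon_ofK j ξ 0 p 1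
  have h1 := A.nf_mon_ofK j ξ μ p 1
  rw [map_one, mul_one] at h0 h1
  rw [A.nf_symb, h0, h1]
  ext q
  rw [NF.top_apply]
  rcases eq_or_ne q p with rfl | h
  · simp
  · simp [h]

theorem A.mon_mem_fil (p : Fin 4 × Fin 2) : A.mon j ξ μ p ∈ A.fil j ξ μ (NF.deg p) := by
  have h1 := A.nf_mon_ofK j ξ μ p 1
  rw [map_one, mul_one] at h1
  intro q hq
  rw [LinearEquiv.coe_coe, h1]
  have : q ≠ p := by
    rintro rfl
    exact lt_irrefl _ hq
  simp [this]

theorem A.mem_fil_zero {u : A j ξ μ} : u ∈ A.fil j ξ μ 0 ↔ ∃ k, A.ofK j ξ μ k = u := by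
  constructor
  · intro hu
    refine ⟨A.nf j ξ μ u (0, 0), (A.nf j ξ μ).injective ?_⟩
    rw [A.nf_ofK]
    have h := (NF.mem_le_iff ξ).1 hu
    simp only [zero_lt_one, forall_const, LinearEquiv.coe_coe, Nat.ofNat_pos] at h
    apply NF.ext <;> simp [h]
  · rintro ⟨k, rfl⟩ p hp
    rw [LinearEquiv.coe_coe, A.nf_ofK]
    have : p ≠ (0, 0) := by
      rintro rfl
      exact lt_irrefl _ hp
    simp [this]

theorem A.ofK_mem_fil (k : K ξ) : A.ofK j ξ μ k ∈ A.fil j ξ μ 0 := (A.mem_fil_zero j ξ μ).2 ⟨k, rfl⟩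

theorem A.one_mem_fil : (1 : A j ξ μ) ∈ A.fil j ξ μ 0 := map_one (A.ofK j ξ μ) ▸ A.ofK_mem_fil j ξ μ 1

theorem A.symb_ofK (k : K ξ) : A.symb j ξ μ 0 (A.ofK j ξ μ k) = A.ofK j ξ 0 k := by
  have h := A.symb_mul_ofK j ξ μ 0 1 k
  have h1 := A.symb_mon j ξ μ (0, 0)
  simp only [A.mon, NF.deg_00, Fin.val_zero, pow_zero, mul_one] at h1
  simpa [h1] using h

/-- Left multiplication by `u` is filtered of degree `m`, with symbol that of `u`. -/
def A.IsFilMul (m : ℕ) (u : A j ξ μ) : Prop :=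
  ∀ n, ∀ v ∈ A.fil j ξ μ n, u * v ∈ A.fil j ξ μ (m + n) ∧
    A.symb j ξ μ (m + n) (u * v) = A.symb j ξ μ m u * A.symb j ξ μ n v

variable {j ξ μ}

theorem A.IsFilMul.mem {m : ℕ} {u : A j ξ μ} (h : A.IsFilMul j ξ μ m u) : u ∈ A.fil j ξ μ m := by
  simpa using (h 0 1 (A.one_mem_fil j ξ μ)).1

theorem A.IsFilMul.add {m : ℕ} {u v : A j ξ μ} (hu : A.IsFilMul j ξ μ m u)
    (hv : A.IsFilMul j ξ μ m v) : A.IsFilMul j ξ μ m (u + v) := by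
  intro n w hw
  rw [add_mul, map_add, map_add, (hu n w hw).2, (hv n w hw).2, add_mul]
  exact ⟨add_mem (hu n w hw).1 (hv n w hw).1, rfl⟩

theorem A.IsFilMul.smul {m : ℕ} {u : A j ξ μ} (c : 𝕜) (hu : A.IsFilMul j ξ μ m u) :
    A.IsFilMul j ξ μ m (c • u) := by
  intro n w hw
  rw [smul_mul_assoc, map_smul, map_smul, (hu n w hw).2, smul_mul_assoc]
  exact ⟨Submodule.smul_mem _ c (hu n w hw).1, rfl⟩

theorem A.IsFilMul.zero (m : ℕ) : A.IsFilMul j ξ μ m 0 := by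
  intro n w _
  simp

theorem A.IsFilMul.mul {m n : ℕ} {u v : A j ξ μ} (hu : A.IsFilMul j ξ μ m u)
    (hv : A.IsFilMul j ξ μ n v) : A.IsFilMul j ξ μ (m + n) (u * v) := by
  intro k w hw
  obtain ⟨h1, h2⟩ := hv k w hw
  obtain ⟨h3, h4⟩ := hu _ _ h1
  rw [mul_assoc, add_assoc, h4, h2, (hu n v hv.mem).2, mul_assoc]
  exact ⟨h3, rfl⟩

/-- When the degree is raised strictly, both sides of the symbol identity vanish. -/
theorem A.IsFilMul.mono {m m' : ℕ} (h : m ≤ m') {u : A j ξ μ} (hu : A.IsFilMul j ξ μ m u) :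
    A.IsFilMul j ξ μ m' u := by
  rcases h.eq_or_lt with rfl | h
  · exact hu
  intro n w hw
  obtain ⟨h1, h2⟩ := hu n w hw
  refine ⟨A.fil_mono j ξ μ (by omega) h1, ?_⟩
  rw [A.symb_eq_zero j ξ μ (by omega) h1, A.symb_eq_zero j ξ μ h hu.mem, zero_mul]

variable (j ξ μ)

/-- The symbol of a generator is the same generator at μ = 0, so it suffices to compare the two
operators on `NF ξ`. -/
theorem A.isFilMul_of (g : AGen) (m : ℕ)
    (h1 : ∀ n, ∀ f ∈ NF.le ξ n, NF.opGen ξ μ g f ∈ NF.le ξ (m + n))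
    (h2 : ∀ n, ∀ f ∈ NF.le ξ n,
      NF.top ξ (m + n) (NF.opGen ξ μ g f) = NF.opGen ξ 0 g (NF.top ξ n f)) :
    A.IsFilMul j ξ μ m (A.gen j ξ μ g) := by
  have key : ∀ n, ∀ v ∈ A.fil j ξ μ n, A.symb j ξ μ (m + n) (A.gen j ξ μ g * v) =
      A.gen j ξ 0 g * A.symb j ξ μ n v := by
    intro n v hv
    apply (A.nf j ξ 0).injective
    rw [A.nf_symb, A.nf_mul, NF.rep_gen, A.nf_mul, NF.rep_gen, A.nf_symb]
    exact h2 n _ hv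
  -- The case v = 1 of `key` determines the symbol of the generator itself.
  have h0 : A.symb j ξ μ m (A.gen j ξ μ g) = A.gen j ξ 0 g := by
    have := key 0 1 (A.one_mem_fil j ξ μ)
    rwa [add_zero, mul_one, ← map_one (A.ofK j ξ μ), A.symb_ofK, map_one, mul_one] at this
  intro n v hv
  refine ⟨?_, ?_⟩
  · rw [A.mem_fil, A.nf_mul, NF.rep_gen]
    exact h1 n _ hv
  · rw [key n v hv, h0]

theorem A.isFilMul_x : A.IsFilMul j ξ μ 1 (A.gen j ξ μ .x) :=
  A.isFilMul_of j ξ μ .x 1 (fun n f hf => add_comm 1 n ▸ NF.opX_mem ξ hf)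
    (fun n f _ => add_comm 1 n ▸ NF.top_opX ξ n f)

theorem A.isFilMul_y : A.IsFilMul j ξ μ 1 (A.gen j ξ μ .y) :=
  A.isFilMul_of j ξ μ .y 1 (fun n f hf => add_comm 1 n ▸ NF.opY_mem ξ μ hf)
    (fun n f hf => add_comm 1 n ▸ NF.top_opY ξ μ hf)

theorem A.isFilMul_ofK (k : K ξ) : A.IsFilMul j ξ μ 0 (A.ofK j ξ μ k) := by
  refine K.induction ξ (P := fun k => A.IsFilMul j ξ μ 0 (A.ofK j ξ μ k)) ?_ ?_ (fun r => ?_)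
    (fun u v hu hv => ?_) (fun u v hu hv => ?_) k
  · rw [A.ofK_gen]
    exact A.isFilMul_of j ξ μ _ 0 (fun n f hf => (zero_add n).symm ▸ NF.opA_mem ξ hf)
      (fun n f _ => (zero_add n).symm ▸ NF.top_opA ξ n f)
  · rw [A.ofK_gen]
    exact A.isFilMul_of j ξ μ _ 0 (fun n f hf => (zero_add n).symm ▸ NF.opB_mem ξ hf)
      (fun n f _ => (zero_add n).symm ▸ NF.top_opB ξ n f)
  · rw [Algebra.algebraMap_eq_smul_one, map_smul, map_one]
    refine A.IsFilMul.smul r fun n w hw => ?_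
    have h1 : A.symb j ξ μ 0 1 = 1 := by
      have := A.symb_ofK j ξ μ 1
      simpa only [map_one] using this
    rw [one_mul, h1, one_mul, zero_add]
    exact ⟨hw, rfl⟩
  · rw [map_add]
    exact hu.add hv
  · rw [map_mul]
    exact hu.mul hv

theorem A.isFilMul_mon (p : Fin 4 × Fin 2) : A.IsFilMul j ξ μ (NF.deg p) (A.mon j ξ μ p) := by
  have h1 : A.IsFilMul j ξ μ 0 1 := map_one (A.ofK j ξ μ) ▸ A.isFilMul_ofK j ξ μ 1
  have hp : ∀ (g : A j ξ μ), A.IsFilMul j ξ μ 1 g → ∀ n : ℕ, A.IsFilMul j ξ μ n (g ^ n) := by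
    intro g hg n
    induction n with
    | zero => simpa using h1
    | succ n ih => exact pow_succ g n ▸ ih.mul hg
  exact (hp _ (A.isFilMul_x j ξ μ) _).mul (hp _ (A.isFilMul_y j ξ μ) _)

theorem A.eq_sum (u : A j ξ μ) : u = ∑ p, A.mon j ξ μ p * A.ofK j ξ μ (A.nf j ξ μ u p) := by
  rw [← A.nf_symm_apply, LinearEquiv.symm_apply_apply]

/-- Induction over `F_n`: it is spanned by the products `xⁱyᵐk` with `i + m ≤ n`. -/
theorem A.fil_induction {n : ℕ} {P : A j ξ μ → Prop} (h0 : P 0)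
    (hadd : ∀ u v, P u → P v → P (u + v))
    (hm : ∀ p k, NF.deg p ≤ n → P (A.mon j ξ μ p * A.ofK j ξ μ k)) {u : A j ξ μ}
    (hu : u ∈ A.fil j ξ μ n) : P u := by
  rw [A.eq_sum j ξ μ u]
  refine Finset.sum_induction _ P hadd h0 fun p _ => ?_
  rcases le_or_gt (NF.deg p) n with h | h
  · exact hm p _ h
  · have h2 : A.nf j ξ μ u p = 0 := hu p h
    rw [h2, map_zero, mul_zero]
    exact h0

/-- The property holds for the generators and is closed under products and sums; a summand xⁱyᵐk of
smaller degree is covered by `A.IsFilMul.mono`. -/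
theorem A.isFilMul {m : ℕ} {u : A j ξ μ} (hu : u ∈ A.fil j ξ μ m) : A.IsFilMul j ξ μ m u := by
  refine A.fil_induction j ξ μ (A.IsFilMul.zero m) (fun u v => A.IsFilMul.add) (fun p k h => ?_) hu
  exact ((A.isFilMul_mon j ξ μ p).mul (A.isFilMul_ofK j ξ μ k)).mono h

theorem A.mul_mem_fil {m n : ℕ} {u v : A j ξ μ} (hu : u ∈ A.fil j ξ μ m) (hv : v ∈ A.fil j ξ μ n) :
    u * v ∈ A.fil j ξ μ (m + n) := (A.isFilMul j ξ μ hu n v hv).1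

theorem A.symb_mul {m n : ℕ} {u v : A j ξ μ} (hu : u ∈ A.fil j ξ μ m) (hv : v ∈ A.fil j ξ μ n) :
    A.symb j ξ μ (m + n) (u * v) = A.symb j ξ μ m u * A.symb j ξ μ n v :=
  (A.isFilMul j ξ μ hu n v hv).2

theorem A.symb_symb (m n : ℕ) (u : A j ξ μ) :
    A.symb j ξ 0 m (A.symb j ξ μ n u) = if m = n then A.symb j ξ μ n u else 0 := by
  apply (A.nf j ξ 0).injective
  rw [A.nf_symb, A.nf_symb, NF.top_top]
  split_ifs
  · rw [A.nf_symb]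
  · rw [map_zero]

theorem A.symb_mem_fil (n : ℕ) (u : A j ξ μ) : A.symb j ξ μ n u ∈ A.fil j ξ 0 n := by
  rw [A.mem_fil, A.nf_symb]
  exact NF.top_mem ξ n _

theorem A.symb_gen_x : A.symb j ξ μ 1 (A.gen j ξ μ .x) = A.gen j ξ 0 .x := by
  simpa [A.mon] using A.symb_mon j ξ μ (1, 0)

theorem A.symb_gen_y : A.symb j ξ μ 1 (A.gen j ξ μ .y) = A.gen j ξ 0 .y := by
  simpa [A.mon] using A.symb_mon j ξ μ (0, 1)

/-- Together with `A.symb_eq_zero`, this makes F_n the exact kernel of the symbol of degree n + 1 on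
F_{n+1}. -/
theorem A.mem_fil_of_symb_eq_zero {n : ℕ} {u : A j ξ μ} (hu : u ∈ A.fil j ξ μ (n + 1))
    (h : A.symb j ξ μ (n + 1) u = 0) : u ∈ A.fil j ξ μ n := by
  refine NF.mem_le_of_top_eq_zero ξ hu ?_
  rw [LinearEquiv.coe_coe, ← A.nf_symb, h, map_zero]

end Symbol


/-! ### Symbols and the coproduct -/

section ComulSymbol

variable {𝕜 : Type u} [Field 𝕜] [CharZero 𝕜] (j : Idx) (ξ μ : 𝕜)
  [hξ : Fact (IsPrimitiveRoot ξ 4)]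

/-- The filtration `∑ F_i ⊗ F_k`, `i + k = n`, of the tensor square. -/
noncomputable def A.filT (n : ℕ) : Submodule 𝕜 (A j ξ μ ⊗[𝕜] A j ξ μ) :=
  ⨆ (i : ℕ) (k : ℕ) (_ : i + k = n),
    LinearMap.range (TensorProduct.mapIncl (A.fil j ξ μ i) (A.fil j ξ μ k))

/-- The symbol of degree `n` on the tensor square. -/
noncomputable def A.symbT (n : ℕ) : A j ξ μ ⊗[𝕜] A j ξ μ →ₗ[𝕜] A j ξ 0 ⊗[𝕜] A j ξ 0 :=
  ∑ q ∈ Finset.HasAntidiagonal.antidiagonal n, TensorProduct.map (A.symb j ξ μ q.1) (A.symb j ξ μ q.2)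

theorem A.tmul_mem_filT {i k n : ℕ} (h : i + k = n) {u v : A j ξ μ} (hu : u ∈ A.fil j ξ μ i)
    (hv : v ∈ A.fil j ξ μ k) : u ⊗ₜ[𝕜] v ∈ A.filT j ξ μ n := by
  refine Submodule.mem_iSup_of_mem i (Submodule.mem_iSup_of_mem k
    (Submodule.mem_iSup_of_mem h ⟨⟨u, hu⟩ ⊗ₜ ⟨v, hv⟩, ?_⟩))
  simp [TensorProduct.mapIncl]

theorem A.filT_induction {n : ℕ} {P : A j ξ μ ⊗[𝕜] A j ξ μ → Prop} (h0 : P 0)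
    (hadd : ∀ z w, P z → P w → P (z + w))
    (hm : ∀ i k u v, i + k = n → u ∈ A.fil j ξ μ i → v ∈ A.fil j ξ μ k → P (u ⊗ₜ v))
    {z : A j ξ μ ⊗[𝕜] A j ξ μ} (hz : z ∈ A.filT j ξ μ n) : P z := by
  refine Submodule.iSup_induction _ (motive := P) hz (fun i z hz => ?_) h0 hadd
  refine Submodule.iSup_induction _ (motive := P) hz (fun k z hz => ?_) h0 hadd
  refine Submodule.iSup_induction _ (motive := P) hz (fun hik z hz => ?_) h0 hadd
  obtain ⟨t, rfl⟩ := hz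
  induction t with
  | zero => rw [map_zero]; exact h0
  | add s t hs ht => rw [map_add]; exact hadd _ _ hs ht
  | tmul u v => exact hm i k u v hik u.2 v.2

/-- If p + q = i + k and (p, q) ≠ (i, k), then p > i or q > k, and one of the two symbols vanishes.
So a single summand of `A.symbT` survives. -/
theorem A.symbT_tmul {i k n : ℕ} (h : i + k = n) {u v : A j ξ μ} (hu : u ∈ A.fil j ξ μ i)
    (hv : v ∈ A.fil j ξ μ k) :
    A.symbT j ξ μ n (u ⊗ₜ v) = A.symb j ξ μ i u ⊗ₜ A.symb j ξ μ k v := by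
  rw [A.symbT, LinearMap.sum_apply, Finset.sum_eq_single (i, k)]
  · rfl
  · rintro ⟨p, q⟩ hpq hne
    rw [Finset.HasAntidiagonal.mem_antidiagonal] at hpq
    rw [TensorProduct.map_tmul]
    rcases lt_trichotomy p i with hp | hp | hp
    · rw [A.symb_eq_zero j ξ μ (show k < q by simp only at hpq; omega) hv, TensorProduct.tmul_zero]
    · exact absurd (Prod.ext hp (by simp only at hpq ⊢; omega)) hne
    · rw [A.symb_eq_zero j ξ μ hp hu, TensorProduct.zero_tmul]
  · intro hik
    exact absurd (Finset.HasAntidiagonal.mem_antidiagonal.2 h) hik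

theorem A.filT_mul {m n : ℕ} {z w : A j ξ μ ⊗[𝕜] A j ξ μ} (hz : z ∈ A.filT j ξ μ m)
    (hw : w ∈ A.filT j ξ μ n) : z * w ∈ A.filT j ξ μ (m + n) ∧
      A.symbT j ξ μ (m + n) (z * w) = A.symbT j ξ μ m z * A.symbT j ξ μ n w := by
  refine A.filT_induction j ξ μ (P := fun z => z * w ∈ A.filT j ξ μ (m + n) ∧
      A.symbT j ξ μ (m + n) (z * w) = A.symbT j ξ μ m z * A.symbT j ξ μ n w) (by simp)
    (fun z z' h h' => ?_) (fun i k u v hik hu hv => ?_) hz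
  · rw [add_mul, map_add, map_add, add_mul, h.2, h'.2]
    exact ⟨add_mem h.1 h'.1, rfl⟩
  · refine A.filT_induction j ξ μ (P := fun w => u ⊗ₜ v * w ∈ A.filT j ξ μ (m + n) ∧
      A.symbT j ξ μ (m + n) (u ⊗ₜ v * w) = A.symbT j ξ μ m (u ⊗ₜ v) * A.symbT j ξ μ n w) (by simp)
      (fun z z' h h' => ?_) (fun i' k' u' v' hik' hu' hv' => ?_) hw
    · rw [mul_add, map_add, map_add, mul_add, h.2, h'.2]
      exact ⟨add_mem h.1 h'.1, rfl⟩
    · have h1 := A.mul_mem_fil j ξ μ hu hu'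
      have h2 := A.mul_mem_fil j ξ μ hv hv'
      have e : i + i' + (k + k') = m + n := by omega
      rw [Algebra.TensorProduct.tmul_mul_tmul, A.symbT_tmul j ξ μ e h1 h2,
        A.symbT_tmul j ξ μ hik hu hv, A.symbT_tmul j ξ μ hik' hu' hv',
        Algebra.TensorProduct.tmul_mul_tmul, A.symb_mul j ξ μ hu hu', A.symb_mul j ξ μ hv hv']
      exact ⟨A.tmul_mem_filT j ξ μ e h1 h2, rfl⟩

theorem A.filT_mono {m n : ℕ} (h : m ≤ n) : A.filT j ξ μ m ≤ A.filT j ξ μ n := by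
  intro z hz
  refine A.filT_induction j ξ μ (zero_mem _) (fun _ _ => add_mem) (fun i k u v hik hu hv => ?_) hz
  exact A.tmul_mem_filT j ξ μ (show i + (k + (n - m)) = n by omega) hu
    (A.fil_mono j ξ μ (by omega) hv)

theorem A.symbT_eq_zero {m n : ℕ} (h : m < n) {z : A j ξ μ ⊗[𝕜] A j ξ μ}
    (hz : z ∈ A.filT j ξ μ m) : A.symbT j ξ μ n z = 0 := by
  refine A.filT_induction j ξ μ (P := fun z => A.symbT j ξ μ n z = 0) (map_zero _)
    (fun z w hz hw => by rw [map_add, hz, hw, add_zero]) (fun i k u v hik hu hv => ?_) hz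
  -- The second factor is regarded as an element of degree k + (n - m), where its symbol is zero.
  rw [A.symbT_tmul j ξ μ (show i + (k + (n - m)) = n by omega) hu
      (A.fil_mono j ξ μ (show k ≤ k + (n - m) by omega) hv),
    A.symb_eq_zero j ξ μ (show k < k + (n - m) by omega) hv, TensorProduct.tmul_zero]

/-- `Δ(u)` lies in the `n`-th term of the tensor filtration and its symbol is `Δ` of the symbol
of `u`. -/
def A.IsFilComul (n : ℕ) (u : A j ξ μ) : Prop :=
  u ∈ A.fil j ξ μ n ∧ comul (R := 𝕜) u ∈ A.filT j ξ μ n ∧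
    comul (R := 𝕜) (A.symb j ξ μ n u) = A.symbT j ξ μ n (comul (R := 𝕜) u)

variable {j ξ μ}

theorem A.IsFilComul.add {n : ℕ} {u v : A j ξ μ} (hu : A.IsFilComul j ξ μ n u)
    (hv : A.IsFilComul j ξ μ n v) : A.IsFilComul j ξ μ n (u + v) := by
  refine ⟨add_mem hu.1 hv.1, ?_, ?_⟩
  · rw [map_add]
    exact add_mem hu.2.1 hv.2.1
  · rw [map_add, map_add, map_add, map_add, hu.2.2, hv.2.2]

theorem A.IsFilComul.smul {n : ℕ} {u : A j ξ μ} (c : 𝕜) (hu : A.IsFilComul j ξ μ n u) :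
    A.IsFilComul j ξ μ n (c • u) := by
  refine ⟨Submodule.smul_mem _ c hu.1, ?_, ?_⟩
  · rw [map_smul]
    exact Submodule.smul_mem _ c hu.2.1
  · rw [map_smul, map_smul, map_smul, map_smul, hu.2.2]

theorem A.IsFilComul.mul {m n : ℕ} {u v : A j ξ μ} (hu : A.IsFilComul j ξ μ m u)
    (hv : A.IsFilComul j ξ μ n v) : A.IsFilComul j ξ μ (m + n) (u * v) := by
  obtain ⟨h1, h2⟩ := A.filT_mul j ξ μ hu.2.1 hv.2.1
  refine ⟨A.mul_mem_fil j ξ μ hu.1 hv.1, ?_, ?_⟩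
  · rw [Bialgebra.comul_mul]
    exact h1
  · rw [Bialgebra.comul_mul, h2, A.symb_mul j ξ μ hu.1 hv.1, Bialgebra.comul_mul, hu.2.2, hv.2.2]

theorem A.IsFilComul.mono {m n : ℕ} (h : m ≤ n) {u : A j ξ μ} (hu : A.IsFilComul j ξ μ m u) :
    A.IsFilComul j ξ μ n u := by
  rcases h.eq_or_lt with rfl | h
  · exact hu
  refine ⟨A.fil_mono j ξ μ h.le hu.1, A.filT_mono j ξ μ h.le hu.2.1, ?_⟩
  rw [A.symb_eq_zero j ξ μ h hu.1, A.symbT_eq_zero j ξ μ h hu.2.1, map_zero]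

theorem A.IsFilComul.one : A.IsFilComul j ξ μ 0 1 := by
  have h1 : A.symb j ξ μ 0 1 = 1 := by
    have := A.symb_ofK j ξ μ 1
    simpa only [map_one] using this
  have h := A.one_mem_fil j ξ μ
  refine ⟨h, ?_, ?_⟩
  · rw [Bialgebra.comul_one, Algebra.TensorProduct.one_def]
    exact A.tmul_mem_filT j ξ μ (add_zero 0) h h
  · rw [h1, Bialgebra.comul_one, Bialgebra.comul_one, Algebra.TensorProduct.one_def,
      Algebra.TensorProduct.one_def, A.symbT_tmul j ξ μ (add_zero 0) h h, h1]

theorem A.IsFilComul.pow {u : A j ξ μ} (hu : A.IsFilComul j ξ μ 1 u) (n : ℕ) :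
    A.IsFilComul j ξ μ n (u ^ n) := by
  induction n with
  | zero => exact pow_zero u ▸ A.IsFilComul.one
  | succ n ih => exact pow_succ u n ▸ ih.mul hu

variable (j ξ μ)

theorem A.gen_mem_fil_zero (g : KGen) : A.gen j ξ μ (.k g) ∈ A.fil j ξ μ 0 :=
  A.ofK_gen j ξ μ g ▸ A.ofK_mem_fil j ξ μ _

theorem A.symb_gen_k (g : KGen) : A.symb j ξ μ 0 (A.gen j ξ μ (.k g)) = A.gen j ξ 0 (.k g) := by
  rw [← A.ofK_gen, A.symb_ofK, A.ofK_gen]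

/-- The coproducts of the generators are given by formulas that do not contain μ and are homogeneous
for the total degree, so their symbols are the same formulas at μ = 0. The cases of x and y below
rest on the same observation. -/
theorem A.isFilComul_of_k (g : KGen) : A.IsFilComul j ξ μ 0 (A.gen j ξ μ (.k g)) := by
  have hm := A.gen_mem_fil_zero j ξ μ
  have hmm : ∀ g g', A.gen j ξ μ (.k g) ⊗ₜ[𝕜] A.gen j ξ μ (.k g') ∈ A.filT j ξ μ 0 :=
    fun g g' => A.tmul_mem_filT j ξ μ (add_zero 0) (hm g) (hm g')
  have hs : ∀ g g', A.symbT j ξ μ 0 (A.gen j ξ μ (.k g) ⊗ₜ[𝕜] A.gen j ξ μ (.k g')) =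
      A.gen j ξ 0 (.k g) ⊗ₜ[𝕜] A.gen j ξ 0 (.k g') := fun g g' => by
    rw [A.symbT_tmul j ξ μ (add_zero 0) (hm g) (hm g'), A.symb_gen_k, A.symb_gen_k]
  refine ⟨hm g, ?_, ?_⟩
  · rw [A.comul_gen]
    cases j <;> cases g <;> simp only [A.comulGen] <;> exact add_mem (hmm _ _) (hmm _ _)
  · rw [A.symb_gen_k, A.comul_gen, A.comul_gen]
    cases j <;> cases g <;> simp only [A.comulGen, map_add, hs]

theorem A.isFilComul_x : A.IsFilComul j ξ μ 1 (A.gen j ξ μ .x) := by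
  have hm := A.gen_mem_fil_zero j ξ μ
  have hx := (A.isFilMul_x j ξ μ).mem
  have hy := (A.isFilMul_y j ξ μ).mem
  have h1 := A.one_mem_fil j ξ μ
  refine ⟨hx, ?_, ?_⟩
  · rw [A.comul_gen]
    cases j <;> simp only [A.comulGen]
    all_goals
      refine add_mem (add_mem ?_ ?_) (Submodule.smul_mem _ _ ?_)
      · exact A.tmul_mem_filT _ ξ μ (add_zero 1) hx h1
      · exact A.tmul_mem_filT _ ξ μ (zero_add 1) (hm _) hx
      · exact A.tmul_mem_filT _ ξ μ (zero_add 1) (hm _) hy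
  · have s1 : A.symb j ξ μ 0 1 = 1 := by
      have := A.symb_ofK j ξ μ 1
      simpa only [map_one] using this
    rw [A.symb_gen_x, A.comul_gen, A.comul_gen]
    cases j <;>
    simp only [A.comulGen, map_add, map_smul, A.symbT_tmul _ ξ μ (add_zero 1) hx h1,
      A.symbT_tmul _ ξ μ (zero_add 1) (hm _) hx, A.symbT_tmul _ ξ μ (zero_add 1) (hm _) hy,
      A.symb_gen_x, A.symb_gen_y, A.symb_gen_k, s1]

theorem A.isFilComul_y : A.IsFilComul j ξ μ 1 (A.gen j ξ μ .y) := by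
  have hm := A.gen_mem_fil_zero j ξ μ
  have hx := (A.isFilMul_x j ξ μ).mem
  have hy := (A.isFilMul_y j ξ μ).mem
  have h1 := A.one_mem_fil j ξ μ
  refine ⟨hy, ?_, ?_⟩
  · rw [A.comul_gen]
    cases j <;> simp only [A.comulGen]
    all_goals
      refine add_mem (add_mem ?_ ?_) (Submodule.smul_mem _ _ ?_)
      · exact A.tmul_mem_filT _ ξ μ (add_zero 1) hy h1
      · exact A.tmul_mem_filT _ ξ μ (zero_add 1) (hm _) hy
      · exact A.tmul_mem_filT _ ξ μ (zero_add 1) (hm _) hx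
  · have s1 : A.symb j ξ μ 0 1 = 1 := by
      have := A.symb_ofK j ξ μ 1
      simpa only [map_one] using this
    rw [A.symb_gen_y, A.comul_gen, A.comul_gen]
    cases j <;>
    simp only [A.comulGen, map_add, map_smul, A.symbT_tmul _ ξ μ (add_zero 1) hy h1,
      A.symbT_tmul _ ξ μ (zero_add 1) (hm _) hx, A.symbT_tmul _ ξ μ (zero_add 1) (hm _) hy,
      A.symb_gen_x, A.symb_gen_y, A.symb_gen_k, s1]

theorem A.isFilComul_ofK (k : K ξ) : A.IsFilComul j ξ μ 0 (A.ofK j ξ μ k) := by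
  refine K.induction ξ (P := fun k => A.IsFilComul j ξ μ 0 (A.ofK j ξ μ k)) ?_ ?_ (fun r => ?_)
    (fun u v hu hv => ?_) (fun u v hu hv => ?_) k
  · exact A.ofK_gen j ξ μ .a ▸ A.isFilComul_of_k j ξ μ .a
  · exact A.ofK_gen j ξ μ .b ▸ A.isFilComul_of_k j ξ μ .b
  · rw [Algebra.algebraMap_eq_smul_one, map_smul, map_one]
    exact A.IsFilComul.one.smul r
  · rw [map_add]
    exact hu.add hv
  · rw [map_mul]
    exact hu.mul hv

/-- Both Δ and the symbol maps are multiplicative, so the condition propagates from the generators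
to the spanning products xⁱyᵐk. -/
theorem A.isFilComul {n : ℕ} {u : A j ξ μ} (hu : u ∈ A.fil j ξ μ n) : A.IsFilComul j ξ μ n u := by
  refine A.fil_induction j ξ μ ?_ (fun u v => A.IsFilComul.add) (fun p k h => ?_) hu
  · simpa using (A.IsFilComul.one (j := j) (ξ := ξ) (μ := μ)).smul 0 |>.mono (Nat.zero_le n)
  · exact ((((A.isFilComul_x j ξ μ).pow _).mul ((A.isFilComul_y j ξ μ).pow _)).mul
      (A.isFilComul_ofK j ξ μ k)).mono h

theorem A.comul_mem_filT {n : ℕ} {u : A j ξ μ} (hu : u ∈ A.fil j ξ μ n) :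
    comul (R := 𝕜) u ∈ A.filT j ξ μ n := (A.isFilComul j ξ μ hu).2.1

theorem A.comul_symb {n : ℕ} {u : A j ξ μ} (hu : u ∈ A.fil j ξ μ n) :
    comul (R := 𝕜) (A.symb j ξ μ n u) = A.symbT j ξ μ n (comul (R := 𝕜) u) :=
  (A.isFilComul j ξ μ hu).2.2

end ComulSymbol

/-! ### The degree filtration is a Hopf algebra filtration -/

section Antipode

variable {𝕜 : Type u} [Field 𝕜] [CharZero 𝕜] (j : Idx) (ξ μ : 𝕜)
  [hξ : Fact (IsPrimitiveRoot ξ 4)]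

theorem A.antipode_eq (u : A j ξ μ) : antipode 𝕜 u = (A.antipodeHom j ξ μ u).unop := rfl

theorem A.antipode_mul (u v : A j ξ μ) : antipode 𝕜 (u * v) = antipode 𝕜 v * antipode 𝕜 u := by
  simp [A.antipode_eq]

theorem A.antipode_ofK_mem_fil (k : K ξ) : antipode 𝕜 (A.ofK j ξ μ k) ∈ A.fil j ξ μ 0 := by
  refine K.induction ξ (P := fun k => antipode 𝕜 (A.ofK j ξ μ k) ∈ A.fil j ξ μ 0) ?_ ?_
    (fun r => ?_) (fun u v hu hv => ?_) (fun u v hu hv => ?_) k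
  · rw [A.ofK_gen, A.antipode_gen]
    cases j <;> exact A.gen_mem_fil_zero _ ξ μ .d
  · rw [A.ofK_gen, A.antipode_gen]
    cases j <;> exact Submodule.smul_mem _ _ (A.gen_mem_fil_zero _ ξ μ .b)
  · rw [Algebra.algebraMap_eq_smul_one, map_smul, map_smul, map_one, A.antipode_eq, map_one]
    exact Submodule.smul_mem _ _ (A.one_mem_fil j ξ μ)
  · rw [map_add, map_add]
    exact add_mem hu hv
  · rw [map_mul, A.antipode_mul]
    exact A.mul_mem_fil j ξ μ hv hu

theorem A.antipode_pow_mem_fil {u : A j ξ μ} (hu : antipode 𝕜 u ∈ A.fil j ξ μ 1) (n : ℕ) :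
    antipode 𝕜 (u ^ n) ∈ A.fil j ξ μ n := by
  induction n with
  | zero =>
    rw [pow_zero, A.antipode_eq, map_one]
    exact A.one_mem_fil j ξ μ
  | succ n ih =>
    rw [pow_succ, A.antipode_mul, add_comm n 1]
    exact A.mul_mem_fil j ξ μ hu ih

/-- S reverses products, preserves 𝒦, and sends x and y to elements of degree at most one. -/
theorem A.antipode_mem_fil {n : ℕ} {u : A j ξ μ} (hu : u ∈ A.fil j ξ μ n) :
    antipode 𝕜 u ∈ A.fil j ξ μ n := by
  have hm := A.gen_mem_fil_zero j ξ μ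
  have hx := (A.isFilMul_x j ξ μ).mem
  have hy := (A.isFilMul_y j ξ μ).mem
  have e : ∀ g : KGen, ∀ v ∈ A.fil j ξ μ 1, A.gen j ξ μ (.k g) * v ∈ A.fil j ξ μ 1 :=
    fun g v hv => zero_add 1 ▸ A.mul_mem_fil j ξ μ (hm g) hv
  refine A.fil_induction j ξ μ (P := fun u => antipode 𝕜 u ∈ A.fil j ξ μ n) ?_
    (fun u v hu hv => ?_) (fun p k h => ?_) hu
  · rw [map_zero]
    exact zero_mem _
  · rw [map_add]
    exact add_mem hu hv
  · have h1 : antipode 𝕜 (A.gen j ξ μ .x) ∈ A.fil j ξ μ 1 := by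
      rw [A.antipode_gen]
      cases j <;> exact sub_mem (neg_mem (e _ _ hx)) (Submodule.smul_mem _ _ (e _ _ hy))
    have h2 : antipode 𝕜 (A.gen j ξ μ .y) ∈ A.fil j ξ μ 1 := by
      rw [A.antipode_gen]
      cases j <;> exact add_mem (neg_mem (e _ _ hy)) (Submodule.smul_mem _ _ (e _ _ hx))
    have h3 := A.mul_mem_fil j ξ μ (A.antipode_pow_mem_fil j ξ μ h2 (p.2 : ℕ))
      (A.antipode_pow_mem_fil j ξ μ h1 (p.1 : ℕ))
    rw [A.antipode_mul, A.mon, A.antipode_mul]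
    refine A.fil_mono j ξ μ ?_ (A.mul_mem_fil j ξ μ (A.antipode_ofK_mem_fil j ξ μ k) h3)
    rw [NF.deg] at h
    omega

theorem A.isHopfFiltration_fil : IsHopfFiltration 𝕜 (A.fil j ξ μ) where
  mono := A.fil_mono j ξ μ
  iSup_eq_top := eq_top_iff.2 (A.fil_four j ξ μ ▸ le_iSup (A.fil j ξ μ) 4)
  one_mem := A.one_mem_fil j ξ μ
  mul_mem _ _ _ hx _ hy := A.mul_mem_fil j ξ μ hx hy
  comul_mem _ _ hx := A.comul_mem_filT j ξ μ hx
  antipode_mem _ _ hx := A.antipode_mem_fil j ξ μ hx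

end Antipode


/-! ### Detecting tensors by slices -/

section Slices

variable {𝕜 V W : Type u} [Field 𝕜] [AddCommGroup V] [Module 𝕜 V] [AddCommGroup W] [Module 𝕜 W]

/-- The slice `v ⊗ w ↦ f(v) w`. -/
noncomputable def sliceL (f : V →ₗ[𝕜] 𝕜) : V ⊗[𝕜] W →ₗ[𝕜] W :=
  (TensorProduct.lid 𝕜 W).toLinearMap ∘ₗ f.rTensor W

/-- The slice `v ⊗ w ↦ f(w) v`. -/
noncomputable def sliceR (f : W →ₗ[𝕜] 𝕜) : V ⊗[𝕜] W →ₗ[𝕜] V :=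
  (TensorProduct.rid 𝕜 V).toLinearMap ∘ₗ f.lTensor V

@[simp]
theorem sliceL_tmul (f : V →ₗ[𝕜] 𝕜) (v : V) (w : W) : sliceL f (v ⊗ₜ[𝕜] w) = f v • w := by
  simp [sliceL]

@[simp]
theorem sliceR_tmul (f : W →ₗ[𝕜] 𝕜) (v : V) (w : W) : sliceR f (v ⊗ₜ[𝕜] w) = f w • v := by
  simp [sliceR]

/-- Slicing by the coordinate functionals of a basis of V reads off all coefficients of z. -/
theorem eq_zero_of_sliceL {z : V ⊗[𝕜] W} (h : ∀ f : V →ₗ[𝕜] 𝕜, sliceL f z = 0) : z = 0 := by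
  classical
  let b := Module.Basis.ofVectorSpace 𝕜 V
  apply (TensorProduct.equivFinsuppOfBasisLeft (N := W) b).injective
  rw [map_zero]
  ext i
  have key : ∀ t : V ⊗[𝕜] W, TensorProduct.equivFinsuppOfBasisLeft (N := W) b t i =
      sliceL (b.coord i) t := by
    intro t
    induction t with
    | zero => simp
    | add s t hs ht => rw [map_add, map_add, Finsupp.add_apply, hs, ht]
    | tmul v w => simp
  rw [key, h, Finsupp.zero_apply]

theorem eq_zero_of_sliceR {z : V ⊗[𝕜] W} (h : ∀ f : W →ₗ[𝕜] 𝕜, sliceR f z = 0) : z = 0 := by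
  apply (TensorProduct.comm 𝕜 V W).injective
  rw [map_zero]
  refine eq_zero_of_sliceL fun f => ?_
  rw [← h f]
  clear h
  induction z with
  | zero => simp
  | add s t hs ht => rw [map_add, map_add, map_add, hs, ht]
  | tmul v w => simp

theorem sliceL_mem {C : Submodule 𝕜 V} {D : Submodule 𝕜 W} {z : V ⊗[𝕜] W}
    (hz : z ∈ LinearMap.range (TensorProduct.mapIncl C D)) (f : V →ₗ[𝕜] 𝕜) : sliceL f z ∈ D := by
  obtain ⟨t, rfl⟩ := hz
  induction t with
  | zero => simp
  | add s t hs ht => rw [map_add, map_add]; exact add_mem hs ht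
  | tmul v w => simpa [TensorProduct.mapIncl] using D.smul_mem _ w.2

theorem sliceR_mem {C : Submodule 𝕜 V} {D : Submodule 𝕜 W} {z : V ⊗[𝕜] W}
    (hz : z ∈ LinearMap.range (TensorProduct.mapIncl C D)) (f : W →ₗ[𝕜] 𝕜) : sliceR f z ∈ C := by
  obtain ⟨t, rfl⟩ := hz
  induction t with
  | zero => simp
  | add s t hs ht => rw [map_add, map_add]; exact add_mem hs ht
  | tmul v w => simpa [TensorProduct.mapIncl] using C.smul_mem _ v.2

theorem sliceL_eq_zero {C : Submodule 𝕜 V} {D : Submodule 𝕜 W} {z : V ⊗[𝕜] W}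
    (hz : z ∈ LinearMap.range (TensorProduct.mapIncl C D)) {f : V →ₗ[𝕜] 𝕜}
    (hf : ∀ v ∈ C, f v = 0) : sliceL f z = 0 := by
  obtain ⟨t, rfl⟩ := hz
  induction t with
  | zero => simp
  | add s t hs ht => rw [map_add, map_add, hs, ht, add_zero]
  | tmul v w => simp [TensorProduct.mapIncl, hf v v.2]

theorem sliceR_eq_zero {C : Submodule 𝕜 V} {D : Submodule 𝕜 W} {z : V ⊗[𝕜] W}
    (hz : z ∈ LinearMap.range (TensorProduct.mapIncl C D)) {f : W →ₗ[𝕜] 𝕜}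
    (hf : ∀ w ∈ D, f w = 0) : sliceR f z = 0 := by
  obtain ⟨t, rfl⟩ := hz
  induction t with
  | zero => simp
  | add s t hs ht => rw [map_add, map_add, hs, ht, add_zero]
  | tmul v w => simp [TensorProduct.mapIncl, hf w w.2]

/-- Choose linear projections p onto C and q onto D. A functional f ∘ (p - 1) vanishes on C, so all
slices of (p ⊗ 1)z - z are zero and (p ⊗ 1)z = z; likewise for q. Hence z = (p ⊗ q)z. In this way
being a subcoalgebra becomes a condition on functionals. -/
theorem mem_range_mapIncl {C : Submodule 𝕜 V} {D : Submodule 𝕜 W} {z : V ⊗[𝕜] W}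
    (hC : ∀ f : V →ₗ[𝕜] 𝕜, (∀ v ∈ C, f v = 0) → sliceL f z = 0)
    (hD : ∀ f : W →ₗ[𝕜] 𝕜, (∀ w ∈ D, f w = 0) → sliceR f z = 0) :
    z ∈ LinearMap.range (TensorProduct.mapIncl C D) := by
  obtain ⟨p, hp⟩ := C.subtype.exists_leftInverse_of_injective C.ker_subtype
  obtain ⟨q, hq⟩ := D.subtype.exists_leftInverse_of_injective D.ker_subtype
  have h1 : (C.subtype ∘ₗ p).rTensor W z = z := by
    rw [← sub_eq_zero]
    refine eq_zero_of_sliceL fun f => ?_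
    have e : sliceL f ((C.subtype ∘ₗ p).rTensor W z - z) =
        sliceL (f ∘ₗ (C.subtype ∘ₗ p - LinearMap.id)) z := by
      clear hC hD
      induction z with
      | zero => simp
      | add s t hs ht => rw [map_add, add_sub_add_comm, map_add, map_add, hs, ht]
      | tmul v w => simp [sub_smul]
    rw [e]
    refine hC _ fun v hv => ?_
    have := LinearMap.congr_fun hp ⟨v, hv⟩
    simp only [LinearMap.comp_apply, Submodule.subtype_apply, LinearMap.id_apply] at this
    simp [this]
  have h2 : (D.subtype ∘ₗ q).lTensor V z = z := by
    rw [← sub_eq_zero]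
    refine eq_zero_of_sliceR fun f => ?_
    have e : sliceR f ((D.subtype ∘ₗ q).lTensor V z - z) =
        sliceR (f ∘ₗ (D.subtype ∘ₗ q - LinearMap.id)) z := by
      clear hC hD h1
      induction z with
      | zero => simp
      | add s t hs ht => rw [map_add, add_sub_add_comm, map_add, map_add, hs, ht]
      | tmul v w => simp [sub_smul]
    rw [e]
    refine hD _ fun w hw => ?_
    have := LinearMap.congr_fun hq ⟨w, hw⟩
    simp only [LinearMap.comp_apply, Submodule.subtype_apply, LinearMap.id_apply] at this
    simp [this]
  refine ⟨TensorProduct.map p q z, ?_⟩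
  conv_rhs => rw [← h2, ← h1]
  rw [TensorProduct.mapIncl, ← LinearMap.comp_apply, ← TensorProduct.map_comp,
    ← LinearMap.comp_apply, LinearMap.lTensor_comp_rTensor]

/-- A functional vanishing on `C ⊓ D` is the sum of functionals vanishing on `C` and `D`. -/
theorem exists_add_of_vanish_inf {C D : Submodule 𝕜 V} {f : V →ₗ[𝕜] 𝕜}
    (hf : ∀ v ∈ C ⊓ D, f v = 0) : ∃ g h : V →ₗ[𝕜] 𝕜, f = g + h ∧ (∀ v ∈ C, g v = 0) ∧
      ∀ v ∈ D, h v = 0 := by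
  have h1 : f ∈ (C ⊓ D).dualAnnihilator := (Submodule.mem_dualAnnihilator f).2 hf
  rw [Subspace.dualAnnihilator_inf_eq, Submodule.mem_sup] at h1
  obtain ⟨g, hg, h, hh, rfl⟩ := h1
  exact ⟨g, h, rfl, (Submodule.mem_dualAnnihilator g).1 hg, (Submodule.mem_dualAnnihilator h).1 hh⟩

end Slices

/-! ### The coradical and Hopf algebra filtrations -/

section Coradical

variable {𝕜 H : Type u} [Field 𝕜] [Ring H] [HopfAlgebra 𝕜 H]

/-- The annihilator of C ⊓ D is the sum of the annihilators of C and of D, so every slice to be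
tested splits into two slices that vanish. -/
theorem IsSubcoalgebra.inf {C D : Submodule 𝕜 H} (hC : IsSubcoalgebra 𝕜 H C)
    (hD : IsSubcoalgebra 𝕜 H D) : IsSubcoalgebra 𝕜 H (C ⊓ D) := by
  intro x hx
  refine mem_range_mapIncl (fun f hf => ?_) (fun f hf => ?_)
  · obtain ⟨g, h, rfl, hg, hh⟩ := exists_add_of_vanish_inf hf
    have e : sliceL (W := H) (g + h) = sliceL g + sliceL h := by
      ext; simp [add_smul]
    rw [e, LinearMap.add_apply, sliceL_eq_zero (hC x hx.1) hg, sliceL_eq_zero (hD x hx.2) hh,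
      add_zero]
  · obtain ⟨g, h, rfl, hg, hh⟩ := exists_add_of_vanish_inf hf
    have e : sliceR (V := H) (g + h) = sliceR g + sliceR h := by
      ext; simp [add_smul]
    rw [e, LinearMap.add_apply, sliceR_eq_zero (hC x hx.1) hg, sliceR_eq_zero (hD x hx.2) hh,
      add_zero]

theorem sliceL_counit_comul (x : H) : sliceL (counit (R := 𝕜)) (comul (R := 𝕜) x) = x := by
  simp [sliceL]

theorem IsHopfFiltration.isSubcoalgebra_zero {F : ℕ → Submodule 𝕜 H} (hF : IsHopfFiltration 𝕜 F) :
    IsSubcoalgebra 𝕜 H (F 0) := by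
  intro x hx
  have h := hF.comul_mem 0 x hx
  refine (iSup_le fun i => iSup_le fun k => iSup_le fun hik => ?_ :
    _ ≤ LinearMap.range (TensorProduct.mapIncl (F 0) (F 0))) h
  obtain ⟨rfl, rfl⟩ : i = 0 ∧ k = 0 := by omega
  exact le_rfl

/-- The coradical is contained in the degree zero part of any Hopf algebra filtration. -/
theorem IsHopfFiltration.coradical_le {F : ℕ → Submodule 𝕜 H} (hF : IsHopfFiltration 𝕜 F) :
    coradical 𝕜 H ≤ F 0 := by
  refine sSup_le fun C hC => ?_
  obtain ⟨hsub, hne, hmin⟩ := hC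
  rcases hmin _ (hsub.inf hF.isSubcoalgebra_zero) inf_le_left with h | h
  · exfalso
    -- When C ⊓ F₀ = 0, the counit splits as g + f with g zero on C and f zero on F₀. On C the
    -- counit may then be replaced by f, so slicing Δ by f fixes C.
    obtain ⟨g, f, hgf, hg, hf⟩ := exists_add_of_vanish_inf (C := C) (D := F 0)
      (f := counit (R := 𝕜)) (by
        intro v hv
        rw [h, Submodule.mem_bot] at hv
        rw [hv, map_zero])
    have key : ∀ x ∈ C, x = sliceL f (comul (R := 𝕜) x) := by
      intro x hx
      conv_lhs => rw [← sliceL_counit_comul (𝕜 := 𝕜) x]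
      have e : sliceL (W := H) (counit (R := 𝕜)) = sliceL g + sliceL f := by
        rw [hgf]; ext; simp [add_smul]
      rw [e, LinearMap.add_apply, sliceL_eq_zero (hsub x hx) hg, zero_add]
    -- Since f kills F₀, only terms F_i ⊗ F_k with i > 0, hence k < n, survive the slice. So slicing
    -- by f lowers the filtration degree.
    have hsl : ∀ n, ∀ x ∈ F n, sliceL f (comul (R := 𝕜) x) ∈ prev F n := by
      intro n x hx
      refine (iSup_le fun i => iSup_le fun k => iSup_le fun hik => ?_ :
        _ ≤ (prev F n).comap (sliceL (W := H) f)) (hF.comul_mem n x hx)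
      intro z hz
      rw [Submodule.mem_comap]
      rcases Nat.eq_zero_or_pos i with rfl | hi
      · rw [sliceL_eq_zero hz hf]
        exact zero_mem _
      · exact mapQ_mem_prev_of_lt hF (by omega) (sliceL_mem hz f)
    -- An element of C is fixed by an operation that lowers its degree, so it descends to zero.
    have hz : ∀ n, ∀ x ∈ C, x ∈ F n → x = 0 := by
      intro n
      induction n with
      | zero =>
        intro x hx hxF
        have := hsl 0 x hxF
        rwa [← key x hx, prev, Submodule.mem_bot] at this
      | succ n ih =>
        intro x hx hxF
        have := hsl (n + 1) x hxF
        rw [← key x hx] at this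
        exact ih x hx this
    refine hne ((Submodule.eq_bot_iff _).2 fun x hx => ?_)
    have hx' : x ∈ ⨆ n, F n := hF.iSup_eq_top ▸ Submodule.mem_top
    obtain ⟨n, hn⟩ := (Submodule.mem_iSup_of_directed _ hF.mono.directed_le).1 hx'
    exact hz n x hx hn
  · exact h ▸ inf_le_right

/-- A matrix coalgebra is simple. -/
theorem isSimpleSubcoalgebra_span {ι : Type} [Fintype ι] [DecidableEq ι] [Nonempty ι]
    (e : ι → ι → H) (he : ∀ i l, comul (R := 𝕜) (e i l) = ∑ k, e i k ⊗ₜ[𝕜] e k l)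
    (f : ι → ι → H →ₗ[𝕜] 𝕜)
    (hf : ∀ i k i' k', f i k (e i' k') = if i = i' ∧ k = k' then 1 else 0) :
    IsSimpleSubcoalgebra 𝕜 H (Submodule.span 𝕜 (Set.range fun p : ι × ι => e p.1 p.2)) := by
  set C := Submodule.span 𝕜 (Set.range fun p : ι × ι => e p.1 p.2)
  have heC : ∀ i k, e i k ∈ C := fun i k => Submodule.subset_span ⟨(i, k), rfl⟩
  refine ⟨?_, ?_, fun D hD hDC => ?_⟩
  · intro x hx
    induction hx using Submodule.span_induction with
    | zero => rw [map_zero]; exact zero_mem _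
    | add u v _ _ hu hv => rw [map_add]; exact add_mem hu hv
    | smul c u _ hu => rw [map_smul]; exact Submodule.smul_mem _ c hu
    | mem w hw =>
      obtain ⟨p, rfl⟩ := hw
      rw [he]
      refine Submodule.sum_mem _ fun k _ => ⟨⟨_, heC p.1 k⟩ ⊗ₜ ⟨_, heC k p.2⟩, ?_⟩
      simp [TensorProduct.mapIncl]
  · obtain ⟨i⟩ := ‹Nonempty ι›
    intro h
    have h0 : e i i = 0 := by simpa [h] using heC i i
    simpa [h0] using hf i i i i
  · rw [or_iff_not_imp_left]
    intro hne
    obtain ⟨x, hxD, hx0⟩ := (Submodule.ne_bot_iff _).1 hne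
    have hx : x = ∑ i, ∑ k, f i k x • e i k := by
      have hxC := hDC hxD
      clear hxD hx0
      induction hxC using Submodule.span_induction with
      | zero => simp
      | add u v _ _ hu hv =>
        conv_lhs => rw [hu, hv]
        simp only [map_add, add_smul, Finset.sum_add_distrib]
      | smul c u _ hu =>
        conv_lhs => rw [hu]
        simp only [map_smul, smul_eq_mul, mul_smul, Finset.smul_sum]
      | mem w hw =>
        obtain ⟨p, rfl⟩ := hw
        simp [hf, ite_and]
    obtain ⟨p, q, hpq⟩ : ∃ p q, f p q x ≠ 0 := by
      by_contra! h
      exact hx0 (by rw [hx]; simp [h])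
    -- Slicing Δ(x) on the left by the functional dual to e_{pk} extracts row p of the coefficients
    -- of x and places it on row k.
    have h1 : ∀ k, ∑ l, f p l x • e k l ∈ D := by
      intro k
      convert sliceL_mem (hD x hxD) (f p k) using 1
      conv_rhs => rw [hx]
      simp [he, hf, ite_and, Finset.smul_sum]
    -- A second slice, on the right by the functional dual to e_{lq}, isolates the coefficient at
    -- (p, q), which is nonzero.
    have h2 : ∀ k l, e k l ∈ D := by
      intro k l
      have h3 : f p q x • e k l ∈ D := by
        convert sliceR_mem (hD _ (h1 k)) (f l q) using 1
        simp [he, hf, ite_and, Finset.smul_sum]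
      exact (Submodule.smul_mem_iff _ hpq).1 h3
    refine le_antisymm hDC (Submodule.span_le.2 ?_)
    rintro _ ⟨p, rfl⟩
    exact h2 _ _

end Coradical

/-! ### The Hopf coradical is 𝒦 -/

section HopfCoradical

variable {𝕜 : Type u} [Field 𝕜] [CharZero 𝕜] (j : Idx) (ξ μ : 𝕜)
  [hξ : Fact (IsPrimitiveRoot ξ 4)]

/-- The matrix coalgebra spanned by `a, b, c, d`. -/
def KGen.matrix : Fin 2 → Fin 2 → KGen
  | 0, 0 => .a
  | 0, 1 => .b
  | 1, 0 => .c
  | 1, 1 => .d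

/-- The exponents of `a, b, c, d` in the basis `aᵏbˡ` of `𝒦`. -/
def KGen.exponent : KGen → Fin 4 × Fin 2
  | .a => (1, 0)
  | .b => (0, 1)
  | .c => (2, 1)
  | .d => (3, 0)

theorem K.gen_eq_mono (g : KGen) : K.gen ξ g = K.mono ξ g.exponent := by
  cases g <;> simp [K.mono, KGen.exponent, K.c_eq, K.d_eq, pow_succ, mul_assoc]

/-- The elements a, b, c, d form a 2 × 2 matrix coalgebra. As they are the distinct monomials a, b,
a²b, a³ of 𝒦, coordinate functionals of `K.basis` pulled back along `A.nf` are dual to them, and the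
matrix coalgebra is simple. -/
theorem A.gen_mem_coradical (g : KGen) : A.gen j ξ μ (.k g) ∈ coradical 𝕜 (A j ξ μ) := by
  have h := isSimpleSubcoalgebra_span (𝕜 := 𝕜) (fun i l => A.gen j ξ μ (.k (KGen.matrix i l)))
    (by
      intro i l
      rw [A.comul_gen, Fin.sum_univ_two]
      fin_cases i <;> fin_cases l <;> cases j <;> rfl)
    (fun i l => (K.basis ξ).coord (KGen.matrix i l).exponent ∘ₗ LinearMap.proj (0, 0) ∘ₗ
      (A.nf j ξ μ).toLinearMap)
    (by
      intro i l i' l'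
      simp only [LinearMap.comp_apply, LinearEquiv.coe_coe, ← A.ofK_gen, A.nf_ofK,
        LinearMap.proj_apply, Pi.single_eq_same, K.gen_eq_mono, ← K.basis_apply,
        Module.Basis.coord_apply, Module.Basis.repr_self]
      fin_cases i <;> fin_cases l <;> fin_cases i' <;> fin_cases l' <;>
        simp [KGen.matrix, KGen.exponent])
  refine le_sSup (a := Submodule.span 𝕜 _) h ?_
  cases g
  · exact Submodule.subset_span ⟨(0, 0), rfl⟩
  · exact Submodule.subset_span ⟨(0, 1), rfl⟩
  · exact Submodule.subset_span ⟨(1, 0), rfl⟩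
  · exact Submodule.subset_span ⟨(1, 1), rfl⟩

/-- The coradical lies in F₀ = 𝒦 because F is a Hopf algebra filtration. Conversely 𝒦 is generated
by elements of the coradical. -/
theorem A.hopfCoradical_eq : hopfCoradical 𝕜 (A j ξ μ) = (A.ofK j ξ μ).range := by
  apply le_antisymm
  · refine Algebra.adjoin_le fun u hu => ?_
    exact (A.mem_fil_zero j ξ μ).1 ((A.isHopfFiltration_fil j ξ μ).coradical_le hu)
  · rintro _ ⟨k, rfl⟩
    have hg := A.gen_mem_coradical j ξ μ
    rw [AlgHom.toRingHom_eq_coe, RingHom.coe_coe]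
    refine K.induction ξ (P := fun k => A.ofK j ξ μ k ∈ hopfCoradical 𝕜 (A j ξ μ)) ?_ ?_
      (fun r => ?_) (fun u v hu hv => ?_) (fun u v hu hv => ?_) k
    · rw [A.ofK_gen]
      exact Algebra.subset_adjoin (hg _)
    · rw [A.ofK_gen]
      exact Algebra.subset_adjoin (hg _)
    · rw [AlgHom.commutes]
      exact Subalgebra.algebraMap_mem _ r
    · rw [map_add]
      exact add_mem hu hv
    · rw [map_mul]
      exact mul_mem hu hv

theorem A.hopfCoradical_eq_fil :
    Subalgebra.toSubmodule (hopfCoradical 𝕜 (A j ξ μ)) = A.fil j ξ μ 0 := by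
  ext u
  rw [A.mem_fil_zero, A.hopfCoradical_eq]
  rfl

/-- The inclusion of `𝒦` as a bialgebra map. -/
noncomputable def A.ofKBialg : K ξ →ₐc[𝕜] A j ξ μ :=
  BialgHom.ofAlgHom (A.ofK j ξ μ)
    (K.hom_ext fun g => by
      change counit (R := 𝕜) (A.ofK j ξ μ (K.gen ξ g)) = counit (R := 𝕜) (K.gen ξ g)
      rw [A.ofK_gen, A.counit_gen, K.counit_gen, A.counitGen])
    (K.hom_ext fun g => by
      change Algebra.TensorProduct.map (A.ofK j ξ μ) (A.ofK j ξ μ) (comul (R := 𝕜) (K.gen ξ g)) =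
        comul (R := 𝕜) (A.ofK j ξ μ (K.gen ξ g))
      rw [A.ofK_gen, A.comul_gen, K.comul_gen]
      cases j <;> cases g <;> simp [A.comulGen, K.comulGen])

theorem A.exists_ofK : ∃ φ : K ξ →ₐc[𝕜] A j ξ μ,
    (∀ g, φ (K.gen ξ g) = A.gen j ξ μ (.k g)) ∧ Function.Injective φ ∧
      Set.range φ = (hopfCoradical 𝕜 (A j ξ μ) : Set (A j ξ μ)) := by
  refine ⟨A.ofKBialg j ξ μ, fun g => A.ofK_gen j ξ μ g, A.ofK_injective j ξ μ, ?_⟩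
  rw [A.hopfCoradical_eq]
  rfl

end HopfCoradical


/-! ### Strictness: the degree filtration is the standard filtration -/

section Strict

variable {𝕜 : Type u} [Field 𝕜] [CharZero 𝕜] (j : Idx) (ξ μ : 𝕜)
  [hξ : Fact (IsPrimitiveRoot ξ 4)]

/-- The matrices by which `𝔄_{3,j}(0)` acts on the basis `1, x, y` of its quotient by the left
ideal generated by the elements of degree at least two and the kernel of `ε` on `𝒦`. -/
def A.smallMatrix : AGen → Matrix (Fin 3) (Fin 3) 𝕜
  | .x => !![0, 0, 0; 1, 0, 0; 0, 0, 0]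
  | .y => !![0, 0, 0; 0, 0, 0; 1, 0, 0]
  | .k .a => !![1, 0, 0; 0, -ξ, 0; 0, 0, -1]
  | .k .b => !![0, 0, 0; 0, 0, -1; 0, 0, 0]
  | .k .c => !![0, 0, 0; 0, 0, 1; 0, 0, 0]
  | .k .d => !![1, 0, 0; 0, ξ, 0; 0, 0, -1]

/-- The action of `𝔄_{3,j}(0)` on the span of `1, x, y`. -/
noncomputable def A.smallRep : A j ξ 0 →ₐ[𝕜] Matrix (Fin 3) (Fin 3) 𝕜 :=
  A.lift (A.smallMatrix ξ) (by
    have hs := sq_eq_neg_one ξ hξ.out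
    refine A.rel_of ξ 0 _ (K.rel_of ξ hs _ ?_ ?_ ?_ ?_ ?_) ?_ ?_ ?_ ?_ ?_ ?_ ?_
    all_goals
      ext i k
      fin_cases i <;> fin_cases k <;>
        simp [A.smallMatrix, Matrix.mul_apply, Fin.sum_univ_three, hs])

theorem A.smallRep_gen (g : AGen) : A.smallRep j ξ (A.gen j ξ 0 g) = A.smallMatrix ξ g :=
  A.lift_gen _ _ _

/-- The basis vector 1 spans a trivial 𝒦-submodule, on which 𝒦 acts through ε. -/
theorem A.smallRep_ofK (k : K ξ) (i : Fin 3) :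
    A.smallRep j ξ (A.ofK j ξ 0 k) i 0 = if i = 0 then counit (R := 𝕜) k else 0 := by
  revert i
  refine K.induction ξ (P := fun k => ∀ i, A.smallRep j ξ (A.ofK j ξ 0 k) i 0 =
    if i = 0 then counit (R := 𝕜) k else 0) (fun i => ?_) (fun i => ?_) (fun r i => ?_)
    (fun u v hu hv i => ?_) (fun u v hu hv i => ?_) k
  · rw [A.ofK_gen, A.smallRep_gen, K.counit_gen]
    fin_cases i <;> simp [A.smallMatrix, K.counitGen]
  · rw [A.ofK_gen, A.smallRep_gen, K.counit_gen]
    fin_cases i <;> simp [A.smallMatrix, K.counitGen]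
  · rw [AlgHom.commutes, AlgHom.commutes, Matrix.algebraMap_matrix_apply,
      Bialgebra.counit_algebraMap]
    rfl
  · rw [map_add, map_add, map_add, Matrix.add_apply, hu, hv]
    split_ifs <;> simp
  · rw [map_mul, map_mul, Bialgebra.counit_mul, Matrix.mul_apply, Fin.sum_univ_three, hv, hv, hv]
    simp only [if_true, hu, one_ne_zero, if_false, mul_zero, add_zero]
    split_ifs <;> simp_all

/-- The coefficient of `x`, after evaluation of `𝒦` by `ε`. -/
noncomputable def A.coeffX : A j ξ 0 →ₗ[𝕜] 𝕜 where
  toFun u := A.smallRep j ξ u 1 0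
  map_add' u v := by rw [map_add, Matrix.add_apply]
  map_smul' c u := by rw [map_smul, Matrix.smul_apply, RingHom.id_apply]

theorem A.coeffX_apply (u : A j ξ 0) : A.coeffX j ξ u = A.smallRep j ξ u 1 0 := rfl

theorem A.coeffX_mon_mul_ofK (p : Fin 4 × Fin 2) (h : NF.deg p ≠ 1) (k : K ξ) :
    A.coeffX j ξ (A.mon j ξ 0 p * A.ofK j ξ 0 k) = 0 := by
  rw [A.coeffX_apply, map_mul, Matrix.mul_apply, Fin.sum_univ_three, A.smallRep_ofK,
    A.smallRep_ofK, A.smallRep_ofK]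
  have : A.smallRep j ξ (A.mon j ξ 0 p) 1 0 = 0 := by
    rw [A.mon, map_mul, map_pow, map_pow, A.smallRep_gen, A.smallRep_gen]
    obtain ⟨i, l⟩ := p
    fin_cases i <;> fin_cases l <;>
      first
      | exact absurd rfl h
      | simp [A.smallMatrix, Matrix.mul_apply, Fin.sum_univ_three, pow_succ]
  simp [this]

theorem A.coeffX_symb {n : ℕ} (h : n ≠ 1) (u : A j ξ μ) :
    A.coeffX j ξ (A.symb j ξ μ n u) = 0 := by
  rw [A.eq_sum j ξ 0 (A.symb j ξ μ n u), map_sum]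
  refine Finset.sum_eq_zero fun p _ => ?_
  rw [A.nf_symb, NF.top_apply]
  split_ifs with hp
  · exact A.coeffX_mon_mul_ofK j ξ p (hp ▸ h) _
  · simp

/-- The map `u ↦ (u₁ ρ(u₂)_{ik})`, where `ρ` is the action on the span of `1, x, y`. -/
noncomputable def A.matrixHom : A j ξ 0 →ₐ[𝕜] Matrix (Fin 3) (Fin 3) (A j ξ 0) :=
  (matrixEquivTensor (Fin 3) 𝕜 (A j ξ 0)).symm.toAlgHom.comp
    ((Algebra.TensorProduct.map (AlgHom.id 𝕜 _) (A.smallRep j ξ)).comp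
      (Bialgebra.comulAlgHom 𝕜 (A j ξ 0)))

theorem A.matrixHom_apply (u : A j ξ 0) : A.matrixHom j ξ u =
    (matrixEquivTensor (Fin 3) 𝕜 (A j ξ 0)).symm
      (Algebra.TensorProduct.map (AlgHom.id 𝕜 _) (A.smallRep j ξ) (comul (R := 𝕜) u)) := rfl

/-- The skew derivation dual to `x`. -/
noncomputable def A.skewX : A j ξ 0 →ₗ[𝕜] A j ξ 0 := sliceR (A.coeffX j ξ) ∘ₗ comul

/-- Slicing Δ by a matrix coefficient of a representation gives an entry of the algebra map
`A.matrixHom`. The skew Leibniz rule thus becomes matrix multiplication. -/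
theorem A.skewX_apply (u : A j ξ 0) : A.skewX j ξ u = A.matrixHom j ξ u 1 0 := by
  rw [A.matrixHom_apply, A.skewX, LinearMap.comp_apply]
  generalize comul (R := 𝕜) u = z
  induction z with
  | zero => simp
  | add s t hs ht => rw [map_add, map_add, map_add, Matrix.add_apply, hs, ht]
  | tmul v w =>
    rw [sliceR_tmul, Algebra.TensorProduct.map_tmul, matrixEquivTensor_apply_symm,
      A.coeffX_apply]
    simp [Algebra.algebraMap_eq_smul_one]

theorem A.matrixHom_ofK (k : K ξ) (i : Fin 3) :
    A.matrixHom j ξ (A.ofK j ξ 0 k) i 0 = if i = 0 then A.ofK j ξ 0 k else 0 := by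
  have h : comul (R := 𝕜) (A.ofK j ξ 0 k) =
      TensorProduct.map (A.ofK j ξ 0).toLinearMap (A.ofK j ξ 0).toLinearMap (comul (R := 𝕜) k) :=
    (CoalgHomClass.map_comp_comul_apply (A.ofKBialg j ξ 0) k).symm
  have h2 : (if i = 0 then A.ofK j ξ 0 k else 0) =
      if i = 0 then A.ofK j ξ 0 (sliceR (counit (R := 𝕜)) (comul (R := 𝕜) k)) else 0 := by
    congr 2
    simp [sliceR]
  rw [A.matrixHom_apply, h, h2]
  generalize comul (R := 𝕜) k = z
  induction z with
  | zero => simp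
  | add s t hs ht =>
    simp only [map_add, Matrix.add_apply, hs, ht]
    split_ifs <;> simp
  | tmul v w =>
    rw [TensorProduct.map_tmul, Algebra.TensorProduct.map_tmul, matrixEquivTensor_apply_symm,
      sliceR_tmul, Matrix.smul_apply, Matrix.map_apply, AlgHom.toLinearMap_apply,
      AlgHom.toLinearMap_apply, A.smallRep_ofK]
    split_ifs <;> simp [Algebra.algebraMap_eq_smul_one]

local notation "ax" => A.gen j ξ 0 AGen.x
local notation "ay" => A.gen j ξ 0 AGen.y

/-- In column 0 of the matrix of k the only nonzero entry is k itself, at the top. -/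
theorem A.skewX_mul_ofK (u : A j ξ 0) (k : K ξ) :
    A.skewX j ξ (u * A.ofK j ξ 0 k) = A.skewX j ξ u * A.ofK j ξ 0 k := by
  rw [A.skewX_apply, map_mul, Matrix.mul_apply, Fin.sum_univ_three]
  simp [A.matrixHom_ofK, A.skewX_apply]

/-- The values of the skew derivation dual to `x` at `x` and `y`. -/
noncomputable def A.skewXGen : Idx → Fin 2 → K ξ
  | .one, 0 => K.gen ξ .d
  | .one, 1 => (1 / 2 * (-ξ - 1)) • K.gen ξ .b
  | .three, 0 => K.gen ξ .a
  | .three, 1 => (1 / 2 * (1 - ξ)) • K.gen ξ .c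

/-- The entry at (2, 0) belongs to the skew derivation dual to y. It may stay unspecified: in the
products below it only meets an entry at (1, 2), which is zero. -/
theorem A.matrixHom_x : ∃ k, A.matrixHom j ξ ax =
    !![ax, 0, 0; A.ofK j ξ 0 (A.skewXGen ξ j 0), ax, 0; k, 0, ax] := by
  cases j
  · refine ⟨(ξ - 1) • A.gen .one ξ 0 (.k .c), ?_⟩
    rw [A.matrixHom_apply, A.comul_gen, A.comulGen]
    simp only [map_add, map_smul, Algebra.TensorProduct.map_tmul, map_one, A.smallRep_gen,
      matrixEquivTensor_apply_symm, A.skewXGen, A.ofK_gen]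
    ext i k
    fin_cases i <;> fin_cases k <;> simp [A.smallMatrix]
  · refine ⟨(ξ + 1) • A.gen .three ξ 0 (.k .b), ?_⟩
    rw [A.matrixHom_apply, A.comul_gen, A.comulGen]
    simp only [map_add, map_smul, Algebra.TensorProduct.map_tmul, map_one, A.smallRep_gen,
      matrixEquivTensor_apply_symm, A.skewXGen, A.ofK_gen]
    ext i k
    fin_cases i <;> fin_cases k <;> simp [A.smallMatrix]

theorem A.matrixHom_y : ∃ k, A.matrixHom j ξ ay =
    !![ay, 0, 0; A.ofK j ξ 0 (A.skewXGen ξ j 1), ay, 0; k, 0, ay] := by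
  cases j
  · refine ⟨A.gen .one ξ 0 (.k .a), ?_⟩
    rw [A.matrixHom_apply, A.comul_gen, A.comulGen]
    simp only [map_add, map_smul, Algebra.TensorProduct.map_tmul, map_one, A.smallRep_gen,
      matrixEquivTensor_apply_symm, A.skewXGen, A.ofK_gen]
    ext i k
    fin_cases i <;> fin_cases k <;> simp [A.smallMatrix]
  · refine ⟨A.gen .three ξ 0 (.k .d), ?_⟩
    rw [A.matrixHom_apply, A.comul_gen, A.comulGen]
    simp only [map_add, map_smul, Algebra.TensorProduct.map_tmul, map_one, A.smallRep_gen,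
      matrixEquivTensor_apply_symm, A.skewXGen, A.ofK_gen]
    ext i k
    fin_cases i <;> fin_cases k <;> simp [A.smallMatrix]

theorem A.skewX_pow_mul (i : ℕ) : A.matrixHom j ξ (ax ^ i) 1 1 = ax ^ i ∧
    A.matrixHom j ξ (ax ^ i) 1 2 = 0 := by
  obtain ⟨k, hk⟩ := A.matrixHom_x j ξ
  induction i with
  | zero => simp
  | succ i ih =>
    rw [pow_succ, map_mul, Matrix.mul_apply, Matrix.mul_apply, Fin.sum_univ_three,
      Fin.sum_univ_three, ih.1, ih.2, hk]
    simp

theorem A.skewX_pow_succ (i : ℕ) : A.skewX j ξ (ax ^ (i + 1)) =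
    A.skewX j ξ (ax ^ i) * ax + ax ^ i * A.ofK j ξ 0 (A.skewXGen ξ j 0) := by
  obtain ⟨k, hk⟩ := A.matrixHom_x j ξ
  rw [A.skewX_apply, A.skewX_apply, pow_succ, map_mul, Matrix.mul_apply, Fin.sum_univ_three,
    (A.skewX_pow_mul j ξ i).1, (A.skewX_pow_mul j ξ i).2, hk]
  simp

theorem A.skewX_pow_mul_y (i : ℕ) : A.skewX j ξ (ax ^ i * ay) =
    A.skewX j ξ (ax ^ i) * ay + ax ^ i * A.ofK j ξ 0 (A.skewXGen ξ j 1) := by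
  obtain ⟨k, hk⟩ := A.matrixHom_y j ξ
  rw [A.skewX_apply, A.skewX_apply, map_mul, Matrix.mul_apply, Fin.sum_univ_three,
    (A.skewX_pow_mul j ξ i).1, (A.skewX_pow_mul j ξ i).2, hk]
  simp

/-- The scalar `ζ` with `g x = ζ x g`, where `g` is the value at `x` of the skew derivation. -/
def A.twist : Idx → 𝕜
  | .one => ξ
  | .three => -ξ

theorem A.skewXGen_mul_x : A.ofK j ξ 0 (A.skewXGen ξ j 0) * ax =
    A.twist ξ j • (ax * A.ofK j ξ 0 (A.skewXGen ξ j 0)) := by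
  have hs := sq_eq_neg_one ξ hξ.out
  cases j
  · simp only [A.skewXGen, A.ofK_gen, A.twist, A.d_eq, mul_assoc, A.rel_ax, A.rel_ax_assoc,
      mul_neg, mul_smul_comm, smul_smul, hs, smul_neg, neg_neg, neg_smul, one_smul]
  · simp only [A.skewXGen, A.ofK_gen, A.twist, A.rel_ax, neg_smul]

/-- Only the leading term -yg matters later; the error xe is absorbed by the coefficient of a power
of x. -/
theorem A.exists_skewXGen_mul_y : ∃ e, A.ofK j ξ 0 (A.skewXGen ξ j 0) * ay =
    -(ay * A.ofK j ξ 0 (A.skewXGen ξ j 0)) + ax * A.ofK j ξ 0 e := by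
  cases j
  · refine ⟨K.gen ξ .b, ?_⟩
    simp only [A.skewXGen, A.ofK_gen]
    have h : A.mk .one ξ 0 _ = _ := A.mk_rel .dy
    rw [map_mul, map_add, map_neg, map_mul, map_mul] at h
    exact h
  · refine ⟨-K.gen ξ .c, ?_⟩
    simp only [A.skewXGen, A.ofK_gen, map_neg, mul_neg, ← sub_eq_add_neg]
    have h : A.mk .three ξ 0 _ = _ := A.mk_rel .ay
    rw [map_mul, map_sub, map_neg, map_mul, map_mul] at h
    exact h

/-- The value of the skew derivation at x is d or a, a unit of 𝒦. -/
theorem A.skewXGen_mul_cancel {k : K ξ} (h : A.skewXGen ξ j 0 * k = 0) : k = 0 := by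
  cases j
  · have := congrArg (K.gen ξ .a * ·) h
    simpa [A.skewXGen, ← mul_assoc, K.rel_ad] using this
  · have := congrArg (K.gen ξ .d * ·) h
    simpa [A.skewXGen, ← mul_assoc, K.rel_da] using this

theorem A.twist_sq : A.twist ξ j * A.twist ξ j = -1 := by
  have hs := sq_eq_neg_one ξ hξ.out
  cases j <;> simp [A.twist, hs]

/-- With g the value at x and gx = ζxg, each further factor x contributes another power of ζ, and
the sum is the quantum integer (i + 1)_ζ. -/
theorem A.skewX_pow (i : ℕ) : A.skewX j ξ (ax ^ (i + 1)) =
    (∑ t ∈ Finset.range (i + 1), A.twist ξ j ^ t) •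
      (ax ^ i * A.ofK j ξ 0 (A.skewXGen ξ j 0)) := by
  induction i with
  | zero =>
    rw [A.skewX_pow_succ, A.skewX_apply, pow_zero, map_one]
    simp
  | succ i ih =>
    rw [A.skewX_pow_succ, ih, smul_mul_assoc, mul_assoc, A.skewXGen_mul_x, mul_smul_comm,
      smul_smul, ← mul_assoc, ← pow_succ, Finset.sum_range_succ' _ (i + 1), pow_zero, add_smul,
      one_smul, Finset.sum_mul]
    simp only [pow_succ]

/-- By ζ² = -1 the quantum integers (1), (2), (3) are 1, 1 + ζ, ζ. The next one is zero, in
accordance with x⁴ = 0. -/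
theorem A.sum_twist_ne_zero (i : ℕ) (hi : i < 3) :
    ∑ t ∈ Finset.range (i + 1), A.twist ξ j ^ t ≠ 0 := by
  have h := A.twist_sq j ξ
  generalize A.twist ξ j = z at h
  interval_cases i
  · simp
  · simp only [Finset.sum_range_succ, Finset.sum_range_zero, pow_zero, pow_one, zero_add]
    intro h1
    have h2 : z = -1 := by linear_combination h1
    rw [h2] at h
    exact (two_ne_zero (α := 𝕜)) (by linear_combination h)
  · simp only [Finset.sum_range_succ, Finset.sum_range_zero, pow_zero, pow_one, zero_add, pow_two,
      h]
    intro h1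
    have h2 : z = 0 := by linear_combination h1
    rw [h2] at h
    simp at h

/-- The derivation gives -c xⁱy · gl + xⁱ⁺¹(c'gk + (ce + g')l), where c, c' are consecutive quantum
integers, g is a unit and g' is the value at y. The coefficient of xⁱy forces l = 0, and then that
of xⁱ⁺¹ forces k = 0. For i = 2 the integer c' is no longer available as a nonzero scalar, but there
xⁱ⁺² = x⁴ = 0. -/
theorem A.eq_zero_of_skewX_aux (i : ℕ) (hi : i < 3) (k l : K ξ)
    (h : A.skewX j ξ (ax ^ (i + 2) * A.ofK j ξ 0 k + ax ^ (i + 1) * ay * A.ofK j ξ 0 l) = 0) :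
    ax ^ (i + 2) * A.ofK j ξ 0 k + ax ^ (i + 1) * ay * A.ofK j ξ 0 l = 0 := by
  obtain ⟨e, he⟩ := A.exists_skewXGen_mul_y j ξ
  rw [map_add, A.skewX_mul_ofK, A.skewX_mul_ofK, A.skewX_pow_mul_y, A.skewX_pow, A.skewX_pow] at h
  have hc := A.sum_twist_ne_zero j ξ i hi
  have hc' := A.sum_twist_ne_zero j ξ (i + 1)
  generalize ∑ t ∈ Finset.range (i + 1), A.twist ξ j ^ t = c at *
  generalize ∑ t ∈ Finset.range (i + 1 + 1), A.twist ξ j ^ t = c' at *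
  have h2 : A.mon j ξ 0 (⟨i, by omega⟩, 1) * A.ofK j ξ 0 (-c • (A.skewXGen ξ j 0 * l)) +
      A.mon j ξ 0 (⟨i + 1, by omega⟩, 0) * A.ofK j ξ 0 (c' • (A.skewXGen ξ j 0 * k) +
        (c • e + A.skewXGen ξ j 1) * l) = 0 := by
    rw [← h, smul_mul_assoc c, mul_assoc (ax ^ i), he]
    simp only [A.mon, map_add, map_mul, map_smul, mul_add, add_mul, smul_mul_assoc, mul_smul_comm,
      mul_assoc, pow_succ, pow_zero, Fin.val_zero, Fin.val_one, one_mul, mul_one, mul_neg, smul_add,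
      neg_mul]
    module
  have h3 := congrArg (A.nf j ξ 0) h2
  rw [map_add, A.nf_mon_ofK, A.nf_mon_ofK, map_zero] at h3
  have hl : l = 0 := by
    have := congrFun h3 (⟨i, by omega⟩, 1)
    simp at this
    exact A.skewXGen_mul_cancel j ξ (this.resolve_left hc)
  subst hl
  have hk : c' • (A.skewXGen ξ j 0 * k) = 0 := by
    have := congrFun h3 (⟨i + 1, by omega⟩, 0)
    simpa using this
  rcases eq_or_ne i 2 with rfl | hi2
  · have : ax ^ 4 = 0 := by simpa [pow_succ, mul_assoc] using A.rel_x_four j ξ 0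
    simp [this]
  · rw [A.skewXGen_mul_cancel j ξ ((smul_eq_zero.1 hk).resolve_left (hc' (by omega)))]
    simp

/-- The skew derivation dual to `x` is injective in each degree at least two. -/
theorem A.eq_zero_of_skewX {m : ℕ} (hm : 2 ≤ m) (u : A j ξ μ)
    (h : A.skewX j ξ (A.symb j ξ μ m u) = 0) : A.symb j ξ μ m u = 0 := by
  rcases le_or_gt m 4 with hm4 | hm4
  · obtain ⟨i, rfl⟩ : ∃ i, m = i + 2 := ⟨m - 2, by omega⟩
    -- Up to 𝒦, the only monomials of degree i + 2 are xⁱ⁺² and xⁱ⁺¹y. For i = 2 the first is x⁴ =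
    -- 0, which is not among the normal forms, so its coefficient is set to the default value 0.
    have key : A.symb j ξ μ (i + 2) u = ax ^ (i + 2) * A.ofK j ξ 0
          (if hi : i + 2 < 4 then A.nf j ξ μ u (⟨i + 2, hi⟩, 0) else 0) +
        ax ^ (i + 1) * ay * A.ofK j ξ 0 (A.nf j ξ μ u (⟨i + 1, by omega⟩, 1)) := by
      rw [A.eq_sum j ξ 0 (A.symb j ξ μ (i + 2) u), A.nf_symb]
      simp only [Fintype.sum_prod_type, Fin.sum_univ_four, Fin.sum_univ_two, NF.top_apply,
        NF.deg_00, NF.deg_10, NF.deg_20, NF.deg_30, NF.deg_01, NF.deg_11, NF.deg_21, NF.deg_31]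
      obtain rfl | rfl | rfl : i = 0 ∨ i = 1 ∨ i = 2 := by omega
      all_goals simp [A.mon, add_comm]
    rw [key] at h ⊢
    exact A.eq_zero_of_skewX_aux j ξ i (by omega) _ _ h
  · exact A.symb_eq_zero j ξ μ hm4 (A.fil_four j ξ μ ▸ Submodule.mem_top)

/-- `A.coeffX` vanishes on symbols of degree other than one, so among the bidegrees of total degree
m + 1 only (m, 1) contributes. -/
theorem A.skewX_symb {m : ℕ} {u : A j ξ μ} (hu : u ∈ A.fil j ξ μ (m + 1)) :
    A.skewX j ξ (A.symb j ξ μ (m + 1) u) = sliceR (A.coeffX j ξ)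
      (TensorProduct.map (A.symb j ξ μ m) (A.symb j ξ μ 1) (comul (R := 𝕜) u)) := by
  rw [A.skewX, LinearMap.comp_apply, A.comul_symb j ξ μ hu, A.symbT, LinearMap.sum_apply, map_sum,
    Finset.sum_eq_single (m, 1)]
  · rintro ⟨p, q⟩ hpq hne
    have hq : q ≠ 1 := by
      rintro rfl
      rw [Finset.HasAntidiagonal.mem_antidiagonal] at hpq
      exact hne (by congr 1; simpa using hpq)
    generalize comul (R := 𝕜) u = z
    induction z with
    | zero => simp
    | add s t hs ht => rw [map_add, map_add, hs, ht, add_zero]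
    | tmul v w => simp [A.coeffX_symb j ξ μ hq]
  · intro hn
    exact absurd (Finset.HasAntidiagonal.mem_antidiagonal.2 (rfl : (m, 1).1 + (m, 1).2 = m + 1)) hn

/-- H ⊗ F₀ has no part of degree one on the right, and F_n ⊗ H has none of degree above n on the
left. -/
theorem A.map_symb_eq_zero_of_mem {m n : ℕ} (h : n < m) {z : A j ξ μ ⊗[𝕜] A j ξ μ}
    (hz : z ∈ LinearMap.range ((A.fil j ξ μ 0).subtype.lTensor (A j ξ μ)) ⊔
      LinearMap.range ((A.fil j ξ μ n).subtype.rTensor (A j ξ μ))) :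
    TensorProduct.map (A.symb j ξ μ m) (A.symb j ξ μ 1) z = 0 := by
  refine (sup_le ?_ ?_ : _ ≤ LinearMap.ker _) hz
  · rintro _ ⟨t, rfl⟩
    rw [LinearMap.mem_ker]
    induction t with
    | zero => simp
    | add s t hs ht => rw [map_add, map_add, hs, ht, add_zero]
    | tmul v w => simp [A.symb_eq_zero j ξ μ one_pos w.2]
  · rintro _ ⟨t, rfl⟩
    rw [LinearMap.mem_ker]
    induction t with
    | zero => simp
    | add s t hs ht => rw [map_add, map_add, hs, ht, add_zero]
    | tmul v w => simp [A.symb_eq_zero j ξ μ h v.2]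

/-- Descend from F₄, which is everything. If u lies in F_{n+1+m+1}, the condition on Δ(u) kills its
part of bidegree (n + 1 + m, 1), so the skew derivation annihilates the symbol of u of degree n + 1
+ m + 1. That degree is at least two, hence the symbol is zero and u drops one step. -/
theorem A.mem_fil_of_comul_mem {n : ℕ} {u : A j ξ μ} (hz : comul (R := 𝕜) u ∈
      LinearMap.range ((A.fil j ξ μ 0).subtype.lTensor (A j ξ μ)) ⊔
      LinearMap.range ((A.fil j ξ μ n).subtype.rTensor (A j ξ μ))) :
    u ∈ A.fil j ξ μ (n + 1) := by
  have key : ∀ m, u ∈ A.fil j ξ μ (n + 1 + m) → u ∈ A.fil j ξ μ (n + 1) := by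
    intro m
    induction m with
    | zero => exact id
    | succ m ih =>
      intro hm
      refine ih (A.mem_fil_of_symb_eq_zero j ξ μ hm
        (A.eq_zero_of_skewX j ξ μ (by omega) u ?_))
      rw [A.skewX_symb j ξ μ (m := n + 1 + m) hm, A.map_symb_eq_zero_of_mem j ξ μ (by omega) hz, map_zero]
  exact key 4 (A.fil_mono j ξ μ (by omega) (A.fil_four j ξ μ ▸ Submodule.mem_top : u ∈ _))

theorem A.standardFiltration_eq : standardFiltration 𝕜 (A j ξ μ) = A.fil j ξ μ := by
  funext n
  induction n with
  | zero => exact A.hopfCoradical_eq_fil j ξ μ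
  | succ n ih =>
    rw [standardFiltration, ih, A.hopfCoradical_eq_fil]
    refine le_antisymm (fun u hu => A.mem_fil_of_comul_mem j ξ μ hu) fun u hu => ?_
    rw [Submodule.mem_comap]
    refine A.filT_induction j ξ μ (zero_mem _) (fun _ _ => add_mem) (fun i k v w hik hv hw => ?_)
      (A.comul_mem_filT j ξ μ hu)
    -- For i + k = n + 1, the term F_i ⊗ F_k lies in H ⊗ F₀ when k = 0, and in F_n ⊗ H otherwise.
    rcases Nat.eq_zero_or_pos k with rfl | hk
    · exact Submodule.mem_sup_left ⟨v ⊗ₜ ⟨w, hw⟩, rfl⟩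
    · exact Submodule.mem_sup_right ⟨⟨v, A.fil_mono j ξ μ (by omega) hv⟩ ⊗ₜ w, rfl⟩

end Strict


/-! ### Tensor identities for coactions -/

section Tensor

variable {𝕜 K V W : Type u} [Field 𝕜] [Ring K] [HopfAlgebra 𝕜 K]

/-- Reduces compatibility of the coaction with products to multiplicativity into the ordinary tensor
product algebra K ⊗ R. -/
theorem lTensor_mul_diagCoact {R : Type u} [Ring R] [Algebra 𝕜 R] (D : ActCoact 𝕜 K R) (r s : R) :
    (LinearMap.mul' 𝕜 R).lTensor K (diagCoact D D (r ⊗ₜ s)) = D.coact r * D.coact s := by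
  rw [diagCoact, LinearMap.comp_apply, LinearMap.comp_apply, TensorProduct.map_tmul]
  generalize D.coact r = z
  generalize D.coact s = w
  induction z with
  | zero => simp
  | add s t hs ht => simp only [TensorProduct.add_tmul, map_add, hs, ht, add_mul]
  | tmul u v =>
    induction w with
    | zero => simp
    | add s t hs ht => simp only [TensorProduct.tmul_add, map_add, hs, ht, mul_add]
    | tmul u' v' => simp

theorem lTensor_lTensor_assoc_rTensor [AddCommGroup V] [Module 𝕜 V] [AddCommGroup W] [Module 𝕜 W]
    (f : V →ₗ[𝕜] W) (g : K →ₗ[𝕜] K ⊗[𝕜] K) (z : K ⊗[𝕜] V) :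
    (f.lTensor K).lTensor K (TensorProduct.assoc 𝕜 K K V (g.rTensor V z)) =
      TensorProduct.assoc 𝕜 K K W (g.rTensor W (f.lTensor K z)) := by
  induction z with
  | zero => simp
  | add s t hs ht => simp only [map_add, hs, ht]
  | tmul k r =>
    simp only [LinearMap.rTensor_tmul, LinearMap.lTensor_tmul]
    generalize g k = w
    induction w with
    | zero => simp
    | add s t hs ht => simp only [TensorProduct.add_tmul, map_add, hs, ht]
    | tmul u v => simp

end Tensor

/-! ### Radford's decomposition: coalgebra and Yetter–Drinfeld structure of the coinvariants -/

section Splitting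

variable (𝕜 K H : Type u) [Field 𝕜] [Ring K] [HopfAlgebra 𝕜 K] [Ring H] [HopfAlgebra 𝕜 H]

/-- A Hopf algebra `H` with Hopf algebra maps `ι : K → H`, `π : H → K`, `π ι = id`, and an
algebra `R` of coinvariants, such that `H = R ι(K)`; `proj` is the map `r ι(k) ↦ ε(k) r`, which
identifies `R` with `H / H ι(K)⁺`. -/
structure Splitting where
  /-- the coinvariants -/
  R : Type u
  [ring : Ring R]
  [algebra : Algebra 𝕜 R]
  /-- the inclusion of `K` -/
  ι : K →ₐ[𝕜] H
  /-- the projection to `K` -/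
  π : H →ₐ[𝕜] K
  /-- the inclusion of the coinvariants -/
  val : R →ₐ[𝕜] H
  /-- the projection to the coinvariants -/
  proj : H →ₗ[𝕜] R
  π_ι : ∀ k, π (ι k) = k
  counit_ι : ∀ k, counit (R := 𝕜) (ι k) = counit (R := 𝕜) k
  comul_ι : ∀ k, comul (R := 𝕜) (ι k) =
    TensorProduct.map ι.toLinearMap ι.toLinearMap (comul (R := 𝕜) k)
  counit_π : ∀ u, counit (R := 𝕜) (π u) = counit (R := 𝕜) u
  comul_π : ∀ u, comul (R := 𝕜) (π u) =
    TensorProduct.map π.toLinearMap π.toLinearMap (comul (R := 𝕜) u)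
  π_val : ∀ r : R, π (val r) = algebraMap 𝕜 K (counit (R := 𝕜) (val r))
  proj_val : ∀ r : R, proj (val r) = r
  proj_val_mul : ∀ (r : R) (u : H), proj (val r * u) = r * proj u
  proj_mul_ι : ∀ (u : H) (k : K), proj (u * ι k) = counit (R := 𝕜) k • proj u
  exists_mul : ∀ u : H, ∃ z : R ⊗[𝕜] K,
    LinearMap.mul' 𝕜 H (TensorProduct.map val.toLinearMap ι.toLinearMap z) = u
  coact_mem : ∀ r : R, π.toLinearMap.rTensor H (comul (R := 𝕜) (val r)) ∈
    LinearMap.range (val.toLinearMap.lTensor K)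
  -- The smash rule kr = (k₁ · r)k₂, where k · r is the class of ι(k)r modulo Hι(K)⁺. This class
  -- plays the part of the adjoint action k₁rS(k₂) without mentioning the antipode.
  ι_mul_val : ∀ (k : K) (r : R), ι k * val r = LinearMap.mul' 𝕜 H
    (TensorProduct.map (val.toLinearMap ∘ₗ proj ∘ₗ LinearMap.mulRight 𝕜 (val r) ∘ₗ ι.toLinearMap)
      ι.toLinearMap (comul (R := 𝕜) k))

attribute [instance] Splitting.ring Splitting.algebra

namespace Splitting

variable {𝕜 K H} (S : Splitting 𝕜 K H)

/-- Induction over `H = R ι(K)`. -/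
theorem induction {P : H → Prop} (h0 : P 0) (hadd : ∀ u v, P u → P v → P (u + v))
    (hm : ∀ (r : S.R) k, P (S.val r * S.ι k)) (u : H) : P u := by
  obtain ⟨z, rfl⟩ := S.exists_mul u
  induction z with
  | zero => simpa using h0
  | add s t hs ht => rw [map_add, map_add]; exact hadd _ _ hs ht
  | tmul r k => simpa using hm r k

/-- The kernel Hι(K)⁺ of `proj` is a left ideal, so the class of vu depends only on v and on the
class of u. -/
theorem proj_mul_proj (v u : H) : S.proj (v * (S.val (S.proj u))) = S.proj (v * u) := by
  refine S.induction (P := fun u => S.proj (v * (S.val (S.proj u))) = S.proj (v * u)) (by simp)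
    (fun s t hs ht => ?_) (fun r k => ?_) u
  · simp only [map_add, mul_add, hs, ht]
  · rw [S.proj_mul_ι, S.proj_val, ← mul_assoc, S.proj_mul_ι, map_smul, mul_smul_comm,
      map_smul]

theorem counit_proj (u : H) : counit (R := 𝕜) (S.val (S.proj u)) = counit (R := 𝕜) u := by
  refine S.induction (P := fun u => counit (R := 𝕜) (S.val (S.proj u)) = counit (R := 𝕜) u) (by simp)
    (fun s t hs ht => ?_) (fun r k => ?_) u
  · simp only [map_add, hs, ht]
  · rw [S.proj_mul_ι, S.proj_val, map_smul, map_smul, Bialgebra.counit_mul, S.counit_ι,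
      smul_eq_mul, mul_comm]

theorem proj_one : S.proj 1 = 1 := by simpa using S.proj_val 1

theorem proj_ι (k : K) : S.proj (S.ι k) = counit (R := 𝕜) k • (1 : S.R) := by
  have h := S.proj_mul_ι 1 k
  rwa [one_mul, show S.proj 1 = 1 from S.proj_one] at h

theorem map_proj_mul_ι (z : H ⊗[𝕜] H) (w : K ⊗[𝕜] K) :
    TensorProduct.map S.proj S.proj
        (z * TensorProduct.map S.ι.toLinearMap S.ι.toLinearMap w) =
      counit (R := 𝕜) (sliceL (counit (R := 𝕜)) w) • TensorProduct.map S.proj S.proj z := by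
  induction w with
  | zero => simp
  | add s t hs ht => rw [map_add, mul_add, map_add, hs, ht, map_add, map_add, add_smul]
  | tmul k l =>
    induction z with
    | zero => simp
    | add s t hs ht => rw [add_mul, map_add, hs, ht, map_add, smul_add]
    | tmul u v =>
      simp only [TensorProduct.map_tmul, Algebra.TensorProduct.tmul_mul_tmul,
        AlgHom.toLinearMap_apply, S.proj_mul_ι, sliceL_tmul, map_smul, smul_eq_mul]
      rw [TensorProduct.smul_tmul_smul]

/-- The coproduct of `R`. -/
noncomputable def comulR : S.R →ₗ[𝕜] S.R ⊗[𝕜] S.R :=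
  TensorProduct.map S.proj S.proj ∘ₗ comul ∘ₗ S.val.toLinearMap

theorem comulR_apply (r : S.R) :
    S.comulR r = TensorProduct.map S.proj S.proj (comul (R := 𝕜) (S.val r)) := rfl

/-- Hι(K)⁺ is a coideal as well, so `proj` is a coalgebra map. The coalgebra axioms of R are
inherited from H through it. -/
theorem comulR_proj (u : H) :
    S.comulR (S.proj u) = TensorProduct.map S.proj S.proj (comul (R := 𝕜) u) := by
  refine S.induction (P := fun u => S.comulR (S.proj u) =
    TensorProduct.map S.proj S.proj (comul (R := 𝕜) u)) (by simp)
    (fun s t hs ht => ?_) (fun r k => ?_) u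
  · rw [map_add, map_add, map_add, map_add, hs, ht]
  · rw [S.proj_mul_ι, S.proj_val, map_smul, Bialgebra.comul_mul, S.comul_ι, S.map_proj_mul_ι,
      sliceL_counit_comul, S.comulR_apply]

/-- The counit of `R`. -/
noncomputable def counitR : S.R →ₗ[𝕜] 𝕜 := counit ∘ₗ S.val.toLinearMap

theorem counitR_apply (r : S.R) : S.counitR r = counit (R := 𝕜) (S.val r) := rfl

theorem coassoc_comulR : (TensorProduct.assoc 𝕜 S.R S.R S.R).toLinearMap ∘ₗ
    S.comulR.rTensor S.R ∘ₗ S.comulR = S.comulR.lTensor S.R ∘ₗ S.comulR := by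
  have h1 : ∀ z : H ⊗[𝕜] H, S.comulR.rTensor S.R (TensorProduct.map S.proj S.proj z) =
      TensorProduct.map (TensorProduct.map S.proj S.proj) S.proj (comul.rTensor H z) := by
    intro z
    induction z with
    | zero => simp
    | add s t hs ht => simp only [map_add, hs, ht]
    | tmul u v => simp [S.comulR_proj]
  have h2 : ∀ z : H ⊗[𝕜] H, S.comulR.lTensor S.R (TensorProduct.map S.proj S.proj z) =
      TensorProduct.map S.proj (TensorProduct.map S.proj S.proj) (comul.lTensor H z) := by
    intro z
    induction z with
    | zero => simp
    | add s t hs ht => simp only [map_add, hs, ht]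
    | tmul u v => simp [S.comulR_proj]
  refine LinearMap.ext fun r => ?_
  rw [LinearMap.comp_apply, LinearMap.comp_apply, LinearMap.comp_apply, S.comulR_apply, h1, h2,
    LinearEquiv.coe_coe, ← Coalgebra.coassoc_apply, TensorProduct.map_map_assoc]

noncomputable instance instCoalgebra : Coalgebra 𝕜 S.R where
  comul := S.comulR
  counit := S.counitR
  coassoc := S.coassoc_comulR
  rTensor_counit_comp_comul := by
    refine LinearMap.ext fun r => ?_
    rw [LinearMap.comp_apply, S.comulR_apply]
    have h : ∀ z : H ⊗[𝕜] H, S.counitR.rTensor S.R (TensorProduct.map S.proj S.proj z) =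
        S.proj.lTensor 𝕜 (counit.rTensor H z) := by
      intro z
      induction z with
      | zero => simp
      | add s t hs ht => simp only [map_add, hs, ht]
      | tmul u v => simp [S.counitR_apply, S.counit_proj]
    rw [h, Coalgebra.rTensor_counit_comul]
    simp [S.proj_val]
  lTensor_counit_comp_comul := by
    refine LinearMap.ext fun r => ?_
    rw [LinearMap.comp_apply, S.comulR_apply]
    have h : ∀ z : H ⊗[𝕜] H, S.counitR.lTensor S.R (TensorProduct.map S.proj S.proj z) =
        S.proj.rTensor 𝕜 (counit.lTensor H z) := by
      intro z
      induction z with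
      | zero => simp
      | add s t hs ht => simp only [map_add, hs, ht]
      | tmul u v => simp [S.counitR_apply, S.counit_proj]
    rw [h, Coalgebra.lTensor_counit_comul]
    simp [S.proj_val]

theorem comul_def (r : S.R) : comul (R := 𝕜) r = S.comulR r := rfl

theorem counit_def (r : S.R) : counit (R := 𝕜) r = counit (R := 𝕜) (S.val r) := rfl

/-- The Yetter-Drinfeld structure of `R`: `k · r` is the class of `ι(k) r` modulo `H ι(K)⁺`, and
the coaction is the restriction of `(π ⊗ id) Δ`. -/
noncomputable def actCoact : ActCoact 𝕜 K S.R where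
  act :=
    { toFun := fun k => S.proj ∘ₗ LinearMap.mulLeft 𝕜 (S.ι k) ∘ₗ S.val.toLinearMap
      map_one' := by
        refine LinearMap.ext fun r => ?_
        simp [S.proj_val]
      map_mul' := fun k l => by
        refine LinearMap.ext fun r => ?_
        simp [S.proj_mul_proj, mul_assoc]
      map_zero' := by
        refine LinearMap.ext fun r => ?_
        simp
      map_add' := fun k l => by
        refine LinearMap.ext fun r => ?_
        simp [add_mul]
      commutes' := fun c => by
        refine LinearMap.ext fun r => ?_
        simp [Algebra.algebraMap_eq_smul_one, S.proj_val] }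
  coact := TensorProduct.map S.π.toLinearMap S.proj ∘ₗ comul ∘ₗ S.val.toLinearMap

theorem act_apply (k : K) (r : S.R) : S.actCoact.act k r = S.proj (S.ι k * S.val r) := rfl

theorem coact_apply (r : S.R) :
    S.actCoact.coact r = TensorProduct.map S.π.toLinearMap S.proj (comul (R := 𝕜) (S.val r)) := rfl

/-- By `coact_mem`, nothing is lost when the second leg is projected to R. Identities for the
coaction can therefore be checked in K ⊗ H, where it is (π ⊗ id)Δ. -/
theorem lTensor_val_coact (r : S.R) : S.val.toLinearMap.lTensor K (S.actCoact.coact r) =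
    S.π.toLinearMap.rTensor H (comul (R := 𝕜) (S.val r)) := by
  obtain ⟨t, ht⟩ := S.coact_mem r
  have h : S.actCoact.coact r = S.proj.lTensor K (S.π.toLinearMap.rTensor H (comul (R := 𝕜) (S.val r))) := by
    rw [S.coact_apply, ← LinearMap.lTensor_comp_rTensor, LinearMap.comp_apply]
  rw [h, ← ht, ← LinearMap.comp_apply (S.proj.lTensor K), ← LinearMap.lTensor_comp]
  have : S.proj ∘ₗ S.val.toLinearMap = LinearMap.id := LinearMap.ext S.proj_val
  rw [this, LinearMap.lTensor_id, LinearMap.id_apply]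

theorem lTensor_val_injective : Function.Injective (S.val.toLinearMap.lTensor K) := by
  refine Function.LeftInverse.injective (g := S.proj.lTensor K) fun z => ?_
  have : S.proj ∘ₗ S.val.toLinearMap = LinearMap.id := LinearMap.ext S.proj_val
  rw [← LinearMap.comp_apply, ← LinearMap.lTensor_comp, this, LinearMap.lTensor_id,
    LinearMap.id_apply]

theorem ι_mul_val_eq (k : K) (r : S.R) : S.ι k * S.val r = LinearMap.mul' 𝕜 H
    (TensorProduct.map (S.val.toLinearMap ∘ₗ S.actCoact.act.toLinearMap.flip r)
      S.ι.toLinearMap (comul (R := 𝕜) k)) := S.ι_mul_val k r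

theorem act_one (k : K) : S.actCoact.act k 1 = counit (R := 𝕜) k • (1 : S.R) := by
  rw [S.act_apply, map_one, mul_one, S.proj_ι]

theorem diagAct_tmul (k : K) (r s : S.R) : diagAct S.actCoact S.actCoact k (r ⊗ₜ s) =
    TensorProduct.map (S.actCoact.act.toLinearMap.flip r) (S.actCoact.act.toLinearMap.flip s) (comul (R := 𝕜) k) := by
  rw [diagAct, LinearMap.comp_apply, LinearMap.comp_apply]
  generalize comul (R := 𝕜) k = z
  induction z with
  | zero => simp
  | add s t hs ht => rw [map_add, map_add, LinearMap.add_apply, hs, ht, map_add]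
  | tmul u v => simp

/-- Straighten k(rs) = (k₁ · r)k₂s by the smash rule, then project. -/
theorem act_mul (k : K) (z : S.R ⊗[𝕜] S.R) :
    S.actCoact.act k (LinearMap.mul' 𝕜 S.R z) = LinearMap.mul' 𝕜 S.R (diagAct S.actCoact S.actCoact k z) := by
  induction z with
  | zero => simp
  | add s t hs ht => simp only [map_add, hs, ht]
  | tmul r s =>
    rw [S.diagAct_tmul, LinearMap.mul'_apply, S.act_apply, map_mul S.val, ← mul_assoc,
      S.ι_mul_val_eq]
    generalize comul (R := 𝕜) k = z
    induction z with
    | zero => simp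
    | add s t hs ht => simp only [map_add, add_mul, hs, ht]
    | tmul u v => simp [mul_assoc, S.proj_val_mul, S.act_apply]

theorem coact_one : S.actCoact.coact 1 = 1 ⊗ₜ 1 := by
  rw [S.coact_apply, map_one, Bialgebra.comul_one, Algebra.TensorProduct.one_def,
    TensorProduct.map_tmul, AlgHom.toLinearMap_apply, map_one, S.proj_one]

/-- Inside K ⊗ H the coaction is the restriction of the algebra map (π ⊗ id)Δ. -/
theorem coact_mul (r s : S.R) : S.actCoact.coact (r * s) = S.actCoact.coact r * S.actCoact.coact s := by
  apply S.lTensor_val_injective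
  have h : ∀ z w : K ⊗[𝕜] S.R, S.val.toLinearMap.lTensor K (z * w) =
      S.val.toLinearMap.lTensor K z * S.val.toLinearMap.lTensor K w :=
    map_mul (Algebra.TensorProduct.map (AlgHom.id 𝕜 K) S.val)
  have h' : ∀ z w : H ⊗[𝕜] H, S.π.toLinearMap.rTensor H (z * w) =
      S.π.toLinearMap.rTensor H z * S.π.toLinearMap.rTensor H w :=
    map_mul (Algebra.TensorProduct.map S.π (AlgHom.id 𝕜 H))
  rw [h, S.lTensor_val_coact, S.lTensor_val_coact, S.lTensor_val_coact, map_mul,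
    Bialgebra.comul_mul, h']

/-- Project Δ(ι(k)r) = Δ(ι(k))Δ(r): as `proj` only sees classes, the two legs of Δ(k) act on the two
legs of Δ(r). -/
theorem comul_act (k : K) (r : S.R) :
    comul (R := 𝕜) (S.actCoact.act k r) = diagAct S.actCoact S.actCoact k (comul (R := 𝕜) r) := by
  rw [S.act_apply, S.comul_def, S.comul_def, S.comulR_proj, Bialgebra.comul_mul, S.comul_ι,
    S.comulR_apply]
  generalize comul (R := 𝕜) (S.val r) = z
  induction z with
  | zero => simp
  | add s t hs ht => simp only [mul_add, map_add, hs, ht]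
  | tmul u v =>
    rw [TensorProduct.map_tmul, S.diagAct_tmul]
    generalize comul (R := 𝕜) k = w
    induction w with
    | zero => simp
    | add s t hs ht => simp only [add_mul, map_add, hs, ht]
    | tmul k l => simp [S.act_apply, S.proj_mul_proj]

theorem counit_act (k : K) (r : S.R) :
    counit (R := 𝕜) (S.actCoact.act k r) = counit (R := 𝕜) k * counit (R := 𝕜) r := by
  rw [S.act_apply, S.counit_def, S.counit_def, S.counit_proj, Bialgebra.counit_mul, S.counit_ι]

theorem counit_coact (r : S.R) :
    counit.lTensor K (S.actCoact.coact r) = (1 : K) ⊗ₜ[𝕜] (counit (R := 𝕜) r) := by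
  have h : ∀ z : H ⊗[𝕜] H, (counit (R := 𝕜) (A := S.R)).lTensor K
      (TensorProduct.map S.π.toLinearMap S.proj z) =
      S.π.toLinearMap.rTensor 𝕜 (counit.lTensor H z) := by
    intro z
    induction z with
    | zero => simp
    | add s t hs ht => simp only [map_add, hs, ht]
    | tmul u v => simp [S.counit_def, S.counit_proj]
  rw [S.coact_apply, h, Coalgebra.lTensor_counit_comul, LinearMap.rTensor_tmul,
    AlgHom.toLinearMap_apply, S.π_val, Algebra.algebraMap_eq_smul_one, TensorProduct.smul_tmul,
    smul_eq_mul, mul_one]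
  rfl

/-- After embedding in K ⊗ K ⊗ H this is the coassociativity of H, with the coalgebra map π applied
to the first two legs. -/
theorem coassoc_coact : (TensorProduct.assoc 𝕜 K K S.R).toLinearMap ∘ₗ
    comul.rTensor S.R ∘ₗ S.actCoact.coact = S.actCoact.coact.lTensor K ∘ₗ S.actCoact.coact := by
  refine LinearMap.ext fun r => ?_
  have hinj : Function.Injective ((S.val.toLinearMap.lTensor K).lTensor K) :=
    Module.Flat.lTensor_preserves_injective_linearMap _ S.lTensor_val_injective
  apply hinj
  have h2 : ∀ z : K ⊗[𝕜] S.R, (S.val.toLinearMap.lTensor K).lTensor K (S.actCoact.coact.lTensor K z) =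
      (S.π.toLinearMap.rTensor H ∘ₗ comul).lTensor K (S.val.toLinearMap.lTensor K z) := by
    intro z
    induction z with
    | zero => simp
    | add s t hs ht => simp only [map_add, hs, ht]
    | tmul k r => simp [S.lTensor_val_coact]
  have h3 : ∀ z : H ⊗[𝕜] H, TensorProduct.assoc 𝕜 K K H
      (comul.rTensor H (S.π.toLinearMap.rTensor H z)) =
      TensorProduct.map S.π.toLinearMap (S.π.toLinearMap.rTensor H)
        (TensorProduct.assoc 𝕜 H H H (comul.rTensor H z)) := by
    intro z
    induction z with
    | zero => simp
    | add s t hs ht => simp only [map_add, hs, ht]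
    | tmul u v =>
      simp only [LinearMap.rTensor_tmul, AlgHom.toLinearMap_apply, S.comul_π]
      generalize comul (R := 𝕜) u = w
      induction w with
      | zero => simp
      | add s t hs ht => simp only [TensorProduct.add_tmul, map_add, hs, ht]
      | tmul u v => simp
  have h4 : ∀ z : H ⊗[𝕜] H, (S.π.toLinearMap.rTensor H ∘ₗ comul).lTensor K
      (S.π.toLinearMap.rTensor H z) =
      TensorProduct.map S.π.toLinearMap (S.π.toLinearMap.rTensor H) (comul.lTensor H z) := by
    intro z
    induction z with
    | zero => simp
    | add s t hs ht => simp only [map_add, hs, ht]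
    | tmul u v => simp
  rw [LinearMap.comp_apply, LinearMap.comp_apply, LinearMap.comp_apply, LinearEquiv.coe_coe,
    lTensor_lTensor_assoc_rTensor, h2, S.lTensor_val_coact, h3, h4, Coalgebra.coassoc_apply]

theorem counit_coact_left : (TensorProduct.lid 𝕜 S.R).toLinearMap ∘ₗ counit.rTensor S.R ∘ₗ S.actCoact.coact =
    LinearMap.id := by
  refine LinearMap.ext fun r => ?_
  have h : ∀ z : H ⊗[𝕜] H, (counit (R := 𝕜) (A := K)).rTensor S.R
      (TensorProduct.map S.π.toLinearMap S.proj z) =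
      S.proj.lTensor 𝕜 (counit.rTensor H z) := by
    intro z
    induction z with
    | zero => simp
    | add s t hs ht => simp only [map_add, hs, ht]
    | tmul u v => simp [S.counit_π]
  rw [LinearMap.comp_apply, LinearMap.comp_apply, S.coact_apply, h,
    Coalgebra.rTensor_counit_comul]
  simp [S.proj_val]

end Splitting

end Splitting


/-! ### Twisted products, the adjoint coaction formula and convolution inverses -/

section Tensor

variable {𝕜 K V R B : Type u} [Field 𝕜] [Ring K] [HopfAlgebra 𝕜 K] [Ring R] [Algebra 𝕜 R]
  [Ring B] [Algebra 𝕜 B] [AddCommGroup V] [Module 𝕜 V]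

theorem twistedMul_tmul (D : ActCoact 𝕜 K R) (f : B →ₗ[𝕜] K ⊗[𝕜] B) (r s : R) (b c : B) :
    twistedMul D f (r ⊗ₜ b) (s ⊗ₜ c) =
      TensorProduct.map (LinearMap.mulLeft 𝕜 r ∘ₗ D.act.toLinearMap.flip s)
        (LinearMap.mulRight 𝕜 c) (f b) := by
  rw [twistedMul, LinearMap.comp_apply, TensorProduct.map_tmul, LinearMap.comp_apply,
    LinearMap.comp_apply, LinearMap.comp_apply, LinearMap.mul'_apply, Module.End.mul_apply]
  generalize f b = z
  induction z with
  | zero => simp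
  | add s t hs ht => rw [map_add, map_add, LinearMap.add_apply, map_add, hs, ht, map_add]
  | tmul u v => simp

/-- The map `k ⊗ l ↦ (p ⊗ v ↦ k p ⊗ l · v)`. -/
noncomputable def ActCoact.leftMul (D : ActCoact 𝕜 K V) : K ⊗[𝕜] K →ₗ[𝕜] Module.End 𝕜 (K ⊗[𝕜] V) :=
  TensorProduct.homTensorHomMap (RingHom.id 𝕜) K V K V ∘ₗ
    TensorProduct.map (LinearMap.mul 𝕜 K) D.act.toLinearMap

@[simp]
theorem ActCoact.leftMul_tmul (D : ActCoact 𝕜 K V) (k l : K) (p : K) (v : V) :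
    D.leftMul (k ⊗ₜ l) (p ⊗ₜ v) = (k * p) ⊗ₜ D.act l v := by
  simp [ActCoact.leftMul]

/-- The map `w ⊗ m ↦ w · S(m)`. -/
noncomputable def mulAntipode : (K ⊗[𝕜] V) ⊗[𝕜] K →ₗ[𝕜] K ⊗[𝕜] V :=
  TensorProduct.lift (LinearMap.flip
    (LinearMap.rTensorHom V ∘ₗ (LinearMap.mul 𝕜 K).flip ∘ₗ antipode 𝕜))

@[simp]
theorem mulAntipode_tmul (k m : K) (v : V) :
    mulAntipode (𝕜 := 𝕜) ((k ⊗ₜ[𝕜] v) ⊗ₜ[𝕜] m) = (k * antipode 𝕜 m) ⊗ₜ[𝕜] v := by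
  simp [mulAntipode]

/-- The Yetter–Drinfeld condition involves three legs of an iterated coproduct. Bracketed to the
left, the first two act by `leftMul` and the third only multiplies by its antipode; in this form the
antipode can be cancelled in `Splitting.compat`. -/
theorem ActCoact.adj_assoc (D : ActCoact 𝕜 K V) (z : (K ⊗[𝕜] K) ⊗[𝕜] K) (w : K ⊗[𝕜] V) :
    D.adj (TensorProduct.assoc 𝕜 K K K z) w =
      mulAntipode ((D.leftMul.flip w).rTensor K z) := by
  induction w with
  | zero => simp
  | add s t hs ht =>
    rw [map_add, map_add, LinearMap.rTensor_add, LinearMap.add_apply, map_add, hs, ht]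
  | tmul p v =>
    induction z with
    | zero => simp
    | add s t hs ht => simp only [map_add, LinearMap.add_apply, hs, ht]
    | tmul z m =>
      induction z with
      | zero => simp
      | add s t hs ht =>
        simp only [map_add, TensorProduct.add_tmul, LinearMap.add_apply, hs, ht]
      | tmul k l => simp [ActCoact.adj, ActCoact.adjAux, mul_assoc]

/-- A right inverse of the identity for the convolution product is a left inverse. -/
theorem convolution_left_of_right [Coalgebra 𝕜 R] [FiniteDimensional 𝕜 R] (T : R →ₗ[𝕜] R)
    (h : LinearMap.mul' 𝕜 R ∘ₗ T.lTensor R ∘ₗ comul = Algebra.linearMap 𝕜 R ∘ₗ counit) :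
    LinearMap.mul' 𝕜 R ∘ₗ T.rTensor R ∘ₗ comul = Algebra.linearMap 𝕜 R ∘ₗ counit := by
  let i : WithConv (R →ₗ[𝕜] R) := WithConv.toConv LinearMap.id
  let t : WithConv (R →ₗ[𝕜] R) := WithConv.toConv T
  have h1 : i * t = 1 := congrArg WithConv.toConv h
  haveI : FiniteDimensional 𝕜 (WithConv (R →ₗ[𝕜] R)) :=
    (WithConv.linearEquiv 𝕜 (R →ₗ[𝕜] R)).symm.finiteDimensional
  -- One-sided inverses in a finite-dimensional algebra are two-sided: left multiplication by T is
  -- injective, hence surjective, so T has a right inverse for convolution, which must be the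
  -- identity map.
  have hinj : Function.Injective (LinearMap.mulLeft 𝕜 t) := by
    refine Function.LeftInverse.injective (g := LinearMap.mulLeft 𝕜 i) fun z => ?_
    rw [LinearMap.mulLeft_apply, LinearMap.mulLeft_apply, ← mul_assoc, h1, one_mul]
  obtain ⟨z, hz⟩ := LinearMap.injective_iff_surjective.1 hinj 1
  rw [LinearMap.mulLeft_apply] at hz
  have hzi : z = i := by
    rw [← one_mul z, ← h1, mul_assoc, hz, mul_one]
  rw [hzi] at hz
  exact congrArg WithConv.ofConv hz

end Tensor

/-! ### Radford's decomposition: braided Hopf algebra and bosonization -/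

namespace Splitting

variable {𝕜 K H : Type u} [Field 𝕜] [Ring K] [HopfAlgebra 𝕜 K] [Ring H] [HopfAlgebra 𝕜 H]
  (S : Splitting 𝕜 K H)

/-- The map `k ⊗ s ↦ ι(k) ⊗ s`. -/
noncomputable def incl : K ⊗[𝕜] S.R →ₐ[𝕜] H ⊗[𝕜] H := Algebra.TensorProduct.map S.ι S.val

@[simp]
theorem incl_tmul (k : K) (s : S.R) : S.incl (k ⊗ₜ s) = S.ι k ⊗ₜ (S.val s) := rfl

/-- The map `r ⊗ s ↦ r s₍₋₁₎ ⊗ s₍₀₎`, which sends the braided coproduct of `R` to the coproduct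
of `H`. -/
noncomputable def lift : S.R ⊗[𝕜] S.R →ₗ[𝕜] H ⊗[𝕜] H :=
  LinearMap.mul' 𝕜 (H ⊗[𝕜] H) ∘ₗ
    TensorProduct.map ((TensorProduct.mk 𝕜 H H).flip 1 ∘ₗ S.val.toLinearMap)
      (S.incl.toLinearMap ∘ₗ S.actCoact.coact)

theorem lift_tmul (r s : S.R) :
    S.lift (r ⊗ₜ s) = ((S.val r) ⊗ₜ[𝕜] (1 : H)) * S.incl (S.actCoact.coact s) := by
  simp [lift]

/-- Projection replaces s₍₋₁₎ by its counit, so `lift` is a section of proj ⊗ proj. -/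
theorem map_proj_lift (z : S.R ⊗[𝕜] S.R) : TensorProduct.map S.proj S.proj (S.lift z) = z := by
  induction z with
  | zero => simp
  | add s t hs ht => rw [map_add, map_add, hs, ht]
  | tmul r s =>
    have h := LinearMap.congr_fun S.counit_coact_left s
    rw [LinearMap.comp_apply, LinearMap.comp_apply, LinearMap.id_apply] at h
    rw [S.lift_tmul]
    conv_rhs => rw [← h]
    generalize S.actCoact.coact s = w
    induction w with
    | zero => simp
    | add s t hs ht => simp only [map_add, mul_add, hs, ht, TensorProduct.tmul_add]
    | tmul k t => simp [S.proj_mul_ι, S.proj_val, TensorProduct.smul_tmul]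

/-- Moving t to the left of s₍₋₁₎ by the smash rule produces the braiding s ⊗ t ↦ s₍₋₁₎ · t ⊗ s₍₀₎;
coassociativity of the coaction accounts for the extra leg. -/
theorem incl_coact_mul (s t : S.R) : S.incl (S.actCoact.coact s) * ((S.val t) ⊗ₜ[𝕜] (1 : H)) =
    LinearMap.mul' 𝕜 (H ⊗[𝕜] H) (TensorProduct.map ((TensorProduct.mk 𝕜 H H).flip 1 ∘ₗ
      S.val.toLinearMap ∘ₗ S.actCoact.act.toLinearMap.flip t)
      (S.incl.toLinearMap ∘ₗ S.actCoact.coact) (S.actCoact.coact s)) := by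
  have h := LinearMap.congr_fun S.coassoc_coact s
  rw [LinearMap.comp_apply, LinearMap.comp_apply, LinearMap.comp_apply, LinearEquiv.coe_coe] at h
  set f := (TensorProduct.mk 𝕜 H H).flip 1 ∘ₗ S.val.toLinearMap ∘ₗ
    S.actCoact.act.toLinearMap.flip t with hf
  have h1 : TensorProduct.map f (S.incl.toLinearMap ∘ₗ S.actCoact.coact) (S.actCoact.coact s) =
      TensorProduct.map f S.incl.toLinearMap
        (S.actCoact.coact.lTensor K (S.actCoact.coact s)) := by
    rw [← LinearMap.map_comp_lTensor, LinearMap.comp_apply]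
  rw [h1, ← h]
  generalize S.actCoact.coact s = z
  induction z with
  | zero => simp
  | add s t hs ht => simp only [map_add, add_mul, hs, ht]
  | tmul k r =>
    rw [S.incl_tmul, Algebra.TensorProduct.tmul_mul_tmul, mul_one, S.ι_mul_val_eq,
      LinearMap.rTensor_tmul]
    generalize comul (R := 𝕜) k = w
    induction w with
    | zero => simp
    | add s t hs ht => simp only [map_add, TensorProduct.add_tmul, hs, ht]
    | tmul k l => simp [hf]

/-- In H ⊗ H, the coaction of s has to cross r', and by `incl_coact_mul` this crossing is the
braiding. So `lift` is multiplicative on the braided tensor square. -/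
theorem lift_twistedMul (z w : S.R ⊗[𝕜] S.R) :
    S.lift (twistedMul S.actCoact S.actCoact.coact z w) = S.lift z * S.lift w := by
  induction z with
  | zero => simp
  | add s t hs ht => simp only [map_add, LinearMap.add_apply, hs, ht, add_mul]
  | tmul r s =>
    induction w with
    | zero => simp
    | add s t hs ht => simp only [map_add, hs, ht, mul_add]
    | tmul r' s' =>
      rw [twistedMul_tmul, S.lift_tmul, S.lift_tmul, mul_assoc,
        ← mul_assoc (S.incl (S.actCoact.coact s)), S.incl_coact_mul]
      generalize S.actCoact.coact s = z
      induction z with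
      | zero => simp
      | add s t hs ht => simp only [map_add, mul_add, add_mul, hs, ht]
      | tmul k t =>
        rw [TensorProduct.map_tmul, S.lift_tmul, LinearMap.mulRight_apply, S.coact_mul, map_mul]
        simp [← mul_assoc]

/-- An element of the range of `lift` is recovered from its projection. Since that range is closed
under products by `lift_twistedMul`, the hypothesis `hΔ` need only be verified on algebra generators
of R. -/
theorem lift_comul (hΔ : ∀ r : S.R, comul (R := 𝕜) (S.val r) ∈ LinearMap.range S.lift) (r : S.R) :
    S.lift (comul (R := 𝕜) r) = comul (R := 𝕜) (S.val r) := by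
  obtain ⟨z, hz⟩ := hΔ r
  rw [S.comul_def, S.comulR_apply, ← hz, S.map_proj_lift]

/-- Multiplicativity of Δ on H, transported along `lift`. -/
theorem comul_mul (hΔ : ∀ r : S.R, comul (R := 𝕜) (S.val r) ∈ LinearMap.range S.lift) (r s : S.R) :
    comul (R := 𝕜) (r * s) =
      twistedMul S.actCoact S.actCoact.coact (comul (R := 𝕜) r) (comul (R := 𝕜) s) := by
  rw [S.comul_def, S.comulR_apply, map_mul, Bialgebra.comul_mul, ← S.lift_comul hΔ,
    ← S.lift_comul hΔ, ← S.lift_twistedMul, S.map_proj_lift]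

/-- The first leg of Δ(ι(k)) survives under π, while `proj` reduces the second to its counit;
together they leave k. -/
theorem map_π_proj_mul (v : H ⊗[𝕜] H) (k : K) :
    TensorProduct.map S.π.toLinearMap S.proj (v * comul (R := 𝕜) (S.ι k)) =
      TensorProduct.map S.π.toLinearMap S.proj v * (k ⊗ₜ[𝕜] (1 : S.R)) := by
  have hk : sliceR (counit (R := 𝕜)) (comul (R := 𝕜) k) = k := by simp [sliceR]
  conv_rhs => rw [← hk]
  rw [S.comul_ι]
  generalize comul (R := 𝕜) k = w
  induction w with
  | zero => simp
  | add s t hs ht => simp only [map_add, mul_add, TensorProduct.add_tmul, hs, ht]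
  | tmul k l =>
    induction v with
    | zero => simp
    | add s t hs ht => simp only [map_add, add_mul, hs, ht]
    | tmul u u' =>
      simp only [TensorProduct.map_tmul, Algebra.TensorProduct.tmul_mul_tmul,
        AlgHom.toLinearMap_apply, map_mul, S.π_ι, S.proj_mul_ι, sliceR_tmul, mul_one,
        mul_smul_comm, TensorProduct.smul_tmul]

theorem map_π_proj_comul_mul (r : S.R) (k : K) :
    TensorProduct.map S.π.toLinearMap S.proj (comul (R := 𝕜) ((S.val r) * S.ι k)) =
      S.actCoact.coact r * (k ⊗ₜ[𝕜] (1 : S.R)) := by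
  rw [Bialgebra.comul_mul, S.map_π_proj_mul, S.coact_apply]

theorem leftMul_comul_coact (k : K) (r : S.R) :
    S.actCoact.leftMul (comul (R := 𝕜) k) (S.actCoact.coact r) =
      TensorProduct.map S.π.toLinearMap S.proj (comul (R := 𝕜) (S.ι k * (S.val r))) := by
  rw [Bialgebra.comul_mul, S.comul_ι, S.coact_apply]
  generalize comul (R := 𝕜) k = w
  generalize comul (R := 𝕜) (S.val r) = v
  induction w with
  | zero => simp
  | add s t hs ht => simp only [map_add, add_mul, LinearMap.add_apply, hs, ht]
  | tmul k l =>
    induction v with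
    | zero => simp
    | add s t hs ht => simp only [map_add, mul_add, hs, ht]
    | tmul u u' => simp [S.π_ι, S.act_apply, S.proj_mul_proj]

/-- The map `k ⊗ l ↦ δ(k · r) (l ⊗ 1)`. -/
noncomputable def coactAct (r : S.R) : K ⊗[𝕜] K →ₗ[𝕜] K ⊗[𝕜] S.R :=
  LinearMap.mul' 𝕜 (K ⊗[𝕜] S.R) ∘ₗ TensorProduct.map
    (S.actCoact.coact ∘ₗ S.actCoact.act.toLinearMap.flip r) ((TensorProduct.mk 𝕜 K S.R).flip 1)

theorem coactAct_tmul (r : S.R) (k l : K) :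
    S.coactAct r (k ⊗ₜ l) = S.actCoact.coact (S.actCoact.act k r) * (l ⊗ₜ[𝕜] (1 : S.R)) := by
  simp [coactAct]

/-- Both sides compute (π ⊗ proj)Δ(ι(k)r): once from Δ(ι(k))Δ(r), once after straightening ι(k)r =
(k₁ · r)ι(k₂). This is the Yetter–Drinfeld condition without antipode, k₁r₍₋₁₎ ⊗ k₂ · r₍₀₎ = (k₁ ·
r)₍₋₁₎k₂ ⊗ (k₁ · r)₍₀₎. -/
theorem leftMul_comul_coact_eq (k : K) (r : S.R) :
    S.actCoact.leftMul (comul (R := 𝕜) k) (S.actCoact.coact r) =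
      S.coactAct r (comul (R := 𝕜) k) := by
  rw [S.leftMul_comul_coact, S.ι_mul_val_eq]
  generalize comul (R := 𝕜) k = w
  induction w with
  | zero => simp
  | add s t hs ht => simp only [map_add, hs, ht]
  | tmul k l =>
    rw [S.coactAct_tmul, ← S.map_π_proj_comul_mul]
    simp

theorem mulAntipode_mul (w : K ⊗[𝕜] S.R) (l m : K) :
    mulAntipode (𝕜 := 𝕜) ((w * (l ⊗ₜ[𝕜] (1 : S.R))) ⊗ₜ[𝕜] m) =
      w * ((l * antipode 𝕜 m) ⊗ₜ[𝕜] (1 : S.R)) := by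
  induction w with
  | zero => simp
  | add s t hs ht => simp only [add_mul, TensorProduct.add_tmul, map_add, hs, ht]
  | tmul p v => simp [mul_assoc]

/-- Apply the antipode-free condition to the first leg of Δ(k) and multiply by the antipode of the
last one; then k₂S(k₃) collapses to a counit. -/
theorem compat (k : K) (r : S.R) : S.actCoact.coact (S.actCoact.act k r) =
    S.actCoact.adj (comul.lTensor K (comul k)) (S.actCoact.coact r) := by
  rw [← Coalgebra.coassoc_apply, ActCoact.adj_assoc]
  have h1 : ∀ z : K ⊗[𝕜] K, (S.actCoact.leftMul.flip (S.actCoact.coact r)).rTensor K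
      (comul.rTensor K z) = (S.coactAct r).rTensor K (comul.rTensor K z) := by
    intro z
    induction z with
    | zero => simp
    | add s t hs ht => simp only [map_add, hs, ht]
    | tmul k l =>
      simp only [LinearMap.rTensor_tmul, LinearMap.flip_apply, S.leftMul_comul_coact_eq]
  have h2 : (S.coactAct r).rTensor K (comul.rTensor K (comul (R := 𝕜) k)) =
      (S.coactAct r).rTensor K ((TensorProduct.assoc 𝕜 K K K).symm
        (comul.lTensor K (comul (R := 𝕜) k))) := by
    rw [← Coalgebra.coassoc_apply, LinearEquiv.symm_apply_apply]
  have h3 : ∀ z : K ⊗[𝕜] K, mulAntipode ((S.coactAct r).rTensor K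
      ((TensorProduct.assoc 𝕜 K K K).symm (comul.lTensor K z))) =
      S.actCoact.coact (S.actCoact.act (sliceR (counit (R := 𝕜)) z) r) := by
    intro z
    induction z with
    | zero => simp
    | add s t hs ht => simp only [map_add, LinearMap.add_apply, hs, ht]
    | tmul k l =>
      have h4 : ∀ w : K ⊗[𝕜] K, mulAntipode ((S.coactAct r).rTensor K
          ((TensorProduct.assoc 𝕜 K K K).symm (k ⊗ₜ[𝕜] w))) =
          S.actCoact.coact (S.actCoact.act k r) *
            (LinearMap.mul' 𝕜 K ((antipode 𝕜).lTensor K w) ⊗ₜ[𝕜] (1 : S.R)) := by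
        intro w
        induction w with
        | zero => simp
        | add s t hs ht =>
          simp only [TensorProduct.tmul_add, map_add, hs, ht, TensorProduct.add_tmul, mul_add]
        | tmul l m =>
          rw [TensorProduct.assoc_symm_tmul, LinearMap.rTensor_tmul, S.coactAct_tmul,
            S.mulAntipode_mul, LinearMap.lTensor_tmul, LinearMap.mul'_apply]
      rw [LinearMap.lTensor_tmul, h4, mul_antipode_lTensor_comul_apply,
        Algebra.algebraMap_eq_smul_one, ← TensorProduct.smul_tmul', mul_smul_comm,
        ← Algebra.TensorProduct.one_def, mul_one, sliceR_tmul, map_smul, LinearMap.smul_apply,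
        map_smul]
  rw [h1, h2, h3]
  congr 2
  simp [sliceR]

theorem isYetterDrinfeld : IsYetterDrinfeld S.actCoact where
  coassoc := S.coassoc_coact
  counit_coact := S.counit_coact_left
  compat := S.compat

/-- Both sides are the image under π ⊗ proj ⊗ proj of the iterated coproduct of r in H, bracketed in
the two possible ways. -/
theorem comul_coact (hΔ : ∀ r : S.R, comul (R := 𝕜) (S.val r) ∈ LinearMap.range S.lift) (r : S.R) :
    comul.lTensor K (S.actCoact.coact r) =
      diagCoact S.actCoact S.actCoact (comul (R := 𝕜) r) := by
  have h1 : ∀ z : H ⊗[𝕜] H, (comul (R := 𝕜) (A := S.R)).lTensor K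
      (TensorProduct.map S.π.toLinearMap S.proj z) =
      TensorProduct.map S.π.toLinearMap (TensorProduct.map S.proj S.proj) (comul.lTensor H z) := by
    intro z
    induction z with
    | zero => simp
    | add s t hs ht => simp only [map_add, hs, ht]
    | tmul u v => simp [S.comul_def, S.comulR_proj]
  rw [S.coact_apply, h1, ← Coalgebra.coassoc_apply, TensorProduct.map_map_assoc,
    ← S.lift_comul hΔ]
  generalize comul (R := 𝕜) r = z
  induction z with
  | zero => simp
  | add s t hs ht => simp only [map_add, hs, ht]
  | tmul r s =>
    rw [S.lift_tmul, diagCoact, LinearMap.comp_apply, LinearMap.comp_apply, TensorProduct.map_tmul]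
    generalize S.actCoact.coact s = w
    induction w with
    | zero => simp
    | add s t hs ht => simp only [TensorProduct.tmul_add, map_add, mul_add, hs, ht]
    | tmul k t =>
      rw [S.incl_tmul, Algebra.TensorProduct.tmul_mul_tmul, one_mul, LinearMap.rTensor_tmul,
        TensorProduct.map_tmul, S.map_π_proj_comul_mul, S.proj_val]
      generalize S.actCoact.coact r = v
      induction v with
      | zero => simp
      | add s t hs ht => simp only [TensorProduct.add_tmul, map_add, add_mul, hs, ht]
      | tmul l q => simp

/-- The antipode of `R`. -/
noncomputable def antipodeR : S.R →ₗ[𝕜] S.R :=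
  S.proj ∘ₗ LinearMap.mul' 𝕜 H ∘ₗ (antipode 𝕜).lTensor H ∘ₗ S.incl.toLinearMap ∘ₗ
    S.actCoact.coact

/-- By `lift_comul`, r¹S_R(r²) becomes proj(r₁S(r₂)), and the antipode axiom of H applies. In
`isBraidedHopf` the other antipode identity then follows from finite dimension, by
`convolution_left_of_right`. -/
theorem mul_antipodeR (hΔ : ∀ r : S.R, comul (R := 𝕜) (S.val r) ∈ LinearMap.range S.lift) :
    LinearMap.mul' 𝕜 S.R ∘ₗ S.antipodeR.lTensor S.R ∘ₗ comul = Algebra.linearMap 𝕜 S.R ∘ₗ counit := by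
  have h1 : ∀ z : S.R ⊗[𝕜] S.R, LinearMap.mul' 𝕜 S.R (S.antipodeR.lTensor S.R z) =
      S.proj (LinearMap.mul' 𝕜 H ((antipode 𝕜).lTensor H (S.lift z))) := by
    intro z
    induction z with
    | zero => simp
    | add s t hs ht => simp only [map_add, hs, ht]
    | tmul r s =>
      rw [LinearMap.lTensor_tmul, LinearMap.mul'_apply, S.lift_tmul, antipodeR,
        LinearMap.comp_apply, LinearMap.comp_apply, LinearMap.comp_apply, LinearMap.comp_apply,
        AlgHom.toLinearMap_apply, ← S.proj_val_mul]
      congr 1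
      generalize S.incl (S.actCoact.coact s) = w
      induction w with
      | zero => simp
      | add s t hs ht => simp only [map_add, mul_add, hs, ht]
      | tmul u v => simp [mul_assoc]
  refine LinearMap.ext fun r => ?_
  rw [LinearMap.comp_apply, LinearMap.comp_apply, LinearMap.comp_apply, h1, S.lift_comul hΔ,
    mul_antipode_lTensor_comul_apply, S.counit_def, Algebra.linearMap_apply,
    Algebra.algebraMap_eq_smul_one, Algebra.algebraMap_eq_smul_one, map_smul, S.proj_one]

theorem isBraidedHopf [FiniteDimensional 𝕜 S.R]
    (hΔ : ∀ r : S.R, comul (R := 𝕜) (S.val r) ∈ LinearMap.range S.lift) :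
    IsBraidedHopf S.actCoact where
  yetterDrinfeld := S.isYetterDrinfeld
  act_one := S.act_one
  act_mul := S.act_mul
  coact_one := S.coact_one
  coact_mul := fun z => by
    induction z with
    | zero => simp
    | add s t hs ht => simp only [map_add, hs, ht]
    | tmul r s => rw [lTensor_mul_diagCoact, LinearMap.mul'_apply, S.coact_mul]
  counit_act := S.counit_act
  comul_act := S.comul_act
  counit_coact := S.counit_coact
  comul_coact := S.comul_coact hΔ
  counit_one := by rw [S.counit_def, map_one, Bialgebra.counit_one]
  counit_mul := fun r s => by
    rw [S.counit_def, S.counit_def, S.counit_def, map_mul, Bialgebra.counit_mul]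
  comul_one := by
    rw [S.comul_def, S.comulR_apply, map_one, Bialgebra.comul_one,
      Algebra.TensorProduct.one_def, TensorProduct.map_tmul, S.proj_one]
  comul_mul := S.comul_mul hΔ
  exists_antipode := ⟨S.antipodeR, convolution_left_of_right _ (S.mul_antipodeR hΔ),
    S.mul_antipodeR hΔ⟩

/-- The isomorphism `R ⊗ K → H`, `r ⊗ k ↦ r ι(k)`. -/
noncomputable def smash : S.R ⊗[𝕜] K →ₗ[𝕜] H :=
  LinearMap.mul' 𝕜 H ∘ₗ TensorProduct.map S.val.toLinearMap S.ι.toLinearMap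

@[simp]
theorem smash_tmul (r : S.R) (k : K) : S.smash (r ⊗ₜ k) = S.val r * S.ι k := rfl

/-- In rι(k)sι(l) the inner factor ι(k)s is straightened by the smash rule. -/
theorem smash_bosonMul (z w : S.R ⊗[𝕜] K) :
    S.smash (bosonMul S.actCoact z w) = S.smash z * S.smash w := by
  induction z with
  | zero => simp
  | add s t hs ht => simp only [map_add, LinearMap.add_apply, hs, ht, add_mul]
  | tmul r k =>
    induction w with
    | zero => simp
    | add s t hs ht => simp only [map_add, hs, ht, mul_add]
    | tmul s l =>
      rw [bosonMul, twistedMul_tmul, S.smash_tmul, S.smash_tmul, mul_assoc,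
        ← mul_assoc (S.ι k), S.ι_mul_val_eq]
      generalize comul (R := 𝕜) k = z
      induction z with
      | zero => simp
      | add s t hs ht => simp only [map_add, mul_add, add_mul, hs, ht]
      | tmul k t => simp [mul_assoc]

theorem smash_one : S.smash (1 ⊗ₜ 1) = 1 := by simp

theorem counit_smash (z : S.R ⊗[𝕜] K) : counit (R := 𝕜) (S.smash z) = bosonCounit z := by
  induction z with
  | zero => simp
  | add s t hs ht => simp only [map_add, hs, ht]
  | tmul r k => simp [bosonCounit, S.counit_ι, S.counit_def]

/-- Write Δ(r) = r¹(r²)₍₋₁₎ ⊗ (r²)₍₀₎ by `lift_comul` and multiply by k₁ ⊗ k₂. -/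
theorem comul_smash (hΔ : ∀ r : S.R, comul (R := 𝕜) (S.val r) ∈ LinearMap.range S.lift)
    (z : S.R ⊗[𝕜] K) : comul (R := 𝕜) (S.smash z) =
      TensorProduct.map S.smash S.smash (bosonComul S.actCoact z) := by
  induction z with
  | zero => simp
  | add s t hs ht => simp only [map_add, hs, ht]
  | tmul r k =>
    rw [S.smash_tmul, Bialgebra.comul_mul, ← S.lift_comul hΔ, S.comul_ι, bosonComul,
      LinearMap.comp_apply, LinearMap.comp_apply, TensorProduct.map_tmul, LinearMap.comp_apply,
      LinearMap.comp_apply]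
    generalize comul (R := 𝕜) r = v
    induction v with
    | zero => simp
    | add s t hs ht => simp only [map_add, TensorProduct.add_tmul, add_mul, hs, ht]
    | tmul r s =>
      rw [S.lift_tmul, LinearMap.lTensor_tmul]
      generalize S.actCoact.coact s = w
      induction w with
      | zero => simp
      | add s t hs ht =>
        simp only [map_add, TensorProduct.tmul_add, TensorProduct.add_tmul, add_mul, mul_add, hs, ht]
      | tmul l t =>
        generalize comul (R := 𝕜) k = w
        induction w with
        | zero => simp
        | add s t hs ht => simp only [map_add, TensorProduct.tmul_add, mul_add, hs, ht]
        | tmul p q => simp [mul_assoc]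

end Splitting


/-! ### The splitting of 𝔄_{3,j}(0) over 𝒦 -/

section Coinvariants

variable {𝕜 : Type u} [Field 𝕜] [CharZero 𝕜] (j : Idx) (ξ : 𝕜)
  [hξ : Fact (IsPrimitiveRoot ξ 4)]

local notation "ax" => A.gen j ξ 0 AGen.x
local notation "ay" => A.gen j ξ 0 AGen.y

/-- The subalgebra generated by `x` and `y`. -/
noncomputable def A.coinv : Subalgebra 𝕜 (A j ξ 0) := Algebra.adjoin 𝕜 {ax, ay}

theorem A.x_mem_coinv : ax ∈ A.coinv j ξ := Algebra.subset_adjoin (Set.mem_insert _ _)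

theorem A.y_mem_coinv : ay ∈ A.coinv j ξ :=
  Algebra.subset_adjoin (Set.mem_insert_of_mem _ rfl)

theorem A.mon_mem_coinv (p : Fin 4 × Fin 2) : A.mon j ξ 0 p ∈ A.coinv j ξ :=
  mul_mem (pow_mem (A.x_mem_coinv j ξ) _) (pow_mem (A.y_mem_coinv j ξ) _)

theorem A.x_mul_mon_mem (p : Fin 4 × Fin 2) :
    ax * A.mon j ξ 0 p ∈ Submodule.span 𝕜 (Set.range (A.mon j ξ 0)) := by
  have hm : ∀ q, A.mon j ξ 0 q ∈ Submodule.span 𝕜 (Set.range (A.mon j ξ 0)) :=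
    fun q => Submodule.subset_span ⟨q, rfl⟩
  obtain ⟨i, m⟩ := p
  rw [A.mon, ← mul_assoc, ← pow_succ']
  rcases eq_or_ne i 3 with rfl | hi
  · have : ax ^ 4 = 0 := by simpa [pow_succ, mul_assoc] using A.rel_x_four j ξ 0
    simp [this]
  · have hi' : (i : ℕ) + 1 < 4 := by omega
    exact hm (⟨i + 1, hi'⟩, m)

/-- At μ = 0 the rules are yx = -xy and y² = ½x², with no coefficients from 𝒦. So the monomials xⁱyᵐ
alone span a subalgebra. -/
theorem A.y_mul_mon_mem (p : Fin 4 × Fin 2) :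
    ay * A.mon j ξ 0 p ∈ Submodule.span 𝕜 (Set.range (A.mon j ξ 0)) := by
  have hm : ∀ q, A.mon j ξ 0 q ∈ Submodule.span 𝕜 (Set.range (A.mon j ξ 0)) :=
    fun q => Submodule.subset_span ⟨q, rfl⟩
  have hx : ∀ u ∈ Submodule.span 𝕜 (Set.range (A.mon j ξ 0)),
      ax * u ∈ Submodule.span 𝕜 (Set.range (A.mon j ξ 0)) := by
    intro u hu
    induction hu using Submodule.span_induction with
    | zero => simp
    | add u v _ _ hu hv => rw [mul_add]; exact add_mem hu hv
    | smul c u _ hu => rw [mul_smul_comm]; exact Submodule.smul_mem _ c hu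
    | mem u hu => obtain ⟨q, rfl⟩ := hu; exact A.x_mul_mon_mem j ξ q
  have hyx : ay * ax = -(ax * ay) := by simpa using A.rel_yx j ξ 0
  have hyy : ay * ay = (1 / 2 : 𝕜) • (ax * ax) := by
    have h := A.rel_xx j ξ 0
    simp only [zero_smul, add_zero, sub_zero] at h
    rw [h, smul_smul, one_div, inv_mul_cancel₀ two_ne_zero, one_smul]
  obtain ⟨i, m⟩ := p
  rw [A.mon]
  have key : ∀ n : ℕ, ay * (ax ^ n * ay ^ (m : ℕ)) ∈ Submodule.span 𝕜 (Set.range (A.mon j ξ 0)) := by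
    intro n
    induction n with
    | zero =>
      rw [pow_zero, one_mul]
      fin_cases m
      · simpa [A.mon] using hm (0, 1)
      · have h2 := Submodule.smul_mem _ (1 / 2 : 𝕜) (hm (2, 0))
        simpa [A.mon, hyy, pow_two] using h2
    | succ n ih =>
      rw [pow_succ', mul_assoc, ← mul_assoc, hyx, neg_mul, mul_assoc]
      exact neg_mem (hx _ ih)
  exact key i

theorem A.coinv_eq_span : Subalgebra.toSubmodule (A.coinv j ξ) =
    Submodule.span 𝕜 (Set.range (A.mon j ξ 0)) := by
  apply le_antisymm
  · have key : ∀ u ∈ A.coinv j ξ, ∀ v ∈ Submodule.span 𝕜 (Set.range (A.mon j ξ 0)),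
        u * v ∈ Submodule.span 𝕜 (Set.range (A.mon j ξ 0)) := by
      intro u hu
      induction hu using Algebra.adjoin_induction with
      | mem u hu =>
        intro v hv
        induction hv using Submodule.span_induction with
        | zero => simp
        | add v w _ _ hv hw => rw [mul_add]; exact add_mem hv hw
        | smul c v _ hv => rw [mul_smul_comm]; exact Submodule.smul_mem _ c hv
        | mem v hv =>
          obtain ⟨q, rfl⟩ := hv
          rcases hu with rfl | rfl
          · exact A.x_mul_mon_mem j ξ q
          · exact A.y_mul_mon_mem j ξ q
      | algebraMap c =>
        intro v hv
        rw [← Algebra.smul_def]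
        exact Submodule.smul_mem _ c hv
      | add u u' _ _ hu hu' =>
        intro v hv
        rw [add_mul]
        exact add_mem (hu v hv) (hu' v hv)
      | mul u u' _ _ hu hu' =>
        intro v hv
        rw [mul_assoc]
        exact hu _ (hu' v hv)
    intro u hu
    have h1 : (1 : A j ξ 0) ∈ Submodule.span 𝕜 (Set.range (A.mon j ξ 0)) := by
      have : A.mon j ξ 0 (0, 0) = 1 := by simp [A.mon]
      exact this ▸ Submodule.subset_span ⟨(0, 0), rfl⟩
    simpa using key u hu 1 h1
  · rw [Submodule.span_le]
    rintro _ ⟨p, rfl⟩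
    exact A.mon_mem_coinv j ξ p

/-- The projection `∑ xⁱyᵐ k_{im} ↦ ∑ ε(k_{im}) xⁱyᵐ`. -/
noncomputable def A.projCoinv : A j ξ 0 →ₗ[𝕜] A.coinv j ξ :=
  ∑ p, (LinearMap.toSpanSingleton 𝕜 _ ⟨A.mon j ξ 0 p, A.mon_mem_coinv j ξ p⟩) ∘ₗ
    counit ∘ₗ LinearMap.proj p ∘ₗ (A.nf j ξ 0).toLinearMap

theorem A.projCoinv_apply (u : A j ξ 0) : A.projCoinv j ξ u =
    ∑ p, counit (R := 𝕜) (A.nf j ξ 0 u p) •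
      (⟨A.mon j ξ 0 p, A.mon_mem_coinv j ξ p⟩ : A.coinv j ξ) := by
  simp [A.projCoinv]

theorem A.projCoinv_mul_ofK (u : A j ξ 0) (k : K ξ) :
    A.projCoinv j ξ (u * A.ofK j ξ 0 k) = counit (R := 𝕜) k • A.projCoinv j ξ u := by
  rw [A.projCoinv_apply, A.projCoinv_apply, Finset.smul_sum]
  refine Finset.sum_congr rfl fun p _ => ?_
  rw [A.nf_mul_ofK, Bialgebra.counit_mul, smul_smul, mul_comm]

theorem A.projCoinv_coe (r : A.coinv j ξ) : A.projCoinv j ξ r = r := by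
  have hr : (r : A j ξ 0) ∈ Submodule.span 𝕜 (Set.range (A.mon j ξ 0)) := by
    rw [← A.coinv_eq_span]
    exact r.2
  have key : ∀ u ∈ Submodule.span 𝕜 (Set.range (A.mon j ξ 0)),
      (A.coinv j ξ).val (A.projCoinv j ξ u) = u := by
    intro u hu
    induction hu using Submodule.span_induction with
    | zero => simp
    | add u v _ _ hu hv => rw [map_add, map_add, hu, hv]
    | smul c u _ hu => rw [map_smul, map_smul, hu]
    | mem u hu =>
      obtain ⟨q, rfl⟩ := hu
      have h := A.nf_mon_ofK j ξ 0 q 1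
      rw [map_one, mul_one] at h
      rw [A.projCoinv_apply, h, Finset.sum_eq_single q]
      · simp
      · intro p _ hp
        simp [Pi.single_eq_of_ne hp]
      · simp
  exact Subtype.ext (key r hr)

/-- Induction over `𝔄_{3,j}(0)`, as the product of the subalgebra generated by `x, y` and `𝒦`. -/
theorem A.coinv_induction {P : A j ξ 0 → Prop} (hadd : ∀ u v, P u → P v → P (u + v)) (h0 : P 0)
    (hm : ∀ (r : A.coinv j ξ) k, P (r * A.ofK j ξ 0 k)) (u : A j ξ 0) : P u := by
  rw [A.eq_sum j ξ 0 u]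
  exact Finset.sum_induction _ P hadd h0 fun p _ => hm ⟨_, A.mon_mem_coinv j ξ p⟩ _

theorem A.projCoinv_coe_mul (r : A.coinv j ξ) (u : A j ξ 0) :
    A.projCoinv j ξ (r * u) = r * A.projCoinv j ξ u := by
  refine A.coinv_induction j ξ (P := fun u => A.projCoinv j ξ (r * u) = r * A.projCoinv j ξ u)
    (fun u v hu hv => ?_) (by simp) (fun s k => ?_) u
  · rw [mul_add, map_add, map_add, hu, hv, mul_add]
  · rw [← mul_assoc, A.projCoinv_mul_ofK, A.projCoinv_mul_ofK, A.projCoinv_coe,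
      ← Subalgebra.coe_mul, A.projCoinv_coe, mul_smul_comm]

/-- The concrete form of `Splitting.proj_mul_proj`; it is needed already to establish the smash rule
for `A.splitting`. -/
theorem A.projCoinv_mul_projCoinv (v u : A j ξ 0) :
    A.projCoinv j ξ (v * (A.projCoinv j ξ u : A j ξ 0)) = A.projCoinv j ξ (v * u) := by
  refine A.coinv_induction j ξ (P := fun u =>
    A.projCoinv j ξ (v * (A.projCoinv j ξ u : A j ξ 0)) = A.projCoinv j ξ (v * u))
    (fun u w hu hw => ?_) (by simp) (fun s k => ?_) u
  · rw [map_add, Subalgebra.coe_add, mul_add, mul_add, map_add, map_add, hu, hw]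
  · rw [← mul_assoc, A.projCoinv_mul_ofK, A.projCoinv_mul_ofK, A.projCoinv_coe,
      Subalgebra.coe_smul, mul_smul_comm, map_smul]

/-- The projection `𝔄_{3,j}(0) → 𝒦`, `x, y ↦ 0`. -/
noncomputable def A.toK : A j ξ 0 →ₐ[𝕜] K ξ :=
  A.lift (fun | .x => 0 | .y => 0 | .k g => K.gen ξ g) (by
    refine A.rel_of ξ 0 _ (fun u v h => ?_) ?_ ?_ ?_ ?_ ?_ ?_ ?_
    · have hg : FreeAlgebra.lift 𝕜 (K.gen ξ) = K.mk ξ := by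
        ext g
        simp [K.gen]
      change FreeAlgebra.lift 𝕜 (K.gen ξ) u = FreeAlgebra.lift 𝕜 (K.gen ξ) v
      rw [hg]
      exact K.mk_rel h
    all_goals simp)

theorem A.toK_x : A.toK j ξ ax = 0 := A.lift_gen _ _ _

theorem A.toK_y : A.toK j ξ ay = 0 := A.lift_gen _ _ _

theorem A.toK_k (g : KGen) : A.toK j ξ (A.gen j ξ 0 (.k g)) = K.gen ξ g := A.lift_gen _ _ _

theorem A.toK_ofK (k : K ξ) : A.toK j ξ (A.ofK j ξ 0 k) = k := by
  have h : (A.toK j ξ).comp (A.ofK j ξ 0) = AlgHom.id 𝕜 (K ξ) := by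
    refine K.hom_ext fun g => ?_
    rw [AlgHom.comp_apply, A.ofK_gen, A.toK_k, AlgHom.id_apply]
  exact DFunLike.congr_fun h k

theorem A.counit_toK (u : A j ξ 0) : counit (R := 𝕜) (A.toK j ξ u) = counit (R := 𝕜) u := by
  have h : (Bialgebra.counitAlgHom 𝕜 (K ξ)).comp (A.toK j ξ) =
      Bialgebra.counitAlgHom 𝕜 (A j ξ 0) := by
    refine A.hom_ext fun g => ?_
    rw [AlgHom.comp_apply, Bialgebra.counitAlgHom_apply, Bialgebra.counitAlgHom_apply,
      A.counit_gen]
    cases g with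
    | x => rw [A.toK_x, map_zero]; rfl
    | y => rw [A.toK_y, map_zero]; rfl
    | k g => rw [A.toK_k, K.counit_gen]; rfl
  exact DFunLike.congr_fun h u

theorem A.comul_toK (u : A j ξ 0) : comul (R := 𝕜) (A.toK j ξ u) =
    TensorProduct.map (A.toK j ξ).toLinearMap (A.toK j ξ).toLinearMap (comul (R := 𝕜) u) := by
  have h : (Bialgebra.comulAlgHom 𝕜 (K ξ)).comp (A.toK j ξ) =
      (Algebra.TensorProduct.map (A.toK j ξ) (A.toK j ξ)).comp
        (Bialgebra.comulAlgHom 𝕜 (A j ξ 0)) := by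
    refine A.hom_ext fun g => ?_
    rw [AlgHom.comp_apply, AlgHom.comp_apply, Bialgebra.comulAlgHom_apply,
      Bialgebra.comulAlgHom_apply, A.comul_gen]
    cases g with
    | x => rw [A.toK_x, map_zero]; cases j <;> simp [A.comulGen, A.toK_x, A.toK_y]
    | y => rw [A.toK_y, map_zero]; cases j <;> simp [A.comulGen, A.toK_x, A.toK_y]
    | k g => rw [A.toK_k, K.comul_gen]; cases j <;> cases g <;> simp [A.comulGen, K.comulGen, A.toK_k]
  exact DFunLike.congr_fun h u

theorem A.toK_coinv (r : A.coinv j ξ) :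
    A.toK j ξ r = algebraMap 𝕜 (K ξ) (counit (R := 𝕜) (r : A j ξ 0)) := by
  have h : A.coinv j ξ ≤ AlgHom.equalizer (A.toK j ξ)
      ((Algebra.ofId 𝕜 (K ξ)).comp (Bialgebra.counitAlgHom 𝕜 (A j ξ 0))) := by
    refine Algebra.adjoin_le ?_
    rintro u (rfl | rfl)
    · simp [AlgHom.mem_equalizer, A.toK_x, A.counit_gen, A.counitGen]
    · simp [AlgHom.mem_equalizer, A.toK_y, A.counit_gen, A.counitGen]
  exact h r.2

/-- The elements whose coaction lies in 𝒦 ⊗ R form a subalgebra, so only x and y matter. Their first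
summand, x ⊗ 1 or y ⊗ 1, dies under `A.toK`, and the others have x or y on the right. -/
theorem A.coact_coinv_mem (r : A.coinv j ξ) :
    (A.toK j ξ).toLinearMap.rTensor (A j ξ 0) (comul (R := 𝕜) (r : A j ξ 0)) ∈
      LinearMap.range ((A.coinv j ξ).val.toLinearMap.lTensor (K ξ)) := by
  let T := (Algebra.TensorProduct.map (AlgHom.id 𝕜 (K ξ)) (A.coinv j ξ).val).range.comap
    ((Algebra.TensorProduct.map (A.toK j ξ) (AlgHom.id 𝕜 (A j ξ 0))).comp
      (Bialgebra.comulAlgHom 𝕜 (A j ξ 0)))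
  have hT : A.coinv j ξ ≤ T := by
    have hkx : ∀ k : K ξ, k ⊗ₜ[𝕜] ax ∈
        (Algebra.TensorProduct.map (AlgHom.id 𝕜 (K ξ)) (A.coinv j ξ).val).range :=
      fun k => ⟨k ⊗ₜ ⟨_, A.x_mem_coinv j ξ⟩, rfl⟩
    have hky : ∀ k : K ξ, k ⊗ₜ[𝕜] ay ∈
        (Algebra.TensorProduct.map (AlgHom.id 𝕜 (K ξ)) (A.coinv j ξ).val).range :=
      fun k => ⟨k ⊗ₜ ⟨_, A.y_mem_coinv j ξ⟩, rfl⟩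
    refine Algebra.adjoin_le ?_
    rintro u (rfl | rfl) <;>
      simp only [T, SetLike.mem_coe, Subalgebra.mem_comap, AlgHom.comp_apply,
        Bialgebra.comulAlgHom_apply, A.comul_gen] <;>
      cases j <;>
      simp only [A.comulGen, map_add, map_smul, Algebra.TensorProduct.map_tmul, A.toK_x, A.toK_y,
        TensorProduct.zero_tmul, zero_add, AlgHom.id_apply]
    · exact add_mem (hkx _) (Subalgebra.smul_mem _ (hky _) _)
    · exact add_mem (hkx _) (Subalgebra.smul_mem _ (hky _) _)
    · exact add_mem (hky _) (Subalgebra.smul_mem _ (hkx _) _)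
    · exact add_mem (hky _) (Subalgebra.smul_mem _ (hkx _) _)
  exact hT r.2

theorem A.comul_gen_matrix (i k : Fin 2) : comul (R := 𝕜) (K.gen ξ (KGen.matrix i k)) =
    ∑ l, K.gen ξ (KGen.matrix i l) ⊗ₜ[𝕜] K.gen ξ (KGen.matrix l k) := by
  rw [K.comul_gen, Fin.sum_univ_two]
  fin_cases i <;> fin_cases k <;> rfl

/-- The matrix `(a, b; c, d)` normalizes the subalgebra generated by `x, y`. -/
theorem A.exists_gen_mul (r : A.coinv j ξ) : ∃ ρ : Fin 2 → Fin 2 → A.coinv j ξ, ∀ i k,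
    A.gen j ξ 0 (.k (KGen.matrix i k)) * (r : A j ξ 0) =
      ∑ l, (ρ i l : A j ξ 0) * A.gen j ξ 0 (.k (KGen.matrix l k)) := by
  obtain ⟨r, hr⟩ := r
  induction hr using Algebra.adjoin_induction with
  | mem u hu =>
    rcases hu with rfl | rfl
    · refine ⟨![![-ξ • ⟨_, A.x_mem_coinv j ξ⟩, 0], ![0, ξ • ⟨_, A.x_mem_coinv j ξ⟩]], ?_⟩
      have h1 : A.gen j ξ 0 (.k .a) * ax = -ξ • (ax * A.gen j ξ 0 (.k .a)) := by
        simpa [A.gen] using A.mk_rel (j := j) (ARel.ax (ξ := ξ) (μ := 0))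
      have h2 : A.gen j ξ 0 (.k .b) * ax = -ξ • (ax * A.gen j ξ 0 (.k .b)) := by
        simpa [A.gen] using A.mk_rel (j := j) (ARel.bx (ξ := ξ) (μ := 0))
      have h3 : A.gen j ξ 0 (.k .c) * ax = ξ • (ax * A.gen j ξ 0 (.k .c)) := by
        simpa [A.gen] using A.mk_rel (j := j) (ARel.cx (ξ := ξ) (μ := 0))
      have h4 : A.gen j ξ 0 (.k .d) * ax = ξ • (ax * A.gen j ξ 0 (.k .d)) := by
        simpa [A.gen] using A.mk_rel (j := j) (ARel.dx (ξ := ξ) (μ := 0))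
      simp only [Fin.forall_fin_two, Fin.sum_univ_two]
      refine ⟨⟨h1.trans ?_, h2.trans ?_⟩, h3.trans ?_, h4.trans ?_⟩ <;> simp [KGen.matrix]
    · refine ⟨![![-⟨_, A.y_mem_coinv j ξ⟩, -⟨_, A.x_mem_coinv j ξ⟩],
        ![⟨_, A.x_mem_coinv j ξ⟩, -⟨_, A.y_mem_coinv j ξ⟩]], ?_⟩
      have h1 : A.gen j ξ 0 (.k .a) * ay =
          -(ay * A.gen j ξ 0 (.k .a)) - ax * A.gen j ξ 0 (.k .c) := by
        simpa [A.gen] using A.mk_rel (j := j) (ARel.ay (ξ := ξ) (μ := 0))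
      have h2 : A.gen j ξ 0 (.k .b) * ay =
          -(ay * A.gen j ξ 0 (.k .b)) - ax * A.gen j ξ 0 (.k .d) := by
        simpa [A.gen] using A.mk_rel (j := j) (ARel.by_ (ξ := ξ) (μ := 0))
      have h3 : A.gen j ξ 0 (.k .c) * ay =
          -(ay * A.gen j ξ 0 (.k .c)) + ax * A.gen j ξ 0 (.k .a) := by
        simpa [A.gen] using A.mk_rel (j := j) (ARel.cy (ξ := ξ) (μ := 0))
      have h4 : A.gen j ξ 0 (.k .d) * ay =
          -(ay * A.gen j ξ 0 (.k .d)) + ax * A.gen j ξ 0 (.k .b) := by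
        simpa [A.gen] using A.mk_rel (j := j) (ARel.dy (ξ := ξ) (μ := 0))
      simp only [Fin.forall_fin_two, Fin.sum_univ_two]
      refine ⟨⟨h1.trans ?_, h2.trans ?_⟩, h3.trans ?_, h4.trans ?_⟩ <;>
        simp [KGen.matrix, sub_eq_add_neg, add_comm]
  | algebraMap c =>
    refine ⟨fun i l => if i = l then algebraMap 𝕜 _ c else 0, fun i k => ?_⟩
    rw [Finset.sum_eq_single i]
    · simp [Algebra.commutes]
    · intro l _ hl
      simp [hl.symm]
    · simp
  | add u v hu hv ihu ihv =>
    obtain ⟨ρ, hρ⟩ := ihu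
    obtain ⟨τ, hτ⟩ := ihv
    refine ⟨fun i l => ρ i l + τ i l, fun i k => ?_⟩
    change _ * (u + v) = _
    rw [mul_add, hρ, hτ, ← Finset.sum_add_distrib]
    simp [add_mul]
  | mul u v hu hv ihu ihv =>
    obtain ⟨ρ, hρ⟩ := ihu
    obtain ⟨τ, hτ⟩ := ihv
    -- Products of coinvariants correspond to products of matrices.
    refine ⟨fun i l => ∑ m, ρ i m * τ m l, fun i k => ?_⟩
    change _ * (u * v) = _
    rw [← mul_assoc, hρ]
    simp only [Fin.sum_univ_two, add_mul, mul_assoc]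
    rw [hτ, hτ]
    simp only [Fin.sum_univ_two, Subalgebra.coe_add, Subalgebra.coe_mul]
    noncomm_ring

/-- The map `p ⊗ q ↦ (p · r) q`. -/
noncomputable def A.straighten (r : A.coinv j ξ) : K ξ ⊗[𝕜] K ξ →ₗ[𝕜] A j ξ 0 :=
  LinearMap.mul' 𝕜 (A j ξ 0) ∘ₗ
    TensorProduct.map ((A.coinv j ξ).val.toLinearMap ∘ₗ A.projCoinv j ξ ∘ₗ
      LinearMap.mulRight 𝕜 (r : A j ξ 0) ∘ₗ (A.ofK j ξ 0).toLinearMap) (A.ofK j ξ 0).toLinearMap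

theorem A.straighten_tmul (r : A.coinv j ξ) (p q : K ξ) : A.straighten j ξ r (p ⊗ₜ q) =
    (A.projCoinv j ξ (A.ofK j ξ 0 p * r) : A j ξ 0) * A.ofK j ξ 0 q := rfl

theorem A.straighten_mul_ofK (r : A.coinv j ξ) (p q : K ξ) (z : K ξ ⊗[𝕜] K ξ) :
    A.straighten j ξ (A.projCoinv j ξ (A.ofK j ξ 0 p * r)) z * A.ofK j ξ 0 q =
      A.straighten j ξ r (z * p ⊗ₜ q) := by
  induction z with
  | zero => simp
  | add s t hs ht => rw [map_add, add_mul, hs, ht, add_mul, map_add]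
  | tmul s t =>
    rw [Algebra.TensorProduct.tmul_mul_tmul, A.straighten_tmul, A.straighten_tmul,
      A.projCoinv_mul_projCoinv, mul_assoc, ← map_mul (A.ofK j ξ 0), ← mul_assoc,
      ← map_mul (A.ofK j ξ 0)]

/-- Once the smash rule is known for k and all r, multiplying a straightened expression by k amounts
to multiplying its argument by Δ(k). This gives closure under products in `A.ofK_mul_coinv`. -/
theorem A.ofK_mul_straighten {k : K ξ}
    (hk : ∀ r : A.coinv j ξ, A.ofK j ξ 0 k * (r : A j ξ 0) = A.straighten j ξ r (comul k))
    (r : A.coinv j ξ) (w : K ξ ⊗[𝕜] K ξ) :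
    A.ofK j ξ 0 k * A.straighten j ξ r w = A.straighten j ξ r (comul k * w) := by
  induction w with
  | zero => simp
  | add s t hs ht => rw [map_add, mul_add, hs, ht, mul_add, map_add]
  | tmul p q => rw [A.straighten_tmul, ← mul_assoc, hk, A.straighten_mul_ofK]

/-- The counit of the matrix (a, b; c, d) is the identity matrix, so projecting `hρ` identifies the
entries of ρ with the action on r. With this, `hρ` itself is the smash rule. -/
theorem A.ofK_matrix_mul (r : A.coinv j ξ) (i k : Fin 2) :
    A.ofK j ξ 0 (K.gen ξ (KGen.matrix i k)) * (r : A j ξ 0) =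
      A.straighten j ξ r (comul (K.gen ξ (KGen.matrix i k))) := by
  obtain ⟨ρ, hρ⟩ := A.exists_gen_mul j ξ r
  have h : ∀ i l, A.projCoinv j ξ (A.ofK j ξ 0 (K.gen ξ (KGen.matrix i l)) * r) = ρ i l := by
    intro i l
    rw [A.ofK_gen, hρ, map_sum, Finset.sum_eq_single l]
    · rw [← A.ofK_gen, A.projCoinv_mul_ofK, A.projCoinv_coe, K.counit_gen]
      fin_cases l <;> simp [KGen.matrix, K.counitGen]
    · intro m _ hm
      rw [← A.ofK_gen, A.projCoinv_mul_ofK, K.counit_gen]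
      fin_cases l <;> fin_cases m <;> simp_all [KGen.matrix, K.counitGen]
    · simp
  rw [A.comul_gen_matrix, map_sum, A.ofK_gen, hρ]
  refine Finset.sum_congr rfl fun l _ => ?_
  rw [A.straighten_tmul, h, A.ofK_gen]

/-- The smash rule is additive in k and passes to products by `A.ofK_mul_straighten`, so the
generators a and b suffice. -/
theorem A.ofK_mul_coinv (k : K ξ) (r : A.coinv j ξ) :
    A.ofK j ξ 0 k * (r : A j ξ 0) = A.straighten j ξ r (comul k) := by
  refine K.induction ξ (P := fun k => ∀ r : A.coinv j ξ,
    A.ofK j ξ 0 k * (r : A j ξ 0) = A.straighten j ξ r (comul k))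
    (fun r => A.ofK_matrix_mul j ξ r 0 0) (fun r => A.ofK_matrix_mul j ξ r 0 1)
    (fun c r => ?_) (fun u v hu hv r => ?_) (fun u v hu hv r => ?_) k r
  · rw [Bialgebra.comul_algebraMap, Algebra.algebraMap_eq_smul_one, Algebra.algebraMap_eq_smul_one,
      map_smul, map_smul, Algebra.TensorProduct.one_def, A.straighten_tmul]
    simp [A.projCoinv_coe]
  · rw [map_add, add_mul, hu, hv, map_add, map_add]
  · rw [map_mul, mul_assoc, hv, A.ofK_mul_straighten j ξ hu, Bialgebra.comul_mul]

theorem A.exists_coinv_mul (u : A j ξ 0) : ∃ z : A.coinv j ξ ⊗[𝕜] K ξ,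
    LinearMap.mul' 𝕜 (A j ξ 0)
      (TensorProduct.map (A.coinv j ξ).val.toLinearMap (A.ofK j ξ 0).toLinearMap z) = u := by
  refine A.coinv_induction j ξ (P := fun u => ∃ z : A.coinv j ξ ⊗[𝕜] K ξ, LinearMap.mul' 𝕜 (A j ξ 0)
    (TensorProduct.map (A.coinv j ξ).val.toLinearMap (A.ofK j ξ 0).toLinearMap z) = u)
    (fun u v hu hv => ?_) ⟨0, by simp⟩ (fun r k => ⟨r ⊗ₜ k, rfl⟩) u
  obtain ⟨z, rfl⟩ := hu
  obtain ⟨w, rfl⟩ := hv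
  exact ⟨z + w, by rw [map_add, map_add]⟩

/-- The decomposition of `𝔄_{3,j}(0)` as a bosonization. -/
noncomputable def A.splitting : Splitting 𝕜 (K ξ) (A j ξ 0) where
  R := A.coinv j ξ
  ι := A.ofK j ξ 0
  π := A.toK j ξ
  val := (A.coinv j ξ).val
  proj := A.projCoinv j ξ
  π_ι := A.toK_ofK j ξ
  counit_ι k := CoalgHomClass.counit_comp_apply (A.ofKBialg j ξ 0) k
  comul_ι k := (CoalgHomClass.map_comp_comul_apply (A.ofKBialg j ξ 0) k).symm
  counit_π := A.counit_toK j ξ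
  comul_π := A.comul_toK j ξ
  π_val := A.toK_coinv j ξ
  proj_val := A.projCoinv_coe j ξ
  proj_val_mul := A.projCoinv_coe_mul j ξ
  proj_mul_ι := A.projCoinv_mul_ofK j ξ
  exists_mul := A.exists_coinv_mul j ξ
  coact_mem := A.coact_coinv_mem j ξ
  ι_mul_val := A.ofK_mul_coinv j ξ

end Coinvariants


/-! ### Subobjects of Yetter–Drinfeld modules -/

section Pullback

variable {𝕜 K V W : Type u} [Field 𝕜] [Ring K] [HopfAlgebra 𝕜 K] [AddCommGroup V] [Module 𝕜 V]
  [AddCommGroup W] [Module 𝕜 W]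

theorem IsYDHom.lTensor_adj {D : ActCoact 𝕜 K V} {E : ActCoact 𝕜 K W} {f : V →ₗ[𝕜] W}
    (hf : IsYDHom D E f) (z : K ⊗[𝕜] (K ⊗[𝕜] K)) (w : K ⊗[𝕜] V) :
    f.lTensor K (D.adj z w) = E.adj z (f.lTensor K w) := by
  induction z with
  | zero => simp
  | add s t hs ht => simp only [map_add, LinearMap.add_apply, hs, ht]
  | tmul h z =>
    induction z with
    | zero => simp
    | add s t hs ht => simp only [TensorProduct.tmul_add, map_add, LinearMap.add_apply, hs, ht]
    | tmul k l =>
      induction w with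
      | zero => simp
      | add s t hs ht => simp only [map_add, hs, ht]
      | tmul p v => simp [ActCoact.adj, ActCoact.adjAux, hf.map_act]

/-- A subobject of a Yetter-Drinfeld module is a Yetter-Drinfeld module. -/
theorem IsYDHom.isYetterDrinfeld {D : ActCoact 𝕜 K V} {E : ActCoact 𝕜 K W} {f : V →ₗ[𝕜] W}
    (hf : IsYDHom D E f) (hi : Function.Injective f) (hE : IsYetterDrinfeld E) :
    IsYetterDrinfeld D where
  coassoc := by
    refine LinearMap.ext fun v => ?_
    apply Module.Flat.lTensor_preserves_injective_linearMap (M := K) _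
      (Module.Flat.lTensor_preserves_injective_linearMap (M := K) f hi)
    have h1 := LinearMap.congr_fun hE.coassoc (f v)
    simp only [LinearMap.comp_apply, LinearEquiv.coe_coe, hf.map_coact] at h1 ⊢
    rw [lTensor_lTensor_assoc_rTensor, h1]
    generalize D.coact v = z
    induction z with
    | zero => simp
    | add s t hs ht => simp only [map_add, hs, ht]
    | tmul k w => simp only [LinearMap.lTensor_tmul, hf.map_coact]
  counit_coact := by
    refine LinearMap.ext fun v => hi ?_
    have h1 := LinearMap.congr_fun hE.counit_coact (f v)
    simp only [LinearMap.comp_apply, LinearEquiv.coe_coe, hf.map_coact, LinearMap.id_apply] at h1 ⊢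
    rw [← h1]
    generalize D.coact v = z
    induction z with
    | zero => simp
    | add s t hs ht => simp only [map_add, hs, ht]
    | tmul k v => simp
  compat h v := by
    apply Module.Flat.lTensor_preserves_injective_linearMap (M := K) f hi
    rw [hf.lTensor_adj, ← hf.map_coact, ← hf.map_coact, hf.map_act, hE.compat]

end Pullback

/-! ### The grading of the coinvariants -/

section Symbols

variable {𝕜 : Type u} [Field 𝕜] [CharZero 𝕜] (j : Idx) (ξ : 𝕜)
  [hξ : Fact (IsPrimitiveRoot ξ 4)]

theorem A.toK_eq (u : A j ξ 0) : A.toK j ξ u = A.nf j ξ 0 u (0, 0) := by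
  conv_lhs => rw [A.eq_sum j ξ 0 u]
  rw [map_sum, Finset.sum_eq_single (0, 0)]
  · rw [map_mul, A.toK_ofK]
    simp [A.mon]
  · rintro ⟨i, m⟩ _ h
    rw [map_mul, A.mon, map_mul, map_pow, map_pow, A.toK_x, A.toK_y]
    rcases eq_or_ne i 0 with rfl | hi
    · have hm : (m : ℕ) ≠ 0 := by
        intro h0
        exact h (by rw [Fin.val_eq_zero_iff.1 h0])
      rw [zero_pow hm, mul_zero, zero_mul]
    · rw [zero_pow (by simpa [Fin.val_eq_zero_iff] using hi), zero_mul, zero_mul]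
  · simp

theorem A.toK_symb {n : ℕ} (hn : n ≠ 0) (u : A j ξ 0) : A.toK j ξ (A.symb j ξ 0 n u) = 0 := by
  rw [A.toK_eq, A.nf_symb, NF.top_apply, NF.deg_00, if_neg hn.symm]

theorem A.symb_zero_eq (u : A j ξ 0) : A.symb j ξ 0 0 u = A.ofK j ξ 0 (A.toK j ξ u) := by
  apply (A.nf j ξ 0).injective
  rw [A.nf_symb, A.nf_ofK, A.toK_eq]
  ext ⟨i, m⟩
  rw [NF.top_apply]
  by_cases h : ((i, m) : Fin 4 × Fin 2) = (0, 0)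
  · rw [h, Pi.single_eq_same, NF.deg_00, if_pos rfl]
  · rw [Pi.single_eq_of_ne h, if_neg]
    intro hd
    refine h (Prod.ext (Fin.ext ?_) (Fin.ext ?_)) <;> simp [NF.deg] at hd ⊢ <;> omega

theorem A.sum_symb (u : A j ξ 0) : ∑ n ∈ Finset.range 5, A.symb j ξ 0 n u = u := by
  apply (A.nf j ξ 0).injective
  rw [map_sum]
  ext p
  rw [Finset.sum_apply]
  simp only [A.nf_symb, NF.top_apply]
  rw [Finset.sum_ite_eq, if_pos]
  have := NF.deg_le p
  rw [Finset.mem_range]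
  omega

theorem A.symb_mon_eq (n : ℕ) (p : Fin 4 × Fin 2) :
    A.symb j ξ 0 n (A.mon j ξ 0 p) = if NF.deg p = n then A.mon j ξ 0 p else 0 := by
  have h := A.symb_symb j ξ 0 n (NF.deg p) (A.mon j ξ 0 p)
  rw [A.symb_mon] at h
  rw [h]
  simp [eq_comm]

theorem A.symb_mem_coinv (n : ℕ) {u : A j ξ 0} (hu : u ∈ A.coinv j ξ) :
    A.symb j ξ 0 n u ∈ A.coinv j ξ := by
  have h : Submodule.span 𝕜 (Set.range (A.mon j ξ 0)) ≤
      (Subalgebra.toSubmodule (A.coinv j ξ)).comap (A.symb j ξ 0 n) := by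
    rw [Submodule.span_le]
    rintro _ ⟨p, rfl⟩
    change A.symb j ξ 0 n (A.mon j ξ 0 p) ∈ A.coinv j ξ
    rw [A.symb_mon_eq]
    split_ifs
    · exact A.mon_mem_coinv j ξ p
    · exact zero_mem _
  rw [← A.coinv_eq_span] at h
  exact h hu

/-- The projection only changes coefficients in 𝒦, which have degree zero. -/
theorem A.symb_projCoinv (n : ℕ) (u : A j ξ 0) :
    A.symb j ξ 0 n (A.projCoinv j ξ u) = A.projCoinv j ξ (A.symb j ξ 0 n u) := by
  refine A.coinv_induction j ξ (P := fun u => A.symb j ξ 0 n (A.projCoinv j ξ u) =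
    A.projCoinv j ξ (A.symb j ξ 0 n u)) (fun u v hu hv => ?_) (by simp) (fun r k => ?_) u
  · rw [map_add, Subalgebra.coe_add, map_add, hu, hv, map_add, map_add, Subalgebra.coe_add]
  · rw [A.projCoinv_mul_ofK, A.projCoinv_coe, A.symb_mul_ofK, A.projCoinv_mul_ofK,
      Subalgebra.coe_smul, map_smul, Subalgebra.coe_smul]
    have h := A.projCoinv_coe j ξ ⟨_, A.symb_mem_coinv j ξ n r.2⟩
    rw [h]

/-- The projection of the coinvariants to their homogeneous component of degree `n`. -/
noncomputable def A.component (n : ℕ) : A.coinv j ξ →ₗ[𝕜] A.coinv j ξ :=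
  A.projCoinv j ξ ∘ₗ A.symb j ξ 0 n ∘ₗ (A.coinv j ξ).val.toLinearMap

theorem A.coe_component (n : ℕ) (r : A.coinv j ξ) :
    (A.component j ξ n r : A j ξ 0) = A.symb j ξ 0 n r := by
  change (A.projCoinv j ξ (A.symb j ξ 0 n r) : A j ξ 0) = _
  rw [← A.symb_projCoinv, A.projCoinv_coe]

theorem A.component_projCoinv (n : ℕ) (u : A j ξ 0) :
    A.component j ξ n (A.projCoinv j ξ u) = A.projCoinv j ξ (A.symb j ξ 0 n u) :=
  Subtype.ext (by rw [A.coe_component, A.symb_projCoinv])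

/-- The homogeneous component of degree `n` of the coinvariants. -/
noncomputable def A.grading (n : ℕ) : Submodule 𝕜 (A.coinv j ξ) :=
  LinearMap.eqLocus (A.component j ξ n) LinearMap.id

theorem A.mem_grading {n : ℕ} {r : A.coinv j ξ} :
    r ∈ A.grading j ξ n ↔ A.symb j ξ 0 n r = r := by
  rw [← A.coe_component]
  exact Subtype.ext_iff

theorem A.component_mem (n : ℕ) (r : A.coinv j ξ) : A.component j ξ n r ∈ A.grading j ξ n := by
  rw [A.mem_grading, A.coe_component, A.symb_symb, if_pos rfl]

theorem A.component_of_mem {m n : ℕ} {r : A.coinv j ξ} (hr : r ∈ A.grading j ξ n) :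
    A.component j ξ m r = if m = n then r else 0 := by
  have h := (A.mem_grading j ξ).1 hr
  apply Subtype.ext
  rw [A.coe_component, ← h, A.symb_symb, h]
  split_ifs <;> rfl

theorem A.mem_fil_of_mem_grading {n : ℕ} {r : A.coinv j ξ} (hr : r ∈ A.grading j ξ n) :
    (r : A j ξ 0) ∈ A.fil j ξ 0 n := by
  rw [← (A.mem_grading j ξ).1 hr]
  exact A.symb_mem_fil j ξ 0 n _

theorem A.sum_component (r : A.coinv j ξ) : ∑ n ∈ Finset.range 5, A.component j ξ n r = r := by
  apply Subtype.ext
  have h := A.sum_symb j ξ r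
  simp only [AddSubmonoidClass.coe_finset_sum, A.coe_component, h]

theorem A.isInternal_grading : DirectSum.IsInternal (A.grading j ξ) := by
  constructor
  · rw [injective_iff_map_eq_zero]
    intro f hf
    -- The component maps recover each summand, whence injectivity. Surjectivity holds because
    -- nothing lives above degree four.
    have key : ∀ (n : ℕ) (f : ⨁ n, A.grading j ξ n),
        A.component j ξ n (DirectSum.coeAddMonoidHom (A.grading j ξ) f) =
          (f n : A.coinv j ξ) := by
      intro n f
      induction f using DirectSum.induction_on with
      | zero => simp
      | add f g hf hg => rw [map_add, map_add, hf, hg]; rfl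
      | of m r =>
        rw [DirectSum.coeAddMonoidHom_of, A.component_of_mem j ξ r.2]
        split_ifs with h
        · subst h
          rw [DirectSum.of_eq_same]
        · rw [DirectSum.of_eq_of_ne _ _ _ h]
          rfl
    refine DFinsupp.ext fun n => Subtype.ext ?_
    have := key n f
    rw [hf, map_zero] at this
    exact this.symm
  · intro r
    refine ⟨∑ n ∈ Finset.range 5, DirectSum.of (fun n => A.grading j ξ n) n
      ⟨A.component j ξ n r, A.component_mem j ξ n r⟩, ?_⟩
    rw [map_sum]
    simp only [DirectSum.coeAddMonoidHom_of]
    exact A.sum_component j ξ r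

theorem A.map_proj_symbT (n : ℕ) (z : A j ξ 0 ⊗[𝕜] A j ξ 0) :
    TensorProduct.map (A.projCoinv j ξ) (A.projCoinv j ξ) (A.symbT j ξ 0 n z) =
      ∑ q ∈ Finset.HasAntidiagonal.antidiagonal n,
        TensorProduct.map (A.component j ξ q.1) (A.component j ξ q.2)
          (TensorProduct.map (A.projCoinv j ξ) (A.projCoinv j ξ) z) := by
  rw [A.symbT, LinearMap.sum_apply, map_sum]
  refine Finset.sum_congr rfl fun q _ => ?_
  induction z with
  | zero => simp
  | add s t hs ht => simp only [map_add, hs, ht]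
  | tmul u v => simp only [TensorProduct.map_tmul, A.component_projCoinv]

/-- `A.toK` kills positive degree, so only the bidegree (0, n) contributes; this is why the coaction
preserves the degree. -/
theorem A.map_toK_symbT (n : ℕ) (z : A j ξ 0 ⊗[𝕜] A j ξ 0) :
    TensorProduct.map (A.toK j ξ).toLinearMap (A.projCoinv j ξ) (A.symbT j ξ 0 n z) =
      (A.component j ξ n).lTensor (K ξ) (TensorProduct.map
        ((A.toK j ξ).toLinearMap ∘ₗ A.symb j ξ 0 0) (A.projCoinv j ξ) z) := by
  rw [A.symbT, LinearMap.sum_apply, map_sum, Finset.sum_eq_single (0, n)]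
  · induction z with
    | zero => simp
    | add s t hs ht => simp only [map_add, hs, ht]
    | tmul u v =>
      simp only [TensorProduct.map_tmul, LinearMap.lTensor_tmul, A.component_projCoinv]
      rfl
  · rintro ⟨p, q⟩ hq hne
    rw [Finset.HasAntidiagonal.mem_antidiagonal] at hq
    have hp : p ≠ 0 := by
      rintro rfl
      exact hne (by simp_all)
    induction z with
    | zero => simp
    | add s t hs ht => simp only [map_add, hs, ht, add_zero]
    | tmul u v => simp [A.toK_symb j ξ hp]
  · simp

theorem A.lTensor_component_mem (n : ℕ) (z : K ξ ⊗[𝕜] A.coinv j ξ) :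
    (A.component j ξ n).lTensor (K ξ) z ∈
      LinearMap.range ((A.grading j ξ n).subtype.lTensor (K ξ)) := by
  induction z with
  | zero => rw [map_zero]; exact Submodule.zero_mem _
  | add s t hs ht => rw [map_add]; exact Submodule.add_mem _ hs ht
  | tmul k r => exact ⟨k ⊗ₜ ⟨_, A.component_mem j ξ n r⟩, rfl⟩

theorem A.map_component_mem (m n : ℕ) (z : A.coinv j ξ ⊗[𝕜] A.coinv j ξ) :
    TensorProduct.map (A.component j ξ m) (A.component j ξ n) z ∈
      LinearMap.range (TensorProduct.mapIncl (A.grading j ξ m) (A.grading j ξ n)) := by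
  induction z with
  | zero => rw [map_zero]; exact Submodule.zero_mem _
  | add s t hs ht => rw [map_add]; exact Submodule.add_mem _ hs ht
  | tmul r s =>
    exact ⟨⟨_, A.component_mem j ξ m r⟩ ⊗ₜ ⟨_, A.component_mem j ξ n s⟩, rfl⟩

/-- For homogeneous r, `A.comul_symb` at μ = 0 says that Δ(r) equals its own symbol. -/
theorem A.map_proj_comul_mem {n : ℕ} {r : A.coinv j ξ} (hr : r ∈ A.grading j ξ n) :
    TensorProduct.map (A.projCoinv j ξ) (A.projCoinv j ξ) (comul (R := 𝕜) (r : A j ξ 0)) ∈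
      ⨆ (i : ℕ) (k : ℕ) (_ : i + k = n),
        LinearMap.range (TensorProduct.mapIncl (A.grading j ξ i) (A.grading j ξ k)) := by
  have h1 := A.comul_symb j ξ 0 (A.mem_fil_of_mem_grading j ξ hr)
  rw [(A.mem_grading j ξ).1 hr] at h1
  rw [h1, A.map_proj_symbT]
  refine Submodule.sum_mem _ fun q hq => ?_
  exact Submodule.mem_iSup_of_mem q.1 (Submodule.mem_iSup_of_mem q.2
    (Submodule.mem_iSup_of_mem (Finset.HasAntidiagonal.mem_antidiagonal.1 hq)
      (A.map_component_mem j ξ q.1 q.2 _)))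

theorem A.isBraidedGrading :
    IsBraidedGrading (A.splitting j ξ).actCoact (A.grading j ξ) where
  internal := A.isInternal_grading j ξ
  act_mem := fun n h (r : A.coinv j ξ) hr => by
    refine (A.mem_grading j ξ).2 ?_
    change A.symb j ξ 0 n (A.projCoinv j ξ (A.ofK j ξ 0 h * r)) =
      (A.projCoinv j ξ (A.ofK j ξ 0 h * r) : A j ξ 0)
    have h1 := A.symb_mul j ξ 0 (A.ofK_mem_fil j ξ 0 h) (A.mem_fil_of_mem_grading j ξ hr)
    rw [zero_add, A.symb_ofK, (A.mem_grading j ξ).1 hr] at h1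
    rw [A.symb_projCoinv, h1]
  coact_mem := fun n (r : A.coinv j ξ) hr => by
    have h1 := A.comul_symb j ξ 0 (A.mem_fil_of_mem_grading j ξ hr)
    rw [(A.mem_grading j ξ).1 hr] at h1
    change TensorProduct.map (A.toK j ξ).toLinearMap (A.projCoinv j ξ)
      (comul (R := 𝕜) (r : A j ξ 0)) ∈ _
    rw [h1, A.map_toK_symbT]
    exact A.lTensor_component_mem j ξ n _
  one_mem := (A.mem_grading j ξ).2 (by
    have h := A.symb_ofK j ξ 0 1
    rw [map_one (A.ofK j ξ 0)] at h
    exact h)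
  mul_mem := fun m n (r : A.coinv j ξ) hr (s : A.coinv j ξ) hs => by
    refine (A.mem_grading j ξ).2 ?_
    refine (A.symb_mul j ξ 0 (A.mem_fil_of_mem_grading j ξ hr)
      (A.mem_fil_of_mem_grading j ξ hs)).trans ?_
    rw [(A.mem_grading j ξ).1 hr, (A.mem_grading j ξ).1 hs]
    rfl
  counit_eq_zero := fun n hn (r : A.coinv j ξ) hr => by
    change counit (R := 𝕜) (r : A j ξ 0) = 0
    rw [← (A.mem_grading j ξ).1 hr, ← A.counit_toK, A.toK_symb j ξ hn, map_zero]
  comul_mem := fun n (r : A.coinv j ξ) hr => A.map_proj_comul_mem j ξ hr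

end Symbols


/-! ### Primitive elements seen in H -/

namespace Splitting

variable {𝕜 K H : Type u} [Field 𝕜] [Ring K] [HopfAlgebra 𝕜 K] [Ring H] [HopfAlgebra 𝕜 H]
  (S : Splitting 𝕜 K H)

theorem lift_one : S.lift (1 ⊗ₜ 1) = 1 := by
  rw [S.lift_tmul, S.coact_one, map_one, ← Algebra.TensorProduct.one_def, one_mul]
  exact map_one S.incl

/-- With `lift_comul`, a primitive r of R has Δ(r) = r ⊗ 1 + δ(r) in H. This shape is used to
recognize x and y as primitive and to bound the degree of every primitive element. -/
theorem lift_primitive (r : S.R) :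
    S.lift (r ⊗ₜ 1 + 1 ⊗ₜ r) = S.val r ⊗ₜ 1 + S.incl (S.actCoact.coact r) := by
  rw [map_add, S.lift_tmul, S.lift_tmul, S.coact_one, map_one, S.incl_tmul, map_one, map_one,
    ← Algebra.TensorProduct.one_def, one_mul, mul_one]

end Splitting

/-! ### The coinvariants are the Nichols algebra of V_{3,j} -/

section Nichols

variable {𝕜 : Type u} [Field 𝕜] [CharZero 𝕜] (j : Idx) (ξ : 𝕜)
  [hξ : Fact (IsPrimitiveRoot ξ 4)]

/-- The generator `x` as a coinvariant. -/
noncomputable def A.coinvX : A.coinv j ξ := ⟨_, A.x_mem_coinv j ξ⟩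

/-- The generator `y` as a coinvariant. -/
noncomputable def A.coinvY : A.coinv j ξ := ⟨_, A.y_mem_coinv j ξ⟩

theorem A.projCoinv_x : A.projCoinv j ξ (A.gen j ξ 0 .x) = A.coinvX j ξ :=
  A.projCoinv_coe j ξ (A.coinvX j ξ)

theorem A.projCoinv_y : A.projCoinv j ξ (A.gen j ξ 0 .y) = A.coinvY j ξ :=
  A.projCoinv_coe j ξ (A.coinvY j ξ)

/-- The inclusion `V_{3,j} → 𝔄_{3,j}(0)`, `e₁ ↦ x`, `e₂ ↦ y`. -/
noncomputable def A.ofV3 : (Fin 2 → 𝕜) →ₗ[𝕜] A.coinv j ξ :=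
  (Pi.basisFun 𝕜 (Fin 2)).constr 𝕜 ![A.coinvX j ξ, A.coinvY j ξ]

theorem A.ofV3_apply (v : Fin 2 → 𝕜) :
    A.ofV3 j ξ v = v 0 • A.coinvX j ξ + v 1 • A.coinvY j ξ := by
  simp [A.ofV3, Module.Basis.constr_apply_fintype, Fin.sum_univ_two]

/-- The commutation relations of a and b with x and y, after applying ε to the factor from 𝒦 on the
right, give the matrices of the action on V_{3,j}. -/
theorem A.ofV3_act (h : K ξ) (v : Fin 2 → 𝕜) : A.ofV3 j ξ ((V3 j ξ).act h v) =
    A.projCoinv j ξ (A.ofK j ξ 0 h * (A.ofV3 j ξ v : A j ξ 0)) := by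
  refine K.induction ξ (P := fun h => ∀ v, A.ofV3 j ξ ((V3 j ξ).act h v) =
    A.projCoinv j ξ (A.ofK j ξ 0 h * (A.ofV3 j ξ v : A j ξ 0))) (fun v => ?_) (fun v => ?_)
    (fun c v => ?_) (fun p q hp hq v => ?_) (fun p q hp hq v => ?_) h v
  · have h1 : A.gen j ξ 0 (.k .a) * A.gen j ξ 0 .x =
        -ξ • (A.gen j ξ 0 .x * A.gen j ξ 0 (.k .a)) := by
      simpa [A.gen] using A.mk_rel (j := j) (ARel.ax (ξ := ξ) (μ := 0))
    have h2 : A.gen j ξ 0 (.k .a) * A.gen j ξ 0 .y =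
        -(A.gen j ξ 0 .y * A.gen j ξ 0 (.k .a)) - A.gen j ξ 0 .x * A.gen j ξ 0 (.k .c) := by
      simpa [A.gen] using A.mk_rel (j := j) (ARel.ay (ξ := ξ) (μ := 0))
    have hx : A.projCoinv j ξ (A.ofK j ξ 0 (K.gen ξ .a) * (A.coinvX j ξ : A j ξ 0)) =
        -ξ • A.coinvX j ξ := by
      rw [A.ofK_gen]
      change A.projCoinv j ξ (_ * A.gen j ξ 0 .x) = _
      rw [h1, ← A.ofK_gen, map_smul, A.projCoinv_mul_ofK, A.projCoinv_x, K.counit_gen]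
      simp [K.counitGen]
    have hy : A.projCoinv j ξ (A.ofK j ξ 0 (K.gen ξ .a) * (A.coinvY j ξ : A j ξ 0)) =
        -A.coinvY j ξ := by
      rw [A.ofK_gen]
      change A.projCoinv j ξ (_ * A.gen j ξ 0 .y) = _
      rw [h2, ← A.ofK_gen, ← A.ofK_gen, map_sub, map_neg, A.projCoinv_mul_ofK,
        A.projCoinv_mul_ofK, A.projCoinv_y, K.counit_gen, K.counit_gen]
      simp [K.counitGen]
    rw [A.ofV3_apply, A.ofV3_apply, Subalgebra.coe_add, Subalgebra.coe_smul, Subalgebra.coe_smul,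
      mul_add, mul_smul_comm, mul_smul_comm, map_add, map_smul, map_smul, hx, hy]
    simp [V3, V3.act, V3.actMatrix, Matrix.toLinAlgEquiv'_apply, smul_smul, mul_comm,
      Matrix.vecHead, Matrix.vecTail]
  · have h1 : A.gen j ξ 0 (.k .b) * A.gen j ξ 0 .x =
        -ξ • (A.gen j ξ 0 .x * A.gen j ξ 0 (.k .b)) := by
      simpa [A.gen] using A.mk_rel (j := j) (ARel.bx (ξ := ξ) (μ := 0))
    have h2 : A.gen j ξ 0 (.k .b) * A.gen j ξ 0 .y =
        -(A.gen j ξ 0 .y * A.gen j ξ 0 (.k .b)) - A.gen j ξ 0 .x * A.gen j ξ 0 (.k .d) := by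
      simpa [A.gen] using A.mk_rel (j := j) (ARel.by_ (ξ := ξ) (μ := 0))
    have hx : A.projCoinv j ξ (A.ofK j ξ 0 (K.gen ξ .b) * (A.coinvX j ξ : A j ξ 0)) = 0 := by
      rw [A.ofK_gen]
      change A.projCoinv j ξ (_ * A.gen j ξ 0 .x) = _
      rw [h1, ← A.ofK_gen, map_smul, A.projCoinv_mul_ofK, K.counit_gen]
      simp [K.counitGen]
    have hy : A.projCoinv j ξ (A.ofK j ξ 0 (K.gen ξ .b) * (A.coinvY j ξ : A j ξ 0)) =
        -A.coinvX j ξ := by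
      rw [A.ofK_gen]
      change A.projCoinv j ξ (_ * A.gen j ξ 0 .y) = _
      rw [h2, ← A.ofK_gen, ← A.ofK_gen, map_sub, map_neg, A.projCoinv_mul_ofK,
        A.projCoinv_mul_ofK, A.projCoinv_x, K.counit_gen, K.counit_gen]
      simp [K.counitGen]
    rw [A.ofV3_apply, A.ofV3_apply, Subalgebra.coe_add, Subalgebra.coe_smul, Subalgebra.coe_smul,
      mul_add, mul_smul_comm, mul_smul_comm, map_add, map_smul, map_smul, hx, hy]
    simp [V3, V3.act, V3.actMatrix, Matrix.toLinAlgEquiv'_apply, Matrix.vecHead, Matrix.vecTail]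
  · rw [AlgHom.commutes, AlgHom.commutes, ← Algebra.smul_def, map_smul, A.projCoinv_coe]
    simp [Algebra.algebraMap_eq_smul_one]
  · rw [map_add, map_add, add_mul, map_add, ← hp, ← hq, LinearMap.add_apply, map_add]
  · rw [map_mul, Module.End.mul_apply, hp, hq, A.projCoinv_mul_projCoinv, map_mul (A.ofK j ξ 0),
      mul_assoc]

theorem A.coact_ofV3 (v : Fin 2 → 𝕜) :
    TensorProduct.map (A.toK j ξ).toLinearMap (A.projCoinv j ξ)
      (comul (R := 𝕜) (A.ofV3 j ξ v : A j ξ 0)) =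
    (A.ofV3 j ξ).lTensor (K ξ) ((V3 j ξ).coact v) := by
  have h : TensorProduct.map (A.toK j ξ).toLinearMap (A.projCoinv j ξ) ∘ₗ comul ∘ₗ
      (A.coinv j ξ).val.toLinearMap ∘ₗ A.ofV3 j ξ =
      (A.ofV3 j ξ).lTensor (K ξ) ∘ₗ (V3 j ξ).coact := by
    refine (Pi.basisFun 𝕜 (Fin 2)).ext fun i => ?_
    simp only [LinearMap.comp_apply, V3, Module.Basis.constr_basis, A.ofV3]
    fin_cases i
    · change TensorProduct.map (A.toK j ξ).toLinearMap (A.projCoinv j ξ)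
        (comul (R := 𝕜) (A.gen j ξ 0 .x)) = (A.ofV3 j ξ).lTensor (K ξ) (V3.coactBasis ξ j 0)
      rw [A.comul_gen]
      cases j <;> simp [A.comulGen, V3.coactBasis, A.toK_x, A.toK_k, A.projCoinv_x, A.projCoinv_y,
        A.ofV3_apply]
    · change TensorProduct.map (A.toK j ξ).toLinearMap (A.projCoinv j ξ)
        (comul (R := 𝕜) (A.gen j ξ 0 .y)) = (A.ofV3 j ξ).lTensor (K ξ) (V3.coactBasis ξ j 1)
      rw [A.comul_gen]
      cases j <;> simp [A.comulGen, V3.coactBasis, A.toK_y, A.toK_k, A.projCoinv_x, A.projCoinv_y,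
        A.ofV3_apply]
  exact LinearMap.congr_fun h v

theorem A.isYDHom_ofV3 :
    IsYDHom (V3 j ξ) (A.splitting j ξ).actCoact (A.ofV3 j ξ) where
  map_act := A.ofV3_act j ξ
  map_coact := A.coact_ofV3 j ξ

theorem A.coe_eq_sum (r : A.coinv j ξ) : r = ∑ p, counit (R := 𝕜) (A.nf j ξ 0 r p) •
    (⟨A.mon j ξ 0 p, A.mon_mem_coinv j ξ p⟩ : A.coinv j ξ) := by
  rw [← A.projCoinv_apply, A.projCoinv_coe]

theorem A.nf_gen_x : A.nf j ξ 0 (A.gen j ξ 0 .x) = Pi.single (1, 0) 1 := by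
  simpa [A.mon] using A.nf_mon_ofK j ξ 0 (1, 0) 1

theorem A.nf_gen_y : A.nf j ξ 0 (A.gen j ξ 0 .y) = Pi.single (0, 1) 1 := by
  simpa [A.mon] using A.nf_mon_ofK j ξ 0 (0, 1) 1

theorem A.ofV3_injective : Function.Injective (A.ofV3 j ξ) := by
  rw [injective_iff_map_eq_zero]
  intro v hv
  have e : v 0 • A.gen j ξ 0 .x + v 1 • A.gen j ξ 0 .y = 0 := by
    rw [A.ofV3_apply] at hv
    exact congrArg (A.coinv j ξ).val hv
  have h := congrArg (A.nf j ξ 0) e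
  rw [map_add, map_smul, map_smul, A.nf_gen_x, A.nf_gen_y, map_zero] at h
  have hv0 := congrArg (counit (R := 𝕜)) (congrFun h (1, 0))
  have hv1 := congrArg (counit (R := 𝕜)) (congrFun h (0, 1))
  funext i
  fin_cases i
  · simpa using hv0
  · simpa using hv1

theorem A.range_ofV3 : LinearMap.range (A.ofV3 j ξ) = A.grading j ξ 1 := by
  apply le_antisymm
  · rintro _ ⟨v, rfl⟩
    rw [A.mem_grading, A.ofV3_apply, Subalgebra.coe_add, Subalgebra.coe_smul, Subalgebra.coe_smul,
      map_add, map_smul, map_smul]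
    exact congrArg₂ (fun p q => v 0 • p + v 1 • q) (A.symb_gen_x j ξ 0) (A.symb_gen_y j ξ 0)
  · intro r hr
    have h0 : ∀ p, NF.deg p ≠ 1 → A.nf j ξ 0 r p = 0 := fun p hp => by
      rw [← (A.mem_grading j ξ).1 hr, A.nf_symb, NF.top_apply, if_neg hp]
    refine ⟨![counit (R := 𝕜) (A.nf j ξ 0 r (1, 0)), counit (R := 𝕜) (A.nf j ξ 0 r (0, 1))], ?_⟩
    conv_rhs => rw [A.coe_eq_sum j ξ r]
    rw [A.ofV3_apply, Fintype.sum_prod_type]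
    simp only [Fin.sum_univ_four, Fin.sum_univ_two]
    rw [h0 (0, 0) (by simp), h0 (1, 1) (by simp), h0 (2, 0) (by simp), h0 (2, 1) (by simp),
      h0 (3, 0) (by simp), h0 (3, 1) (by simp)]
    have hx : (⟨A.mon j ξ 0 (1, 0), A.mon_mem_coinv j ξ (1, 0)⟩ : A.coinv j ξ) = A.coinvX j ξ :=
      Subtype.ext (by simp [A.mon, A.coinvX])
    have hy : (⟨A.mon j ξ 0 (0, 1), A.mon_mem_coinv j ξ (0, 1)⟩ : A.coinv j ξ) = A.coinvY j ξ :=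
      Subtype.ext (by simp [A.mon, A.coinvY])
    rw [hx, hy]
    simp [add_comm]

/-- In Δ(x) and Δ(y) every summand but the first lies in 𝒦 ⊗ R, and those summands make up the
coaction. -/
theorem A.comul_ofV3 (v : Fin 2 → 𝕜) : comul (R := 𝕜) (A.ofV3 j ξ v : A j ξ 0) =
    (A.ofV3 j ξ v : A j ξ 0) ⊗ₜ 1 + TensorProduct.map (A.ofK j ξ 0).toLinearMap
      (A.coinv j ξ).val.toLinearMap (TensorProduct.map (A.toK j ξ).toLinearMap (A.projCoinv j ξ)
        (comul (R := 𝕜) (A.ofV3 j ξ v : A j ξ 0))) := by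
  have hx : comul (R := 𝕜) (A.gen j ξ 0 .x) = A.gen j ξ 0 .x ⊗ₜ 1 +
      TensorProduct.map (A.ofK j ξ 0).toLinearMap
      (A.coinv j ξ).val.toLinearMap (TensorProduct.map (A.toK j ξ).toLinearMap (A.projCoinv j ξ)
        (comul (R := 𝕜) (A.gen j ξ 0 .x))) := by
    rw [A.comul_gen]
    cases j <;> simp [A.comulGen, A.toK_x, A.toK_k, A.projCoinv_x, A.projCoinv_y, A.coinvX,
      A.coinvY, A.ofK_gen, add_assoc]
  have hy : comul (R := 𝕜) (A.gen j ξ 0 .y) = A.gen j ξ 0 .y ⊗ₜ 1 +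
      TensorProduct.map (A.ofK j ξ 0).toLinearMap
      (A.coinv j ξ).val.toLinearMap (TensorProduct.map (A.toK j ξ).toLinearMap (A.projCoinv j ξ)
        (comul (R := 𝕜) (A.gen j ξ 0 .y))) := by
    rw [A.comul_gen]
    cases j <;> simp [A.comulGen, A.toK_y, A.toK_k, A.projCoinv_x, A.projCoinv_y, A.coinvX,
      A.coinvY, A.ofK_gen, add_assoc]
  have e : (A.ofV3 j ξ v : A j ξ 0) = v 0 • A.gen j ξ 0 .x + v 1 • A.gen j ξ 0 .y := by
    rw [A.ofV3_apply]
    rfl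
  rw [e]
  simp only [map_add, map_smul, TensorProduct.add_tmul, ← TensorProduct.smul_tmul']
  nth_rw 1 [hx, hy]
  simp only [smul_add]
  abel

/-- `A.ofV3`, with values in the coinvariants of the splitting. -/
noncomputable def A.ofV3' (v : Fin 2 → 𝕜) : (A.splitting j ξ).R := A.ofV3 j ξ v

theorem A.lift_ofV3 (v : Fin 2 → 𝕜) : (A.splitting j ξ).lift
    (A.ofV3' j ξ v ⊗ₜ 1 + 1 ⊗ₜ A.ofV3' j ξ v) =
    comul (R := 𝕜) (A.ofV3 j ξ v : A j ξ 0) :=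
  (Splitting.lift_primitive _ _).trans (A.comul_ofV3 j ξ v).symm

/-- Coproducts in the range of `lift` are closed under products by `lift_twistedMul`, and for x and
y the membership is `A.lift_ofV3`. -/
theorem A.comul_mem_range_lift (r : (A.splitting j ξ).R) :
    comul (R := 𝕜) ((A.splitting j ξ).val r) ∈ LinearMap.range (A.splitting j ξ).lift := by
  obtain ⟨u, hu⟩ := r
  change comul (R := 𝕜) u ∈ _
  induction hu using Algebra.adjoin_induction with
  | mem u hu =>
    rcases hu with rfl | rfl
    · have h := A.lift_ofV3 j ξ ![1, 0]
      rw [show (A.ofV3 j ξ ![1, 0] : A j ξ 0) = A.gen j ξ 0 .x by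
        simp [A.ofV3_apply, A.coinvX]] at h
      exact ⟨_, h⟩
    · have h := A.lift_ofV3 j ξ ![0, 1]
      rw [show (A.ofV3 j ξ ![0, 1] : A j ξ 0) = A.gen j ξ 0 .y by
        simp [A.ofV3_apply, A.coinvY]] at h
      exact ⟨_, h⟩
  | algebraMap c =>
    refine ⟨c • 1 ⊗ₜ 1, ?_⟩
    rw [map_smul, Splitting.lift_one, Bialgebra.comul_algebraMap, Algebra.algebraMap_eq_smul_one]
  | add u v _ _ hu hv => rw [map_add]; exact Submodule.add_mem _ hu hv
  | mul u v _ _ hu hv =>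
    obtain ⟨z, hz⟩ := hu
    obtain ⟨w, hw⟩ := hv
    exact ⟨_, (Splitting.lift_twistedMul _ z w).trans (by rw [hz, hw, Bialgebra.comul_mul])⟩

instance A.finiteDimensional_coinv : FiniteDimensional 𝕜 (A.splitting j ξ).R := by
  haveI : FiniteDimensional 𝕜 (A j ξ 0) := Module.finite_of_finrank_pos (by
    rw [A.finrank_eq]
    norm_num)
  exact inferInstanceAs (FiniteDimensional 𝕜 (Subalgebra.toSubmodule (A.coinv j ξ)))

theorem A.isBraidedHopf : IsBraidedHopf (A.splitting j ξ).actCoact :=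
  (A.splitting j ξ).isBraidedHopf (A.comul_mem_range_lift j ξ)

/-- Apply proj ⊗ proj to `A.lift_ofV3`; it undoes `lift`. -/
theorem A.comul_coinv_ofV3 (v : Fin 2 → 𝕜) :
    comul (R := 𝕜) (A.ofV3' j ξ v) =
      A.ofV3' j ξ v ⊗ₜ 1 + 1 ⊗ₜ A.ofV3' j ξ v := by
  have h := (A.splitting j ξ).map_proj_lift
    (A.ofV3' j ξ v ⊗ₜ 1 + 1 ⊗ₜ A.ofV3' j ξ v)
  rw [A.lift_ofV3] at h
  exact h

/-- A primitive r has Δ(r) = r ⊗ 1 + δ(r) in H ⊗ F₀ + F₀ ⊗ H, and strictness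
(`A.mem_fil_of_comul_mem` with n = 0) puts it in F₁. This is what rules out primitive elements of
higher degree. -/
theorem A.mem_fil_one_of_primitive {r : (A.splitting j ξ).R}
    (hr : comul (R := 𝕜) r = r ⊗ₜ 1 + 1 ⊗ₜ r) : (A.splitting j ξ).val r ∈ A.fil j ξ 0 1 := by
  have h := Splitting.lift_comul _ (A.comul_mem_range_lift j ξ) r
  rw [hr, Splitting.lift_primitive] at h
  refine A.mem_fil_of_comul_mem j ξ 0 (n := 0) ?_
  rw [← h]
  refine Submodule.add_mem_sup ⟨_ ⊗ₜ ⟨1, A.one_mem_fil j ξ 0⟩, rfl⟩ ?_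
  generalize (A.splitting j ξ).actCoact.coact r = z
  induction z with
  | zero => rw [map_zero]; exact Submodule.zero_mem _
  | add s t hs ht => rw [map_add]; exact Submodule.add_mem _ hs ht
  | tmul k s => exact ⟨⟨_, A.ofK_mem_fil j ξ 0 k⟩ ⊗ₜ _, rfl⟩

theorem A.component_zero (r : A.coinv j ξ) :
    A.component j ξ 0 r = counit (R := 𝕜) (r : A j ξ 0) • (1 : A.coinv j ξ) := by
  apply Subtype.ext
  rw [A.coe_component, A.symb_zero_eq, A.toK_coinv, AlgHom.commutes,
    Algebra.algebraMap_eq_smul_one]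
  rfl

theorem A.counit_eq_zero_of_primitive {r : (A.splitting j ξ).R}
    (hr : comul (R := 𝕜) r = r ⊗ₜ 1 + 1 ⊗ₜ r) : counit (R := 𝕜) r = 0 := by
  have h := congrArg (counit (R := 𝕜)) (congrArg (TensorProduct.lid 𝕜 _)
    (Coalgebra.rTensor_counit_comul (R := 𝕜) r))
  rw [hr, map_add, LinearMap.rTensor_tmul, LinearMap.rTensor_tmul, map_add,
    TensorProduct.lid_tmul, TensorProduct.lid_tmul, TensorProduct.lid_tmul, map_add,
    (A.isBraidedHopf j ξ).counit_one, map_smul, (A.isBraidedHopf j ξ).counit_one] at h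
  simpa using h

/-- The component of degree zero is ε(r) = 0, and those above degree one vanish because r lies in
F₁. -/
theorem A.mem_grading_one_of_primitive {r : (A.splitting j ξ).R}
    (hr : comul (R := 𝕜) r = r ⊗ₜ 1 + 1 ⊗ₜ r) : r ∈ A.grading j ξ 1 := by
  have h1 := A.mem_fil_one_of_primitive j ξ hr
  have h2 := A.counit_eq_zero_of_primitive j ξ hr
  refine (A.mem_grading j ξ).2 ?_
  have h := A.sum_symb j ξ ((A.splitting j ξ).val r)
  rw [Finset.sum_eq_single 1] at h
  · exact h
  · intro n _ hn
    rcases Nat.lt_or_gt_of_ne hn with hn | hn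
    · obtain rfl : n = 0 := by omega
      refine (A.symb_zero_eq j ξ _).trans ((congrArg _ (A.toK_coinv j ξ r)).trans ?_)
      exact (congrArg (fun c => A.ofK j ξ 0 (algebraMap 𝕜 (K ξ) c)) h2).trans (by simp)
    · exact A.symb_eq_zero j ξ 0 hn h1
  · simp

/-- `𝒢 0 ≃ 𝕜`. -/
noncomputable def A.gradingZeroEquiv : A.grading j ξ 0 ≃ₗ[𝕜] 𝕜 :=
  LinearEquiv.ofLinear (counit ∘ₗ (A.coinv j ξ).val.toLinearMap ∘ₗ (A.grading j ξ 0).subtype)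
    (LinearMap.toSpanSingleton 𝕜 _ ⟨1, (A.isBraidedGrading j ξ).one_mem⟩)
    (by
      ext
      simp)
    (by
      refine LinearMap.ext fun r => Subtype.ext ?_
      have h := A.component_zero j ξ r
      rw [A.component_of_mem j ξ r.2, if_pos rfl] at h
      exact h.symm)

/-- The coinvariants are the Nichols algebra of `V_{3,j}`. -/
theorem A.isNicholsAlgebra :
    IsNicholsAlgebra (V3 j ξ) (A.splitting j ξ).actCoact (A.grading j ξ) where
  yetterDrinfeld := (A.isYDHom_ofV3 j ξ).isYetterDrinfeld (A.ofV3_injective j ξ)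
    (A.splitting j ξ).isYetterDrinfeld
  braidedHopf := A.isBraidedHopf j ξ
  grading := A.isBraidedGrading j ξ
  degree_zero := ⟨A.gradingZeroEquiv j ξ⟩
  degree_one := ⟨A.ofV3 j ξ, A.isYDHom_ofV3 j ξ, A.ofV3_injective j ξ, A.range_ofV3 j ξ⟩
  primitive r := by
    refine ⟨fun hr => ?_, A.mem_grading_one_of_primitive j ξ⟩
    have hr' : (r : A.coinv j ξ) ∈ A.grading j ξ 1 := hr
    rw [← A.range_ofV3] at hr'
    obtain ⟨v, rfl⟩ := hr'
    exact A.comul_coinv_ofV3 j ξ v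
  generated := by
    have h : Algebra.adjoin 𝕜 (A.grading j ξ 1 : Set (A.coinv j ξ)) = ⊤ := by
      have h0 : Algebra.adjoin 𝕜 {r : A.coinv j ξ | (r : A j ξ 0) ∈
          ({A.gen j ξ 0 .x, A.gen j ξ 0 .y} : Set (A j ξ 0))} = ⊤ :=
        Algebra.adjoin_adjoin_coe_preimage
      refine top_le_iff.1 (h0.ge.trans (Algebra.adjoin_mono ?_))
      rintro ⟨u, hu⟩ (rfl | rfl)
      · exact (A.mem_grading j ξ).2 (A.symb_gen_x j ξ 0)
      · exact (A.mem_grading j ξ).2 (A.symb_gen_y j ξ 0)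
    exact h

end Nichols


/-! ### The associated graded Hopf algebra is the bosonization -/

section AssociatedGraded

variable {𝕜 : Type u} [Field 𝕜] [CharZero 𝕜] (j : Idx) (ξ μ : 𝕜)
  [hξ : Fact (IsPrimitiveRoot ξ 4)]

theorem A.symb_eq_zero_of_mem_prev (n : ℕ) {u : A j ξ μ} (hu : u ∈ prev (A.fil j ξ μ) n) :
    A.symb j ξ μ n u = 0 := by
  cases n with
  | zero => rw [(Submodule.mem_bot 𝕜).1 hu, map_zero]
  | succ n => exact A.symb_eq_zero j ξ μ (Nat.lt_succ_self n) hu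

theorem A.mem_prev_of_symb_eq_zero (n : ℕ) {u : A j ξ μ} (hu : u ∈ A.fil j ξ μ n)
    (h : A.symb j ξ μ n u = 0) : u ∈ prev (A.fil j ξ μ) n := by
  cases n with
  | zero =>
    obtain ⟨k, rfl⟩ := (A.mem_fil_zero j ξ μ).1 hu
    rw [A.symb_ofK] at h
    rw [(map_eq_zero_iff _ (A.ofK_injective j ξ 0)).1 h, map_zero]
    exact Submodule.zero_mem _
  | succ n => exact A.mem_fil_of_symb_eq_zero j ξ μ hu h

/-- The symbol map on `H / F_{n-1}`. -/
noncomputable def A.symbQ (n : ℕ) : (A j ξ μ ⧸ prev (A.fil j ξ μ) n) →ₗ[𝕜] A j ξ 0 :=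
  Submodule.liftQ _ (A.symb j ξ μ n) fun _ hu => A.symb_eq_zero_of_mem_prev j ξ μ n hu

/-- The symbol map on `F_n / F_{n-1}`. -/
noncomputable def A.grSymb (n : ℕ) : GrPiece (A.fil j ξ μ) n →ₗ[𝕜] A j ξ 0 :=
  A.symbQ j ξ μ n ∘ₗ grIncl (A.fil j ξ μ) n

theorem A.grSymb_mk (n : ℕ) (u : A.fil j ξ μ n) :
    A.grSymb j ξ μ n (Submodule.Quotient.mk u) = A.symb j ξ μ n u := rfl

/-- The kernel of the symbol of degree n on F_n is F_{n-1}; for n = 0 this is zero because 𝒦 embeds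
in 𝔄_{3,j}(0). -/
theorem A.grSymb_injective (n : ℕ) : Function.Injective (A.grSymb j ξ μ n) := by
  rw [injective_iff_map_eq_zero]
  intro z hz
  induction z using Submodule.Quotient.induction_on with
  | H u => exact (Submodule.Quotient.mk_eq_zero _).2 (A.mem_prev_of_symb_eq_zero j ξ μ n u.2 hz)

/-- The map `gr 𝔄_{3,j}(μ) → 𝔄_{3,j}(0)`. -/
noncomputable def A.ofGr : Gr (A.fil j ξ μ) →ₗ[𝕜] A j ξ 0 :=
  DirectSum.toModule 𝕜 ℕ _ (A.grSymb j ξ μ)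

theorem A.ofGr_lof (n : ℕ) (z : GrPiece (A.fil j ξ μ) n) :
    A.ofGr j ξ μ (DirectSum.lof 𝕜 ℕ (GrPiece (A.fil j ξ μ)) n z) = A.grSymb j ξ μ n z :=
  DirectSum.toModule_lof _ _ _

/-- Induction over `gr 𝔄_{3,j}(μ)`. -/
theorem A.gr_induction {P : Gr (A.fil j ξ μ) → Prop} (h0 : P 0)
    (hadd : ∀ u v, P u → P v → P (u + v))
    (hm : ∀ n (u : A.fil j ξ μ n),
      P (DirectSum.lof 𝕜 ℕ (GrPiece (A.fil j ξ μ)) n (Submodule.Quotient.mk u)))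
    (z : Gr (A.fil j ξ μ)) : P z := by
  induction z using DirectSum.induction_on with
  | zero => exact h0
  | add u v hu hv => exact hadd u v hu hv
  | of n z =>
    induction z using Submodule.Quotient.induction_on with
    | H u => exact hm n u

/-- Symbols in 𝔄_{3,j}(0) separate the homogeneous components, which reduces the injectivity of
`A.ofGr` to that of each `A.grSymb`. -/
theorem A.symb_ofGr (m : ℕ) (z : Gr (A.fil j ξ μ)) :
    A.symb j ξ 0 m (A.ofGr j ξ μ z) = A.grSymb j ξ μ m (z m) := by
  refine A.gr_induction j ξ μ (P := fun z => A.symb j ξ 0 m (A.ofGr j ξ μ z) =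
    A.grSymb j ξ μ m (z m)) (by simp) (fun u v hu hv => ?_) (fun n u => ?_) z
  · rw [map_add, map_add, hu, hv, DirectSum.add_apply, map_add]
  · rw [A.ofGr_lof, A.grSymb_mk, A.symb_symb]
    split_ifs with h
    · subst h
      rw [DirectSum.lof_apply, A.grSymb_mk]
    · rw [DirectSum.lof_eq_of, DirectSum.of_eq_of_ne _ _ _ h, map_zero]

theorem A.ofGr_injective : Function.Injective (A.ofGr j ξ μ) := by
  intro z w h
  refine DFinsupp.ext fun n => A.grSymb_injective j ξ μ n ?_
  rw [← A.symb_ofGr, ← A.symb_ofGr, h]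

/-- The element xⁱyᵐk of 𝔄_{3,j}(0) is the symbol of the element of 𝔄_{3,j}(μ) written in the same
way. -/
theorem A.ofGr_surjective : Function.Surjective (A.ofGr j ξ μ) := by
  rw [← LinearMap.range_eq_top, eq_top_iff]
  intro u _
  rw [A.eq_sum j ξ 0 u]
  refine Submodule.sum_mem _ fun p _ => ?_
  generalize A.nf j ξ 0 u p = k
  have hm := A.mul_mem_fil j ξ μ (A.mon_mem_fil j ξ μ p) (A.ofK_mem_fil j ξ μ k)
  refine ⟨DirectSum.lof 𝕜 ℕ (GrPiece (A.fil j ξ μ)) (NF.deg p)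
    (Submodule.Quotient.mk ⟨_, hm⟩), ?_⟩
  rw [A.ofGr_lof, A.grSymb_mk, A.symb_mul_ofK, A.symb_mon]

theorem A.ofGr_mul (hF : IsHopfFiltration 𝕜 (A.fil j ξ μ)) (u v : Gr (A.fil j ξ μ)) :
    A.ofGr j ξ μ (grMul hF u v) = A.ofGr j ξ μ u * A.ofGr j ξ μ v := by
  refine A.gr_induction j ξ μ (P := fun u => A.ofGr j ξ μ (grMul hF u v) =
    A.ofGr j ξ μ u * A.ofGr j ξ μ v) (by simp) (fun u w hu hw => ?_) (fun m u => ?_) u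
  · rw [map_add, LinearMap.add_apply, map_add, hu, hw, map_add, add_mul]
  refine A.gr_induction j ξ μ (P := fun v => A.ofGr j ξ μ (grMul hF _ v) =
    A.ofGr j ξ μ _ * A.ofGr j ξ μ v) (by simp) (fun u w hu hw => ?_) (fun n v => ?_) v
  · rw [map_add, map_add, hu, hw, map_add, mul_add]
  · have h : grMul hF (DirectSum.lof 𝕜 ℕ (GrPiece (A.fil j ξ μ)) m (Submodule.Quotient.mk u))
        (DirectSum.lof 𝕜 ℕ (GrPiece (A.fil j ξ μ)) n (Submodule.Quotient.mk v)) =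
        DirectSum.lof 𝕜 ℕ (GrPiece (A.fil j ξ μ)) (m + n)
          (Submodule.Quotient.mk ⟨(u : A j ξ μ) * v, hF.mul_mem m n u u.2 v v.2⟩) := by
      rw [grMul, DirectSum.toModule_lof, LinearMap.flip_apply, DirectSum.toModule_lof]
      rfl
    rw [h, A.ofGr_lof, A.ofGr_lof, A.ofGr_lof, A.grSymb_mk, A.grSymb_mk, A.grSymb_mk]
    exact A.symb_mul j ξ μ u.2 v.2

theorem A.ofGr_one (hF : IsHopfFiltration 𝕜 (A.fil j ξ μ)) : A.ofGr j ξ μ (grOne hF) = 1 := by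
  rw [grOne, A.ofGr_lof, A.grSymb_mk]
  have h := A.symb_ofK j ξ μ 1
  rwa [map_one (A.ofK j ξ μ), map_one (A.ofK j ξ 0)] at h

theorem A.counit_ofGr (z : Gr (A.fil j ξ μ)) :
    counit (R := 𝕜) (A.ofGr j ξ μ z) = grCounit (A.fil j ξ μ) z := by
  refine A.gr_induction j ξ μ (P := fun z => counit (R := 𝕜) (A.ofGr j ξ μ z) =
    grCounit (A.fil j ξ μ) z) (by simp) (fun u v hu hv => ?_) (fun n u => ?_) z
  · rw [map_add, map_add, map_add, hu, hv]
  · rw [A.ofGr_lof, A.grSymb_mk, grCounit, DirectSum.toModule_lof]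
    cases n with
    | zero =>
      obtain ⟨u, hu⟩ := u
      obtain ⟨k, rfl⟩ := (A.mem_fil_zero j ξ μ).1 hu
      rw [A.symb_ofK]
      exact (CoalgHomClass.counit_comp_apply (A.ofKBialg j ξ 0) k).trans
        (CoalgHomClass.counit_comp_apply (A.ofKBialg j ξ μ) k).symm
    | succ n =>
      have h := A.symb_symb j ξ μ (n + 1) (n + 1) u
      rw [if_pos rfl] at h
      rw [← h, ← A.counit_toK, A.toK_symb j ξ (Nat.succ_ne_zero n), map_zero]
      rfl

/-- The graded coproduct is defined through the embedding into H / F_{i-1} ⊗ H / F_{k-1}. Symbols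
factor through these quotients (`A.symbQ`), so its symbol can be computed there directly from Δ(u).
-/
theorem A.map_grSymb_grPieceComul (hF : IsHopfFiltration 𝕜 (A.fil j ξ μ)) {n i k : ℕ}
    (h : i + k = n) (u : A.fil j ξ μ n) :
    TensorProduct.map (A.grSymb j ξ μ i) (A.grSymb j ξ μ k)
      (grPieceComul hF n i k h (Submodule.Quotient.mk u)) =
    TensorProduct.map (A.symb j ξ μ i) (A.symb j ξ μ k) (comul (R := 𝕜) (u : A j ξ μ)) := by
  have h1 : grIncl₂ (A.fil j ξ μ) i k (grPieceComul hF n i k h (Submodule.Quotient.mk u)) =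
      filComulAux (A.fil j ξ μ) n i k u := by
    have h2 := LinearEquiv.apply_symm_apply
      (LinearEquiv.ofInjective (grIncl₂ (A.fil j ξ μ) i k) (grIncl₂_injective (A.fil j ξ μ) i k))
      ⟨filComulAux (A.fil j ξ μ) n i k u, filComulAux_mem hF h u⟩
    exact congrArg Subtype.val h2
  have h3 := congrArg (TensorProduct.map (A.symbQ j ξ μ i) (A.symbQ j ξ μ k)) h1
  rw [grIncl₂, TensorProduct.map_map, filComulAux, LinearMap.comp_apply,
    TensorProduct.map_map] at h3
  exact h3

theorem A.comul_ofGr (hF : IsHopfFiltration 𝕜 (A.fil j ξ μ)) (z : Gr (A.fil j ξ μ)) :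
    comul (R := 𝕜) (A.ofGr j ξ μ z) =
      TensorProduct.map (A.ofGr j ξ μ) (A.ofGr j ξ μ) (grComul hF z) := by
  refine A.gr_induction j ξ μ (P := fun z => comul (R := 𝕜) (A.ofGr j ξ μ z) =
    TensorProduct.map (A.ofGr j ξ μ) (A.ofGr j ξ μ) (grComul hF z)) (by simp)
    (fun u v hu hv => ?_) (fun n u => ?_) z
  · simp only [map_add, hu, hv]
  · have hl : ∀ i, A.ofGr j ξ μ ∘ₗ DirectSum.lof 𝕜 ℕ (GrPiece (A.fil j ξ μ)) i =
        A.grSymb j ξ μ i := fun i => LinearMap.ext (A.ofGr_lof j ξ μ i)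
    rw [A.ofGr_lof, A.grSymb_mk, A.comul_symb j ξ μ u.2, grComul, DirectSum.toModule_lof,
      LinearMap.sum_apply, map_sum, A.symbT, LinearMap.sum_apply,
      Finset.Nat.sum_antidiagonal_eq_sum_range_succ
        (f := fun i k => TensorProduct.map (A.symb j ξ μ i) (A.symb j ξ μ k)
          (comul (R := 𝕜) (u : A j ξ μ))), ← Fin.sum_univ_eq_sum_range
        (fun i => TensorProduct.map (A.symb j ξ μ i) (A.symb j ξ μ (n - i))
          (comul (R := 𝕜) (u : A j ξ μ)))]
    refine Finset.sum_congr rfl fun i _ => ?_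
    rw [LinearMap.comp_apply, TensorProduct.map_map, hl, hl, A.map_grSymb_grPieceComul]

/-- The multiplication map `R ⊗ 𝒦 → 𝔄_{3,j}(0)`. -/
noncomputable def A.coinvMul : A.coinv j ξ ⊗[𝕜] K ξ →ₗ[𝕜] A j ξ 0 :=
  LinearMap.mul' 𝕜 (A j ξ 0) ∘ₗ
    TensorProduct.map (A.coinv j ξ).val.toLinearMap (A.ofK j ξ 0).toLinearMap

theorem A.coinvMul_tmul (r : A.coinv j ξ) (k : K ξ) :
    A.coinvMul j ξ (r ⊗ₜ k) = (r : A j ξ 0) * A.ofK j ξ 0 k := rfl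

theorem A.nf_coinv (r : A.coinv j ξ) (p : Fin 4 × Fin 2) :
    A.nf j ξ 0 r p = counit (R := 𝕜) (A.nf j ξ 0 r p) • (1 : K ξ) := by
  have h := congrArg (fun s : A.coinv j ξ => A.nf j ξ 0 s p) (A.coe_eq_sum j ξ r)
  refine h.trans ?_
  simp only [AddSubmonoidClass.coe_finset_sum, Subalgebra.coe_smul, map_sum, map_smul,
    Finset.sum_apply, Pi.smul_apply]
  rw [Finset.sum_eq_single p]
  · have h1 := A.nf_mon_ofK j ξ 0 p 1
    rw [map_one, mul_one] at h1
    rw [h1, Pi.single_eq_same]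
  · intro q _ hq
    have h1 := A.nf_mon_ofK j ξ 0 q 1
    rw [map_one, mul_one] at h1
    rw [h1, Pi.single_eq_of_ne hq.symm, smul_zero]
  · simp

/-- The normal form supplies the left inverse u ↦ ∑ xⁱyᵐ ⊗ kᵢₘ, because coinvariants have scalar
coordinates (`A.nf_coinv`). -/
theorem A.coinvMul_injective : Function.Injective (A.coinvMul j ξ) := by
  refine Function.LeftInverse.injective (g := fun u => ∑ p,
    (⟨A.mon j ξ 0 p, A.mon_mem_coinv j ξ p⟩ : A.coinv j ξ) ⊗ₜ[𝕜] A.nf j ξ 0 u p) fun z => ?_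
  induction z with
  | zero => simp
  | add s t hs ht =>
    simp only [map_add, Pi.add_apply, TensorProduct.tmul_add, Finset.sum_add_distrib] at hs ht ⊢
    rw [hs, ht]
  | tmul r k =>
    simp only [A.coinvMul_tmul, A.nf_mul_ofK]
    conv_rhs => rw [A.coe_eq_sum j ξ r, TensorProduct.sum_tmul]
    refine Finset.sum_congr rfl fun p _ => ?_
    conv_lhs => rw [A.nf_coinv, smul_mul_assoc, one_mul]
    rw [TensorProduct.smul_tmul]

theorem A.coinvMul_rTensor_component (n : ℕ) (z : A.coinv j ξ ⊗[𝕜] K ξ) :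
    A.coinvMul j ξ ((A.component j ξ n).rTensor (K ξ) z) =
      A.symb j ξ 0 n (A.coinvMul j ξ z) := by
  induction z with
  | zero => simp
  | add s t hs ht => simp only [map_add, hs, ht]
  | tmul r k =>
    rw [LinearMap.rTensor_tmul, A.coinvMul_tmul, A.coinvMul_tmul, A.coe_component, A.symb_mul_ofK]

theorem A.mem_range_rTensor_grading (n : ℕ) (z : A.coinv j ξ ⊗[𝕜] K ξ) :
    z ∈ LinearMap.range ((A.grading j ξ n).subtype.rTensor (K ξ)) ↔
      A.symb j ξ 0 n (A.coinvMul j ξ z) = A.coinvMul j ξ z := by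
  constructor
  · rintro ⟨w, rfl⟩
    induction w with
    | zero => simp
    | add s t hs ht => simp only [map_add, hs, ht]
    | tmul r k =>
      rw [LinearMap.rTensor_tmul, A.coinvMul_tmul, A.symb_mul_ofK]
      exact congrArg (· * _) ((A.mem_grading j ξ).1 r.2)
  · intro h
    rw [← A.coinvMul_rTensor_component] at h
    rw [← A.coinvMul_injective j ξ h]
    generalize z = w
    induction w with
    | zero => rw [map_zero]; exact Submodule.zero_mem _
    | add s t hs ht => rw [map_add]; exact Submodule.add_mem _ hs ht
    | tmul r k => exact ⟨⟨_, A.component_mem j ξ n r⟩ ⊗ₜ k, rfl⟩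

theorem A.coinvMul_surjective : Function.Surjective (A.coinvMul j ξ) := A.exists_coinv_mul j ξ

/-- The linear isomorphism `gr 𝔄_{3,j}(μ) ≃ R # 𝒦`. -/
noncomputable def A.grEquiv : Gr (A.fil j ξ μ) ≃ₗ[𝕜] (A.splitting j ξ).R ⊗[𝕜] K ξ :=
  (LinearEquiv.ofBijective _ ⟨A.ofGr_injective j ξ μ, A.ofGr_surjective j ξ μ⟩).trans
    (LinearEquiv.ofBijective (A.splitting j ξ).smash
      ⟨A.coinvMul_injective j ξ, A.coinvMul_surjective j ξ⟩).symm

theorem A.smash_grEquiv (z : Gr (A.fil j ξ μ)) :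
    (A.splitting j ξ).smash (A.grEquiv j ξ μ z) = A.ofGr j ξ μ z :=
  LinearEquiv.apply_symm_apply (LinearEquiv.ofBijective (A.splitting j ξ).smash
      ⟨A.coinvMul_injective j ξ, A.coinvMul_surjective j ξ⟩) _

theorem A.smash_injective : Function.Injective (A.splitting j ξ).smash := A.coinvMul_injective j ξ

/-- Each identity is tested after applying the injective map `smash` into 𝔄_{3,j}(0), where it turns
into a property of `A.ofGr` on one side and of the splitting on the other. -/
theorem A.grIsoBosonization (hF : IsHopfFiltration 𝕜 (A.fil j ξ μ)) :
    GrIsoBosonization hF (A.splitting j ξ).actCoact (A.grading j ξ) := by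
  refine ⟨A.grEquiv j ξ μ, ?_, fun u v => ?_, fun u => ?_, fun u => ?_, fun n => ?_⟩
  · apply A.smash_injective j ξ
    rw [A.smash_grEquiv, A.ofGr_one, Splitting.smash_one]
  · apply A.smash_injective j ξ
    rw [A.smash_grEquiv, A.ofGr_mul, Splitting.smash_bosonMul, A.smash_grEquiv, A.smash_grEquiv]
  · rw [← Splitting.counit_smash, A.smash_grEquiv, A.counit_ofGr]
  · apply TensorProduct.map_injective_of_flat_flat _ _ (A.smash_injective j ξ)
      (A.smash_injective j ξ)
    rw [← Splitting.comul_smash _ (A.comul_mem_range_lift j ξ), A.smash_grEquiv,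
      A.comul_ofGr j ξ μ hF, TensorProduct.map_map]
    have h : (A.splitting j ξ).smash ∘ₗ (A.grEquiv j ξ μ).toLinearMap = A.ofGr j ξ μ :=
      LinearMap.ext (A.smash_grEquiv j ξ μ)
    rw [h]
  · ext w
    -- Both homogeneous components of degree n correspond to the fixed points of the symbol of
    -- degree n on 𝔄_{3,j}(0).
    refine Iff.trans ?_ (A.mem_range_rTensor_grading j ξ n w).symm
    change _ ↔ A.symb j ξ 0 n ((A.splitting j ξ).smash w) = (A.splitting j ξ).smash w
    obtain ⟨z, rfl⟩ := (A.grEquiv j ξ μ).surjective w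
    rw [A.smash_grEquiv]
    constructor
    · rintro ⟨_, ⟨y, rfl⟩, hy⟩
      rw [← (A.grEquiv j ξ μ).injective hy, A.ofGr_lof]
      induction y using Submodule.Quotient.induction_on with
      | H u => rw [A.grSymb_mk, A.symb_symb, if_pos rfl]
    · intro h
      refine ⟨_, ⟨z n, rfl⟩, congrArg (A.grEquiv j ξ μ) (A.ofGr_injective j ξ μ ?_)⟩
      rw [A.ofGr_lof, ← A.symb_ofGr, h]

/-- The filtration is a variable, with an equation, so that `A.standardFiltration_eq` can be
substituted even though the graded structures depend on the proof that F is a Hopf algebra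
filtration. -/
theorem A.exists_nichols {F : ℕ → Submodule 𝕜 (A j ξ μ)} (h : F = A.fil j ξ μ) :
    ∃ hF : IsHopfFiltration 𝕜 F,
      ∃ (R : Type u) (_ : Ring R) (_ : Algebra 𝕜 R) (_ : Coalgebra 𝕜 R)
        (D : ActCoact 𝕜 (K ξ) R) (𝒢 : ℕ → Submodule 𝕜 R),
        IsNicholsAlgebra (V3 j ξ) D 𝒢 ∧ GrIsoBosonization hF D 𝒢 := by
  subst h
  exact ⟨A.isHopfFiltration_fil j ξ μ, (A.splitting j ξ).R, inferInstance, inferInstance,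
    inferInstance, _, _, A.isNicholsAlgebra j ξ, A.grIsoBosonization j ξ μ _⟩

end AssociatedGraded

end HopfLift

theorem mainTheorem11 {𝕜 : Type u} [Field 𝕜] [IsAlgClosed 𝕜] [CharZero 𝕜] (ξ : 𝕜)
    [Fact (IsPrimitiveRoot ξ 4)] (μ : 𝕜) (j : HopfLift.Idx) :
    -- the coproduct, counit and antipode of the Hopf algebra `𝔄_{3,j}(μ)`
    (∀ g, comul (R := 𝕜) (HopfLift.A.gen j ξ μ g) = HopfLift.A.comulGen ξ μ j g) ∧
    (∀ g, counit (R := 𝕜) (HopfLift.A.gen j ξ μ g) = HopfLift.A.counitGen g) ∧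
    (∀ g, antipode 𝕜 (HopfLift.A.gen j ξ μ g) =
      MulOpposite.unop (HopfLift.A.antipodeGen ξ μ j g)) ∧
    -- the elements `x ^ i * y ^ m * a ^ k * b ^ l` form a basis, and the dimension is 64
    (∃ B : Module.Basis (Fin 2 × Fin 4 × Fin 4 × Fin 2) 𝕜 (HopfLift.A j ξ μ),
      ∀ (i : Fin 2) (m : Fin 4) (k : Fin 4) (l : Fin 2), B (i, m, k, l) =
        HopfLift.A.gen j ξ μ .x ^ (i : ℕ) * HopfLift.A.gen j ξ μ .y ^ (m : ℕ) *
          HopfLift.A.gen j ξ μ (.k .a) ^ (k : ℕ) * HopfLift.A.gen j ξ μ (.k .b) ^ (l : ℕ)) ∧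
    Module.finrank 𝕜 (HopfLift.A j ξ μ) = 64 ∧
    -- the Hopf coradical is `𝒦`
    (∃ φ : HopfLift.K ξ →ₐc[𝕜] HopfLift.A j ξ μ,
      (∀ g, φ (HopfLift.K.gen ξ g) = HopfLift.A.gen j ξ μ (.k g)) ∧ Function.Injective φ ∧
      Set.range φ = (HopfLift.hopfCoradical 𝕜 (HopfLift.A j ξ μ) : Set (HopfLift.A j ξ μ))) ∧
    -- the standard filtration is a Hopf algebra filtration whose associated graded Hopf algebra
    -- is the bosonization of the Nichols algebra of `V_{3,j}` by `𝒦`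
    (∃ hF : HopfLift.IsHopfFiltration 𝕜 (HopfLift.standardFiltration 𝕜 (HopfLift.A j ξ μ)),
      ∃ (R : Type u) (_ : Ring R) (_ : Algebra 𝕜 R) (_ : Coalgebra 𝕜 R)
        (D : HopfLift.ActCoact 𝕜 (HopfLift.K ξ) R) (𝒢 : ℕ → Submodule 𝕜 R),
        HopfLift.IsNicholsAlgebra (HopfLift.V3 j ξ) D 𝒢 ∧ HopfLift.GrIsoBosonization hF D 𝒢) :=
  ⟨HopfLift.A.comul_gen j ξ μ, HopfLift.A.counit_gen j ξ μ, HopfLift.A.antipode_gen j ξ μ,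
    HopfLift.A.exists_basis j ξ μ, HopfLift.A.finrank_eq j ξ μ, HopfLift.A.exists_ofK j ξ μ,
    HopfLift.A.exists_nichols j ξ μ (HopfLift.A.standardFiltration_eq j ξ μ)⟩
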